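/- Let $\phi:[0,\infty)\to[0,\infty)$ be a convex function with $\phi\in C^2((0,\infty))\cap C^1([0,\infty))$, $\phi(0)=0$, $\phi'(0)=0$ and $\lim_{t\to\infty}\phi(t)=\infty$, and suppose that there are constants $\kappa_1,\kappa_2>0$ (the characteristics of $\phi$) such that $$\phi'(t)\le \kappa_1\,\phi''(t)\,t\qquad\text{and}\qquad \phi''(t)\,t\le \kappa_2\,\phi'(t)\qquad\text{for all } t>0 .$$ Let $\Omega\subset\mathbb{R}^n$ be open, and let $u:\Omega\to\mathbb{R}^N$, $u\in W^{1,\phi}_{\mathrm{loc}}(\Omega;\mathbb{R}^N)$ (that is, $u$ has a weak gradient $\nabla u$ on $\Omega$, and $u$ and $\nabla u$ belong to the Orlicz space $L^\phi(K)$ for every compact $K\subset\Omega$), be a local weak solution of $$\Delta_\phi u=\operatorname{div}\Big(\frac{\phi'(|\nabla u|)}{|\nabla u|}\nabla u\Big)=0 \quad\text{in }\Omega,$$ that is, $$\int_\Omega \frac{\phi'(|\nabla u|)}{|\nabla u|}\,\nabla u\cdot\nabla\zeta\,dx=0\qquad\text{for all }\zeta\in C_0^\infty(\Omega;\mathbb{R}^N),$$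 where $|\cdot|$ and $\cdot$ are the Euclidean (Frobenius) norm and inner product on $\mathbb{R}^{n\times N}$ and the integrand is $0$ where $\nabla u=0$. Then, for every ball $B_R=B_R(x_0)$, $R>0$, such that the concentric ball $B_{2R}$ satisfies $\overline{B_{2R}}\subset\Omega$, the function $\phi(|\nabla u|)$ is integrable on $B_{2R}$ and $$\operatorname*{ess\,sup}_{B_R}\phi(|\nabla u|)\;\le\; c\,\frac{1}{|B_{2R}|}\int_{B_{2R}}\phi(|\nabla u|)\,dx ,$$ with a constant $c>0$ that depends only on $n$, $\kappa_1$ and $\kappa_2$. -/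

import Mathlib

open MeasureTheory Set Filter Topology
open scoped ContDiff

noncomputable section

namespace PhiLaplace

/-- The structural assumption on the Orlicz function `φ : [0,∞) → [0,∞)`; only the values of `φ` on
`[0,∞)` matter. The numbers `κ₁, κ₂` are the characteristics of `φ`, that is, the two constants in
the equivalence `φ'(t) ≂ φ''(t) t` on `(0,∞)`. -/
structure IsOrliczWith (κ₁ κ₂ : ℝ) (φ : ℝ → ℝ) : Prop where
  nonneg : ∀ t, 0 ≤ t → 0 ≤ φ t
  convexOn : ConvexOn ℝ (Ici 0) φ
  contDiffOn_two : ContDiffOn ℝ 2 φ (Ioi 0)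
  contDiffOn_one : ContDiffOn ℝ 1 φ (Ici 0)
  map_zero : φ 0 = 0
  deriv_zero : HasDerivWithinAt φ 0 (Ici 0) 0
  tendsto_atTop : Tendsto φ atTop atTop
  deriv_le : ∀ t, 0 < t → deriv φ t ≤ κ₁ * (deriv (deriv φ) t * t)
  le_deriv : ∀ t, 0 < t → deriv (deriv φ) t * t ≤ κ₂ * deriv φ t

/-- `ℝⁿ` with the Euclidean norm. -/
abbrev Vec (n : ℕ) : Type := EuclideanSpace ℝ (Fin n)

/-- `ℝ^{n × N}` with the Frobenius norm and inner product. The entry `(j, i)` of a gradient is the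
`j`-th partial derivative of the `i`-th component. -/
abbrev Mat (n N : ℕ) : Type := EuclideanSpace ℝ (Fin n × Fin N)

/-- Compactly supported smooth functions in the set `Ω`. -/
structure IsTestFunction {n : ℕ} {F : Type*} [NormedAddCommGroup F] [NormedSpace ℝ F]
    (Ω : Set (Vec n)) (ζ : Vec n → F) : Prop where
  contDiff : ContDiff ℝ ∞ ζ
  hasCompactSupport : HasCompactSupport ζ
  tsupport_subset : tsupport ζ ⊆ Ω

/-- The `j`-th classical partial derivative. -/
def partialDeriv {n : ℕ} {F : Type*} [NormedAddCommGroup F] [NormedSpace ℝ F]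
    (j : Fin n) (ζ : Vec n → F) (x : Vec n) : F :=
  fderiv ℝ ζ x (EuclideanSpace.single j 1)

/-- The classical gradient of an `ℝᴺ`-valued function. -/
def classicalGrad {n N : ℕ} (ζ : Vec n → Vec N) (x : Vec n) : Mat n N :=
  WithLp.toLp 2 fun p => partialDeriv p.1 ζ x p.2

/-- `Du` is the weak (distributional) gradient of `u` on `Ω`. -/
structure IsWeakGradient {n N : ℕ} (Ω : Set (Vec n)) (u : Vec n → Vec N)
    (Du : Vec n → Mat n N) : Prop where
  locallyIntegrableOn : LocallyIntegrableOn u Ω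
  locallyIntegrableOn_grad : LocallyIntegrableOn Du Ω
  integral_eq : ∀ ψ : Vec n → ℝ, IsTestFunction Ω ψ → ∀ (j : Fin n) (i : Fin N),
    ∫ x in Ω, u x i * partialDeriv j ψ x = - ∫ x in Ω, Du x (j, i) * ψ x

/-- Membership in the Orlicz space `L^φ(S)` (finiteness of the Luxemburg norm). -/
def MemOrlicz {n : ℕ} {F : Type*} [NormedAddCommGroup F] (φ : ℝ → ℝ) (S : Set (Vec n))
    (f : Vec n → F) : Prop :=
  AEStronglyMeasurable f (volume.restrict S) ∧
    ∃ k : ℝ, 0 < k ∧ IntegrableOn (fun x => φ (‖f x‖ / k)) S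

/-- `u` belongs to `W^{1,φ}_loc(Ω)`, with weak gradient `Du`. -/
structure MemOrliczSobolevLoc {n N : ℕ} (φ : ℝ → ℝ) (Ω : Set (Vec n)) (u : Vec n → Vec N)
    (Du : Vec n → Mat n N) : Prop where
  isWeakGradient : IsWeakGradient Ω u Du
  memOrlicz : ∀ K : Set (Vec n), IsCompact K → K ⊆ Ω → MemOrlicz φ K u
  memOrlicz_grad : ∀ K : Set (Vec n), IsCompact K → K ⊆ Ω → MemOrlicz φ K Du

/-- The nonlinearity `A(P) = φ'(|P|) P / |P|`, with `A(0) = 0`. -/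
def flux {n N : ℕ} (φ : ℝ → ℝ) (P : Mat n N) : Mat n N :=
  (deriv φ ‖P‖ / ‖P‖) • P

/-- `u`, with weak gradient `Du`, is a local weak solution of
`Δ_φ u = div (φ'(|∇u|) ∇u / |∇u|) = 0` on `Ω`. -/
structure IsLocalWeakSolution {n N : ℕ} (φ : ℝ → ℝ) (Ω : Set (Vec n)) (u : Vec n → Vec N)
    (Du : Vec n → Mat n N) : Prop where
  memOrliczSobolevLoc : MemOrliczSobolevLoc φ Ω u Du
  weak_eq : ∀ ζ : Vec n → Vec N, IsTestFunction Ω ζ →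
    ∫ x in Ω, inner ℝ (flux φ (Du x)) (classicalGrad ζ x) = 0

end PhiLaplace

end

open MeasureTheory Set Filter Topology
open scoped ContDiff

noncomputable section

namespace PhiLaplace

/-! ### A generalised dominated convergence theorem -/

/-! The a priori estimate is Uhlenbeck's. Suppose W is a gradient with weak derivatives in L² and
div(α(|W|²)W) = 0. Differentiating the equation and testing it with η²γ(|W|²)W_s, where γ switches
on when the density α(|W|²)|W|² passes a level, gives a Caccioppoli inequality on superlevel sets.
The term containing γ' has a good sign because the field is radial and second derivatives are
symmetric (`RegCoef.le_sum_inner_testGrad`, `IsRegularField.caccioppoli`). The constants involve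
only m and M, which compare the eigenvalues of the linearisation with α; the size of α itself does
not enter. Together with the L¹ Sobolev inequality this starts a De Giorgi iteration
(`IsRegularField.levelPart_step`, `exists_sup_const`), which bounds the density on a ball by its
integral over a larger one.

The given solution is too rough for this, and φ'(t)/t may degenerate or blow up. So φ' is replaced
by `t * regCoef φ l (t ^ 2)`. For every l > 0 this is uniformly elliptic, its constants m = min(1,
1/κ₁) and M = max(1, κ₂) do not depend on l, and a suitably small l brings it uniformly close to φ'
on any prescribed bounded interval. For such coefficients the Dirichlet problem is solved in L² by
strong monotonicity (`exists_regular_solution`), difference quotients give weak derivatives of the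
gradient (`exists_difference_bound`, `exists_weak_partialDeriv`), and the estimate applies
(`exists_comparison_const`).

It remains to compare with ∇u. Let Q_k and F_k be the mollifications of ∇u and of its flux, after
truncation near the ball. Then Q_k is the gradient of a smooth function, and F_k is divergence free
because the weak equation is linear in the flux. Choose l_k so small that the regularised flux A_k
is ε_k-close to the true one on the range of Q_k, and let W_k be the gradient of the regularised
solution with boundary datum Q_k. Both F_k and A_k(W_k) are orthogonal to W_k − Q_k, hence ∫
(A_k(W_k) − A_k(Q_k))·(W_k − Q_k) = ∫ (F_k − A_k(Q_k))·(W_k − Q_k). The right side tends to zero: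
the mollification defect F_k − A(Q_k) is controlled where |W_k| is comparable with the local size of
Q_k, and where |W_k| is much larger the energy pays with a small factor
(`IsOrliczWith.inner_sub_regFlux_le`, `IsOrliczWith.tendsto_integral_defect`).

The integrand on the left is nonnegative, so it tends to zero almost everywhere along a subsequence.
At a point where |W_k| ≤ t < |∇u| it would stay bounded away from zero, because a radial monotone
field separates vectors of different length (`mul_sub_le_inner_smul_sub`). So the sup bound for W_k
passes to ∇u without any convergence of W_k itself (`exists_norm_le_const`). Throughout, tφ'(t)
stands in for φ(t), to which it is comparable. -/

theorem tendsto_integral_norm_sub_of_dominating {X : Type*} [MeasurableSpace X] {μ : Measure X}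
    {E : Type*} [NormedAddCommGroup E] {F : ℕ → X → E} {f : X → E} {G : ℕ → X → ℝ} {g : X → ℝ}
    (hF : ∀ k, AEStronglyMeasurable (F k) μ) (hG : ∀ k, Integrable (G k) μ) (hg : Integrable g μ)
    (hbound : ∀ k, ∀ᵐ x ∂μ, ‖F k x‖ ≤ G k x)
    (hlim : ∀ᵐ x ∂μ, Tendsto (fun k => F k x) atTop (𝓝 (f x)))
    (hGlim : ∀ᵐ x ∂μ, Tendsto (fun k => G k x) atTop (𝓝 (g x)))
    (hint : Tendsto (fun k => ∫ x, G k x ∂μ) atTop (𝓝 (∫ x, g x ∂μ))) :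
    Tendsto (fun k => ∫ x, ‖F k x - f x‖ ∂μ) atTop (𝓝 0) := by
  have hf : AEStronglyMeasurable f μ := aestronglyMeasurable_of_tendsto_ae _ hF hlim
  have hfg : ∀ᵐ x ∂μ, ‖f x‖ ≤ g x := by
    filter_upwards [ae_all_iff.2 hbound, hlim, hGlim] with x h1 h2 h3
    exact le_of_tendsto_of_tendsto' h2.norm h3 h1
  have hg0 : ∀ᵐ x ∂μ, 0 ≤ g x := by
    filter_upwards [hfg] with x hx using (norm_nonneg _).trans hx
  have hG0 : ∀ k, ∀ᵐ x ∂μ, 0 ≤ G k x := fun k => by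
    filter_upwards [hbound k] with x hx using (norm_nonneg _).trans hx
  -- The part of ‖F − f‖ below 2g is handled by ordinary dominated convergence. The excess over 2g
  -- is at most (G − g)⁺ because ‖F − f‖ ≤ G + g, and (G − g)⁺ = (g − G)⁺ + (G − g): the first
  -- summand is dominated by g, the integral of the second tends to zero by hypothesis.
  have hmin : Tendsto (fun k => ∫ x, min ‖F k x - f x‖ (2 * g x) ∂μ) atTop
      (𝓝 (∫ _, (0 : ℝ) ∂μ)) := by
    refine tendsto_integral_of_dominated_convergence (fun x => 2 * g x)
      (fun k => ((hF k).sub hf).norm.inf (hg.1.const_mul 2)) (hg.const_mul 2) (fun k => ?_) ?_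
    · filter_upwards [hg0] with x hx
      rw [Real.norm_of_nonneg (le_min (norm_nonneg _) (by positivity))]
      exact min_le_right _ _
    · filter_upwards [hlim, hg0] with x hx hx0
      have h1 : Tendsto (fun k => ‖F k x - f x‖) atTop (𝓝 0) := by
        simpa using (hx.sub_const (f x)).norm
      have := h1.min (tendsto_const_nhds (x := 2 * g x))
      rwa [min_eq_left (by positivity)] at this
  have hpos : Tendsto (fun k => ∫ x, max (g x - G k x) 0 ∂μ) atTop (𝓝 (∫ _, (0 : ℝ) ∂μ)) := by
    refine tendsto_integral_of_dominated_convergence g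
      (fun k => (hg.1.sub (hG k).1).sup aestronglyMeasurable_const) hg (fun k => ?_) ?_
    · filter_upwards [hg0, hG0 k] with x hx hx'
      rw [Real.norm_of_nonneg (le_max_right _ _)]
      exact max_le (by linarith) hx
    · filter_upwards [hGlim] with x hx
      have := (hx.const_sub (g x)).max (tendsto_const_nhds (x := (0 : ℝ)))
      simpa using this
  have hsum : Tendsto (fun k => (∫ x, min ‖F k x - f x‖ (2 * g x) ∂μ)
      + ((∫ x, max (g x - G k x) 0 ∂μ) + ((∫ x, G k x ∂μ) - ∫ x, g x ∂μ))) atTop (𝓝 0) := by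
    have := hmin.add (hpos.add (hint.sub_const (∫ x, g x ∂μ)))
    simpa using this
  refine squeeze_zero (fun k => integral_nonneg fun x => norm_nonneg _) (fun k => ?_) hsum
  have hmi : Integrable (fun x => min ‖F k x - f x‖ (2 * g x)) μ := by
    refine (hg.const_mul 2).mono' (((hF k).sub hf).norm.inf (hg.1.const_mul 2)) ?_
    filter_upwards [hg0] with x hx
    rw [Real.norm_of_nonneg (le_min (norm_nonneg _) (by positivity))]
    exact min_le_right _ _
  have hpi : Integrable (fun x => max (g x - G k x) 0) μ := (hg.sub (hG k)).pos_part
  have hFi : Integrable (fun x => ‖F k x - f x‖) μ := by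
    refine ((hG k).add hg).mono' ((hF k).sub hf).norm ?_
    filter_upwards [hbound k, hfg] with x h1 h2
    rw [norm_norm]
    exact (norm_sub_le _ _).trans (add_le_add h1 h2)
  have hsi : Integrable (fun x => G k x - g x) μ := (hG k).sub hg
  have hpsi : Integrable (fun x => max (g x - G k x) 0 + (G k x - g x)) μ := hpi.add hsi
  rw [← integral_sub (hG k) hg, ← integral_add hpi hsi, ← integral_add hmi hpsi]
  refine integral_mono_ae hFi (hmi.add hpsi) ?_
  filter_upwards [hbound k, hfg] with x h1 h2
  have h3 : ‖F k x - f x‖ ≤ G k x + g x := (norm_sub_le _ _).trans (add_le_add h1 h2)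
  rcases le_total ‖F k x - f x‖ (2 * g x) with h | h
  · rw [min_eq_left h]
    rcases le_total (g x) (G k x) with h' | h'
    · rw [max_eq_right (by linarith)]; linarith
    · rw [max_eq_left (by linarith)]; linarith
  · rw [min_eq_right h]
    rcases le_total (g x) (G k x) with h' | h'
    · rw [max_eq_right (by linarith)]; linarith
    · rw [max_eq_left (by linarith)]; linarith

theorem tendsto_integral_of_dominating {X : Type*} [MeasurableSpace X] {μ : Measure X}
    {E : Type*} [NormedAddCommGroup E] [NormedSpace ℝ E]
    {F : ℕ → X → E} {f : X → E} {G : ℕ → X → ℝ} {g : X → ℝ}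
    (hF : ∀ k, AEStronglyMeasurable (F k) μ) (hG : ∀ k, Integrable (G k) μ) (hg : Integrable g μ)
    (hbound : ∀ k, ∀ᵐ x ∂μ, ‖F k x‖ ≤ G k x)
    (hlim : ∀ᵐ x ∂μ, Tendsto (fun k => F k x) atTop (𝓝 (f x)))
    (hGlim : ∀ᵐ x ∂μ, Tendsto (fun k => G k x) atTop (𝓝 (g x)))
    (hint : Tendsto (fun k => ∫ x, G k x ∂μ) atTop (𝓝 (∫ x, g x ∂μ))) :
    Tendsto (fun k => ∫ x, F k x ∂μ) atTop (𝓝 (∫ x, f x ∂μ)) := by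
  have hf : AEStronglyMeasurable f μ := aestronglyMeasurable_of_tendsto_ae _ hF hlim
  have hfi : Integrable f μ := by
    refine hg.mono' hf ?_
    filter_upwards [ae_all_iff.2 hbound, hlim, hGlim] with x h1 h2 h3
    exact le_of_tendsto_of_tendsto' h2.norm h3 h1
  have hFi : ∀ k, Integrable (F k) μ := fun k => (hG k).mono' (hF k) (hbound k)
  have key := tendsto_integral_norm_sub_of_dominating hF hG hg hbound hlim hGlim hint
  rw [tendsto_iff_norm_sub_tendsto_zero]
  refine squeeze_zero (fun k => norm_nonneg _) (fun k => ?_) key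
  rw [← integral_sub (hFi k) hfi]
  exact norm_integral_le_integral_norm _

/-! ### Mollification -/

/-- The bump function of outer radius `1 / (k + 1)`. -/
def mollBump (n k : ℕ) : ContDiffBump (0 : Vec n) where
  rIn := 1 / (2 * ((k : ℝ) + 1))
  rOut := 1 / ((k : ℝ) + 1)
  rIn_pos := by positivity
  rIn_lt_rOut := by
    have : (0 : ℝ) < (k : ℝ) + 1 := by positivity
    apply one_div_lt_one_div_of_lt this
    linarith

/-- The mollifier supported in the ball of radius `1 / (k + 1)`. -/
def mker (n k : ℕ) : Vec n → ℝ := (mollBump n k).normed volume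

/-- The mollification of `f` at scale `1 / (k + 1)`. -/
def mol {n : ℕ} {F : Type*} [NormedAddCommGroup F] [NormedSpace ℝ F] (k : ℕ) (f : Vec n → F) :
    Vec n → F :=
  fun x => ∫ y, mker n k (x - y) • f y

section Mollifier

variable {n : ℕ} {F : Type*} [NormedAddCommGroup F] [NormedSpace ℝ F]

theorem mker_nonneg (k : ℕ) (x : Vec n) : 0 ≤ mker n k x := (mollBump n k).nonneg_normed x

theorem mker_contDiff (k : ℕ) : ContDiff ℝ ∞ (mker n k) := (mollBump n k).contDiff_normed

theorem mker_continuous (k : ℕ) : Continuous (mker n k) := (mker_contDiff k).continuous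

theorem mker_hasCompactSupport (k : ℕ) : HasCompactSupport (mker n k) :=
  (mollBump n k).hasCompactSupport_normed

theorem mker_tsupport (k : ℕ) : tsupport (mker n k) = Metric.closedBall 0 (1 / ((k : ℝ) + 1)) :=
  (mollBump n k).tsupport_normed_eq

theorem mker_eq_zero {k : ℕ} {x : Vec n} (hx : 1 / ((k : ℝ) + 1) ≤ ‖x‖) : mker n k x = 0 := by
  have h : x ∉ Function.support (mker n k) := by
    unfold mker
    rw [(mollBump n k).support_normed_eq]
    simpa [mollBump] using hx
  simpa using h

theorem mker_neg (k : ℕ) (x : Vec n) : mker n k (-x) = mker n k x := (mollBump n k).normed_neg x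

theorem mker_sub_comm (k : ℕ) (x y : Vec n) : mker n k (x - y) = mker n k (y - x) := by
  rw [← mker_neg, neg_sub]

theorem integral_mker (k : ℕ) : ∫ x, mker n k x = 1 := (mollBump n k).integral_normed

theorem integral_mker_sub (k : ℕ) (x : Vec n) : ∫ y, mker n k (x - y) = 1 := by
  rw [integral_sub_left_eq_self (mker n k) volume x, integral_mker]

theorem mker_integrable (k : ℕ) : Integrable (mker n k) := (mollBump n k).integrable_normed

theorem mker_sub_integrable (k : ℕ) (x : Vec n) : Integrable fun y => mker n k (x - y) :=
  (mker_integrable k).comp_sub_left x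

theorem mol_eq_convolution (k : ℕ) (f : Vec n → F) :
    mol k f = convolution (mker n k) f (ContinuousLinearMap.lsmul ℝ ℝ) volume := by
  ext x
  exact (convolution_lsmul_swap).symm

theorem mol_eq_convolution_flip (k : ℕ) (f : Vec n → F) :
    mol k f = convolution f (mker n k) (ContinuousLinearMap.lsmul ℝ ℝ).flip volume := by
  rw [mol_eq_convolution, convolution_flip]

theorem mol_integrand_integrable (k : ℕ) {f : Vec n → F} (hf : LocallyIntegrable f) (x : Vec n) :
    Integrable fun y => mker n k (x - y) • f y := by
  have := ((mker_hasCompactSupport k).convolutionExists_left (ContinuousLinearMap.lsmul ℝ ℝ)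
    (mker_continuous k) hf x).integrable_swap
  simpa using this

theorem mol_contDiff (k : ℕ) {f : Vec n → F} (hf : LocallyIntegrable f) :
    ContDiff ℝ ∞ (mol k f) := by
  rw [mol_eq_convolution]
  exact (mker_hasCompactSupport k).contDiff_convolution_left _ (mker_contDiff k) hf

theorem partialDeriv_mol (k : ℕ) {f : Vec n → F} (hf : LocallyIntegrable f) (s : Fin n)
    (x : Vec n) :
    partialDeriv s (mol k f) x = ∫ y, partialDeriv s (mker n k) (x - y) • f y := by
  have h := (mker_hasCompactSupport k).hasFDerivAt_convolution_right
    (ContinuousLinearMap.lsmul ℝ ℝ).flip hf ((mker_contDiff k).of_le (by simp)) x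
  rw [← mol_eq_convolution_flip] at h
  unfold partialDeriv
  rw [h.fderiv, convolution_precompR_apply _ hf ((mker_hasCompactSupport k).fderiv ℝ)
    ((mker_contDiff k).continuous_fderiv (by simp))]
  rfl

theorem partialDeriv_mol_of_contDiff [CompleteSpace F] (k : ℕ) {f : Vec n → F}
    (hf : ContDiff ℝ 1 f) (hfc : HasCompactSupport f) (s : Fin n) :
    partialDeriv s (mol k f) = mol k (partialDeriv s f) := by
  ext x
  have h := hfc.hasFDerivAt_convolution_right (ContinuousLinearMap.lsmul ℝ ℝ)
    (mker_continuous k).locallyIntegrable (μ := volume) hf x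
  rw [← mol_eq_convolution] at h
  rw [partialDeriv, h.fderiv, convolution_precompR_apply _
    (mker_continuous k).locallyIntegrable (hfc.fderiv ℝ) (hf.continuous_fderiv (by simp)),
    mol_eq_convolution]
  rfl

theorem mol_tendsto_ae [CompleteSpace F] {f : Vec n → F} (hf : LocallyIntegrable f) :
    ∀ᵐ x, Tendsto (fun k => mol k f x) atTop (𝓝 (f x)) := by
  simp_rw [mol_eq_convolution]
  refine ContDiffBump.ae_convolution_tendsto_right_of_locallyIntegrable (K := 2)
    (φ := mollBump n) ?_ (Eventually.of_forall fun k => ?_) hf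
  · exact tendsto_one_div_add_atTop_nhds_zero_nat
  · simp only [mollBump]
    rw [one_div, one_div, mul_inv]
    linarith

theorem mol_integrable [CompleteSpace F] (k : ℕ) {f : Vec n → F} (hf : Integrable f) :
    Integrable (mol k f) := by
  rw [mol_eq_convolution]
  exact (mker_integrable k).integrable_convolution _ hf

theorem integral_mol [CompleteSpace F] (k : ℕ) {f : Vec n → F} (hf : Integrable f) :
    ∫ x, mol k f x = ∫ x, f x := by
  rw [mol_eq_convolution, integral_convolution _ (mker_integrable k) hf, integral_mker]
  simp

theorem mol_nonneg (k : ℕ) {f : Vec n → ℝ} (hf : ∀ x, 0 ≤ f x) (x : Vec n) : 0 ≤ mol k f x :=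
  integral_nonneg fun y => mul_nonneg (mker_nonneg k _) (hf y)

theorem mol_mono (k : ℕ) {f g : Vec n → ℝ} (hf : LocallyIntegrable f) (hg : LocallyIntegrable g)
    (h : ∀ x, f x ≤ g x) (x : Vec n) : mol k f x ≤ mol k g x :=
  integral_mono (mol_integrand_integrable k hf x) (mol_integrand_integrable k hg x)
    fun y => mul_le_mul_of_nonneg_left (h y) (mker_nonneg k _)

theorem norm_mol_le (k : ℕ) (f : Vec n → F) (x : Vec n) :
    ‖mol k f x‖ ≤ mol k (fun y => ‖f y‖) x := by
  refine (norm_integral_le_integral_norm _).trans (le_of_eq ?_)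
  refine integral_congr_ae (Eventually.of_forall fun y => ?_)
  simp [norm_smul, abs_of_nonneg (mker_nonneg k _)]

/-- Jensen's inequality for the square, obtained from the nonnegativity of the variance of ‖f‖ under
the probability density `mker n k (x - ·)`. -/
theorem norm_mol_sq_le (k : ℕ) {f : Vec n → F} (hf : LocallyIntegrable f)
    (hf2 : LocallyIntegrable fun y => ‖f y‖ ^ 2) (x : Vec n) :
    ‖mol k f x‖ ^ 2 ≤ mol k (fun y => ‖f y‖ ^ 2) x := by
  have hfn : LocallyIntegrable fun y => ‖f y‖ := fun y => (hf y).norm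
  set m := mol k (fun y => ‖f y‖) x with hm
  have h0 : 0 ≤ ∫ y, mker n k (x - y) * (‖f y‖ - m) ^ 2 :=
    integral_nonneg fun y => mul_nonneg (mker_nonneg k _) (sq_nonneg _)
  have i1 := mol_integrand_integrable k hf2 x
  have i2 := mol_integrand_integrable k hfn x
  have i3 := mker_sub_integrable (n := n) k x
  have h1 : ∫ y, mker n k (x - y) * (‖f y‖ - m) ^ 2 =
      mol k (fun y => ‖f y‖ ^ 2) x - 2 * m * m + m ^ 2 := by
    have : (fun y => mker n k (x - y) * (‖f y‖ - m) ^ 2) = fun y =>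
        (mker n k (x - y) • ‖f y‖ ^ 2 - (2 * m) * (mker n k (x - y) • ‖f y‖))
          + m ^ 2 * mker n k (x - y) := by
      ext y; simp only [smul_eq_mul]; ring
    have i4 : Integrable fun y => mker n k (x - y) • ‖f y‖ ^ 2
        - 2 * m * (mker n k (x - y) • ‖f y‖) := i1.sub (i2.const_mul _)
    rw [this, integral_add i4 (i3.const_mul _), integral_sub i1 (i2.const_mul _), integral_const_mul, integral_const_mul,
      integral_mker_sub]
    simp only [hm, mol]; ring
  have h2 : ‖mol k f x‖ ^ 2 ≤ m ^ 2 :=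
    pow_le_pow_left₀ (norm_nonneg _) (norm_mol_le k f x) 2
  nlinarith

/-- Values of a mollification only depend on values on a small ball. -/
theorem mol_congr {k : ℕ} {f g : Vec n → F} {x : Vec n}
    (h : ∀ y ∈ Metric.ball x (1 / ((k : ℝ) + 1)), f y = g y) : mol k f x = mol k g x := by
  refine integral_congr_ae (Eventually.of_forall fun y => ?_)
  by_cases hy : y ∈ Metric.ball x (1 / ((k : ℝ) + 1))
  · simp [h y hy]
  · have : mker n k (x - y) = 0 := mker_eq_zero (by
      rw [Metric.mem_ball, dist_comm, dist_eq_norm, not_lt] at hy; exact hy)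
    simp [this]

theorem mol_hasCompactSupport (k : ℕ) {f : Vec n → F} (hf : HasCompactSupport f) :
    HasCompactSupport (mol k f) := by
  rw [mol_eq_convolution]
  exact (mker_hasCompactSupport k).convolution _ hf

theorem tsupport_mol_subset (k : ℕ) (f : Vec n → F) :
    tsupport (mol k f) ⊆ Metric.cthickening (1 / ((k : ℝ) + 1)) (tsupport f) := by
  refine closure_minimal (fun x hx => ?_) Metric.isClosed_cthickening
  by_contra hc
  apply hx
  have h0 : mol k f x = mol k (fun _ => (0 : F)) x := by
    refine mol_congr fun y hy => ?_
    by_contra hfy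
    apply hc
    refine Metric.mem_cthickening_of_dist_le x y _ _ (subset_tsupport _ hfy) ?_
    rw [dist_comm]
    exact (Metric.mem_ball.1 hy).le
  rw [h0]
  simp [mol]

/-- Fubini and the evenness of the kernel make mollification self-adjoint. This is how the mollified
flux inherits the weak equation. -/
theorem integral_inner_mol {G : Type*} [NormedAddCommGroup G] [InnerProductSpace ℝ G]
    [CompleteSpace G] (k : ℕ) {f g : Vec n → G} (hf : Integrable f)
    (hg : Continuous g) (hgb : ∃ C, ∀ x, ‖g x‖ ≤ C) :
    ∫ x, inner ℝ (mol k f x) (g x) = ∫ x, inner ℝ (f x) (mol k g x) := by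
  obtain ⟨C, hC⟩ := hgb
  have hconv : Integrable (fun p : Vec n × Vec n => mker n k (p.1 - p.2) • f p.2)
      (volume.prod volume) := by
    have := hf.convolution_integrand (ContinuousLinearMap.lsmul ℝ ℝ).flip
      (mker_integrable (n := n) k) (μ := volume)
    simpa using this
  have hF : Integrable (fun p : Vec n × Vec n => inner ℝ (mker n k (p.1 - p.2) • f p.2) (g p.1))
      (volume.prod volume) := by
    refine (hconv.norm.mul_const C).mono'
      (hconv.1.inner (hg.comp continuous_fst).aestronglyMeasurable) (Eventually.of_forall ?_)
    intro p
    exact (norm_inner_le_norm _ _).trans (mul_le_mul_of_nonneg_left (hC _) (norm_nonneg _))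
  have hgl : LocallyIntegrable g := hg.locallyIntegrable
  have e1 : ∀ x, inner ℝ (mol k f x) (g x)
      = ∫ y, inner ℝ (mker n k (x - y) • f y) (g x) := fun x => by
    rw [mol, real_inner_comm,
      ← integral_inner (mol_integrand_integrable k hf.locallyIntegrable x) (g x)]
    exact integral_congr_ae (Eventually.of_forall fun y => real_inner_comm _ _)
  have e2 : ∀ y, inner ℝ (f y) (mol k g y)
      = ∫ x, inner ℝ (mker n k (x - y) • f y) (g x) := fun y => by
    rw [mol, ← integral_inner (mol_integrand_integrable k hgl y) (f y)]
    refine integral_congr_ae (Eventually.of_forall fun x => ?_)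
    simp only [inner_smul_left, inner_smul_right]
    rw [mker_sub_comm]
    rfl
  simp_rw [e1, e2]
  exact integral_integral_swap hF

end Mollifier


/-! ### Regular coefficients -/

/-- A `C¹` coefficient `α` such that `P ↦ α (|P|²) P` is uniformly elliptic; `m` and `M` control the
ratio of the eigenvalues of the linearisation. -/
structure RegCoef (α : ℝ → ℝ) (lo hi m M : ℝ) : Prop where
  lo_pos : 0 < lo
  m_pos : 0 < m
  m_le_one : m ≤ 1
  one_le : 1 ≤ M
  contDiffOn : ∃ c, 0 < c ∧ ContDiffOn ℝ 1 α (Ioi (-c))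
  lo_le : ∀ r, 0 ≤ r → lo ≤ α r
  le_hi : ∀ r, 0 ≤ r → α r ≤ hi
  lower : ∀ r, 0 ≤ r → (m - 1) * α r ≤ 2 * r * deriv α r
  upper : ∀ r, 0 ≤ r → 2 * r * deriv α r ≤ (M - 1) * α r

section Coefficient

variable {G : Type*} [NormedAddCommGroup G] [InnerProductSpace ℝ G]

/-- The vector field `P ↦ α (|P|²) P`. -/
def regFlux (α : ℝ → ℝ) (P : G) : G := α (‖P‖ ^ 2) • P

/-- The derivative of `regFlux α` at `P`. -/
def regFluxDeriv (α : ℝ → ℝ) (P : G) : G →L[ℝ] G :=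
  α (‖P‖ ^ 2) • ContinuousLinearMap.id ℝ G
    + ((2 * deriv α (‖P‖ ^ 2)) • innerSL ℝ P).smulRight P

theorem regFluxDeriv_apply (α : ℝ → ℝ) (P ξ : G) :
    regFluxDeriv α P ξ = α (‖P‖ ^ 2) • ξ + (2 * deriv α (‖P‖ ^ 2) * inner ℝ P ξ) • P := by
  simp [regFluxDeriv]

/-- A radially nondecreasing vector field is monotone, with a lower bound in terms of the norms. -/
theorem mul_sub_le_inner_smul_sub {a b : ℝ} (ha : 0 ≤ a) (hb : 0 ≤ b) (P Q : G) :
    (a * ‖P‖ - b * ‖Q‖) * (‖P‖ - ‖Q‖) ≤ inner ℝ (a • P - b • Q) (P - Q) := by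
  have h1 : inner ℝ (a • P - b • Q) (P - Q)
      = a * ‖P‖ ^ 2 + b * ‖Q‖ ^ 2 - (a + b) * inner ℝ P Q := by
    simp only [inner_sub_left, inner_sub_right, inner_smul_left, real_inner_self_eq_norm_sq,
      RCLike.conj_to_real]
    rw [real_inner_comm P Q]; ring
  have h2 := real_inner_le_norm P Q
  rw [h1]
  nlinarith [mul_le_mul_of_nonneg_left h2 (add_nonneg ha hb)]

namespace RegCoef

variable {α : ℝ → ℝ} {lo hi m M : ℝ} (hα : RegCoef α lo hi m M)
include hα

theorem pos {r : ℝ} (hr : 0 ≤ r) : 0 < α r := hα.lo_pos.trans_le (hα.lo_le r hr)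

theorem hi_pos : 0 < hi := (hα.pos le_rfl).trans_le (hα.le_hi 0 le_rfl)

theorem abs_le {r : ℝ} (hr : 0 ≤ r) : |2 * r * deriv α r| ≤ M * α r := by
  have h0 := hα.pos hr
  have h1 := hα.lower r hr
  have h2 := hα.upper r hr
  have h3 := hα.one_le
  have h4 := hα.m_pos
  rw [_root_.abs_le]
  constructor <;> nlinarith

theorem hasDerivAt {r : ℝ} (hr : 0 ≤ r) : HasDerivAt α (deriv α r) r := by
  obtain ⟨c, hc, h⟩ := hα.contDiffOn
  exact ((h.contDiffAt (Ioi_mem_nhds (by linarith))).differentiableAt (by simp)).hasDerivAt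

theorem continuousAt_deriv {r : ℝ} (hr : 0 ≤ r) : ContinuousAt (deriv α) r := by
  obtain ⟨c, hc, h⟩ := hα.contDiffOn
  exact (h.continuousOn_deriv_of_isOpen isOpen_Ioi le_rfl).continuousAt
    (Ioi_mem_nhds (by linarith))

theorem contDiff_comp {E : Type*} [NormedAddCommGroup E] [NormedSpace ℝ E] {f : E → ℝ}
    (hf : ContDiff ℝ 1 f) (hf0 : ∀ x, 0 ≤ f x) : ContDiff ℝ 1 fun x => α (f x) := by
  obtain ⟨c, hc, h⟩ := hα.contDiffOn
  exact h.comp_contDiff hf fun x => lt_of_lt_of_le (by simpa using hc) (hf0 x)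

theorem continuous_comp {X : Type*} [TopologicalSpace X] {f : X → ℝ}
    (hf : Continuous f) (hf0 : ∀ x, 0 ≤ f x) : Continuous fun x => α (f x) :=
  continuous_iff_continuousAt.2 fun x =>
    (hα.hasDerivAt (hf0 x)).continuousAt.comp (f := f) hf.continuousAt

theorem continuous_deriv_comp {X : Type*} [TopologicalSpace X] {f : X → ℝ}
    (hf : Continuous f) (hf0 : ∀ x, 0 ≤ f x) : Continuous fun x => deriv α (f x) :=
  continuous_iff_continuousAt.2 fun x =>
    (hα.continuousAt_deriv (hf0 x)).comp (f := f) hf.continuousAt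

theorem hasFDerivAt_regFlux (P : G) : HasFDerivAt (regFlux α) (regFluxDeriv α P) P := by
  have h1 : HasFDerivAt (fun P : G => ‖P‖ ^ 2) (2 • innerSL ℝ P) P :=
    (hasStrictFDerivAt_norm_sq P).hasFDerivAt
  have h2 := (hα.hasDerivAt (sq_nonneg ‖P‖)).comp_hasFDerivAt P h1
  have h3 := h2.smul (hasFDerivAt_id P)
  refine h3.congr_fderiv (ContinuousLinearMap.ext fun ξ => ?_)
  rw [regFluxDeriv_apply]
  simp only [Function.comp_apply, add_apply, smul_apply,
    ContinuousLinearMap.id_apply, ContinuousLinearMap.smulRight_apply, innerSL_apply_apply, id,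
    smul_eq_mul, nsmul_eq_mul]
  congr 2
  push_cast
  ring

theorem norm_regFluxDeriv_apply_le (P ξ : G) :
    ‖regFluxDeriv α P ξ‖ ≤ (1 + M) * α (‖P‖ ^ 2) * ‖ξ‖ := by
  have h0 := hα.pos (sq_nonneg ‖P‖)
  have h1 := hα.abs_le (sq_nonneg ‖P‖)
  rw [regFluxDeriv_apply]
  refine (norm_add_le _ _).trans ?_
  rw [norm_smul, norm_smul, Real.norm_eq_abs, Real.norm_eq_abs, abs_of_pos h0, abs_mul]
  have h2 := abs_real_inner_le_norm P ξ
  have h3 : |2 * deriv α (‖P‖ ^ 2)| * |inner ℝ P ξ| * ‖P‖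
      ≤ |2 * deriv α (‖P‖ ^ 2)| * (‖P‖ * ‖ξ‖) * ‖P‖ := by gcongr
  have h4 : |2 * deriv α (‖P‖ ^ 2)| * (‖P‖ * ‖ξ‖) * ‖P‖
      = |2 * ‖P‖ ^ 2 * deriv α (‖P‖ ^ 2)| * ‖ξ‖ := by
    rw [show 2 * ‖P‖ ^ 2 * deriv α (‖P‖ ^ 2) = (2 * deriv α (‖P‖ ^ 2)) * ‖P‖ ^ 2 by ring,
      abs_mul _ (‖P‖ ^ 2), abs_of_nonneg (sq_nonneg ‖P‖)]
    ring
  have h5 := mul_le_mul_of_nonneg_right h1 (norm_nonneg ξ)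
  nlinarith

/-- The linearisation is α·id plus the rank one term 2α' P⊗P. If α' ≥ 0 that term helps, and m ≤ 1
suffices. If α' ≤ 0, Cauchy–Schwarz shows that the worst direction is ξ parallel to P, where `lower`
still leaves mα. -/
theorem le_inner_regFluxDeriv (P ξ : G) :
    m * α (‖P‖ ^ 2) * ‖ξ‖ ^ 2 ≤ inner ℝ (regFluxDeriv α P ξ) ξ := by
  have h0 := hα.pos (sq_nonneg ‖P‖)
  have h1 := hα.lower _ (sq_nonneg ‖P‖)
  have h4 := hα.m_le_one
  rw [regFluxDeriv_apply, inner_add_left, inner_smul_left, inner_smul_left,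
    real_inner_self_eq_norm_sq]
  simp only [RCLike.conj_to_real]
  have h2 : (inner ℝ P ξ) ^ 2 ≤ ‖P‖ ^ 2 * ‖ξ‖ ^ 2 := by
    rw [← mul_pow]; exact sq_le_sq' (by
      have := abs_real_inner_le_norm P ξ
      rw [_root_.abs_le] at this; linarith [this.1]) (real_inner_le_norm P ξ)
  rcases le_total 0 (deriv α (‖P‖ ^ 2)) with h | h
  · have h5 : 0 ≤ 2 * deriv α (‖P‖ ^ 2) * inner ℝ P ξ * inner ℝ P ξ := by
      rw [mul_assoc]; exact mul_nonneg (by positivity) (mul_self_nonneg _)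
    nlinarith [mul_nonneg h0.le (sq_nonneg ‖ξ‖)]
  · have h5 : 2 * deriv α (‖P‖ ^ 2) * (‖P‖ ^ 2 * ‖ξ‖ ^ 2)
        ≤ 2 * deriv α (‖P‖ ^ 2) * (inner ℝ P ξ) ^ 2 :=
      mul_le_mul_of_nonpos_left h2 (by linarith)
    nlinarith [mul_le_mul_of_nonneg_right h1 (sq_nonneg ‖ξ‖)]

theorem norm_regFlux_sub_le (P Q : G) :
    ‖regFlux α P - regFlux α Q‖ ≤ (1 + M) * hi * ‖P - Q‖ := by
  have hM : 0 ≤ 1 + M := by linarith [hα.one_le]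
  refine convex_univ.norm_image_sub_le_of_norm_hasFDerivWithin_le (f' := regFluxDeriv α)
    (fun x _ => (hα.hasFDerivAt_regFlux x).hasFDerivWithinAt) (fun x _ => ?_)
    (mem_univ Q) (mem_univ P)
  refine ContinuousLinearMap.opNorm_le_bound _ (mul_nonneg hM hα.hi_pos.le) fun ξ => ?_
  refine (hα.norm_regFluxDeriv_apply_le x ξ).trans ?_
  have := hα.le_hi _ (sq_nonneg ‖x‖)
  gcongr

theorem lipschitzWith_regFlux :
    LipschitzWith (Real.toNNReal ((1 + M) * hi)) (regFlux α : G → G) := by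
  refine LipschitzWith.of_dist_le_mul fun P Q => ?_
  rw [dist_eq_norm, dist_eq_norm, Real.coe_toNNReal _
    (mul_nonneg (by linarith [hα.one_le]) hα.hi_pos.le)]
  exact hα.norm_regFlux_sub_le P Q

omit hα in
theorem regFlux_zero (α : ℝ → ℝ) : regFlux α (0 : G) = 0 := by simp [regFlux]

theorem continuous_regFlux : Continuous (regFlux α : G → G) := hα.lipschitzWith_regFlux.continuous

theorem norm_regFlux (P : G) : ‖regFlux α P‖ = α (‖P‖ ^ 2) * ‖P‖ := by
  rw [regFlux, norm_smul, Real.norm_of_nonneg (hα.pos (sq_nonneg _)).le]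

theorem norm_regFlux_le (P : G) : ‖regFlux α P‖ ≤ hi * ‖P‖ := by
  rw [hα.norm_regFlux]
  exact mul_le_mul_of_nonneg_right (hα.le_hi _ (sq_nonneg _)) (norm_nonneg _)

/-- The mean value theorem for t ↦ ⟨A(Q + tξ), ξ⟩ with ξ = P − Q reduces this to the ellipticity of
the linearisation. -/
theorem le_inner_regFlux_sub (P Q : G) :
    m * lo * ‖P - Q‖ ^ 2 ≤ inner ℝ (regFlux α P - regFlux α Q) (P - Q) := by
  set ξ := P - Q with hξ
  have hd : ∀ t : ℝ, HasDerivAt (fun t : ℝ => inner ℝ (regFlux α (Q + t • ξ)) ξ)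
      (inner ℝ (regFluxDeriv α (Q + t • ξ) ξ) ξ) t := fun t => by
    have h1 : HasDerivAt (fun t : ℝ => Q + t • ξ) ξ t := by
      simpa using ((hasDerivAt_id t).smul_const ξ).const_add Q
    have h2 := (hα.hasFDerivAt_regFlux (Q + t • ξ)).comp_hasDerivAt t h1
    simpa using h2.inner ℝ (hasDerivAt_const t ξ)
  obtain ⟨t, -, ht⟩ := exists_hasDerivAt_eq_slope _ _ (zero_lt_one (α := ℝ))
    (fun t _ => (hd t).continuousAt.continuousWithinAt) (fun t _ => hd t)
  have h3 := hα.le_inner_regFluxDeriv (Q + t • ξ) ξ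
  rw [ht] at h3
  simp only [one_smul, zero_smul, add_zero, sub_zero, div_one] at h3
  rw [show Q + ξ = P by simp [hξ], ← inner_sub_left] at h3
  refine le_trans ?_ h3
  have := hα.lo_le _ (sq_nonneg ‖Q + t • ξ‖)
  have := hα.m_pos
  gcongr

theorem hasDerivAt_mul_self (t : ℝ) :
    HasDerivAt (fun t => t * α (t ^ 2)) (α (t ^ 2) + 2 * t ^ 2 * deriv α (t ^ 2)) t := by
  have h1 : HasDerivAt (fun t : ℝ => α (t ^ 2)) (deriv α (t ^ 2) * (2 * t)) t := by
    have := HasDerivAt.comp (h₂ := α) (h := fun t : ℝ => t ^ 2) t (hα.hasDerivAt (sq_nonneg t))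
      (hasDerivAt_pow 2 t)
    exact this.congr_deriv (by norm_num)
  have h := (hasDerivAt_id t).mul h1
  refine h.congr_deriv ?_
  simp only [id]
  ring

theorem monotone_mul_self : Monotone fun t => t * α (t ^ 2) := by
  refine monotone_of_hasDerivAt_nonneg hα.hasDerivAt_mul_self fun t => ?_
  have h1 := hα.lower _ (sq_nonneg t)
  have h2 := hα.pos (sq_nonneg t)
  have h3 := hα.m_pos
  simp only [Pi.zero_apply]
  nlinarith

/-- The function tα(t²)t^(−M) is nonincreasing: `upper` bounds the logarithmic derivative of tα(t²)
by M/t. -/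
theorem doubling {t : ℝ} (ht : 0 ≤ t) :
    (2 * t) * α ((2 * t) ^ 2) ≤ 2 ^ M * (t * α (t ^ 2)) := by
  rcases ht.eq_or_lt with rfl | ht
  · simp
  set f : ℝ → ℝ := fun t => t * α (t ^ 2) with hf
  have hmono : AntitoneOn (fun t : ℝ => f t * t ^ (-M)) (Ioi 0) := by
    have hder : ∀ t ∈ Ioi (0 : ℝ), HasDerivAt (fun t : ℝ => f t * t ^ (-M))
        ((α (t ^ 2) + 2 * t ^ 2 * deriv α (t ^ 2)) * t ^ (-M)
          + f t * (-M * t ^ (-M - 1))) t := fun t ht =>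
      (hα.hasDerivAt_mul_self t).mul (Real.hasDerivAt_rpow_const (Or.inl (ne_of_gt ht)))
    refine antitoneOn_of_deriv_nonpos (convex_Ioi 0)
      (fun t ht => (hder t ht).continuousAt.continuousWithinAt)
      (fun t ht => ((hder t (interior_subset ht)).differentiableAt).differentiableWithinAt) ?_
    intro t ht
    rw [interior_Ioi] at ht
    rw [(hder t ht).deriv, Real.rpow_sub_one (ne_of_gt ht)]
    have h1 := hα.upper _ (sq_nonneg t)
    have h2 : 0 < t ^ (-M) := Real.rpow_pos_of_pos ht _
    have h3 : f t * (-M * (t ^ (-M) / t)) = -M * α (t ^ 2) * t ^ (-M) := by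
      have : t ≠ 0 := ne_of_gt ht
      simp only [hf]; field_simp
    rw [h3, ← add_mul]
    refine mul_nonpos_of_nonpos_of_nonneg ?_ h2.le
    linarith
  have h := hmono (mem_Ioi.2 ht) (mem_Ioi.2 (by linarith : 0 < 2 * t)) (by linarith)
  simp only at h
  rw [Real.mul_rpow (by norm_num) ht.le, ← mul_assoc] at h
  have h4 := le_of_mul_le_mul_right h (Real.rpow_pos_of_pos ht _)
  rw [Real.rpow_neg (by norm_num), ← div_eq_mul_inv,
    div_le_iff₀ (Real.rpow_pos_of_pos (by norm_num) _)] at h4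
  rw [mul_comm (2 ^ M)]
  exact h4

/-- Young's inequality for the energy. -/
theorem inner_regFlux_le (P Q : G) :
    inner ℝ (regFlux α P) Q ≤ (1 / 2) * (α (‖P‖ ^ 2) * ‖P‖ ^ 2)
      + 2 ^ M * (α (‖Q‖ ^ 2) * ‖Q‖ ^ 2) := by
  have hP := hα.pos (sq_nonneg ‖P‖)
  have hQ := hα.pos (sq_nonneg ‖Q‖)
  have h2M : (0 : ℝ) < 2 ^ M := Real.rpow_pos_of_pos (by norm_num) _
  refine (real_inner_le_norm _ _).trans ?_
  rw [hα.norm_regFlux]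
  -- If |Q| ≤ |P|/2, half of the P-energy absorbs the product. Otherwise |P| ≤ 2|Q|, and
  -- monotonicity with doubling turns everything into Q-energy at the price 2^M.
  rcases le_total ‖Q‖ ((1 / 2) * ‖P‖) with h | h
  · have h1 : α (‖P‖ ^ 2) * ‖P‖ * ‖Q‖ ≤ α (‖P‖ ^ 2) * ‖P‖ * ((1 / 2) * ‖P‖) := by gcongr
    have h3 : 0 ≤ 2 ^ M * (α (‖Q‖ ^ 2) * ‖Q‖ ^ 2) := by positivity
    nlinarith
  · have h1 : ‖P‖ * α (‖P‖ ^ 2) ≤ (2 * ‖Q‖) * α ((2 * ‖Q‖) ^ 2) :=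
      hα.monotone_mul_self (by linarith)
    have h2 := h1.trans (hα.doubling (norm_nonneg Q))
    have h3 := mul_le_mul_of_nonneg_right h2 (norm_nonneg Q)
    have h4 : 0 ≤ α (‖P‖ ^ 2) * ‖P‖ ^ 2 := by positivity
    nlinarith

end RegCoef

end Coefficient

/-! ### The pointwise inequality behind the Caccioppoli estimate -/

/-- The `n × N` matrix with entries `p j * W s i`. -/
def rowTensor {n N : ℕ} (p : Fin n → ℝ) (W : Mat n N) (s : Fin n) : Mat n N :=
  WithLp.toLp 2 fun q => p q.1 * W (s, q.2)

theorem rowTensor_apply {n N : ℕ} (p : Fin n → ℝ) (W : Mat n N) (s : Fin n)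
    (q : Fin n × Fin N) : rowTensor p W s q = p q.1 * W (s, q.2) := rfl

theorem inner_eq_sum {ι : Type*} [Fintype ι] (P Q : EuclideanSpace ℝ ι) :
    inner ℝ P Q = ∑ q, P q * Q q := by
  rw [PiLp.inner_apply]
  refine Finset.sum_congr rfl fun q _ => ?_
  simp [mul_comm]

theorem sum_norm_rowTensor_sq {n N : ℕ} (p : Fin n → ℝ) (W : Mat n N) :
    ∑ s, ‖rowTensor p W s‖ ^ 2 = (∑ j, p j ^ 2) * ‖W‖ ^ 2 := by
  simp_rw [EuclideanSpace.real_norm_sq_eq, rowTensor_apply, Fintype.sum_prod_type, mul_pow,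
    ← Finset.mul_sum, ← Finset.sum_mul]
  rw [← Finset.mul_sum]

/-- The symmetry of D is what lets the tensor with entries p_j W_{si} be contracted into the
products W·D_j, that is, half the derivatives of |W|². -/
theorem sum_inner_rowTensor {n N : ℕ} (p : Fin n → ℝ) (W : Mat n N) (D : Fin n → Mat n N)
    (hD : ∀ s j i, D s (j, i) = D j (s, i)) :
    ∑ s, inner ℝ (D s) (rowTensor p W s) = ∑ j, p j * inner ℝ W (D j) := by
  simp_rw [inner_eq_sum, rowTensor_apply, Fintype.sum_prod_type, Finset.mul_sum]
  rw [Finset.sum_comm]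
  refine Finset.sum_congr rfl fun j _ => Finset.sum_congr rfl fun s _ =>
    Finset.sum_congr rfl fun i _ => ?_
  rw [hD s j i]; ring

/-- The sum is the squared length of the vector Σ_s p_s W_s, so it is nonnegative and Cauchy–Schwarz
bounds it. -/
theorem sum_mul_inner_rowTensor {n N : ℕ} (p : Fin n → ℝ) (W : Mat n N) :
    0 ≤ ∑ s, p s * inner ℝ W (rowTensor p W s) ∧
      ∑ s, p s * inner ℝ W (rowTensor p W s) ≤ (∑ j, p j ^ 2) * ‖W‖ ^ 2 := by
  have h1 : ∑ s, p s * inner ℝ W (rowTensor p W s) = ∑ i, (∑ s, p s * W (s, i)) ^ 2 := by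
    simp_rw [inner_eq_sum, rowTensor_apply, Fintype.sum_prod_type, Finset.mul_sum, sq,
      Finset.sum_mul_sum]
    rw [Finset.sum_comm' (t' := Finset.univ) (s' := fun _ => Finset.univ) (by simp)]
    rw [Finset.sum_comm]
    rw [Finset.sum_comm' (t' := Finset.univ) (s' := fun _ => Finset.univ) (by simp)]
    rw [Finset.sum_comm]
    conv_rhs => rw [Finset.sum_comm]
    refine Finset.sum_congr rfl fun j _ => ?_
    rw [Finset.sum_comm]
    refine Finset.sum_congr rfl fun s _ => Finset.sum_congr rfl fun i _ => ?_
    ring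
  rw [h1]
  refine ⟨Finset.sum_nonneg fun i _ => sq_nonneg _, ?_⟩
  have h2 : ∀ i, (∑ s, p s * W (s, i)) ^ 2 ≤ (∑ j, p j ^ 2) * ∑ s, W (s, i) ^ 2 := fun i =>
    Finset.sum_mul_sq_le_sq_mul_sq _ _ _
  refine (Finset.sum_le_sum fun i _ => h2 i).trans (le_of_eq ?_)
  rw [← Finset.mul_sum, EuclideanSpace.real_norm_sq_eq, Fintype.sum_prod_type, Finset.sum_comm]

/-- The matrix `∇ (η² g(|W|²) W_s)`, where `D` is the derivative of `W` and `e` that of `η`. -/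
def testGrad {n N : ℕ} (η g g' : ℝ) (e : Fin n → ℝ) (W : Mat n N) (D : Fin n → Mat n N)
    (s : Fin n) : Mat n N :=
  (η ^ 2 * g) • (WithLp.toLp 2 fun q => D q.1 (s, q.2))
    + (2 * η ^ 2 * g') • rowTensor (fun j => inner ℝ W (D j)) W s + (2 * η * g) • rowTensor e W s

/-- The gradient of the test function has three parts. The one with D is coercive by ellipticity,
the one with g' is nonnegative, and the one with e is split by Young's inequality so that half of
the coercive part survives. -/
theorem RegCoef.le_sum_inner_testGrad {α : ℝ → ℝ} {lo hi m M : ℝ} (hα : RegCoef α lo hi m M)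
    {n N : ℕ} {η g g' : ℝ} (hg : 0 ≤ g) (hg' : 0 ≤ g') (e : Fin n → ℝ)
    (W : Mat n N) (D : Fin n → Mat n N) (hD : ∀ s j i, D s (j, i) = D j (s, i)) :
    m / 2 * (η ^ 2 * g * α (‖W‖ ^ 2) * ∑ s, ‖D s‖ ^ 2)
        - 2 * (1 + M) ^ 2 / m * (g * α (‖W‖ ^ 2) * ‖W‖ ^ 2 * ∑ j, e j ^ 2)
      ≤ ∑ s, inner ℝ (regFluxDeriv α W (D s)) (testGrad η g g' e W D s) := by
  have hm := hα.m_pos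
  have hM := hα.one_le
  set a := α (‖W‖ ^ 2) with ha
  have ha0 : 0 < a := hα.pos (sq_nonneg _)
  set p : Fin n → ℝ := fun j => inner ℝ W (D j) with hp
  have hrow : ∀ s, (WithLp.toLp 2 fun q : Fin n × Fin N => D q.1 (s, q.2)) = D s := fun s => by
    ext q
    simp [← hD s q.1 q.2]
  have h1 : ∀ s, m * a * ‖D s‖ ^ 2 ≤ inner ℝ (regFluxDeriv α W (D s)) (D s) := fun s =>
    hα.le_inner_regFluxDeriv W (D s)
  -- The sign of the g' term. With p_j = W·D_j, half of ∂_j|W|², symmetry turns the sum into α|p|² +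
  -- 2α'q with 0 ≤ q ≤ |p|²|W|². For α' ≥ 0 both summands are nonnegative; for α' ≤ 0, `lower`
  -- leaves at least mα|p|².
  have h2 : 0 ≤ ∑ s, inner ℝ (regFluxDeriv α W (D s)) (rowTensor p W s) := by
    simp_rw [regFluxDeriv_apply, inner_add_left, inner_smul_left, RCLike.conj_to_real]
    rw [Finset.sum_add_distrib, ← Finset.mul_sum, sum_inner_rowTensor p W D hD]
    have e1 : ∑ j, p j * inner ℝ W (D j) = ∑ j, p j ^ 2 :=
      Finset.sum_congr rfl fun j _ => by rw [sq]
    have e2 : ∑ s, 2 * deriv α (‖W‖ ^ 2) * inner ℝ W (D s) * inner ℝ W (rowTensor p W s)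
        = 2 * deriv α (‖W‖ ^ 2) * ∑ s, p s * inner ℝ W (rowTensor p W s) := by
      rw [Finset.mul_sum]
      exact Finset.sum_congr rfl fun s _ => by ring
    rw [e1, e2]
    obtain ⟨q0, q1⟩ := sum_mul_inner_rowTensor p W
    set q := ∑ s, p s * inner ℝ W (rowTensor p W s)
    have hp0 : 0 ≤ ∑ j, p j ^ 2 := Finset.sum_nonneg fun j _ => sq_nonneg _
    rcases le_total 0 (deriv α (‖W‖ ^ 2)) with h | h
    · positivity
    · have h5 : 2 * deriv α (‖W‖ ^ 2) * ((∑ j, p j ^ 2) * ‖W‖ ^ 2)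
          ≤ 2 * deriv α (‖W‖ ^ 2) * q := mul_le_mul_of_nonpos_left q1 (by linarith)
      have h6 := mul_le_mul_of_nonneg_right (hα.lower _ (sq_nonneg ‖W‖)) hp0
      have h7 : 0 ≤ m * a * ∑ j, p j ^ 2 := by positivity
      nlinarith
  have h3 : ∀ s, -(m / 2 * (η ^ 2 * g * a * ‖D s‖ ^ 2)
      + 2 * (1 + M) ^ 2 / m * (g * a * ‖rowTensor e W s‖ ^ 2))
      ≤ 2 * η * g * inner ℝ (regFluxDeriv α W (D s)) (rowTensor e W s) := fun s => by
    have k1 := abs_real_inner_le_norm (regFluxDeriv α W (D s)) (rowTensor e W s)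
    have k2 := hα.norm_regFluxDeriv_apply_le W (D s)
    have k3 : |inner ℝ (regFluxDeriv α W (D s)) (rowTensor e W s)|
        ≤ (1 + M) * a * ‖D s‖ * ‖rowTensor e W s‖ :=
      k1.trans (mul_le_mul_of_nonneg_right k2 (norm_nonneg _))
    set x := ‖D s‖
    set y := ‖rowTensor e W s‖
    have k4 : |2 * η * g * inner ℝ (regFluxDeriv α W (D s)) (rowTensor e W s)|
        ≤ 2 * |η| * g * ((1 + M) * a * x * y) := by
      rw [abs_mul, abs_mul, abs_mul, abs_of_nonneg hg, abs_of_pos (by norm_num : (0 : ℝ) < 2)]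
      gcongr
    have k5 : 2 * |η| * g * ((1 + M) * a * x * y)
        ≤ m / 2 * (η ^ 2 * g * a * x ^ 2) + 2 * (1 + M) ^ 2 / m * (g * a * y ^ 2) := by
      have e : m / 2 * (η ^ 2 * g * a * x ^ 2) + 2 * (1 + M) ^ 2 / m * (g * a * y ^ 2)
          - 2 * |η| * g * ((1 + M) * a * x * y)
          = g * a * (m / 2) * (|η| * x - 2 * (1 + M) / m * y) ^ 2 := by
        rw [← sq_abs η]; field_simp; ring
      have : 0 ≤ g * a * (m / 2) * (|η| * x - 2 * (1 + M) / m * y) ^ 2 := by positivity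
      linarith
    have := neg_abs_le (2 * η * g * inner ℝ (regFluxDeriv α W (D s)) (rowTensor e W s))
    linarith
  have h4 : ∑ s, inner ℝ (regFluxDeriv α W (D s)) (testGrad η g g' e W D s)
      = η ^ 2 * g * (∑ s, inner ℝ (regFluxDeriv α W (D s)) (D s))
        + 2 * η ^ 2 * g' * (∑ s, inner ℝ (regFluxDeriv α W (D s)) (rowTensor p W s))
        + ∑ s, 2 * η * g * inner ℝ (regFluxDeriv α W (D s)) (rowTensor e W s) := by
    simp_rw [testGrad, hrow, inner_add_right, inner_smul_right, Finset.sum_add_distrib,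
      Finset.mul_sum]
    rfl
  rw [h4]
  have h5 := Finset.sum_le_sum fun s (_ : s ∈ Finset.univ) => h1 s
  have h6 := Finset.sum_le_sum fun s (_ : s ∈ Finset.univ) => h3 s
  simp_rw [Finset.sum_neg_distrib, Finset.sum_add_distrib, ← Finset.mul_sum] at h6
  rw [sum_norm_rowTensor_sq] at h6
  rw [← Finset.mul_sum] at h5
  have h7 := mul_le_mul_of_nonneg_left h5 (mul_nonneg (sq_nonneg η) hg)
  have h8 : 0 ≤ 2 * η ^ 2 * g' * (∑ s, inner ℝ (regFluxDeriv α W (D s)) (rowTensor p W s)) := by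
    positivity
  rw [← Finset.mul_sum]
  nlinarith


/-! ### Monotone operators on Hilbert spaces -/

/-- Zarantonello's argument: with P the orthogonal projection onto X, the map G ↦ G − τ P(T G) is a
contraction of X for small τ, and a fixed point satisfies P(T G) = 0. -/
theorem exists_inner_eq_zero_of_strongly_monotone {E : Type*} [NormedAddCommGroup E]
    [InnerProductSpace ℝ E] (X : Submodule ℝ E) [CompleteSpace X] {T : E → E} {c L : ℝ}
    (hc : 0 < c) (hL : ∀ P Q, ‖T P - T Q‖ ≤ L * ‖P - Q‖)
    (hT : ∀ P Q, c * ‖P - Q‖ ^ 2 ≤ inner ℝ (T P - T Q) (P - Q)) :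
    ∃ G ∈ X, ∀ Z ∈ X, inner ℝ (T G) Z = 0 := by
  -- Enlarging the Lipschitz constant beyond c keeps 1 − c²/L'² in [0, 1). With τ = c/L'² this
  -- number is the square of the contraction factor.
  set L' := max L (c + 1) with hL'
  have hL'0 : 0 < L' := lt_of_lt_of_le (by linarith) (le_max_right _ _)
  have hcL : c < L' := lt_of_lt_of_le (by linarith) (le_max_right _ _)
  set τ := c / L' ^ 2 with hτ
  have hτ0 : 0 < τ := by positivity
  set P := X.orthogonalProjectionOnto with hP
  set S : X → X := fun G => G - τ • P (T G) with hS
  have hK0 : 0 ≤ 1 - c ^ 2 / L' ^ 2 := by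
    rw [sub_nonneg, div_le_one (by positivity)]
    gcongr
  have hK1 : 1 - c ^ 2 / L' ^ 2 < 1 := by
    have : 0 < c ^ 2 / L' ^ 2 := by positivity
    linarith
  have hcontr : ContractingWith (Real.toNNReal (Real.sqrt (1 - c ^ 2 / L' ^ 2))) S := by
    refine ⟨?_, LipschitzWith.of_dist_le_mul fun G G' => ?_⟩
    · rw [← NNReal.coe_lt_coe, Real.coe_toNNReal _ (Real.sqrt_nonneg _), NNReal.coe_one]
      rw [Real.sqrt_lt' one_pos]; simpa using hK1
    · rw [Real.coe_toNNReal _ (Real.sqrt_nonneg _), dist_eq_norm, dist_eq_norm]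
      refine le_of_sq_le_sq ?_ (mul_nonneg (Real.sqrt_nonneg _) (norm_nonneg _))
      rw [mul_pow, Real.sq_sqrt hK0]
      have e : S G - S G' = (G - G') - τ • P (T G - T G') := by
        simp only [hS, map_sub, smul_sub]; abel
      have h1 : inner ℝ (G - G') (P (T G - T G')) = inner ℝ (T G - T G') ((G : E) - G') := by
        rw [real_inner_comm, hP, Submodule.inner_orthogonalProjectionOnto_eq_of_mem_right]
        rfl
      have h2 : ‖P (T G - T G')‖ ≤ L' * ‖G - G'‖ := by
        refine (X.norm_orthogonalProjectionOnto_apply_le _).trans ((hL _ _).trans ?_)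
        exact mul_le_mul_of_nonneg_right (le_max_left _ _) (norm_nonneg _)
      have h3 := hT G G'
      have h4 : ‖(G : E) - G'‖ = ‖G - G'‖ := rfl
      rw [h4, ← h1] at h3
      rw [e, norm_sub_sq_real, inner_smul_right, norm_smul, Real.norm_of_nonneg hτ0.le, mul_pow]
      have h5 : τ ^ 2 * ‖P (T G - T G')‖ ^ 2 ≤ τ ^ 2 * (L' * ‖G - G'‖) ^ 2 := by gcongr
      have h6 : τ ^ 2 * (L' * ‖G - G'‖) ^ 2 = τ * c * ‖G - G'‖ ^ 2 := by
        rw [hτ]; field_simp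
      have h7 : c ^ 2 / L' ^ 2 = τ * c := by rw [hτ]; ring
      rw [h7]
      nlinarith [mul_le_mul_of_nonneg_left h3 hτ0.le]
  obtain ⟨G, hG⟩ : ∃ G : X, S G = G :=
    ⟨hcontr.fixedPoint S, hcontr.fixedPoint_isFixedPt⟩
  refine ⟨G, G.2, fun Z hZ => ?_⟩
  have h1 : P (T G) = 0 := by
    have : τ • P (T G) = 0 := by simpa [hS] using hG
    exact (smul_eq_zero.1 this).resolve_left hτ0.ne'
  have h2 := X.inner_orthogonalProjectionOnto_eq_of_mem_left ⟨Z, hZ⟩ (T G)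
  rw [real_inner_comm, ← h2, ← hP, h1]
  simp

/-! ### Gradients of test functions -/

section ClassicalGrad

variable {n N : ℕ}

theorem classicalGrad_apply (ζ : Vec n → Vec N) (x : Vec n) (q : Fin n × Fin N) :
    classicalGrad ζ x q = partialDeriv q.1 ζ x q.2 := rfl

theorem partialDeriv_add {F : Type*} [NormedAddCommGroup F] [NormedSpace ℝ F] {f g : Vec n → F}
    (hf : Differentiable ℝ f) (hg : Differentiable ℝ g) (j : Fin n) (x : Vec n) :
    partialDeriv j (fun y => f y + g y) x = partialDeriv j f x + partialDeriv j g x := by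
  simp [partialDeriv, fderiv_fun_add (hf x) (hg x)]

theorem partialDeriv_sub {F : Type*} [NormedAddCommGroup F] [NormedSpace ℝ F] {f g : Vec n → F}
    (hf : Differentiable ℝ f) (hg : Differentiable ℝ g) (j : Fin n) (x : Vec n) :
    partialDeriv j (fun y => f y - g y) x = partialDeriv j f x - partialDeriv j g x := by
  simp [partialDeriv, fderiv_fun_sub (hf x) (hg x)]

theorem partialDeriv_smul {F : Type*} [NormedAddCommGroup F] [NormedSpace ℝ F] {c : Vec n → ℝ}
    {f : Vec n → F} (hc : Differentiable ℝ c) (hf : Differentiable ℝ f) (j : Fin n) (x : Vec n) :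
    partialDeriv j (fun y => c y • f y) x = c x • partialDeriv j f x + partialDeriv j c x • f x := by
  simp [partialDeriv, fderiv_fun_smul (hc x) (hf x)]

theorem partialDeriv_const_smul {F : Type*} [NormedAddCommGroup F] [NormedSpace ℝ F] (c : ℝ)
    {f : Vec n → F} (hf : Differentiable ℝ f) (j : Fin n) (x : Vec n) :
    partialDeriv j (fun y => c • f y) x = c • partialDeriv j f x := by
  simp [partialDeriv, fderiv_fun_const_smul (hf x)]

theorem partialDeriv_eq_of_hasFDerivAt {F : Type*} [NormedAddCommGroup F] [NormedSpace ℝ F]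
    {f : Vec n → F} {f' : Vec n →L[ℝ] F} {x : Vec n} (h : HasFDerivAt f f' x) (j : Fin n) :
    partialDeriv j f x = f' (EuclideanSpace.single j 1) := by
  rw [partialDeriv, h.fderiv]

theorem partialDeriv_clm_comp {F F' : Type*} [NormedAddCommGroup F] [NormedSpace ℝ F]
    [NormedAddCommGroup F'] [NormedSpace ℝ F'] (L : F →L[ℝ] F') {f : Vec n → F}
    (hf : Differentiable ℝ f) (j : Fin n) (x : Vec n) :
    partialDeriv j (fun y => L (f y)) x = L (partialDeriv j f x) := by
  rw [partialDeriv_eq_of_hasFDerivAt (f := fun y => L (f y))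
    (L.hasFDerivAt.comp x (hf x).hasFDerivAt)]
  rfl

theorem partialDeriv_coord {ι : Type*} [Fintype ι] {f : Vec n → EuclideanSpace ℝ ι}
    (hf : Differentiable ℝ f) (j : Fin n) (x : Vec n) (i : ι) :
    partialDeriv j (fun y => f y i) x = partialDeriv j f x i :=
  partialDeriv_clm_comp (EuclideanSpace.proj i) hf j x

theorem partialDeriv_continuous {F : Type*} [NormedAddCommGroup F] [NormedSpace ℝ F]
    {f : Vec n → F} (hf : ContDiff ℝ 1 f) (j : Fin n) : Continuous (partialDeriv j f) :=
  (hf.continuous_fderiv (by simp)).clm_apply continuous_const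

theorem partialDeriv_contDiff {F : Type*} [NormedAddCommGroup F] [NormedSpace ℝ F]
    {f : Vec n → F} (hf : ContDiff ℝ ∞ f) (j : Fin n) : ContDiff ℝ ∞ (partialDeriv j f) :=
  (hf.fderiv_right (m := ∞) (by simp)).clm_apply contDiff_const

theorem tsupport_partialDeriv_subset {F : Type*} [NormedAddCommGroup F] [NormedSpace ℝ F]
    (f : Vec n → F) (j : Fin n) : tsupport (partialDeriv j f) ⊆ tsupport f := by
  refine closure_minimal (fun x hx => ?_) (isClosed_tsupport f)
  refine support_fderiv_subset ℝ (f := f) fun h0 => hx ?_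
  simp [partialDeriv, h0]

theorem hasCompactSupport_partialDeriv {F : Type*} [NormedAddCommGroup F] [NormedSpace ℝ F]
    {f : Vec n → F} (hf : HasCompactSupport f) (j : Fin n) :
    HasCompactSupport (partialDeriv j f) :=
  hf.of_isClosed_subset (isClosed_tsupport _) (tsupport_partialDeriv_subset f j)

theorem partialDeriv_comp_add_right {F : Type*} [NormedAddCommGroup F] [NormedSpace ℝ F]
    (f : Vec n → F) (h : Vec n) (j : Fin n) (x : Vec n) :
    partialDeriv j (fun y => f (y + h)) x = partialDeriv j f (x + h) := by
  simp [partialDeriv, fderiv_comp_add_right]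

theorem classicalGrad_continuous {ζ : Vec n → Vec N} (hζ : ContDiff ℝ 1 ζ) :
    Continuous (classicalGrad ζ) := by
  refine (PiLp.continuous_toLp 2 _).comp (continuous_pi fun q => ?_)
  exact (EuclideanSpace.proj q.2).continuous.comp (partialDeriv_continuous hζ q.1)

theorem tsupport_classicalGrad_subset (ζ : Vec n → Vec N) :
    tsupport (classicalGrad ζ) ⊆ tsupport ζ := by
  refine closure_minimal (fun x hx => ?_) (isClosed_tsupport ζ)
  by_contra hc
  apply hx
  ext q
  have := image_eq_zero_of_notMem_tsupport
    (fun h => hc (tsupport_partialDeriv_subset ζ q.1 h))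
  simp [classicalGrad_apply, this]

theorem hasCompactSupport_classicalGrad {ζ : Vec n → Vec N} (hζ : HasCompactSupport ζ) :
    HasCompactSupport (classicalGrad ζ) :=
  hζ.of_isClosed_subset (isClosed_tsupport _) (tsupport_classicalGrad_subset ζ)

theorem classicalGrad_add {f g : Vec n → Vec N} (hf : Differentiable ℝ f)
    (hg : Differentiable ℝ g) (x : Vec n) :
    classicalGrad (fun y => f y + g y) x = classicalGrad f x + classicalGrad g x := by
  ext q; simp [classicalGrad_apply, partialDeriv_add hf hg]

theorem classicalGrad_sub {f g : Vec n → Vec N} (hf : Differentiable ℝ f)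
    (hg : Differentiable ℝ g) (x : Vec n) :
    classicalGrad (fun y => f y - g y) x = classicalGrad f x - classicalGrad g x := by
  ext q; simp [classicalGrad_apply, partialDeriv_sub hf hg]

theorem classicalGrad_const_smul (c : ℝ) {f : Vec n → Vec N} (hf : Differentiable ℝ f)
    (x : Vec n) : classicalGrad (fun y => c • f y) x = c • classicalGrad f x := by
  ext q; simp [classicalGrad_apply, partialDeriv_const_smul c hf]

theorem classicalGrad_comp_add_right (f : Vec n → Vec N) (h x : Vec n) :
    classicalGrad (fun y => f (y + h)) x = classicalGrad f (x + h) := by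
  ext q; simp [classicalGrad_apply, partialDeriv_comp_add_right]

end ClassicalGrad

namespace IsTestFunction

variable {n : ℕ} {F : Type*} [NormedAddCommGroup F] [NormedSpace ℝ F] {Ω : Set (Vec n)}
  {f g : Vec n → F}

theorem differentiable (hf : IsTestFunction Ω f) : Differentiable ℝ f :=
  hf.contDiff.differentiable (by simp)

theorem add (hf : IsTestFunction Ω f) (hg : IsTestFunction Ω g) :
    IsTestFunction Ω fun x => f x + g x where
  contDiff := hf.contDiff.add hg.contDiff
  hasCompactSupport := hf.hasCompactSupport.add hg.hasCompactSupport
  tsupport_subset := (tsupport_add f g).trans (union_subset hf.tsupport_subset hg.tsupport_subset)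

theorem const_smul (c : ℝ) (hf : IsTestFunction Ω f) : IsTestFunction Ω fun x => c • f x where
  contDiff := contDiff_const.smul hf.contDiff
  hasCompactSupport := hf.hasCompactSupport.smul_left (f := fun _ => c)
  tsupport_subset := (tsupport_smul_subset_right (fun _ => c) f).trans hf.tsupport_subset

theorem zero (Ω : Set (Vec n)) : IsTestFunction Ω fun _ : Vec n => (0 : F) where
  contDiff := contDiff_const
  hasCompactSupport := HasCompactSupport.zero
  tsupport_subset := by
    rw [show (fun _ : Vec n => (0 : F)) = 0 from rfl, tsupport_zero]; exact empty_subset _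

theorem mono {Ω' : Set (Vec n)} (hf : IsTestFunction Ω f) (h : Ω ⊆ Ω') : IsTestFunction Ω' f where
  contDiff := hf.contDiff
  hasCompactSupport := hf.hasCompactSupport
  tsupport_subset := hf.tsupport_subset.trans h

theorem smul_right {c : Vec n → ℝ} (hc : IsTestFunction Ω c) (hf : ContDiff ℝ ∞ f) :
    IsTestFunction Ω fun x => c x • f x where
  contDiff := hc.contDiff.smul hf
  hasCompactSupport := hc.hasCompactSupport.smul_right (f' := f)
  tsupport_subset := (tsupport_smul_subset_left c f).trans hc.tsupport_subset

theorem partialDeriv (hf : IsTestFunction Ω f) (j : Fin n) :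
    IsTestFunction Ω (PhiLaplace.partialDeriv j f) where
  contDiff := partialDeriv_contDiff hf.contDiff j
  hasCompactSupport := hasCompactSupport_partialDeriv hf.hasCompactSupport j
  tsupport_subset := (tsupport_partialDeriv_subset f j).trans hf.tsupport_subset

theorem memLp_classicalGrad {N : ℕ} {ζ : Vec n → Vec N} (hζ : IsTestFunction Ω ζ)
    (μ : Measure (Vec n)) [IsFiniteMeasureOnCompacts μ] : MemLp (classicalGrad ζ) 2 μ :=
  (classicalGrad_continuous (hζ.contDiff.of_le (by simp))).memLp_of_hasCompactSupport
    (hasCompactSupport_classicalGrad hζ.hasCompactSupport)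

end IsTestFunction

/-! ### Existence for the regularised problem -/

theorem integral_norm_sq_eq_norm_toLp {X : Type*} [MeasurableSpace X] {μ : Measure X} {E : Type*}
    [NormedAddCommGroup E] [InnerProductSpace ℝ E] {f : X → E} (hf : MemLp f 2 μ) :
    ∫ x, ‖f x‖ ^ 2 ∂μ = ‖hf.toLp f‖ ^ 2 := by
  rw [← real_inner_self_eq_norm_sq, L2.inner_def]
  refine integral_congr_ae ?_
  filter_upwards [hf.coeFn_toLp] with x hx
  rw [hx, real_inner_self_eq_norm_sq]

theorem integral_inner_eq_inner_toLp {X : Type*} [MeasurableSpace X] {μ : Measure X} {E : Type*}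
    [NormedAddCommGroup E] [InnerProductSpace ℝ E] {f g : X → E} (hf : MemLp f 2 μ)
    (hg : MemLp g 2 μ) : ∫ x, inner ℝ (f x) (g x) ∂μ = inner ℝ (hf.toLp f) (hg.toLp g) := by
  rw [L2.inner_def]
  refine integral_congr_ae ?_
  filter_upwards [hf.coeFn_toLp, hg.coeFn_toLp] with x hx hy
  rw [hx, hy]

/-- If `ζ k → g` in `L²` then `∫ f · ζ k → ∫ f · g` for `f ∈ L²`. -/
theorem tendsto_integral_inner_of_tendsto_sq {X : Type*} [MeasurableSpace X] {μ : Measure X}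
    {E : Type*} [NormedAddCommGroup E] [InnerProductSpace ℝ E] {f g : X → E} {ζ : ℕ → X → E}
    (hf : MemLp f 2 μ) (hg : MemLp g 2 μ) (hζ : ∀ k, MemLp (ζ k) 2 μ)
    (h : Tendsto (fun k => ∫ x, ‖ζ k x - g x‖ ^ 2 ∂μ) atTop (𝓝 0)) :
    Tendsto (fun k => ∫ x, inner ℝ (f x) (ζ k x) ∂μ) atTop (𝓝 (∫ x, inner ℝ (f x) (g x) ∂μ)) := by
  simp_rw [integral_inner_eq_inner_toLp hf (hζ _), integral_inner_eq_inner_toLp hf hg]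
  have h1 : Tendsto (fun k => (hζ k).toLp (ζ k)) atTop (𝓝 (hg.toLp g)) := by
    rw [tendsto_iff_norm_sub_tendsto_zero]
    have h2 : ∀ k, ∫ x, ‖ζ k x - g x‖ ^ 2 ∂μ = ‖(hζ k).toLp (ζ k) - hg.toLp g‖ ^ 2 := fun k => by
      rw [← MemLp.toLp_sub, ← integral_norm_sq_eq_norm_toLp ((hζ k).sub hg)]
      rfl
    simp_rw [h2] at h
    have := h.sqrt
    simpa [Real.sqrt_sq (norm_nonneg _)] using this
  exact tendsto_const_nhds.inner h1

/-- The gradients of test functions, as a subspace of `L²`. -/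
def gradSubmodule (n N : ℕ) (U : Set (Vec n)) :
    Submodule ℝ (Lp (Mat n N) 2 (volume.restrict U)) where
  carrier := {f | ∃ ζ : Vec n → Vec N, ∃ hζ : IsTestFunction U ζ,
    f = (hζ.memLp_classicalGrad (volume.restrict U)).toLp (classicalGrad ζ)}
  zero_mem' := by
    refine ⟨fun _ => 0, IsTestFunction.zero U, ?_⟩
    rw [← MemLp.toLp_zero (MemLp.zero' (p := 2) (μ := volume.restrict U))]
    refine MemLp.toLp_congr _ _ (Eventually.of_forall fun x => ?_)
    ext q
    simp [classicalGrad_apply, partialDeriv]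
  add_mem' := by
    rintro _ _ ⟨ζ, hζ, rfl⟩ ⟨ξ, hξ, rfl⟩
    refine ⟨_, hζ.add hξ, ?_⟩
    rw [← MemLp.toLp_add]
    refine MemLp.toLp_congr _ _ (Eventually.of_forall fun x => ?_)
    exact (classicalGrad_add hζ.differentiable hξ.differentiable x).symm
  smul_mem' := by
    rintro c _ ⟨ζ, hζ, rfl⟩
    refine ⟨_, hζ.const_smul c, ?_⟩
    rw [← MemLp.toLp_const_smul]
    refine MemLp.toLp_congr _ _ (Eventually.of_forall fun x => ?_)
    exact (classicalGrad_const_smul c hζ.differentiable x).symm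

/-- The strongly monotone operator G ↦ A(Q + G) is solved on the L² closure of the gradients of test
functions. The approximating sequence encodes the boundary condition, so no Sobolev space, trace or
Poincaré inequality enters. -/
theorem exists_regular_solution {n N : ℕ} {α : ℝ → ℝ} {lo hi m M : ℝ} (hα : RegCoef α lo hi m M)
    {U : Set (Vec n)} {Q : Vec n → Mat n N} (hQ : MemLp Q 2 (volume.restrict U)) :
    ∃ G : Vec n → Mat n N, MemLp G 2 (volume.restrict U) ∧
      (∃ ζ : ℕ → Vec n → Vec N, (∀ k, IsTestFunction U (ζ k)) ∧
        Tendsto (fun k => ∫ x in U, ‖classicalGrad (ζ k) x - G x‖ ^ 2) atTop (𝓝 0)) ∧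
      ∀ ζ : Vec n → Vec N, IsTestFunction U ζ →
        ∫ x in U, inner ℝ (regFlux α (Q x + G x)) (classicalGrad ζ x) = 0 := by
  set μ := volume.restrict U with hμ
  set X := (gradSubmodule n N U).topologicalClosure with hX
  have : CompleteSpace X := (gradSubmodule n N U).isClosed_topologicalClosure.completeSpace_coe
  set T : Lp (Mat n N) 2 μ → Lp (Mat n N) 2 μ := fun G =>
    hα.lipschitzWith_regFlux.compLp (RegCoef.regFlux_zero α) (hQ.toLp Q + G) with hT
  have hTae : ∀ G, T G =ᵐ[μ] fun x => regFlux α (Q x + G x) := fun G => by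
    filter_upwards [hα.lipschitzWith_regFlux.coeFn_compLp (RegCoef.regFlux_zero α)
      (hQ.toLp Q + G), Lp.coeFn_add (hQ.toLp Q) G, hQ.coeFn_toLp] with x h1 h2 h3
    rw [h1, Function.comp_apply, h2, Pi.add_apply, h3]
  obtain ⟨G, hGX, hG⟩ := exists_inner_eq_zero_of_strongly_monotone X (T := T)
    (mul_pos hα.m_pos hα.lo_pos) (L := (1 + M) * hi) (fun P P' => by
      have h := hα.lipschitzWith_regFlux.norm_compLp_sub_le (RegCoef.regFlux_zero α)
        (hQ.toLp Q + P) (hQ.toLp Q + P')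
      rw [add_sub_add_left_eq_sub, Real.coe_toNNReal _
        (mul_nonneg (by linarith [hα.one_le]) hα.hi_pos.le)] at h
      exact h) (fun P P' => by
      rw [← real_inner_self_eq_norm_sq, L2.inner_def, L2.inner_def, ← integral_const_mul]
      refine integral_mono_ae ((L2.integrable_inner _ _).const_mul _) (L2.integrable_inner _ _) ?_
      filter_upwards [hTae P, hTae P', Lp.coeFn_sub P P', Lp.coeFn_sub (T P) (T P')]
        with x h1 h2 h3 h4
      rw [h3, h4, Pi.sub_apply, Pi.sub_apply, h1, h2, real_inner_self_eq_norm_sq]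
      have := hα.le_inner_regFlux_sub (Q x + P x) (Q x + P' x)
      rwa [add_sub_add_left_eq_sub] at this)
  refine ⟨G, Lp.memLp G, ?_, fun ζ hζ => ?_⟩
  · obtain ⟨g, hg, hlim⟩ := mem_closure_iff_seq_limit.1 hGX
    choose ζ hζ hgζ using hg
    refine ⟨ζ, hζ, ?_⟩
    have h1 : Tendsto (fun k => ‖g k - G‖ ^ 2) atTop (𝓝 0) := by
      simpa using (tendsto_iff_norm_sub_tendsto_zero.1 hlim).pow 2
    refine h1.congr fun k => ?_
    have h2 := integral_norm_sq_eq_norm_toLp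
      (((hζ k).memLp_classicalGrad μ).sub (Lp.memLp G))
    rw [MemLp.toLp_sub ((hζ k).memLp_classicalGrad μ) (Lp.memLp G), Lp.toLp_coeFn, ← hgζ k] at h2
    rw [← h2]
    rfl
  · have h1 := hG _ (Submodule.le_topologicalClosure _ ⟨ζ, hζ, rfl⟩)
    rw [L2.inner_def] at h1
    rw [← h1]
    refine integral_congr_ae ?_
    filter_upwards [hTae G, (hζ.memLp_classicalGrad μ).coeFn_toLp] with x h2 h3
    rw [h2, h3]

/-- A field orthogonal to gradients of test functions is orthogonal to their `L²` limits. -/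
theorem integral_inner_eq_zero_of_tendsto {n N : ℕ} {U : Set (Vec n)}
    {F G : Vec n → Mat n N} (hF : MemLp F 2 (volume.restrict U))
    (hG : MemLp G 2 (volume.restrict U)) {ζ : ℕ → Vec n → Vec N}
    (hζ : ∀ k, IsTestFunction U (ζ k))
    (hlim : Tendsto (fun k => ∫ x in U, ‖classicalGrad (ζ k) x - G x‖ ^ 2) atTop (𝓝 0))
    (h : ∀ ζ : Vec n → Vec N, IsTestFunction U ζ →
      ∫ x in U, inner ℝ (F x) (classicalGrad ζ x) = 0) :
    ∫ x in U, inner ℝ (F x) (G x) = 0 := by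
  have := tendsto_integral_inner_of_tendsto_sq hF hG
    (fun k => (hζ k).memLp_classicalGrad _) hlim
  simp_rw [h _ (hζ _)] at this
  exact tendsto_nhds_unique this tendsto_const_nhds


/-! ### Translations and differences -/

section Differences

variable {n N : ℕ}

theorem norm_fderiv_apply_le {v : Vec n → Vec N} (x h : Vec n) :
    ‖fderiv ℝ v x h‖ ≤ ‖h‖ * ‖classicalGrad v x‖ := by
  refine le_of_sq_le_sq ?_ (by positivity)
  have hh : h = ∑ j, h j • EuclideanSpace.single j (1 : ℝ) := by
    ext i; simp [Finset.sum_apply, Pi.single_apply]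
  have h1 : fderiv ℝ v x h = ∑ j, h j • partialDeriv j v x := by
    conv_lhs => rw [hh]
    simp [map_sum, partialDeriv]
  have h2 : ∀ i, (fderiv ℝ v x h) i = ∑ j, h j * partialDeriv j v x i := fun i => by
    rw [h1]; simp
  rw [mul_pow, EuclideanSpace.real_norm_sq_eq, EuclideanSpace.real_norm_sq_eq h,
    EuclideanSpace.real_norm_sq_eq (classicalGrad v x), Fintype.sum_prod_type, Finset.sum_comm,
    Finset.mul_sum]
  refine Finset.sum_le_sum fun i _ => ?_
  rw [h2 i]
  exact Finset.sum_mul_sq_le_sq_mul_sq _ _ _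

theorem sq_intervalIntegral_le {f : ℝ → ℝ} (hf : Continuous f) :
    (∫ t in (0 : ℝ)..1, f t) ^ 2 ≤ ∫ t in (0 : ℝ)..1, f t ^ 2 := by
  set m := ∫ t in (0 : ℝ)..1, f t with hm
  have h0 : 0 ≤ ∫ t in (0 : ℝ)..1, (f t - m) ^ 2 :=
    intervalIntegral.integral_nonneg zero_le_one fun t _ => sq_nonneg _
  have h1 : ∫ t in (0 : ℝ)..1, (f t - m) ^ 2 = (∫ t in (0 : ℝ)..1, f t ^ 2) - m ^ 2 := by
    have e : (fun t => (f t - m) ^ 2) = fun t => (f t ^ 2 - 2 * m * f t) + m ^ 2 := by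
      ext t; ring
    rw [e, intervalIntegral.integral_add
      (Continuous.intervalIntegrable (by fun_prop) _ _) (by simp),
      intervalIntegral.integral_sub (Continuous.intervalIntegrable (by fun_prop) _ _)
      (Continuous.intervalIntegrable (by fun_prop) _ _), intervalIntegral.integral_const_mul, ← hm]
    simp
    ring
  linarith

theorem norm_sub_sq_le_integral {v : Vec n → Vec N} (hv : ContDiff ℝ 1 v) (x h : Vec n) :
    ‖v (x + h) - v x‖ ^ 2
      ≤ ‖h‖ ^ 2 * ∫ t in (0 : ℝ)..1, ‖classicalGrad v (x + t • h)‖ ^ 2 := by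
  have hgc := classicalGrad_continuous hv
  have hder : ∀ t : ℝ, HasDerivAt (fun t : ℝ => v (x + t • h)) (fderiv ℝ v (x + t • h) h) t :=
    fun t => by
    have h1 : HasDerivAt (fun t : ℝ => x + t • h) h t := by
      simpa using ((hasDerivAt_id t).smul_const h).const_add x
    exact ((hv.differentiable (by simp)).differentiableAt.hasFDerivAt).comp_hasDerivAt t h1
  have hc : Continuous fun t : ℝ => fderiv ℝ v (x + t • h) h :=
    ((hv.continuous_fderiv (by simp)).comp (by fun_prop)).clm_apply continuous_const
  have hftc := intervalIntegral.integral_eq_sub_of_hasDerivAt (a := 0) (b := 1)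
    (fun t _ => hder t) (hc.intervalIntegrable _ _)
  simp only [one_smul, zero_smul, add_zero] at hftc
  have hgc' : Continuous fun t : ℝ => ‖classicalGrad v (x + t • h)‖ :=
    (hgc.comp (by fun_prop)).norm
  have h1 : ‖v (x + h) - v x‖ ≤ ‖h‖ * ∫ t in (0 : ℝ)..1, ‖classicalGrad v (x + t • h)‖ := by
    rw [← hftc, ← intervalIntegral.integral_const_mul]
    refine (intervalIntegral.norm_integral_le_integral_norm zero_le_one).trans ?_
    exact intervalIntegral.integral_mono_on zero_le_one (hc.norm.intervalIntegrable _ _)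
      ((hgc'.const_smul ‖h‖).intervalIntegrable _ _) fun t _ => norm_fderiv_apply_le _ _
  have h2 := pow_le_pow_left₀ (norm_nonneg _) h1 2
  rw [mul_pow] at h2
  exact h2.trans (mul_le_mul_of_nonneg_left (sq_intervalIntegral_le hgc') (sq_nonneg _))

theorem integrableOn_comp_add {F : Type*} [NormedAddCommGroup F] {f : Vec n → F}
    {U B : Set (Vec n)} (hU : MeasurableSet U) (hf : IntegrableOn f U) (h : Vec n)
    (hB : MeasurableSet B) (hBU : ∀ x ∈ B, x + h ∈ U) : IntegrableOn (fun x => f (x + h)) B := by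
  have h1 : Integrable (fun x => U.indicator f (x + h)) :=
    (hf.integrable_indicator hU).comp_add_right h
  refine (h1.integrableOn (s := B)).congr_fun (fun x hx => ?_) hB
  simp [indicator_of_mem (hBU x hx)]

theorem setIntegral_comp_add_le {f : Vec n → ℝ} {U B : Set (Vec n)} (hU : MeasurableSet U)
    (hf : IntegrableOn f U) (hf0 : ∀ x, 0 ≤ f x) (h : Vec n)
    (hB : MeasurableSet B) (hBU : ∀ x ∈ B, x + h ∈ U) :
    ∫ x in B, f (x + h) ≤ ∫ x in U, f x := by
  have h1 : Integrable (fun x => U.indicator f (x + h)) :=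
    (hf.integrable_indicator hU).comp_add_right h
  have h0 : ∀ x, 0 ≤ U.indicator f x := fun x => indicator_nonneg (fun y _ => hf0 y) x
  calc ∫ x in B, f (x + h) = ∫ x in B, U.indicator f (x + h) :=
        setIntegral_congr_fun hB fun x hx => by simp [indicator_of_mem (hBU x hx)]
    _ ≤ ∫ x, U.indicator f (x + h) :=
        setIntegral_le_integral h1 (Eventually.of_forall fun x => h0 _)
    _ = ∫ x in U, f x := by
        rw [integral_add_right_eq_self (fun x => U.indicator f x) h, integral_indicator hU]

/-- The bound along the segment from x to x + h is integrated over x; after Fubini, each translate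
of B lies in U. This controls difference quotients by the gradient. -/
theorem setIntegral_norm_sub_sq_le {v : Vec n → Vec N} (hv : ContDiff ℝ 1 v) {U B : Set (Vec n)}
    (hU : MeasurableSet U) (hUi : IntegrableOn (fun x => ‖classicalGrad v x‖ ^ 2) U)
    (hB : IsCompact B) {h : Vec n}
    (hBU : ∀ x ∈ B, ∀ t ∈ Icc (0 : ℝ) 1, x + t • h ∈ U) :
    ∫ x in B, ‖v (x + h) - v x‖ ^ 2 ≤ ‖h‖ ^ 2 * ∫ x in U, ‖classicalGrad v x‖ ^ 2 := by
  have hgc := classicalGrad_continuous hv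
  have hvc := hv.continuous
  set F : Vec n → ℝ → ℝ := fun x t => ‖classicalGrad v (x + t • h)‖ ^ 2 with hF
  have hFc : Continuous (Function.uncurry F) := by
    refine ((hgc.comp ?_).norm).pow 2
    fun_prop
  have hFi : Integrable (Function.uncurry F)
      ((volume.restrict B).prod (volume.restrict (Ioc (0 : ℝ) 1))) := by
    have h1 : IntegrableOn (Function.uncurry F) (B ×ˢ Icc (0 : ℝ) 1) (volume.prod volume) :=
      hFc.continuousOn.integrableOn_compact (hB.prod isCompact_Icc)
    rw [Measure.prod_restrict]
    exact h1.mono_set (prod_mono subset_rfl Ioc_subset_Icc_self)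
  have hi1 : IntegrableOn (fun x => ‖v (x + h) - v x‖ ^ 2) B :=
    ContinuousOn.integrableOn_compact hB (by fun_prop)
  have e1 : ∀ x, ∫ t in (0 : ℝ)..1, F x t = ∫ t in Ioc (0 : ℝ) 1, F x t := fun x =>
    intervalIntegral.integral_of_le zero_le_one
  calc ∫ x in B, ‖v (x + h) - v x‖ ^ 2
      ≤ ∫ x in B, ‖h‖ ^ 2 * ∫ t in Ioc (0 : ℝ) 1, F x t := by
        refine integral_mono hi1 (hFi.integral_prod_left.const_mul _) fun x => ?_
        simp only
        rw [← e1 x]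
        exact norm_sub_sq_le_integral hv x h
    _ = ‖h‖ ^ 2 * ∫ t in Ioc (0 : ℝ) 1, ∫ x in B, F x t := by
        rw [integral_const_mul, integral_integral_swap hFi]
    _ ≤ ‖h‖ ^ 2 * ∫ t in Ioc (0 : ℝ) 1, ∫ x in U, ‖classicalGrad v x‖ ^ 2 := by
        refine mul_le_mul_of_nonneg_left ?_ (sq_nonneg _)
        refine setIntegral_mono_on hFi.integral_prod_right (by simp) measurableSet_Ioc
          fun t ht => ?_
        exact setIntegral_comp_add_le hU hUi (fun x => sq_nonneg _) (t • h) hB.measurableSet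
          fun x hx => hBU x hx t (Ioc_subset_Icc_self ht)
    _ = ‖h‖ ^ 2 * ∫ x in U, ‖classicalGrad v x‖ ^ 2 := by simp

end Differences


/-! ### The difference quotient estimate -/

section DifferenceQuotient

variable {n N : ℕ}

/-- The rank one matrix `p ⊗ y`. -/
def outer (p : Fin n → ℝ) (y : Vec N) : Mat n N := WithLp.toLp 2 fun q => p q.1 * y q.2

theorem outer_apply (p : Fin n → ℝ) (y : Vec N) (q : Fin n × Fin N) :
    outer p y q = p q.1 * y q.2 := rfl

theorem norm_outer_sq (p : Fin n → ℝ) (y : Vec N) :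
    ‖outer p y‖ ^ 2 = (∑ j, p j ^ 2) * ‖y‖ ^ 2 := by
  simp_rw [EuclideanSpace.real_norm_sq_eq, outer_apply, Fintype.sum_prod_type, mul_pow,
    Finset.sum_mul_sum]

theorem outer_continuous {X : Type*} [TopologicalSpace X] {p : X → Fin n → ℝ} {y : X → Vec N}
    (hp : ∀ j, Continuous fun x => p x j) (hy : Continuous y) :
    Continuous fun x => outer (p x) (y x) := by
  refine (PiLp.continuous_toLp 2 _).comp (continuous_pi fun q => ?_)
  exact (hp q.1).mul ((EuclideanSpace.proj q.2).continuous.comp hy)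

theorem classicalGrad_smul {c : Vec n → ℝ} {f : Vec n → Vec N} (hc : Differentiable ℝ c)
    (hf : Differentiable ℝ f) (x : Vec n) :
    classicalGrad (fun y => c y • f y) x
      = c x • classicalGrad f x + outer (fun j => partialDeriv j c x) (f x) := by
  ext q
  simp [classicalGrad_apply, partialDeriv_smul hc hf, outer_apply]

theorem exists_bound_sum_partialDeriv_sq {η : Vec n → ℝ} (hη : ContDiff ℝ 1 η)
    (hηc : HasCompactSupport η) : ∃ C, 0 ≤ C ∧ ∀ x, ∑ j, partialDeriv j η x ^ 2 ≤ C := by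
  have h1 : ∀ j, ∃ C, ∀ x, ‖partialDeriv j η x‖ ≤ C := fun j =>
    (hasCompactSupport_partialDeriv hηc j).exists_bound_of_continuous (partialDeriv_continuous hη j)
  choose C hC using h1
  refine ⟨∑ j, C j ^ 2, Finset.sum_nonneg fun j _ => sq_nonneg _, fun x => ?_⟩
  refine Finset.sum_le_sum fun j _ => ?_
  rw [← sq_abs, ← Real.norm_eq_abs]
  exact pow_le_pow_left₀ (norm_nonneg _) (hC j x) 2

theorem partialDeriv_sq {η : Vec n → ℝ} (hη : Differentiable ℝ η) (j : Fin n) (x : Vec n) :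
    partialDeriv j (fun y => η y ^ 2) x = 2 * η x * partialDeriv j η x := by
  have : (fun y => η y ^ 2) = fun y => η y • η y := by ext y; simp [sq]
  rw [this, partialDeriv_smul hη hη]
  simp only [smul_eq_mul]; ring

theorem IsTestFunction.comp_sub {F : Type*} [NormedAddCommGroup F] [NormedSpace ℝ F]
    {U U' : Set (Vec n)} {f : Vec n → F} (hf : IsTestFunction U' f) (h : Vec n)
    (hU : ∀ x ∈ U', x + h ∈ U) : IsTestFunction U fun x => f (x - h) where
  contDiff := hf.contDiff.comp (contDiff_id.sub contDiff_const)
  hasCompactSupport := hf.hasCompactSupport.comp_homeomorph (Homeomorph.subRight h)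
  tsupport_subset := by
    have h1 : tsupport (fun x => f (x - h)) = (Homeomorph.subRight h) ⁻¹' tsupport f :=
      tsupport_comp_eq_preimage f (Homeomorph.subRight h)
    rw [h1]
    intro x hx
    have := hU _ (hf.tsupport_subset hx)
    simpa using this

theorem setIntegral_inner_eq_integral {U : Set (Vec n)} {F Z : Vec n → Mat n N}
    (hF : ∀ x, x ∉ U → F x = 0) :
    ∫ x in U, inner ℝ (F x) (Z x) = ∫ x, inner ℝ (F x) (Z x) := by
  refine setIntegral_eq_integral_of_forall_compl_eq_zero fun x hx => ?_
  rw [hF x hx, inner_zero_left]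

theorem memLp_two_add_right {F : Type*} [NormedAddCommGroup F] {f : Vec n → F}
    (hf : MemLp f 2 volume) (h : Vec n) : MemLp (fun x => f (x + h)) 2 volume :=
  hf.comp_measurePreserving (measurePreserving_add_right volume h)

theorem Continuous.memLp_closedBall {F : Type*} [NormedAddCommGroup F] {f : Vec n → F}
    (hf : Continuous f) (x : Vec n) (r : ℝ) (p : ENNReal) :
    MemLp f p (volume.restrict (Metric.closedBall x r)) := by
  obtain ⟨C, hC⟩ := (isCompact_closedBall x r).exists_bound_of_continuousOn hf.continuousOn
  have : IsFiniteMeasure (volume.restrict (Metric.closedBall x r)) :=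
    ⟨by simpa using measure_closedBall_lt_top⟩
  refine MemLp.of_bound hf.aestronglyMeasurable C ?_
  filter_upwards [ae_restrict_mem Metric.isClosed_closedBall.measurableSet] with y hy using hC y hy

theorem Continuous.memLp_ball {F : Type*} [NormedAddCommGroup F] {f : Vec n → F}
    (hf : Continuous f) (x : Vec n) (r : ℝ) (p : ENNReal) :
    MemLp f p (volume.restrict (Metric.ball x r)) :=
  (Continuous.memLp_closedBall hf x r p).mono_measure
    (Measure.restrict_mono Metric.ball_subset_closedBall le_rfl)

theorem integrable_inner_of_memLp {X : Type*} [MeasurableSpace X] {μ : Measure X} {G : Type*}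
    [NormedAddCommGroup G] [InnerProductSpace ℝ G] {f g : X → G} (hf : MemLp f 2 μ)
    (hg : MemLp g 2 μ) : Integrable (fun x => inner ℝ (f x) (g x)) μ := by
  refine ((hf.integrable_norm_pow (by norm_num)).add
    (hg.integrable_norm_pow (by norm_num))).mono' (hf.1.inner hg.1)
    (Eventually.of_forall fun x => ?_)
  have h1 := norm_inner_le_norm (𝕜 := ℝ) (f x) (g x)
  have h2 : ((2 : ENNReal).toReal) = 2 := rfl
  simp only [Pi.add_apply]
  nlinarith [sq_nonneg (‖f x‖ - ‖g x‖), sq_nonneg ‖f x‖, sq_nonneg ‖g x‖]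

theorem norm_add_sq_le {F : Type*} [NormedAddCommGroup F] (a b : F) :
    ‖a + b‖ ^ 2 ≤ 2 * ‖a‖ ^ 2 + 2 * ‖b‖ ^ 2 := by
  have h := pow_le_pow_left₀ (norm_nonneg _) (norm_add_le a b) 2
  nlinarith [sq_nonneg (‖a‖ - ‖b‖)]

theorem norm_sub_sq_le {F : Type*} [NormedAddCommGroup F] (a b : F) :
    ‖a - b‖ ^ 2 ≤ 2 * ‖a‖ ^ 2 + 2 * ‖b‖ ^ 2 := by
  have := norm_add_sq_le a (-b)
  rwa [← sub_eq_add_neg, norm_neg] at this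

theorem setIntegral_norm_translate_sub_sq_le {F : Type*} [NormedAddCommGroup F] {g : Vec n → F}
    {U K : Set (Vec n)} (hU : MeasurableSet U) (hg : IntegrableOn (fun x => ‖g x‖ ^ 2) U)
    (hK : MeasurableSet K) (hKU : K ⊆ U) {h : Vec n} (hKh : ∀ x ∈ K, x + h ∈ U) :
    ∫ x in K, ‖g (x + h) - g x‖ ^ 2 ≤ 4 * ∫ x in U, ‖g x‖ ^ 2 := by
  have i1 : IntegrableOn (fun x => 2 * ‖g (x + h)‖ ^ 2) K :=
    (integrableOn_comp_add (f := fun x => ‖g x‖ ^ 2) hU hg h hK hKh).const_mul 2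
  have i2 : IntegrableOn (fun x => 2 * ‖g x‖ ^ 2) K := (hg.mono_set hKU).const_mul 2
  have h1 : ∫ x in K, ‖g (x + h) - g x‖ ^ 2 ≤ ∫ x in K, (2 * ‖g (x + h)‖ ^ 2 + 2 * ‖g x‖ ^ 2) :=
    integral_mono_of_nonneg (f := fun x => ‖g (x + h) - g x‖ ^ 2)
      (g := fun x => 2 * ‖g (x + h)‖ ^ 2 + 2 * ‖g x‖ ^ 2)
      (Eventually.of_forall fun x => by positivity) (i1.add i2)
      (Eventually.of_forall fun x => norm_sub_sq_le _ _)
  rw [integral_add i1 i2, integral_const_mul, integral_const_mul] at h1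
  have j1 := setIntegral_comp_add_le (f := fun x => ‖g x‖ ^ 2) hU hg (fun x => by positivity) h hK
    hKh
  have j2 : ∫ x in K, ‖g x‖ ^ 2 ≤ ∫ x in U, ‖g x‖ ^ 2 :=
    setIntegral_mono_set hg (Eventually.of_forall fun x => by positivity) hKU.eventuallyLE
  linarith

set_option maxHeartbeats 1000000 in
-- Nirenberg's method: subtract the equation from its translate by h and test with η² times the
-- difference of the potential. Since W is known only as an L² limit of gradients, the smooth
-- potentials v_k are used, and the resulting bound is passed to the limit in k.
theorem exists_difference_bound {α : ℝ → ℝ} {lo hi m M : ℝ} (hα : RegCoef α lo hi m M)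
    {x₀ : Vec n} {r₁ r₂ : ℝ} (hr₁ : 0 < r₁) (hr : r₁ < r₂) {W : Vec n → Mat n N}
    (hW : MemLp W 2 volume) (hW0 : ∀ x, x ∉ Metric.ball x₀ r₂ → W x = 0)
    {v : ℕ → Vec n → Vec N} (hv : ∀ k, ContDiff ℝ ∞ (v k))
    (hlim : Tendsto (fun k => ∫ x in Metric.ball x₀ r₂, ‖classicalGrad (v k) x - W x‖ ^ 2)
      atTop (𝓝 0))
    (heq : ∀ ζ : Vec n → Vec N, IsTestFunction (Metric.ball x₀ r₂) ζ →
      ∫ x in Metric.ball x₀ r₂, inner ℝ (regFlux α (W x)) (classicalGrad ζ x) = 0) :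
    ∃ C, 0 ≤ C ∧ ∀ h : Vec n, ‖h‖ < (r₂ - r₁) / 2 →
      ∫ x in Metric.ball x₀ r₁, ‖W (x + h) - W x‖ ^ 2 ≤ C * ‖h‖ ^ 2 := by
  set U := Metric.ball x₀ r₂ with hU
  have hUm : MeasurableSet U := Metric.isOpen_ball.measurableSet
  set ρ := (r₁ + r₂) / 2 with hρ
  set K := Metric.closedBall x₀ ρ with hK
  have hKm : MeasurableSet K := Metric.isClosed_closedBall.measurableSet
  have hKc : IsCompact K := isCompact_closedBall x₀ ρ
  have hKU : K ⊆ U := Metric.closedBall_subset_ball (by linarith)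
  let ηb : ContDiffBump x₀ := ⟨r₁, ρ, hr₁, by linarith⟩
  set η : Vec n → ℝ := fun x => ηb x with hη
  have hηs : ContDiff ℝ ∞ η := ηb.contDiff
  have hη1 : ContDiff ℝ 1 η := ηb.contDiff
  have hηd : Differentiable ℝ η := hη1.differentiable (by simp)
  have hηt : tsupport η = K := ηb.tsupport_eq
  have hηc : HasCompactSupport η := ηb.hasCompactSupport
  obtain ⟨Cη, hCη0, hCη⟩ := exists_bound_sum_partialDeriv_sq hη1 hηc
  set c := m * lo with hc
  have hc0 : 0 < c := mul_pos hα.m_pos hα.lo_pos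
  set L := (1 + M) * hi with hL
  have hL0 : 0 ≤ L := mul_nonneg (by linarith [hα.one_le]) hα.hi_pos.le
  set I := ∫ x in U, ‖W x‖ ^ 2 with hI
  have hI0 : 0 ≤ I := integral_nonneg fun x => sq_nonneg _
  -- Half of the ellipticity c is lost to absorption, 2L²Cη/c is the weight left by Young's
  -- inequality, and 2I is the limit of the bound 2∫|∇v_k − W|² + 2I for the energy of v_k.
  refine ⟨(c / 2)⁻¹ * (2 * L ^ 2 * Cη / c * (2 * I)), by positivity, fun h hh => ?_⟩
  have hKh : ∀ x ∈ K, ∀ t ∈ Icc (0 : ℝ) 1, x + t • h ∈ U := fun x hx t ht => by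
    have h1 : ‖t • h‖ ≤ ‖h‖ := by
      rw [norm_smul, Real.norm_of_nonneg ht.1]
      exact mul_le_of_le_one_left (norm_nonneg _) ht.2
    have h2 : dist (x + t • h) x ≤ ‖h‖ := by simpa [dist_eq_norm] using h1
    have h3 : dist x x₀ ≤ ρ := hx
    rw [hU, Metric.mem_ball]
    linarith [dist_triangle (x + t • h) x x₀]
  have hKh1 : ∀ x ∈ K, x + h ∈ U := fun x hx => by
    simpa using hKh x hx 1 (by simp)
  set F : Vec n → Mat n N := fun x => regFlux α (W (x + h)) - regFlux α (W x) with hF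
  set d : Vec n → Mat n N := fun x => W (x + h) - W x with hd
  have hAW : MemLp (fun x => regFlux α (W x)) 2 volume :=
    hα.lipschitzWith_regFlux.comp_memLp (RegCoef.regFlux_zero α) hW
  have hFL : MemLp F 2 volume := (memLp_two_add_right hAW h).sub hAW
  have hdL : MemLp d 2 volume := (memLp_two_add_right hW h).sub hW
  have hFd : ∀ x, ‖F x‖ ≤ L * ‖d x‖ := fun x => hα.norm_regFlux_sub_le _ _
  have hdi : Integrable (fun x => ‖d x‖ ^ 2) := hdL.integrable_norm_pow (by norm_num)
  have hη01 : ∀ x, 0 ≤ η x ∧ η x ≤ 1 := fun x => ⟨ηb.nonneg, ηb.le_one⟩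
  have hηF : MemLp (fun x => η x ^ 2 • F x) 2 (volume.restrict K) := by
    refine (hFL.restrict K).of_le_mul (c := 1)
      ((hηs.continuous.pow 2).aestronglyMeasurable.smul hFL.1.restrict) ?_
    refine Eventually.of_forall fun x => ?_
    rw [norm_smul, one_mul, Real.norm_of_nonneg (sq_nonneg _)]
    exact mul_le_of_le_one_left (norm_nonneg _) (pow_le_one₀ (hη01 x).1 (hη01 x).2)
  have hηdi : Integrable (fun x => η x ^ 2 * ‖d x‖ ^ 2) := by
    refine hdi.mono' ((hηs.continuous.pow 2).aestronglyMeasurable.mul hdi.1)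
      (Eventually.of_forall fun x => ?_)
    rw [Real.norm_of_nonneg (by positivity)]
    exact mul_le_of_le_one_left (sq_nonneg _) (pow_le_one₀ (hη01 x).1 (hη01 x).2)
  have hWi : Integrable (fun x => ‖W x‖ ^ 2) := hW.integrable_norm_pow (by norm_num)
  have hwc : ∀ k, Continuous (classicalGrad (v k)) := fun k =>
    classicalGrad_continuous ((hv k).of_le (by simp))
  have hwL : ∀ k, MemLp (classicalGrad (v k)) 2 (volume.restrict U) := fun k =>
    Continuous.memLp_ball (hwc k) _ _ _
  have hwi : ∀ k, IntegrableOn (fun x => ‖classicalGrad (v k) x‖ ^ 2) U := fun k =>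
    (hwL k).integrable_norm_pow (by norm_num)
  have hwWi : ∀ k, IntegrableOn (fun x => ‖classicalGrad (v k) x - W x‖ ^ 2) U := fun k =>
    ((hwL k).sub (hW.restrict U)).integrable_norm_pow (by norm_num)
  -- testing the equation with `η² (v k (· + h) - v k)`
  have hid : ∀ k, ∫ x in K, inner ℝ (η x ^ 2 • F x)
      (classicalGrad (v k) (x + h) - classicalGrad (v k) x)
      = - ∫ x in K, inner ℝ (F x)
        (outer (fun j => 2 * η x * partialDeriv j η x) (v k (x + h) - v k x)) := fun k => by
    have hvd : Differentiable ℝ (v k) := (hv k).differentiable (by simp)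
    have hvs : ContDiff ℝ ∞ fun x => v k (x + h) := (hv k).comp (contDiff_id.add contDiff_const)
    set ζ : Vec n → Vec N := fun x => η x ^ 2 • (v k (x + h) - v k x) with hζ
    have hη2 : IsTestFunction K fun x => η x ^ 2 := by
      refine ⟨hηs.pow 2, ?_, ?_⟩
      · exact hηc.comp_left (g := fun t => t ^ 2) (by simp)
      · rw [← hηt]
        exact closure_mono fun x hx => by simpa using hx
    have hζK : IsTestFunction K ζ := hη2.smul_right (hvs.sub (hv k))
    have h1 := heq ζ (hζK.mono hKU)
    -- The shifted test function still lives in U because K + h ⊆ U. The substitution x ↦ x + h then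
    -- turns its equation into one for the translated flux against the same gradient; W vanishes off
    -- U, so all integrals may be taken over the whole space.
    have h2 := heq _ (hζK.comp_sub h hKh1)
    have hA0 : ∀ x, x ∉ U → regFlux α (W x) = 0 := fun x hx => by
      rw [hW0 x hx, RegCoef.regFlux_zero]
    rw [setIntegral_inner_eq_integral hA0] at h1 h2
    rw [← integral_add_right_eq_self _ h] at h2
    have hgr : ∀ x, classicalGrad (fun y => ζ (y - h)) (x + h) = classicalGrad ζ x := fun x => by
      simp_rw [sub_eq_add_neg]
      rw [classicalGrad_comp_add_right]
      simp
    simp_rw [hgr] at h2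
    have hgL : MemLp (classicalGrad ζ) 2 volume := hζK.memLp_classicalGrad volume
    have h3 : ∫ x, inner ℝ (F x) (classicalGrad ζ x) = 0 := by
      simp_rw [hF, inner_sub_left]
      rw [integral_sub (integrable_inner_of_memLp (memLp_two_add_right hAW h) hgL)
        (integrable_inner_of_memLp hAW hgL), h1, h2, sub_zero]
    have hζ0 : ∀ x, x ∉ K → classicalGrad ζ x = 0 := fun x hx =>
      image_eq_zero_of_notMem_tsupport fun hx' =>
        hx (hζK.tsupport_subset (tsupport_classicalGrad_subset ζ hx'))
    rw [← setIntegral_eq_integral_of_forall_compl_eq_zero (s := K)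
      fun x hx => by rw [hζ0 x hx, inner_zero_right]] at h3
    have hgζ : ∀ x, classicalGrad ζ x
        = η x ^ 2 • (classicalGrad (v k) (x + h) - classicalGrad (v k) x)
          + outer (fun j => 2 * η x * partialDeriv j η x) (v k (x + h) - v k x) := fun x => by
      rw [hζ, classicalGrad_smul (c := fun y => η y ^ 2) (hηd.pow 2) ((hvs.sub (hv k)).differentiable (by simp)),
        classicalGrad_sub (hvs.differentiable (by simp)) hvd, classicalGrad_comp_add_right]
      simp_rw [partialDeriv_sq hηd]
    simp_rw [hgζ, inner_add_right, inner_smul_right] at h3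
    simp_rw [inner_smul_left, RCLike.conj_to_real]
    have hi1 : IntegrableOn (fun x => η x ^ 2 * inner ℝ (F x)
        (classicalGrad (v k) (x + h) - classicalGrad (v k) x)) K := by
      have h4 : MemLp (fun x => η x ^ 2 • (classicalGrad (v k) (x + h) - classicalGrad (v k) x)) 2
          (volume.restrict K) := by
        refine Continuous.memLp_closedBall ?_ _ _ _
        have := hwc k
        have := hηs.continuous
        fun_prop
      refine (integrable_inner_of_memLp (hFL.restrict K) h4).congr (Eventually.of_forall fun x => ?_)
      exact inner_smul_right _ _ _
    have hi2 : IntegrableOn (fun x => inner ℝ (F x)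
        (outer (fun j => 2 * η x * partialDeriv j η x) (v k (x + h) - v k x))) K := by
      have h4 : MemLp (fun x =>
          outer (fun j => 2 * η x * partialDeriv j η x) (v k (x + h) - v k x)) 2
          (volume.restrict K) := by
        refine Continuous.memLp_closedBall (outer_continuous (fun j => ?_) ?_) _ _ _
        · exact (continuous_const.mul hηs.continuous).mul (partialDeriv_continuous hη1 j)
        · exact hvs.continuous.sub (hv k).continuous
      exact integrable_inner_of_memLp (hFL.restrict K) h4
    rw [integral_add hi1 hi2] at h3
    linarith
  have hub : ∀ k, ∫ x in K, inner ℝ (η x ^ 2 • F x)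
      (classicalGrad (v k) (x + h) - classicalGrad (v k) x)
      ≤ c / 2 * (∫ x in K, η x ^ 2 * ‖d x‖ ^ 2) + 2 * L ^ 2 * Cη / c
        * (‖h‖ ^ 2 * (2 * (∫ x in U, ‖classicalGrad (v k) x - W x‖ ^ 2) + 2 * I)) := fun k => by
    rw [hid k, ← integral_neg]
    have hvc := (hv k).continuous
    have hvi : IntegrableOn (fun x => ‖v k (x + h) - v k x‖ ^ 2) K :=
      ContinuousOn.integrableOn_compact hKc (by fun_prop)
    have hpt : ∀ x, -inner ℝ (F x)
        (outer (fun j => 2 * η x * partialDeriv j η x) (v k (x + h) - v k x))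
        ≤ c / 2 * (η x ^ 2 * ‖d x‖ ^ 2) + 2 * L ^ 2 * Cη / c * ‖v k (x + h) - v k x‖ ^ 2 :=
      fun x => by
      set y := v k (x + h) - v k x
      have e : outer (fun j => 2 * η x * partialDeriv j η x) y
          = (2 * η x) • outer (fun j => partialDeriv j η x) y := by
        ext q; simp [outer_apply]; ring
      rw [e, inner_smul_right]
      set o := outer (fun j => partialDeriv j η x) y with ho
      have h1 : ‖o‖ ^ 2 ≤ Cη * ‖y‖ ^ 2 := by
        rw [ho, norm_outer_sq]; exact mul_le_mul_of_nonneg_right (hCη x) (sq_nonneg _)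
      have h2 : |inner ℝ (F x) o| ≤ L * ‖d x‖ * ‖o‖ :=
        (abs_real_inner_le_norm _ _).trans (mul_le_mul_of_nonneg_right (hFd x) (norm_nonneg _))
      have h3 := neg_abs_le (inner ℝ (F x) o)
      have hη0 := (hη01 x).1
      have h4 : -(2 * η x * inner ℝ (F x) o) ≤ 2 * η x * (L * ‖d x‖ * ‖o‖) := by
        nlinarith
      have h5 : c / 2 * (η x ^ 2 * ‖d x‖ ^ 2) + 2 * L ^ 2 / c * ‖o‖ ^ 2
          - 2 * η x * (L * ‖d x‖ * ‖o‖) = c / 2 * (η x * ‖d x‖ - 2 * L / c * ‖o‖) ^ 2 := by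
        field_simp; ring
      have h6 : 0 ≤ c / 2 * (η x * ‖d x‖ - 2 * L / c * ‖o‖) ^ 2 := by positivity
      have h7 : 2 * L ^ 2 / c * ‖o‖ ^ 2 ≤ 2 * L ^ 2 / c * (Cη * ‖y‖ ^ 2) := by gcongr
      have h8 : 2 * L ^ 2 * Cη / c * ‖y‖ ^ 2 = 2 * L ^ 2 / c * (Cη * ‖y‖ ^ 2) := by ring
      linarith
    have hsum : IntegrableOn (fun x => c / 2 * (η x ^ 2 * ‖d x‖ ^ 2)
        + 2 * L ^ 2 * Cη / c * ‖v k (x + h) - v k x‖ ^ 2) K :=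
      (hηdi.integrableOn.const_mul _).add (hvi.const_mul _)
    have hoL : MemLp (fun x =>
        outer (fun j => 2 * η x * partialDeriv j η x) (v k (x + h) - v k x)) 2
        (volume.restrict K) := by
      refine Continuous.memLp_closedBall (outer_continuous (fun j => ?_) (by fun_prop)) _ _ _
      exact (continuous_const.mul hηs.continuous).mul (partialDeriv_continuous hη1 j)
    refine (integral_mono (integrable_inner_of_memLp (hFL.restrict K) hoL).neg hsum hpt).trans ?_
    rw [integral_add (hηdi.integrableOn.const_mul _) (hvi.const_mul _), integral_const_mul,
      integral_const_mul]
    gcongr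
    refine (setIntegral_norm_sub_sq_le ((hv k).of_le (by simp)) hUm (hwi k) hKc hKh).trans ?_
    gcongr
    rw [← integral_const_mul, hI, ← integral_const_mul,
      ← integral_add ((hwWi k).const_mul _) (hWi.integrableOn.const_mul _)]
    refine integral_mono (hwi k) (((hwWi k).const_mul _).add (hWi.integrableOn.const_mul _))
      fun x => ?_
    have := norm_add_sq_le (classicalGrad (v k) x - W x) (W x)
    simpa using this
  have hlimd : Tendsto (fun k => ∫ x in K,
      ‖(classicalGrad (v k) (x + h) - classicalGrad (v k) x) - d x‖ ^ 2) atTop (𝓝 0) := by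
    refine squeeze_zero (fun k => integral_nonneg fun x => sq_nonneg _) (fun k => ?_)
      (by simpa using hlim.const_mul 4)
    have e : ∀ x, (classicalGrad (v k) (x + h) - classicalGrad (v k) x) - d x
        = (classicalGrad (v k) (x + h) - W (x + h)) - (classicalGrad (v k) x - W x) := fun x => by
      simp only [hd]; abel
    simp_rw [e]
    exact setIntegral_norm_translate_sub_sq_le (g := fun x => classicalGrad (v k) x - W x) hUm
      (hwWi k) hKm hKU hKh1
  have hlima := tendsto_integral_inner_of_tendsto_sq hηF (hdL.restrict K)
    (ζ := fun k x => classicalGrad (v k) (x + h) - classicalGrad (v k) x) (fun k =>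
      Continuous.memLp_closedBall
        (((hwc k).comp (continuous_id.add continuous_const)).sub (hwc k)) _ _ _) hlimd
  have hub2 := le_of_tendsto_of_tendsto' hlima
    ((((((hlim.const_mul 2).add_const (2 * I)).const_mul (‖h‖ ^ 2)).const_mul
      (2 * L ^ 2 * Cη / c))).const_add (c / 2 * (∫ x in K, η x ^ 2 * ‖d x‖ ^ 2))) hub
  have hlow : c * (∫ x in K, η x ^ 2 * ‖d x‖ ^ 2)
      ≤ ∫ x in K, inner ℝ (η x ^ 2 • F x) (d x) := by
    rw [← integral_const_mul]
    refine integral_mono (hηdi.integrableOn.const_mul _)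
      (integrable_inner_of_memLp hηF (hdL.restrict K)) fun x => ?_
    simp only [inner_smul_left, RCLike.conj_to_real]
    have := mul_le_mul_of_nonneg_left (hα.le_inner_regFlux_sub (W (x + h)) (W x))
      (sq_nonneg (η x))
    simp only [hF, hd, hc]
    linarith
  have hball : ∫ x in Metric.ball x₀ r₁, ‖W (x + h) - W x‖ ^ 2
      ≤ ∫ x in K, η x ^ 2 * ‖d x‖ ^ 2 := by
    have e : ∫ x in Metric.ball x₀ r₁, ‖W (x + h) - W x‖ ^ 2
        = ∫ x in Metric.ball x₀ r₁, η x ^ 2 * ‖d x‖ ^ 2 := by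
      refine setIntegral_congr_fun Metric.isOpen_ball.measurableSet fun x hx => ?_
      have : η x = 1 := ηb.one_of_mem_closedBall (Metric.ball_subset_closedBall hx)
      simp [this, hd]
    rw [e]
    refine setIntegral_mono_set hηdi.integrableOn
      (Eventually.of_forall fun x => by positivity) ?_
    exact (Metric.ball_subset_closedBall.trans
      (Metric.closedBall_subset_closedBall (by linarith))).eventuallyLE
  rw [mul_assoc, ← div_eq_inv_mul, le_div_iff₀ (by positivity)]
  nlinarith

end DifferenceQuotient


/-! ### Weak derivatives from difference quotients -/

section WeakDerivative

variable {n N : ℕ}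

theorem memLp_two_locallyIntegrable {F : Type*} [NormedAddCommGroup F] {f : Vec n → F}
    (hf : MemLp f 2 volume) : LocallyIntegrable f :=
  hf.locallyIntegrable (by norm_num)

theorem integrable_smul_of_hasCompactSupport {F : Type*} [NormedAddCommGroup F] [NormedSpace ℝ F]
    {f : Vec n → F} (hf : LocallyIntegrable f) {ψ : Vec n → ℝ} (hψ : Continuous ψ)
    (hψc : HasCompactSupport ψ) : Integrable fun x => ψ x • f x :=
  hf.integrable_smul_left_of_hasCompactSupport hψ hψc

/-- Translation moves the difference quotient onto ψ, where it converges pointwise and is bounded by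
the Lipschitz constant of ψ on a fixed compact neighbourhood of its support. -/
theorem tendsto_integral_difference_quotient {F : Type*} [NormedAddCommGroup F] [NormedSpace ℝ F]
    {W : Vec n → F} (hW : LocallyIntegrable W)
    {ψ : Vec n → ℝ} (hψ : ContDiff ℝ 1 ψ) (hψc : HasCompactSupport ψ) (s : Fin n) :
    Tendsto (fun t : ℝ => ∫ x, ψ x • t⁻¹ • (W (x + t • EuclideanSpace.single s 1) - W x))
      (𝓝[≠] 0) (𝓝 (-∫ x, partialDeriv s ψ x • W x)) := by
  set e : Vec n := EuclideanSpace.single s 1 with he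
  have he1 : ‖e‖ = 1 := by simp [he]
  obtain ⟨L, hL⟩ := hψ.lipschitzWith_of_hasCompactSupport hψc one_ne_zero
  have hψt : ∀ t : ℝ, Continuous fun x => ψ (x - t • e) := fun t =>
    hψ.continuous.comp (continuous_id.sub continuous_const)
  have hψtc : ∀ t : ℝ, HasCompactSupport fun x => ψ (x - t • e) := fun t =>
    hψc.comp_homeomorph (Homeomorph.subRight (t • e))
  have h1 : ∀ t : ℝ, ∫ x, ψ x • t⁻¹ • (W (x + t • e) - W x)
      = ∫ x, (t⁻¹ * (ψ (x - t • e) - ψ x)) • W x := fun t => by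
    have i1 : Integrable fun x => ψ (x - t • e) • W x :=
      integrable_smul_of_hasCompactSupport hW (hψt t) (hψtc t)
    have i1' : Integrable fun x => ψ x • W (x + t • e) := by
      simpa using i1.comp_add_right (t • e)
    have i2 : Integrable fun x => ψ x • W x :=
      integrable_smul_of_hasCompactSupport hW hψ.continuous hψc
    have e1 : ∫ x, ψ x • W (x + t • e) = ∫ x, ψ (x - t • e) • W x := by
      rw [← integral_add_right_eq_self (fun x => ψ (x - t • e) • W x) (t • e)]
      simp
    calc ∫ x, ψ x • t⁻¹ • (W (x + t • e) - W x)
        = ∫ x, t⁻¹ • (ψ x • W (x + t • e) - ψ x • W x) := by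
          congr 1; ext x; rw [smul_comm, smul_sub]
      _ = t⁻¹ • ((∫ x, ψ (x - t • e) • W x) - ∫ x, ψ x • W x) := by
          rw [integral_smul, integral_sub i1' i2, e1]
      _ = ∫ x, t⁻¹ • (ψ (x - t • e) • W x - ψ x • W x) := by
          rw [integral_smul, integral_sub i1 i2]
      _ = ∫ x, (t⁻¹ * (ψ (x - t • e) - ψ x)) • W x := by
          congr 1; ext x; rw [← sub_smul, smul_smul]
  simp_rw [h1]
  rw [← integral_neg]
  set K := Metric.cthickening 1 (tsupport ψ) with hK
  have hKc : IsCompact K := hψc.isCompact.cthickening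
  have hWK : Integrable (K.indicator fun x => (L : ℝ) * ‖W x‖) := by
    rw [integrable_indicator_iff hKc.measurableSet]
    exact (hW.integrableOn_isCompact hKc).norm.const_mul _
  refine tendsto_integral_filter_of_dominated_convergence (K.indicator fun x => (L : ℝ) * ‖W x‖)
    (Eventually.of_forall fun t => ?_) ?_ hWK (Eventually.of_forall fun x => ?_)
  · exact (continuous_const.mul ((hψt t).sub hψ.continuous)).aestronglyMeasurable.smul
      hW.aestronglyMeasurable
  · have hball : ∀ᶠ t : ℝ in 𝓝[≠] 0, |t| < 1 ∧ t ≠ 0 := by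
      refine Filter.Eventually.and ?_ self_mem_nhdsWithin
      refine mem_nhdsWithin_of_mem_nhds ?_
      simpa [Metric.ball, Real.dist_eq] using Metric.ball_mem_nhds (0 : ℝ) one_pos
    filter_upwards [hball] with t ht
    refine Eventually.of_forall fun x => ?_
    by_cases hx : x ∈ K
    · rw [indicator_of_mem hx, norm_smul, norm_mul, norm_inv]
      have h2 : ‖ψ (x - t • e) - ψ x‖ ≤ L * ‖t‖ := by
        have := hL.dist_le_mul (x - t • e) x
        rw [dist_eq_norm, dist_eq_norm] at this
        simpa [norm_smul, he1] using this
      have ht0 : 0 < ‖t‖ := norm_pos_iff.2 ht.2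
      refine mul_le_mul_of_nonneg_right ?_ (norm_nonneg _)
      rw [inv_mul_le_iff₀ ht0]
      linarith
    · rw [indicator_of_notMem hx]
      have h3 : ψ x = 0 := image_eq_zero_of_notMem_tsupport fun h =>
        hx (Metric.self_subset_cthickening _ h)
      have h4 : ψ (x - t • e) = 0 := image_eq_zero_of_notMem_tsupport fun h => hx <| by
        refine Metric.mem_cthickening_of_dist_le x _ _ _ h ?_
        simpa [dist_eq_norm, norm_smul, he1] using ht.1.le
      simp [h3, h4]
  · rw [← neg_smul]
    refine Tendsto.smul_const ?_ _
    have hd : HasDerivAt (fun t : ℝ => ψ (x - t • e)) (-partialDeriv s ψ x) 0 := by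
      have h2 : HasDerivAt (fun t : ℝ => x - t • e) (-e) 0 := by
        simpa using ((hasDerivAt_id (0 : ℝ)).smul_const e).const_sub x
      have h3 : HasFDerivAt ψ (fderiv ℝ ψ x) (x - (0 : ℝ) • e) := by
        simpa using (hψ.differentiable (by simp)).differentiableAt.hasFDerivAt
      have := h3.comp_hasDerivAt (0 : ℝ) h2
      simpa [partialDeriv, he] using! this
    have := hd.tendsto_slope_zero
    simpa using this

/-- The difference quotients are bounded in L²(B), so they have a weak limit point as t → 0, and
discrete integration by parts identifies it with the weak derivative. -/
theorem exists_weak_partialDeriv {W : Vec n → Mat n N} (hW : MemLp W 2 volume)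
    {B : Set (Vec n)} (hB : MeasurableSet B) {C d : ℝ} (hd : 0 < d)
    (hdiff : ∀ h : Vec n, ‖h‖ < d → ∫ x in B, ‖W (x + h) - W x‖ ^ 2 ≤ C * ‖h‖ ^ 2) (s : Fin n) :
    ∃ D : Vec n → Mat n N, MemLp D 2 volume ∧ (∀ x, x ∉ B → D x = 0) ∧
      ∀ ψ : Vec n → ℝ, IsTestFunction B ψ →
        ∫ x, partialDeriv s ψ x • W x = -∫ x, ψ x • D x := by
  set e : Vec n := EuclideanSpace.single s 1 with he
  have he1 : ‖e‖ = 1 := by simp [he]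
  set μ := volume.restrict B with hμ
  set q : ℝ → Vec n → Mat n N := fun t x => t⁻¹ • (W (x + t • e) - W x) with hq
  have hqL' : ∀ t, MemLp (q t) 2 volume := fun t =>
    ((memLp_two_add_right hW (t • e)).sub hW).const_smul t⁻¹
  have hqL : ∀ t, MemLp (q t) 2 μ := fun t => (hqL' t).restrict B
  have hqb : ∀ t : ℝ, |t| < d → t ≠ 0 → ‖(hqL t).toLp (q t)‖ ≤ Real.sqrt C := fun t ht ht0 => by
    refine Real.le_sqrt_of_sq_le ?_
    rw [← integral_norm_sq_eq_norm_toLp]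
    have h1 := hdiff (t • e) (by rwa [norm_smul, he1, mul_one])
    have h2 : ∫ x, ‖q t x‖ ^ 2 ∂μ = (t ^ 2)⁻¹ * ∫ x in B, ‖W (x + t • e) - W x‖ ^ 2 := by
      rw [← integral_const_mul]
      congr 1; ext x
      simp only [hq, norm_smul, mul_pow, norm_inv, inv_pow, Real.norm_eq_abs, sq_abs]
    rw [h2, inv_mul_le_iff₀ (by positivity)]
    rw [norm_smul, he1, mul_one, Real.norm_eq_abs, sq_abs] at h1
    linarith
  set ℓ : ℝ → WeakDual ℝ (Lp (Mat n N) 2 μ) := fun t =>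
    StrongDual.toWeakDual (innerSL ℝ ((hqL t).toLp (q t))) with hℓ
  have hcomp := WeakDual.isCompact_closedBall (𝕜 := ℝ) (0 : StrongDual ℝ (Lp (Mat n N) 2 μ))
    (Real.sqrt C)
  -- Banach–Alaoglu along an ultrafilter finer than the punctured neighbourhoods of 0: the weak
  -- limit exists without extracting a sequence.
  obtain ⟨L, -, hL⟩ := hcomp.ultrafilter_le_nhds ((Ultrafilter.of (𝓝[≠] (0 : ℝ))).map ℓ) (by
    rw [le_principal_iff]
    change ℓ ⁻¹' _ ∈ ((Ultrafilter.of (𝓝[≠] (0 : ℝ)) : Ultrafilter ℝ) : Filter ℝ)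
    refine Ultrafilter.of_le _ ?_
    have hball : ∀ᶠ t : ℝ in 𝓝[≠] 0, |t| < d ∧ t ≠ 0 := by
      refine Filter.Eventually.and ?_ self_mem_nhdsWithin
      refine mem_nhdsWithin_of_mem_nhds ?_
      simpa [Metric.ball, Real.dist_eq] using Metric.ball_mem_nhds (0 : ℝ) hd
    filter_upwards [hball] with t ht
    rw [mem_preimage, mem_preimage, mem_closedBall_zero_iff]
    have : ‖innerSL ℝ ((hqL t).toLp (q t))‖ ≤ Real.sqrt C := by
      rw [innerSL_apply_norm]; exact hqb t ht.1 ht.2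
    exact this)
  set D₀ : Lp (Mat n N) 2 μ :=
    (InnerProductSpace.toDual ℝ (Lp (Mat n N) 2 μ)).symm (WeakDual.toStrongDual L) with hD₀
  have hD₀L : ∀ f, inner ℝ D₀ f = L f := fun f => by
    rw [hD₀, InnerProductSpace.toDual_symm_apply]; rfl
  have hlim : ∀ f, Tendsto (fun t => inner ℝ ((hqL t).toLp (q t)) f)
      (Ultrafilter.of (𝓝[≠] (0 : ℝ)) : Filter ℝ) (𝓝 (inner ℝ D₀ f)) := fun f => by
    rw [hD₀L]
    exact ((WeakDual.eval_continuous f).tendsto L).comp hL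
  refine ⟨B.indicator D₀, (memLp_indicator_iff_restrict hB).2 (Lp.memLp D₀),
    fun x hx => indicator_of_notMem hx _, fun ψ hψ => ?_⟩
  have hψ0 : ∀ x, x ∉ B → ψ x = 0 := fun x hx =>
    image_eq_zero_of_notMem_tsupport fun h => hx (hψ.tsupport_subset h)
  have hψ1 : ContDiff ℝ 1 ψ := hψ.contDiff.of_le (by simp)
  have hDL : MemLp (B.indicator D₀) 2 volume :=
    (memLp_indicator_iff_restrict hB).2 (Lp.memLp D₀)
  have key := (tendsto_integral_difference_quotient (memLp_two_locallyIntegrable hW) hψ1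
    hψ.hasCompactSupport s).mono_left (Ultrafilter.of_le (𝓝[≠] (0 : ℝ)))
  -- The sign is moved so that the goal equates ∫ψD with −∫∂_sψ W. Paired with a constant vector v,
  -- both are limits of the same quantity along the ultrafilter.
  rw [eq_neg_iff_add_eq_zero, add_comm, ← eq_neg_iff_add_eq_zero]
  refine ext_inner_right ℝ fun v => ?_
  have hfL : MemLp (fun x => ψ x • v) 2 μ :=
    (Continuous.memLp_of_hasCompactSupport (hψ1.continuous.smul continuous_const)
      (hψ.hasCompactSupport.smul_right))
  have key1 := hlim (hfL.toLp _)
  have e1 : ∀ t, inner ℝ ((hqL t).toLp (q t)) (hfL.toLp _)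
      = inner ℝ (∫ x, ψ x • t⁻¹ • (W (x + t • e) - W x)) v := fun t => by
    rw [← integral_inner_eq_inner_toLp, hμ, setIntegral_eq_integral_of_forall_compl_eq_zero
      fun x hx => by rw [hψ0 x hx, zero_smul, inner_zero_right], real_inner_comm,
      ← integral_inner (integrable_smul_of_hasCompactSupport
        (memLp_two_locallyIntegrable (hqL' t)) hψ1.continuous hψ.hasCompactSupport)]
    congr 1; ext x
    simp only [hq, inner_smul_right, real_inner_comm v]
  have e2 : inner ℝ D₀ (hfL.toLp _) = inner ℝ (∫ x, ψ x • B.indicator D₀ x) v := by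
    rw [L2.inner_def, real_inner_comm, ← integral_inner (integrable_smul_of_hasCompactSupport
        (memLp_two_locallyIntegrable hDL) hψ1.continuous hψ.hasCompactSupport)]
    have e3 : ∫ x, inner ℝ v (ψ x • B.indicator D₀ x)
        = ∫ x in B, inner ℝ v (ψ x • B.indicator D₀ x) :=
      (setIntegral_eq_integral_of_forall_compl_eq_zero
        fun x hx => by rw [hψ0 x hx, zero_smul, inner_zero_right]).symm
    rw [e3]
    refine integral_congr_ae ?_
    filter_upwards [hfL.coeFn_toLp, ae_restrict_mem hB] with x hx hxB
    rw [hx, indicator_of_mem hxB, inner_smul_right, inner_smul_right, real_inner_comm]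
  simp_rw [e1, e2] at key1
  exact tendsto_nhds_unique key1 (key.inner tendsto_const_nhds)

theorem partialDeriv_comm {F : Type*} [NormedAddCommGroup F] [NormedSpace ℝ F] {f : Vec n → F}
    (hf : ContDiff ℝ ∞ f) (s j : Fin n) (x : Vec n) :
    partialDeriv s (partialDeriv j f) x = partialDeriv j (partialDeriv s f) x := by
  have h1 : ∀ (s j : Fin n), partialDeriv s (partialDeriv j f) x
      = fderiv ℝ (fderiv ℝ f) x (EuclideanSpace.single s 1) (EuclideanSpace.single j 1) :=
    fun s j => by
    have hd : DifferentiableAt ℝ (fderiv ℝ f) x :=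
      ((hf.fderiv_right (m := 1) (by norm_cast)).differentiable (by simp)).differentiableAt
    have := hd.hasFDerivAt.clm_apply (hasFDerivAt_const (EuclideanSpace.single j (1 : ℝ)) x)
    rw [partialDeriv_eq_of_hasFDerivAt (f := partialDeriv j f) this]
    simp
  rw [h1, h1]
  exact ((hf.contDiffAt).isSymmSndFDerivAt
    (by rw [minSmoothness_of_isRCLikeNormedField]; exact WithTop.coe_le_coe.2 (le_top : (2 : ℕ∞) ≤ ⊤))) _ _

theorem integral_mul_partialDeriv {f g : Vec n → ℝ} (hf : ContDiff ℝ 1 f) (hg : ContDiff ℝ 1 g)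
    (hgc : HasCompactSupport g) (s : Fin n) :
    ∫ x, f x * partialDeriv s g x = -∫ x, partialDeriv s f x * g x := by
  have h1 := partialDeriv_continuous hf s
  have h2 := partialDeriv_continuous hg s
  refine integral_mul_fderiv_eq_neg_fderiv_mul_of_integrable
    (v := EuclideanSpace.single s 1) ?_ ?_ ?_ (fun x _ => (hf.differentiable (by simp)) x)
    (fun x _ => (hg.differentiable (by simp)) x)
  · exact (h1.mul hg.continuous).integrable_of_hasCompactSupport (hgc.mul_left)
  · exact (hf.continuous.mul h2).integrable_of_hasCompactSupport
      ((hasCompactSupport_partialDeriv hgc s).mul_left)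
  · exact (hf.continuous.mul hg.continuous).integrable_of_hasCompactSupport hgc.mul_left

/-- An `L²` limit of gradients is curl free. -/
theorem integral_partialDeriv_mul_comm {U : Set (Vec n)} {W : Vec n → Mat n N}
    (hW : MemLp W 2 volume) {v : ℕ → Vec n → Vec N} (hv : ∀ k, ContDiff ℝ ∞ (v k))
    (hvL : ∀ k, MemLp (classicalGrad (v k)) 2 (volume.restrict U))
    (hlim : Tendsto (fun k => ∫ x in U, ‖classicalGrad (v k) x - W x‖ ^ 2) atTop (𝓝 0))
    {ψ : Vec n → ℝ} (hψ : IsTestFunction U ψ) (s j : Fin n) (i : Fin N) :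
    ∫ x, partialDeriv s ψ x * W x (j, i) = ∫ x, partialDeriv j ψ x * W x (s, i) := by
  have hψs : ∀ s, HasCompactSupport (partialDeriv s ψ) := fun s =>
    hasCompactSupport_partialDeriv hψ.hasCompactSupport s
  have hψ1 : ∀ s, ContDiff ℝ 1 (partialDeriv s ψ) := fun s =>
    (partialDeriv_contDiff hψ.contDiff s).of_le (by simp)
  have key : ∀ s j : Fin n, Tendsto (fun k => ∫ x, partialDeriv s ψ x * classicalGrad (v k) x (j, i))
      atTop (𝓝 (∫ x, partialDeriv s ψ x * W x (j, i))) := fun s j => by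
    set f : Vec n → Mat n N := fun x => partialDeriv s ψ x • EuclideanSpace.single (j, i) 1 with hf
    have hfL : MemLp f 2 (volume.restrict U) :=
      Continuous.memLp_of_hasCompactSupport ((hψ1 s).continuous.smul continuous_const)
        ((hψs s).smul_right)
    have hinner : ∀ (x : Vec n) (P : Mat n N),
        inner ℝ (f x) P = partialDeriv s ψ x * P (j, i) := fun x P => by
      rw [hf, inner_smul_left]; simp [EuclideanSpace.inner_single_left]
    have h0 : ∀ x, x ∉ U → f x = 0 := fun x hx => by
      have : partialDeriv s ψ x = 0 := image_eq_zero_of_notMem_tsupport fun h =>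
        hx ((hψ.partialDeriv s).tsupport_subset h)
      simp [hf, this]
    have h1 := tendsto_integral_inner_of_tendsto_sq hfL (hW.restrict U) hvL hlim
    rw [setIntegral_inner_eq_integral h0] at h1
    simp_rw [setIntegral_inner_eq_integral h0, hinner] at h1
    exact h1
  have hsym : ∀ k, ∫ x, partialDeriv s ψ x * classicalGrad (v k) x (j, i)
      = ∫ x, partialDeriv j ψ x * classicalGrad (v k) x (s, i) := fun k => by
    have hvk : ContDiff ℝ 1 fun x => v k x i :=
      (EuclideanSpace.proj (𝕜 := ℝ) i).contDiff.comp ((hv k).of_le (by simp))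
    have h1 : ∀ (s j : Fin n), ∫ x, partialDeriv s ψ x * classicalGrad (v k) x (j, i)
        = -∫ x, v k x i * partialDeriv j (partialDeriv s ψ) x := fun s j => by
      rw [integral_mul_partialDeriv hvk (hψ1 s) (hψs s), neg_neg]
      congr 1; ext x
      rw [classicalGrad_apply, partialDeriv_coord ((hv k).differentiable (by simp)), mul_comm]
    rw [h1, h1]
    simp_rw [partialDeriv_comm hψ.contDiff j s]
  exact tendsto_nhds_unique (key s j) ((key j s).congr fun k => (hsym k).symm)

/-- Curl-freeness makes ∂_s W_j and ∂_j W_s the same distribution on B; being locally integrable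
functions, they agree almost everywhere. -/
theorem weakDeriv_symm {B : Set (Vec n)} (hB : IsOpen B) {W : Vec n → Mat n N}
    {D : Fin n → Vec n → Mat n N} (hW : MemLp W 2 volume) (hD : ∀ s, MemLp (D s) 2 volume)
    (hWD : ∀ s, ∀ ψ : Vec n → ℝ, IsTestFunction B ψ →
        ∫ x, partialDeriv s ψ x • W x = -∫ x, ψ x • D s x)
    (hcurl : ∀ ψ : Vec n → ℝ, IsTestFunction B ψ → ∀ (s j : Fin n) (i : Fin N),
      ∫ x, partialDeriv s ψ x * W x (j, i) = ∫ x, partialDeriv j ψ x * W x (s, i)) :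
    ∀ᵐ x, x ∈ B → ∀ s j i, D s x (j, i) = D j x (s, i) := by
  have hcoord : ∀ (ψ : Vec n → ℝ) (f : Vec n → Mat n N), Integrable (fun x => ψ x • f x) →
      ∀ q, (∫ x, ψ x • f x) q = ∫ x, ψ x * f x q := fun ψ f hf q => by
    have := (EuclideanSpace.proj (𝕜 := ℝ) q).integral_comp_comm hf
    simpa using this.symm
  have hDloc : ∀ s, LocallyIntegrable (D s) := fun s => memLp_two_locallyIntegrable (hD s)
  have hDcl : ∀ s q, LocallyIntegrable fun x => D s x q := fun s q =>
    memLp_two_locallyIntegrable ((EuclideanSpace.proj (𝕜 := ℝ) q).comp_memLp' (hD s))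
  have key : ∀ s j i, ∀ᵐ x, x ∈ B → D s x (j, i) - D j x (s, i) = 0 := fun s j i => by
    refine hB.ae_eq_zero_of_integral_contDiff_smul_eq_zero
      (((hDcl s (j, i)).sub (hDcl j (s, i))).locallyIntegrableOn B) fun ψ h1 h2 h3 => ?_
    have hψ : IsTestFunction B ψ := ⟨h1, h2, h3⟩
    have hi : ∀ s, Integrable fun x => ψ x • D s x := fun s =>
      integrable_smul_of_hasCompactSupport (hDloc s) h1.continuous h2
    have hiW : ∀ s, Integrable fun x => partialDeriv s ψ x • W x := fun s =>
      integrable_smul_of_hasCompactSupport (memLp_two_locallyIntegrable hW)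
        (hψ.partialDeriv s).contDiff.continuous (hψ.partialDeriv s).hasCompactSupport
    have hval : ∀ (s : Fin n) (q : Fin n × Fin N), ∫ x, ψ x * D s x q
        = -∫ x, partialDeriv s ψ x * W x q := fun s q => by
      rw [← hcoord ψ (D s) (hi s), ← hcoord _ W (hiW s), hWD s ψ hψ]
      simp
    have hiq : ∀ s q, Integrable fun x => ψ x * D s x q := fun s q =>
      integrable_smul_of_hasCompactSupport (hDcl s q) h1.continuous h2
    simp_rw [smul_eq_mul, mul_sub]
    rw [integral_sub (hiq s (j, i)) (hiq j (s, i)), hval, hval, hcurl ψ hψ s j i, sub_self]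
  filter_upwards [ae_all_iff.2 fun s => ae_all_iff.2 fun j => ae_all_iff.2 fun i => key s j i]
    with x hx hxB s j i
  exact sub_eq_zero.1 (hx s j i hxB)

/-- Mollification commutes with weak derivatives, away from the boundary. -/
theorem partialDeriv_mol_eq {F : Type*} [NormedAddCommGroup F] [NormedSpace ℝ F]
    {B : Set (Vec n)} {W D : Vec n → F} (hW : LocallyIntegrable W) {s : Fin n} {k : ℕ} {x : Vec n}
    (hx : Metric.closedBall x (1 / ((k : ℝ) + 1)) ⊆ B)
    (hWD : ∀ ψ : Vec n → ℝ, IsTestFunction B ψ →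
        ∫ y, partialDeriv s ψ y • W y = -∫ y, ψ y • D y) :
    partialDeriv s (mol k W) x = mol k D x := by
  have hψ : IsTestFunction B fun y => mker n k (y - x) := by
    refine IsTestFunction.comp_sub (U' := Metric.closedBall 0 (1 / ((k : ℝ) + 1)))
      ⟨mker_contDiff k, mker_hasCompactSupport k, (mker_tsupport k).le⟩ x fun y hy => hx ?_
    simpa [dist_eq_norm] using hy
  have h1 := hWD _ hψ
  rw [partialDeriv_mol k hW]
  have h2 : ∀ y, partialDeriv s (fun y => mker n k (y - x)) y
      = -partialDeriv s (mker n k) (x - y) := fun y => by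
    have e : (fun y => mker n k (y - x)) = fun y => mker n k (x - y) := by
      ext y; exact (mker_sub_comm k x y).symm
    have hd : HasFDerivAt (mker n k) (fderiv ℝ (mker n k) (x - y)) (x - y) :=
      ((mker_contDiff k).differentiable (by simp)).differentiableAt.hasFDerivAt
    have hd2 : HasFDerivAt (fun y => x - y) (-ContinuousLinearMap.id ℝ (Vec n)) y :=
      (hasFDerivAt_id y).const_sub x
    rw [e, partialDeriv_eq_of_hasFDerivAt (f := fun y => mker n k (x - y)) (hd.comp y hd2)]
    simp [partialDeriv]
  simp_rw [h2, neg_smul] at h1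
  rw [integral_neg, neg_inj] at h1
  rw [h1]
  simp only [mol]
  congr 1; ext y
  rw [mker_sub_comm]

end WeakDerivative


/-! ### The Caccioppoli inequality -/

section Caccioppoli

variable {n N : ℕ}

/-- `W` is a curl free field in `W^{1,2}(B)` with derivatives `D s`, and
`div (α (|W|²) W) = 0` in `B`. -/
structure IsRegularField (α : ℝ → ℝ) (B : Set (Vec n)) (W : Vec n → Mat n N)
    (D : Fin n → Vec n → Mat n N) : Prop where
  isOpen : IsOpen B
  memLp : MemLp W 2 volume
  memLp_deriv : ∀ s, MemLp (D s) 2 volume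
  integral_eq : ∀ s, ∀ ψ : Vec n → ℝ, IsTestFunction B ψ →
    ∫ x, partialDeriv s ψ x • W x = -∫ x, ψ x • D s x
  symm : ∀ᵐ x, x ∈ B → ∀ s j i, D s x (j, i) = D j x (s, i)
  weak_eq : ∀ ζ : Vec n → Vec N, IsTestFunction B ζ →
    ∫ x, inner ℝ (regFlux α (W x)) (classicalGrad ζ x) = 0

/-- The density `|W|² + |D|²`. -/
def energy (W : Vec n → Mat n N) (D : Fin n → Vec n → Mat n N) (x : Vec n) : ℝ :=
  ‖W x‖ ^ 2 + ∑ s, ‖D s x‖ ^ 2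

theorem exists_closedBall_subset {K B : Set (Vec n)} (hK : IsCompact K) (hB : IsOpen B)
    (hKB : K ⊆ B) : ∃ k₀ : ℕ, ∀ k, k₀ ≤ k →
      Metric.cthickening (1 / ((k : ℝ) + 1)) K ⊆ B ∧
      ∀ x ∈ K, Metric.closedBall x (1 / ((k : ℝ) + 1)) ⊆ B := by
  obtain ⟨δ, hδ, hδB⟩ := hK.exists_cthickening_subset_open hB hKB
  obtain ⟨k₀, hk₀⟩ := exists_nat_one_div_lt hδ
  refine ⟨k₀, fun k hk => ?_⟩
  have h1 : 1 / ((k : ℝ) + 1) ≤ δ := by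
    refine le_trans ?_ hk₀.le
    gcongr
  exact ⟨(Metric.cthickening_mono h1 K).trans hδB, fun x hx =>
    (Metric.closedBall_subset_closedBall h1).trans
      ((Metric.closedBall_subset_cthickening hx δ).trans hδB)⟩

/-- The majorants C · `mol k g` + h converge almost everywhere and their integrals do not depend on
k, so generalised dominated convergence applies. Passages from mollified fields to W rest on this.
-/
theorem tendsto_integral_of_le_mol {g h : Vec n → ℝ} (hg : Integrable g) (hh : Integrable h)
    {Φ : ℕ → Vec n → ℝ} {Ψ : Vec n → ℝ} (hΦ : ∀ k, AEStronglyMeasurable (Φ k)) {C : ℝ} {k₀ : ℕ}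
    (hb : ∀ k, k₀ ≤ k → ∀ x, |Φ k x| ≤ C * mol k g x + h x)
    (hlim : ∀ᵐ x, Tendsto (fun k => Φ k x) atTop (𝓝 (Ψ x))) :
    Tendsto (fun k => ∫ x, Φ k x) atTop (𝓝 (∫ x, Ψ x)) := by
  rw [← tendsto_add_atTop_iff_nat k₀]
  refine tendsto_integral_of_dominating (G := fun k x => C * mol (k + k₀) g x + h x)
    (g := fun x => C * g x + h x) (fun k => hΦ _)
    (fun k => ((mol_integrable _ hg).const_mul C).add hh) ((hg.const_mul C).add hh)
    (fun k => Eventually.of_forall fun x => hb _ (by omega) x) ?_ ?_ ?_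
  · filter_upwards [hlim] with x hx using hx.comp (tendsto_add_atTop_nat k₀)
  · filter_upwards [mol_tendsto_ae hg.locallyIntegrable] with x hx
    exact ((hx.comp (tendsto_add_atTop_nat k₀)).const_mul C).add_const _
  · refine tendsto_const_nhds.congr fun k => ?_
    rw [integral_add (hg.const_mul C) hh, integral_add ((mol_integrable _ hg).const_mul C) hh,
      integral_const_mul, integral_const_mul, integral_mol _ hg]

namespace IsRegularField

variable {α : ℝ → ℝ} {lo hi m M : ℝ} {B : Set (Vec n)} {W : Vec n → Mat n N}
  {D : Fin n → Vec n → Mat n N}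

theorem energy_integrable (h : IsRegularField α B W D) : Integrable (energy W D) :=
  (h.memLp.integrable_norm_pow (by norm_num)).add
    (integrable_finsetSum _ fun s _ => (h.memLp_deriv s).integrable_norm_pow (by norm_num))

/-- Jensen's inequality. It turns any pointwise bound by the energy of the mollified fields into a
majorant of the form required by `tendsto_integral_of_le_mol`. -/
theorem energy_mol_le (h : IsRegularField α B W D) (k : ℕ) (x : Vec n) :
    energy (mol k W) (fun s => mol k (D s)) x ≤ mol k (energy W D) x := by
  have i1 : LocallyIntegrable fun y => ‖W y‖ ^ 2 :=
    Integrable.locallyIntegrable (h.memLp.integrable_norm_pow (by norm_num))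
  have i2 : ∀ s, LocallyIntegrable fun y => ‖D s y‖ ^ 2 := fun s =>
    Integrable.locallyIntegrable ((h.memLp_deriv s).integrable_norm_pow (by norm_num))
  have e : mol k (energy W D) x
      = mol k (fun y => ‖W y‖ ^ 2) x + ∑ s, mol k (fun y => ‖D s y‖ ^ 2) x := by
    simp only [mol, energy, smul_add, Finset.smul_sum]
    rw [integral_add (mol_integrand_integrable k i1 x)
      (integrable_finsetSum _ fun s _ => mol_integrand_integrable k (i2 s) x),
      integral_finsetSum _ fun s _ => mol_integrand_integrable k (i2 s) x]
  rw [e]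
  exact add_le_add (norm_mol_sq_le k (memLp_two_locallyIntegrable h.memLp) i1 x)
    (Finset.sum_le_sum fun s _ =>
      norm_mol_sq_le k (memLp_two_locallyIntegrable (h.memLp_deriv s)) (i2 s) x)

theorem norm_sq_le_energy (W : Vec n → Mat n N) (D : Fin n → Vec n → Mat n N) (x : Vec n) :
    ‖W x‖ ^ 2 ≤ energy W D x :=
  le_add_of_nonneg_right (Finset.sum_nonneg fun _ _ => sq_nonneg _)

theorem sum_norm_sq_le_energy (W : Vec n → Mat n N) (D : Fin n → Vec n → Mat n N) (x : Vec n) :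
    ∑ s, ‖D s x‖ ^ 2 ≤ energy W D x := le_add_of_nonneg_left (sq_nonneg _)

theorem norm_deriv_sq_le_energy (W : Vec n → Mat n N) (D : Fin n → Vec n → Mat n N) (s : Fin n)
    (x : Vec n) : ‖D s x‖ ^ 2 ≤ energy W D x :=
  (Finset.single_le_sum (f := fun s => ‖D s x‖ ^ 2) (fun _ _ => sq_nonneg _)
    (Finset.mem_univ s)).trans (sum_norm_sq_le_energy W D x)

theorem mol_tendsto (h : IsRegularField α B W D) :
    ∀ᵐ x, Tendsto (fun k => mol k W x) atTop (𝓝 (W x)) ∧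
      ∀ s, Tendsto (fun k => mol k (D s) x) atTop (𝓝 (D s x)) := by
  filter_upwards [mol_tendsto_ae (memLp_two_locallyIntegrable h.memLp),
    ae_all_iff.2 fun s => mol_tendsto_ae (memLp_two_locallyIntegrable (h.memLp_deriv s))]
    with x h1 h2 using ⟨h1, h2⟩

theorem mol_contDiff (h : IsRegularField α B W D) (k : ℕ) : ContDiff ℝ ∞ (mol k W) :=
  PhiLaplace.mol_contDiff k (memLp_two_locallyIntegrable h.memLp)

theorem partialDeriv_mol (h : IsRegularField α B W D) {k : ℕ} {x : Vec n}
    (hx : Metric.closedBall x (1 / ((k : ℝ) + 1)) ⊆ B) (s : Fin n) :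
    partialDeriv s (mol k W) x = mol k (D s) x :=
  partialDeriv_mol_eq (memLp_two_locallyIntegrable h.memLp) hx (h.integral_eq s)

end IsRegularField

theorem partialDeriv_classicalGrad {ζ : Vec n → Vec N} (hζ : ContDiff ℝ ∞ ζ) (s : Fin n)
    (x : Vec n) : partialDeriv s (classicalGrad ζ) x = classicalGrad (partialDeriv s ζ) x := by
  have hd : ContDiff ℝ ∞ (classicalGrad ζ) := by
    rw [contDiff_piLp]
    intro q
    exact (EuclideanSpace.proj (𝕜 := ℝ) q.2).contDiff.comp (partialDeriv_contDiff hζ q.1)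
  ext q
  rw [← partialDeriv_coord (hd.differentiable (by simp)), classicalGrad_apply]
  have : (fun y => classicalGrad ζ y q) = fun y => partialDeriv q.1 ζ y q.2 := rfl
  rw [this, partialDeriv_coord ((partialDeriv_contDiff hζ q.1).differentiable (by simp)),
    partialDeriv_comm hζ]

theorem classicalGrad_contDiff {ζ : Vec n → Vec N} (hζ : ContDiff ℝ ∞ ζ) :
    ContDiff ℝ ∞ (classicalGrad ζ) := by
  rw [contDiff_piLp]
  intro q
  exact (EuclideanSpace.proj (𝕜 := ℝ) q.2).contDiff.comp (partialDeriv_contDiff hζ q.1)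

theorem integral_inner_partialDeriv {G : Type*} [NormedAddCommGroup G] [InnerProductSpace ℝ G]
    {f g : Vec n → G} (hf : ContDiff ℝ 1 f) (hg : ContDiff ℝ 1 g)
    (hgc : HasCompactSupport g) (s : Fin n) :
    ∫ x, inner ℝ (f x) (partialDeriv s g x) = -∫ x, inner ℝ (partialDeriv s f x) (g x) := by
  have h1 := partialDeriv_continuous hf s
  have h2 := partialDeriv_continuous hg s
  have hsupp : ∀ {f g : Vec n → G}, HasCompactSupport g →
      HasCompactSupport fun x => inner ℝ (f x) (g x) := fun {f g} hg => by
    refine hg.mono fun x hx => ?_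
    rw [Function.mem_support] at hx ⊢
    exact fun h0 => hx (by rw [h0, inner_zero_right])
  refine integral_bilinear_fderiv_right_eq_neg_left_of_integrable
    (B := innerSL ℝ) (v := EuclideanSpace.single s 1) ?_ ?_ ?_
    (fun x _ => (hf.differentiable (by simp)) x) (fun x _ => (hg.differentiable (by simp)) x)
  · exact (h1.inner hg.continuous).integrable_of_hasCompactSupport (hsupp hgc)
  · exact (hf.continuous.inner h2).integrable_of_hasCompactSupport
      (hsupp (hasCompactSupport_partialDeriv hgc s))
  · exact (hf.continuous.inner hg.continuous).integrable_of_hasCompactSupport (hsupp hgc)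

theorem RegCoef.continuous_regFluxDeriv {α : ℝ → ℝ} {lo hi m M : ℝ} (hα : RegCoef α lo hi m M) :
    Continuous fun p : Mat n N × Mat n N => regFluxDeriv α p.1 p.2 := by
  simp_rw [regFluxDeriv_apply]
  have h1 : Continuous fun p : Mat n N × Mat n N => α (‖p.1‖ ^ 2) :=
    hα.continuous_comp (by fun_prop) fun x => sq_nonneg _
  have h2 : Continuous fun p : Mat n N × Mat n N => deriv α (‖p.1‖ ^ 2) :=
    hα.continuous_deriv_comp (by fun_prop) fun x => sq_nonneg _
  exact (h1.smul continuous_snd).add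
    (((continuous_const.mul h2).mul (continuous_fst.inner continuous_snd)).smul continuous_fst)

namespace IsRegularField

variable {α : ℝ → ℝ} {lo hi m M : ℝ} {B : Set (Vec n)} {W : Vec n → Mat n N}
  {D : Fin n → Vec n → Mat n N}

theorem memLp_linearised (hα : RegCoef α lo hi m M) (h : IsRegularField α B W D) (s : Fin n) :
    MemLp (fun x => regFluxDeriv α (W x) (D s x)) 2 volume := by
  have hm : AEStronglyMeasurable (fun x => regFluxDeriv α (W x) (D s x)) volume :=
    Continuous.comp_aestronglyMeasurable
      (g := fun p : Mat n N × Mat n N => regFluxDeriv α p.1 p.2) (f := fun x => (W x, D s x))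
      hα.continuous_regFluxDeriv (h.memLp.1.prodMk (h.memLp_deriv s).1)
  refine (h.memLp_deriv s).of_le_mul (c := (1 + M) * hi) hm
    (Eventually.of_forall fun x => (hα.norm_regFluxDeriv_apply_le _ _).trans ?_)
  have h1 := hα.one_le
  have h2 := hα.le_hi _ (sq_nonneg ‖W x‖)
  gcongr

/-- The equation is differentiated by testing it with ∂_sζ. The integration by parts and the chain
rule take place for the mollified W, where they are classical, and both sides pass to the limit. -/
theorem linearised_eq (hα : RegCoef α lo hi m M) (h : IsRegularField α B W D) (s : Fin n)
    {ζ : Vec n → Vec N} (hζ : IsTestFunction B ζ) :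
    ∫ x, inner ℝ (regFluxDeriv α (W x) (D s x)) (classicalGrad ζ x) = 0 := by
  obtain ⟨k₀, hk₀⟩ := exists_closedBall_subset hζ.hasCompactSupport.isCompact h.isOpen
    hζ.tsupport_subset
  have hM := hα.one_le
  have hhi := hα.hi_pos
  have hgc : ContDiff ℝ 1 (classicalGrad ζ) :=
    (classicalGrad_contDiff hζ.contDiff).of_le (by simp)
  have hgs := hasCompactSupport_classicalGrad hζ.hasCompactSupport
  have hgL := hζ.memLp_classicalGrad volume
  have hg'L := (hζ.partialDeriv s).memLp_classicalGrad volume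
  -- the mollified flux and its derivative
  have hAder : ∀ k x, HasFDerivAt (fun y => regFlux α (mol k W y))
      ((regFluxDeriv α (mol k W x)).comp (fderiv ℝ (mol k W) x)) x := fun k x =>
    (hα.hasFDerivAt_regFlux (mol k W x)).comp x
      ((h.mol_contDiff k).differentiable (by simp)).differentiableAt.hasFDerivAt
  have hmc : ∀ k, Continuous (mol k W) := fun k => (h.mol_contDiff k).continuous
  have hA1 : ∀ k, ContDiff ℝ 1 fun y => regFlux α (mol k W y) := fun k => by
    have h1 : ContDiff ℝ 1 (mol k W) := (h.mol_contDiff k).of_le (by simp)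
    exact (hα.contDiff_comp (h1.norm_sq ℝ) fun x => sq_nonneg _).smul h1
  have hpA : ∀ k x, partialDeriv s (fun y => regFlux α (mol k W y)) x
      = regFluxDeriv α (mol k W x) (partialDeriv s (mol k W) x) := fun k x => by
    rw [partialDeriv_eq_of_hasFDerivAt (hAder k x)]; rfl
  have hparts : ∀ k, ∫ x, inner ℝ (regFluxDeriv α (mol k W x) (partialDeriv s (mol k W) x))
      (classicalGrad ζ x)
      = -∫ x, inner ℝ (regFlux α (mol k W x)) (classicalGrad (partialDeriv s ζ) x) := fun k => by
    have := integral_inner_partialDeriv (hA1 k) hgc hgs s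
    simp_rw [partialDeriv_classicalGrad hζ.contDiff, hpA] at this
    rw [this, neg_neg]
  have lim1 : Tendsto (fun k => ∫ x, inner ℝ (regFlux α (mol k W x))
      (classicalGrad (partialDeriv s ζ) x)) atTop
      (𝓝 (∫ x, inner ℝ (regFlux α (W x)) (classicalGrad (partialDeriv s ζ) x))) := by
    refine tendsto_integral_of_le_mol h.energy_integrable
      (hg'L.integrable_norm_pow (p := 2) (by norm_num)) (C := hi ^ 2) (k₀ := 0) (fun k => ?_)
      (fun k _ x => ?_) ?_
    · exact ((hα.continuous_regFlux.comp (hmc k)).aestronglyMeasurable).inner hg'L.1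
    · have h1 := abs_real_inner_le_norm (regFlux α (mol k W x)) (classicalGrad (partialDeriv s ζ) x)
      have h2 := hα.norm_regFlux_le (mol k W x)
      have h3 := (norm_sq_le_energy (mol k W) (fun s => mol k (D s)) x).trans (h.energy_mol_le k x)
      have h4 := pow_le_pow_left₀ (norm_nonneg _) h2 2
      have h5 : hi ^ 2 * ‖mol k W x‖ ^ 2 ≤ hi ^ 2 * mol k (energy W D) x := by gcongr
      have h6 := sq_nonneg (‖regFlux α (mol k W x)‖ - ‖classicalGrad (partialDeriv s ζ) x‖)
      have h7 := sq_nonneg (‖regFlux α (mol k W x)‖)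
      have h8 := sq_nonneg (‖classicalGrad (partialDeriv s ζ) x‖)
      rw [mul_pow] at h4
      nlinarith
    · filter_upwards [h.mol_tendsto] with x hx
      exact ((hα.continuous_regFlux.tendsto _).comp hx.1).inner tendsto_const_nhds
  have lim2 : Tendsto (fun k => ∫ x, inner ℝ (regFluxDeriv α (mol k W x) (mol k (D s) x))
      (classicalGrad ζ x)) atTop
      (𝓝 (∫ x, inner ℝ (regFluxDeriv α (W x) (D s x)) (classicalGrad ζ x))) := by
    have hDc : ∀ k, Continuous (mol k (D s)) := fun k =>
      (PhiLaplace.mol_contDiff k (memLp_two_locallyIntegrable (h.memLp_deriv s))).continuous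
    refine tendsto_integral_of_le_mol h.energy_integrable
      (hgL.integrable_norm_pow (p := 2) (by norm_num)) (C := ((1 + M) * hi) ^ 2) (k₀ := 0)
      (fun k => ?_) (fun k _ x => ?_) ?_
    · exact ((hα.continuous_regFluxDeriv.comp ((hmc k).prodMk (hDc k))).aestronglyMeasurable).inner
        hgL.1
    · have h1 := abs_real_inner_le_norm (regFluxDeriv α (mol k W x) (mol k (D s) x))
        (classicalGrad ζ x)
      have h2 : ‖regFluxDeriv α (mol k W x) (mol k (D s) x)‖ ≤ (1 + M) * hi * ‖mol k (D s) x‖ := by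
        refine (hα.norm_regFluxDeriv_apply_le _ _).trans ?_
        have := hα.le_hi _ (sq_nonneg ‖mol k W x‖)
        gcongr
      have h3 := (norm_deriv_sq_le_energy (mol k W) (fun s => mol k (D s)) s x).trans
        (h.energy_mol_le k x)
      have h4 := pow_le_pow_left₀ (norm_nonneg _) h2 2
      have h5 : ((1 + M) * hi) ^ 2 * ‖mol k (D s) x‖ ^ 2
          ≤ ((1 + M) * hi) ^ 2 * mol k (energy W D) x := by gcongr
      have h6 := sq_nonneg (‖regFluxDeriv α (mol k W x) (mol k (D s) x)‖ - ‖classicalGrad ζ x‖)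
      have h7 := sq_nonneg (‖regFluxDeriv α (mol k W x) (mol k (D s) x)‖)
      have h8 := sq_nonneg (‖classicalGrad ζ x‖)
      rw [mul_pow] at h4
      nlinarith
    · filter_upwards [h.mol_tendsto] with x hx
      exact ((hα.continuous_regFluxDeriv.tendsto (W x, D s x)).comp
        (hx.1.prodMk_nhds (hx.2 s))).inner tendsto_const_nhds
  rw [h.weak_eq _ (hζ.partialDeriv s)] at lim1
  refine tendsto_nhds_unique lim2 ?_
  have lim3 := lim1.neg
  rw [neg_zero] at lim3
  -- On the support of ζ the derivative of `mol k W` equals `mol k (D s)` once the mollification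
  -- radius fits into B; off the support the gradient of ζ vanishes.
  refine lim3.congr' ?_
  filter_upwards [eventually_ge_atTop k₀] with k hk
  rw [← hparts k]
  congr 1; ext x
  by_cases hx : x ∈ tsupport ζ
  · rw [h.partialDeriv_mol ((hk₀ k hk).2 x hx)]
  · have : classicalGrad ζ x = 0 :=
      image_eq_zero_of_notMem_tsupport fun h' => hx (tsupport_classicalGrad_subset ζ h')
    rw [this, inner_zero_right, inner_zero_right]

end IsRegularField

theorem mol_coord {ι : Type*} [Fintype ι] (k : ℕ) {f : Vec n → EuclideanSpace ℝ ι}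
    (hf : LocallyIntegrable f) (x : Vec n) (i : ι) :
    mol k f x i = mol k (fun y => f y i) x := by
  have := (EuclideanSpace.proj (𝕜 := ℝ) i).integral_comp_comm (mol_integrand_integrable k hf x)
  simpa [mol] using this.symm

theorem classicalGrad_mol_of_contDiff (k : ℕ) {ζ : Vec n → Vec N} (hζ : ContDiff ℝ 1 ζ)
    (hζc : HasCompactSupport ζ) (x : Vec n) :
    classicalGrad (mol k ζ) x = mol k (classicalGrad ζ) x := by
  ext q
  rw [mol_coord k (classicalGrad_continuous hζ).locallyIntegrable, classicalGrad_apply,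
    partialDeriv_mol_of_contDiff k hζ hζc,
    mol_coord k (partialDeriv_continuous hζ q.1).locallyIntegrable]
  rfl

theorem isTestFunction_mol {F : Type*} [NormedAddCommGroup F] [NormedSpace ℝ F] {k : ℕ}
    {B : Set (Vec n)} {ζ : Vec n → F} (hζ : Continuous ζ) (hζc : HasCompactSupport ζ)
    (hk : Metric.cthickening (1 / ((k : ℝ) + 1)) (tsupport ζ) ⊆ B) :
    IsTestFunction B (mol k ζ) :=
  ⟨mol_contDiff k hζ.locallyIntegrable, mol_hasCompactSupport k hζc,
    (tsupport_mol_subset k ζ).trans hk⟩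

/-- Smooth test functions may be replaced by `C¹` ones. -/
theorem integral_inner_classicalGrad_eq_zero {B : Set (Vec n)} (hB : IsOpen B)
    {F : Vec n → Mat n N} (hF : LocallyIntegrable F)
    (h : ∀ ζ : Vec n → Vec N, IsTestFunction B ζ → ∫ x, inner ℝ (F x) (classicalGrad ζ x) = 0)
    {ζ : Vec n → Vec N} (hζ : ContDiff ℝ 1 ζ) (hζc : HasCompactSupport ζ) (hζB : tsupport ζ ⊆ B) :
    ∫ x, inner ℝ (F x) (classicalGrad ζ x) = 0 := by
  obtain ⟨k₀, hk₀⟩ := exists_closedBall_subset hζc.isCompact hB hζB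
  have hgc := classicalGrad_continuous hζ
  have hgs := hasCompactSupport_classicalGrad hζc
  obtain ⟨C, hC⟩ := hgs.exists_bound_of_continuous hgc
  set K := Metric.cthickening 1 (tsupport ζ) with hK
  have hKc : IsCompact K := hζc.isCompact.cthickening
  have hmb : ∀ k x, ‖mol k (classicalGrad ζ) x‖ ≤ C := fun k x => by
    refine (norm_mol_le k _ x).trans ?_
    refine (mol_mono k hgc.norm.locallyIntegrable continuous_const.locallyIntegrable hC x).trans
      (le_of_eq ?_)
    simp only [mol, smul_eq_mul]
    rw [integral_mul_const, integral_mker_sub, one_mul]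
  have hm0 : ∀ k x, x ∉ K → mol k (classicalGrad ζ) x = 0 := fun k x hx => by
    refine image_eq_zero_of_notMem_tsupport fun h' => hx ?_
    refine Metric.cthickening_mono ?_ _ (tsupport_mol_subset k _ h') |> fun h'' =>
      Metric.cthickening_subset_of_subset 1 (tsupport_classicalGrad_subset ζ) h''
    rw [div_le_one (by positivity)]
    linarith [(Nat.cast_nonneg k : (0 : ℝ) ≤ k)]
  have hlim : Tendsto (fun k => ∫ x, inner ℝ (F x) (mol k (classicalGrad ζ) x)) atTop
      (𝓝 (∫ x, inner ℝ (F x) (classicalGrad ζ x))) := by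
    refine tendsto_integral_of_dominated_convergence (K.indicator fun x => ‖F x‖ * C) (fun k => ?_)
      ?_ (fun k => Eventually.of_forall fun x => ?_) ?_
    · exact hF.aestronglyMeasurable.inner
        (mol_contDiff k hgc.locallyIntegrable).continuous.aestronglyMeasurable
    · rw [integrable_indicator_iff hKc.measurableSet]
      exact (hF.integrableOn_isCompact hKc).norm.mul_const _
    · by_cases hx : x ∈ K
      · rw [indicator_of_mem hx]
        exact (norm_inner_le_norm _ _).trans (mul_le_mul_of_nonneg_left (hmb k x) (norm_nonneg _))
      · rw [indicator_of_notMem hx, hm0 k x hx, inner_zero_right, norm_zero]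
    · filter_upwards [mol_tendsto_ae hgc.locallyIntegrable] with x hx
      exact tendsto_const_nhds.inner hx
  refine tendsto_nhds_unique hlim (tendsto_const_nhds.congr' ?_)
  filter_upwards [eventually_ge_atTop k₀] with k hk
  simp_rw [← classicalGrad_mol_of_contDiff k hζ hζc]
  exact (h _ (isTestFunction_mol hζ.continuous hζc (hk₀ k hk).1)).symm

end Caccioppoli


/-- A `C¹` nondecreasing cutoff function on `[0, ∞)`, with values in `[0, 1]`. -/
structure IsCutoff (γ : ℝ → ℝ) (C : ℝ) : Prop where
  contDiffOn : ∃ c, 0 < c ∧ ContDiffOn ℝ 1 γ (Ioi (-c))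
  nonneg : ∀ r, 0 ≤ r → 0 ≤ γ r
  le_one : ∀ r, 0 ≤ r → γ r ≤ 1
  deriv_nonneg : ∀ r, 0 ≤ r → 0 ≤ deriv γ r
  mul_deriv_le : ∀ r, 0 ≤ r → r * deriv γ r ≤ C

namespace IsCutoff

variable {γ : ℝ → ℝ} {C : ℝ} (hγ : IsCutoff γ C)
include hγ

theorem hasDerivAt {r : ℝ} (hr : 0 ≤ r) : HasDerivAt γ (deriv γ r) r := by
  obtain ⟨c, hc, h⟩ := hγ.contDiffOn
  exact ((h.contDiffAt (Ioi_mem_nhds (by linarith))).differentiableAt (by simp)).hasDerivAt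

theorem continuousAt_deriv {r : ℝ} (hr : 0 ≤ r) : ContinuousAt (deriv γ) r := by
  obtain ⟨c, hc, h⟩ := hγ.contDiffOn
  exact (h.continuousOn_deriv_of_isOpen isOpen_Ioi le_rfl).continuousAt
    (Ioi_mem_nhds (by linarith))

theorem contDiff_comp {E : Type*} [NormedAddCommGroup E] [NormedSpace ℝ E] {f : E → ℝ}
    (hf : ContDiff ℝ 1 f) (hf0 : ∀ x, 0 ≤ f x) : ContDiff ℝ 1 fun x => γ (f x) := by
  obtain ⟨c, hc, h⟩ := hγ.contDiffOn
  exact h.comp_contDiff hf fun x => lt_of_lt_of_le (by simpa using hc) (hf0 x)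

theorem continuous_comp {X : Type*} [TopologicalSpace X] {f : X → ℝ}
    (hf : Continuous f) (hf0 : ∀ x, 0 ≤ f x) : Continuous fun x => γ (f x) :=
  continuous_iff_continuousAt.2 fun x =>
    (hγ.hasDerivAt (hf0 x)).continuousAt.comp (f := f) hf.continuousAt

theorem continuous_deriv_comp {X : Type*} [TopologicalSpace X] {f : X → ℝ}
    (hf : Continuous f) (hf0 : ∀ x, 0 ≤ f x) : Continuous fun x => deriv γ (f x) :=
  continuous_iff_continuousAt.2 fun x =>
    (hγ.continuousAt_deriv (hf0 x)).comp (f := f) hf.continuousAt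

theorem const_nonneg : 0 ≤ C := by simpa using hγ.mul_deriv_le 0 le_rfl

end IsCutoff

/-! ### Admissibility of the nonlinear test function and the Caccioppoli inequality -/

section CaccioppoliInequality

variable {n N : ℕ}

/-- The `s`-th row of a matrix. -/
def row (s : Fin n) : Mat n N →L[ℝ] Vec N :=
  LinearMap.toContinuousLinearMap
    { toFun := fun W => WithLp.toLp 2 fun i => W (s, i)
      map_add' := fun _ _ => rfl
      map_smul' := fun _ _ => rfl }

theorem row_apply (s : Fin n) (W : Mat n N) (i : Fin N) : row s W i = W (s, i) := rfl

theorem sum_row_sq_le (s : Fin n) (P : Mat n N) : ∑ i, P (s, i) ^ 2 ≤ ‖P‖ ^ 2 := by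
  rw [EuclideanSpace.real_norm_sq_eq, Fintype.sum_prod_type]
  have h0 : ∀ j ∈ Finset.univ, 0 ≤ ∑ i, P (j, i) ^ 2 := fun j _ =>
    Finset.sum_nonneg fun i _ => sq_nonneg (P (j, i))
  exact Finset.single_le_sum h0 (Finset.mem_univ s)

theorem continuous_testGrad (s : Fin n) : Continuous
    fun p : (ℝ × ℝ × ℝ) × (Fin n → ℝ) × Mat n N × (Fin n → Mat n N) =>
      testGrad p.1.1 p.1.2.1 p.1.2.2 p.2.1 p.2.2.1 p.2.2.2 s := by
  have hW : Continuous fun p : (ℝ × ℝ × ℝ) × (Fin n → ℝ) × Mat n N × (Fin n → Mat n N) =>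
    row s p.2.2.1 := (row s).continuous.comp (by fun_prop)
  have hD : ∀ j, Continuous fun p : (ℝ × ℝ × ℝ) × (Fin n → ℝ) × Mat n N × (Fin n → Mat n N) =>
    p.2.2.2 j := fun j => by fun_prop
  have h1 : Continuous fun p : (ℝ × ℝ × ℝ) × (Fin n → ℝ) × Mat n N × (Fin n → Mat n N) =>
      (WithLp.toLp 2 fun q : Fin n × Fin N => p.2.2.2 q.1 (s, q.2) : Mat n N) :=
    (PiLp.continuous_toLp 2 _).comp (continuous_pi fun q =>
      (EuclideanSpace.proj (𝕜 := ℝ) (s, q.2)).continuous.comp (hD q.1))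
  have h2 := outer_continuous (p := fun p : (ℝ × ℝ × ℝ) × (Fin n → ℝ) × Mat n N ×
    (Fin n → Mat n N) => fun j => inner ℝ p.2.2.1 (p.2.2.2 j))
    (fun j => (by fun_prop : Continuous fun p : (ℝ × ℝ × ℝ) × (Fin n → ℝ) × Mat n N ×
    (Fin n → Mat n N) => p.2.2.1).inner (hD j)) hW
  have h3 := outer_continuous (p := fun p : (ℝ × ℝ × ℝ) × (Fin n → ℝ) × Mat n N ×
    (Fin n → Mat n N) => p.2.1) (fun j => by fun_prop) hW
  have e1 : Continuous fun p : (ℝ × ℝ × ℝ) × (Fin n → ℝ) × Mat n N × (Fin n → Mat n N) =>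
    p.1.1 ^ 2 * p.1.2.1 := by fun_prop
  have e2 : Continuous fun p : (ℝ × ℝ × ℝ) × (Fin n → ℝ) × Mat n N × (Fin n → Mat n N) =>
    2 * p.1.1 ^ 2 * p.1.2.2 := by fun_prop
  have e3 : Continuous fun p : (ℝ × ℝ × ℝ) × (Fin n → ℝ) × Mat n N × (Fin n → Mat n N) =>
    2 * p.1.1 * p.1.2.1 := by fun_prop
  exact ((e1.smul h1).add (e2.smul h2)).add (e3.smul h3)

/-- The g' term is quadratic in W and linear in D, so it is not square integrable for general W. The
bound |W|²g' ≤ C on the cutoff makes it linear in D, which is why `IsCutoff` contains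
`mul_deriv_le`. -/
theorem norm_testGrad_sq_le {η g g' C E : ℝ} {e : Fin n → ℝ} {W : Mat n N}
    {D : Fin n → Mat n N} (hη : |η| ≤ 1) (hg : 0 ≤ g) (hg1 : g ≤ 1) (hg' : 0 ≤ g')
    (hC : ‖W‖ ^ 2 * g' ≤ C) (hE : ∑ j, e j ^ 2 ≤ E) (s : Fin n) :
    ‖testGrad η g g' e W D s‖ ^ 2
      ≤ (3 + 12 * C ^ 2 + 12 * E) * (‖W‖ ^ 2 + ∑ j, ‖D j‖ ^ 2) := by
  have hη2 : η ^ 2 ≤ 1 := by rw [← sq_abs]; exact pow_le_one₀ (abs_nonneg _) hη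
  have hW : ‖row s W‖ ^ 2 ≤ ‖W‖ ^ 2 := by
    rw [EuclideanSpace.real_norm_sq_eq (row s W)]
    exact sum_row_sq_le s W
  obtain ⟨T, hT⟩ : ∃ T, T = ∑ j, ‖D j‖ ^ 2 := ⟨_, rfl⟩
  have hT0 : 0 ≤ T := hT ▸ Finset.sum_nonneg fun _ _ => sq_nonneg _
  rw [← hT]
  have hE0 : 0 ≤ E := le_trans (Finset.sum_nonneg fun _ _ => sq_nonneg _) hE
  have h1 : ‖(WithLp.toLp 2 fun q : Fin n × Fin N => D q.1 (s, q.2) : Mat n N)‖ ^ 2 ≤ T := by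
    rw [EuclideanSpace.real_norm_sq_eq, Fintype.sum_prod_type, hT]
    exact Finset.sum_le_sum fun j _ => sum_row_sq_le s (D j)
  have h2 : ‖rowTensor (fun j => inner ℝ W (D j)) W s‖ ^ 2 ≤ ‖W‖ ^ 2 * T * ‖W‖ ^ 2 := by
    rw [show rowTensor (fun j => inner ℝ W (D j)) W s
      = outer (fun j => inner ℝ W (D j)) (row s W) from rfl, norm_outer_sq]
    have h0 : ∑ j, inner ℝ W (D j) ^ 2 ≤ ‖W‖ ^ 2 * T := by
      rw [hT, Finset.mul_sum]
      refine Finset.sum_le_sum fun j _ => ?_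
      have h0 := pow_le_pow_left₀ (abs_nonneg (inner ℝ W (D j))) (abs_real_inner_le_norm W (D j)) 2
      rwa [sq_abs, mul_pow] at h0
    exact mul_le_mul h0 hW (sq_nonneg ‖row s W‖) (mul_nonneg (sq_nonneg ‖W‖) hT0)
  have h3 : ‖rowTensor e W s‖ ^ 2 ≤ E * ‖W‖ ^ 2 := by
    rw [show rowTensor e W s = outer e (row s W) from rfl, norm_outer_sq]
    exact mul_le_mul hE hW (sq_nonneg ‖row s W‖) hE0
  set a : Mat n N := WithLp.toLp 2 fun q : Fin n × Fin N => D q.1 (s, q.2)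
  set b := rowTensor (fun j => inner ℝ W (D j)) W s
  set c := rowTensor e W s
  have k1 : ‖(η ^ 2 * g) • a‖ ^ 2 ≤ T := by
    rw [norm_smul, mul_pow, Real.norm_eq_abs, sq_abs]
    have : (η ^ 2 * g) ^ 2 ≤ 1 := pow_le_one₀ (by positivity) (mul_le_one₀ hη2 hg hg1)
    calc _ ≤ 1 * T := mul_le_mul this h1 (sq_nonneg ‖a‖) zero_le_one
      _ = T := one_mul _
  have k2 : ‖(2 * η ^ 2 * g') • b‖ ^ 2 ≤ 4 * C ^ 2 * T := by
    rw [norm_smul, mul_pow, Real.norm_eq_abs, sq_abs]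
    have e4 : (η ^ 2) ^ 2 ≤ 1 := pow_le_one₀ (sq_nonneg _) hη2
    have : (‖W‖ ^ 2 * g') ^ 2 ≤ C ^ 2 := pow_le_pow_left₀ (by positivity) hC 2
    calc (2 * η ^ 2 * g') ^ 2 * ‖b‖ ^ 2
        ≤ (2 * η ^ 2 * g') ^ 2 * (‖W‖ ^ 2 * T * ‖W‖ ^ 2) := by gcongr
      _ = 4 * ((η ^ 2) ^ 2 * (‖W‖ ^ 2 * g') ^ 2) * T := by ring
      _ ≤ 4 * (1 * C ^ 2) * T := by gcongr
      _ = _ := by ring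
  have k3 : ‖(2 * η * g) • c‖ ^ 2 ≤ 4 * E * ‖W‖ ^ 2 := by
    rw [norm_smul, mul_pow, Real.norm_eq_abs, sq_abs]
    have e4 : g ^ 2 ≤ 1 := pow_le_one₀ hg hg1
    calc (2 * η * g) ^ 2 * ‖c‖ ^ 2 ≤ (2 * η * g) ^ 2 * (E * ‖W‖ ^ 2) := by gcongr
      _ = 4 * (η ^ 2 * g ^ 2) * (E * ‖W‖ ^ 2) := by ring
      _ ≤ 4 * (1 * 1) * (E * ‖W‖ ^ 2) := by gcongr
      _ = _ := by ring
  have k4 : ‖testGrad η g g' e W D s‖ ^ 2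
      ≤ 3 * (‖(η ^ 2 * g) • a‖ ^ 2 + ‖(2 * η ^ 2 * g') • b‖ ^ 2 + ‖(2 * η * g) • c‖ ^ 2) := by
    have h4 : ‖testGrad η g g' e W D s‖
        ≤ ‖(η ^ 2 * g) • a‖ + ‖(2 * η ^ 2 * g') • b‖ + ‖(2 * η * g) • c‖ := norm_add₃_le
    have h5 := pow_le_pow_left₀ (norm_nonneg _) h4 2
    set x := ‖(η ^ 2 * g) • a‖
    set y := ‖(2 * η ^ 2 * g') • b‖
    set z := ‖(2 * η * g) • c‖
    nlinarith [sq_nonneg (x - y), sq_nonneg (y - z), sq_nonneg (x - z)]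
  have k5 : 0 ≤ C ^ 2 * ‖W‖ ^ 2 := by positivity
  have k6 : 0 ≤ E * T := by positivity
  nlinarith [sq_nonneg ‖W‖]

theorem classicalGrad_cutoff_mul_row {γ : ℝ → ℝ} {C : ℝ} (hγ : IsCutoff γ C) {η : Vec n → ℝ}
    (hη : ContDiff ℝ 1 η) {V : Vec n → Mat n N} (hV : ContDiff ℝ 1 V) (s : Fin n) (x : Vec n) :
    classicalGrad (fun y => (η y ^ 2 * γ (‖V y‖ ^ 2)) • row s (V y)) x
      = testGrad (η x) (γ (‖V x‖ ^ 2)) (deriv γ (‖V x‖ ^ 2)) (fun j => partialDeriv j η x) (V x)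
        (fun j => partialDeriv j V x) s := by
  have hηd := hη.differentiable (by simp)
  have hVd := hV.differentiable (by simp)
  have hg : ContDiff ℝ 1 fun y => γ (‖V y‖ ^ 2) := hγ.contDiff_comp (hV.norm_sq ℝ) fun y => sq_nonneg _
  have hgd := hg.differentiable (by simp)
  have hrow : Differentiable ℝ fun y => row s (V y) := (row s).differentiable.comp hVd
  have p1 : ∀ j, partialDeriv j (fun y => γ (‖V y‖ ^ 2)) x
      = deriv γ (‖V x‖ ^ 2) * (2 * inner ℝ (V x) (partialDeriv j V x)) := fun j => by
    have h1 := (hγ.hasDerivAt (sq_nonneg ‖V x‖)).comp_hasFDerivAt x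
      (f := fun y => ‖V y‖ ^ 2) (hVd x).hasFDerivAt.norm_sq
    have h2 := partialDeriv_eq_of_hasFDerivAt h1 j
    refine h2.trans ?_
    simp [partialDeriv]
  have p2 : ∀ j, partialDeriv j (fun y => η y ^ 2 * γ (‖V y‖ ^ 2)) x
      = 2 * η x ^ 2 * deriv γ (‖V x‖ ^ 2) * inner ℝ (V x) (partialDeriv j V x)
        + 2 * η x * γ (‖V x‖ ^ 2) * partialDeriv j η x := fun j => by
    have := partialDeriv_smul (c := fun y => η y ^ 2) (f := fun y => γ (‖V y‖ ^ 2))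
      (hηd.pow 2) hgd j x
    simp only [smul_eq_mul] at this
    rw [this, p1, partialDeriv_sq hηd]
    ring
  rw [classicalGrad_smul (c := fun y => η y ^ 2 * γ (‖V y‖ ^ 2)) ((hηd.pow 2).mul hgd) hrow]
  ext q
  have p3 : partialDeriv q.1 (fun y => row s (V y)) x q.2 = partialDeriv q.1 V x (s, q.2) := by
    rw [partialDeriv_clm_comp (row s) hVd]; rfl
  simp only [testGrad, PiLp.add_apply, PiLp.smul_apply, smul_eq_mul, outer_apply, rowTensor_apply,
    classicalGrad_apply, p2, p3, row_apply]
  ring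

namespace IsRegularField

variable {α γ : ℝ → ℝ} {lo hi m M C : ℝ} {B : Set (Vec n)} {W : Vec n → Mat n N}
  {D : Fin n → Vec n → Mat n N}

/-- The test function `η² γ(|W|²) W_s` is admissible in the linearised equation. -/
theorem integral_inner_testGrad (hα : RegCoef α lo hi m M) (h : IsRegularField α B W D)
    (hγ : IsCutoff γ C) {η : Vec n → ℝ} (hη : ContDiff ℝ 1 η) (hηc : HasCompactSupport η)
    (hηB : tsupport η ⊆ B) (hη1 : ∀ x, |η x| ≤ 1) (s : Fin n) :
    Integrable (fun x => inner ℝ (regFluxDeriv α (W x) (D s x))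
      (testGrad (η x) (γ (‖W x‖ ^ 2)) (deriv γ (‖W x‖ ^ 2)) (fun j => partialDeriv j η x) (W x)
        (fun j => D j x) s)) ∧
    ∫ x, inner ℝ (regFluxDeriv α (W x) (D s x))
      (testGrad (η x) (γ (‖W x‖ ^ 2)) (deriv γ (‖W x‖ ^ 2)) (fun j => partialDeriv j η x) (W x)
        (fun j => D j x) s) = 0 := by
  obtain ⟨k₀, hk₀⟩ := exists_closedBall_subset hηc.isCompact h.isOpen hηB
  obtain ⟨E, hE0, hE⟩ := exists_bound_sum_partialDeriv_sq hη hηc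
  have hA := h.memLp_linearised hα s
  have hA2 : Integrable fun x => ‖regFluxDeriv α (W x) (D s x)‖ ^ 2 :=
    hA.integrable_norm_pow (p := 2) (by norm_num)
  obtain ⟨Φ, hΦ'⟩ : ∃ Φ : Vec n × Mat n N × (Fin n → Mat n N) → Mat n N, ∀ p, Φ p =
      testGrad (η p.1) (γ (‖p.2.1‖ ^ 2)) (deriv γ (‖p.2.1‖ ^ 2)) (fun j => partialDeriv j η p.1)
        p.2.1 p.2.2 s := ⟨_, fun _ => rfl⟩
  have hg : Continuous fun P : Mat n N => γ (‖P‖ ^ 2) :=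
    hγ.continuous_comp (by fun_prop) fun x => sq_nonneg _
  have hg' : Continuous fun P : Mat n N => deriv γ (‖P‖ ^ 2) :=
    hγ.continuous_deriv_comp (by fun_prop) fun x => sq_nonneg _
  have hΦ : Continuous Φ := by
    rw [funext hΦ']
    have c1 : Continuous fun p : Vec n × Mat n N × (Fin n → Mat n N) => η p.1 :=
      hη.continuous.comp continuous_fst
    have c2 : Continuous fun p : Vec n × Mat n N × (Fin n → Mat n N) => p.2.1 := by fun_prop
    have c3 : Continuous fun p : Vec n × Mat n N × (Fin n → Mat n N) =>
        fun j => partialDeriv j η p.1 :=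
      continuous_pi fun j => (partialDeriv_continuous hη j).comp continuous_fst
    exact Continuous.comp (f := fun p : Vec n × Mat n N × (Fin n → Mat n N) =>
      ((η p.1, γ (‖p.2.1‖ ^ 2), deriv γ (‖p.2.1‖ ^ 2)), (fun j => partialDeriv j η p.1), p.2))
      (continuous_testGrad (N := N) s)
      ((c1.prodMk ((hg.comp c2).prodMk (hg'.comp c2))).prodMk (c3.prodMk continuous_snd))
  have hΦW : ∀ x, testGrad (η x) (γ (‖W x‖ ^ 2)) (deriv γ (‖W x‖ ^ 2))
      (fun j => partialDeriv j η x) (W x) (fun j => D j x) s = Φ (x, W x, fun j => D j x) :=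
    fun x => (hΦ' (x, W x, fun j => D j x)).symm
  simp_rw [hΦW]
  obtain ⟨T, hT⟩ : ∃ T : (Vec n → Mat n N) → (Fin n → Vec n → Mat n N) → Vec n → Mat n N,
      T = fun V Z x => Φ (x, V x, fun j => Z j x) := ⟨_, rfl⟩
  have hTle : ∀ V Z x, ‖T V Z x‖ ^ 2 ≤ (3 + 12 * C ^ 2 + 12 * E) * energy V Z x := fun V Z x => by
    rw [hT]
    simp only [hΦ']
    have h0 := sq_nonneg ‖V x‖
    exact norm_testGrad_sq_le (D := fun j => Z j x) (hη1 x) (hγ.nonneg _ h0) (hγ.le_one _ h0)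
      (hγ.deriv_nonneg _ h0) (hγ.mul_deriv_le _ h0) (hE x) s
  have hTm : ∀ V Z, AEStronglyMeasurable V volume → (∀ j, AEStronglyMeasurable (Z j) volume) →
      AEStronglyMeasurable (T V Z) volume := fun V Z hV hZ => by
    have hZ' : AEStronglyMeasurable (fun x j => Z j x) volume :=
      (aemeasurable_pi_lambda _ fun j => (hZ j).aemeasurable).aestronglyMeasurable
    rw [hT]
    exact hΦ.comp_aestronglyMeasurable (f := fun x => (x, V x, fun j => Z j x))
      (aestronglyMeasurable_id.prodMk (hV.prodMk hZ'))
  have hbound : ∀ (V : Vec n → Mat n N) Z x, |inner ℝ (regFluxDeriv α (W x) (D s x)) (T V Z x)|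
      ≤ (3 + 12 * C ^ 2 + 12 * E) * energy V Z x + ‖regFluxDeriv α (W x) (D s x)‖ ^ 2 := by
    intro V Z x
    have h1 := abs_real_inner_le_norm (regFluxDeriv α (W x) (D s x)) (T V Z x)
    have h2 := hTle V Z x
    nlinarith [sq_nonneg (‖regFluxDeriv α (W x) (D s x)‖ - ‖T V Z x‖),
      sq_nonneg ‖regFluxDeriv α (W x) (D s x)‖, sq_nonneg ‖T V Z x‖]
  have hint : Integrable fun x => inner ℝ (regFluxDeriv α (W x) (D s x)) (T W D x) :=
    ((h.energy_integrable.const_mul (3 + 12 * C ^ 2 + 12 * E)).add hA2).mono'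
      (hA.1.inner (hTm W D h.memLp.1 fun j => (h.memLp_deriv j).1))
      (Eventually.of_forall fun x => hbound W D x)
  have hTW : T W D = fun x => Φ (x, W x, fun j => D j x) := by rw [hT]
  rw [hTW] at hint
  refine ⟨hint, ?_⟩
  have hVc : ∀ k, Continuous (mol k W) := fun k => (h.mol_contDiff k).continuous
  have hDc : ∀ k j, Continuous (mol k (D j)) := fun k j =>
    (PhiLaplace.mol_contDiff k (memLp_two_locallyIntegrable (h.memLp_deriv j))).continuous
  have hlim : Tendsto (fun k => ∫ x, inner ℝ (regFluxDeriv α (W x) (D s x))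
      (T (mol k W) (fun j => mol k (D j)) x)) atTop
      (𝓝 (∫ x, inner ℝ (regFluxDeriv α (W x) (D s x)) (Φ (x, W x, fun j => D j x)))) := by
    refine tendsto_integral_of_le_mol h.energy_integrable hA2 (C := 3 + 12 * C ^ 2 + 12 * E)
      (k₀ := 0) (fun k => ?_) (fun k _ x => ?_) ?_
    · exact hA.1.inner (hTm _ _ (hVc k).aestronglyMeasurable
        fun j => (hDc k j).aestronglyMeasurable)
    · refine (hbound _ _ x).trans ?_
      have := h.energy_mol_le k x
      gcongr
    · filter_upwards [h.mol_tendsto] with x hx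
      refine tendsto_const_nhds.inner ?_
      rw [hT]
      exact (hΦ.tendsto (x, W x, fun j => D j x)).comp
        (tendsto_const_nhds.prodMk_nhds (hx.1.prodMk_nhds (tendsto_pi_nhds.2 hx.2)))
  refine tendsto_nhds_unique hlim (tendsto_const_nhds.congr' ?_)
  filter_upwards [eventually_ge_atTop k₀] with k hk
  have hV1 : ContDiff ℝ 1 (mol k W) := (h.mol_contDiff k).of_le (by simp)
  have hs0 : Function.support (fun y => (η y ^ 2 * γ (‖mol k W y‖ ^ 2)) • row s (mol k W y))
      ⊆ Function.support η := fun y hy => by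
    rw [Function.mem_support] at hy ⊢
    exact fun h0 => hy (by rw [h0]; simp)
  -- For the mollified field the test function is C¹ with compact support in B, hence admissible,
  -- and its classical gradient is the expression whose limit was computed. The coefficient is kept
  -- at the original W, so only one factor varies with k.
  have key := integral_inner_classicalGrad_eq_zero h.isOpen (memLp_two_locallyIntegrable hA)
    (fun ζ hζ => h.linearised_eq hα s hζ)
    (ζ := fun y => (η y ^ 2 * γ (‖mol k W y‖ ^ 2)) • row s (mol k W y))
    (((hη.pow 2).mul (hγ.contDiff_comp (hV1.norm_sq ℝ) fun y => sq_nonneg _)).smul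
      ((row s).contDiff.comp hV1)) (hηc.mono hs0) ((closure_mono hs0).trans hηB)
  rw [← key]
  congr 1; ext x
  rw [classicalGrad_cutoff_mul_row hγ hη hV1]
  by_cases hx : x ∈ tsupport η
  · have : ∀ j, PhiLaplace.partialDeriv j (mol k W) x = mol k (D j) x :=
      fun j => h.partialDeriv_mol ((hk₀ k hk).2 x hx) j
    simp_rw [this, hT, hΦ']
  · have e1 : η x = 0 := image_eq_zero_of_notMem_tsupport hx
    simp [hT, hΦ', testGrad, e1]

/-- The Caccioppoli inequality for the derivatives of the field. -/
theorem caccioppoli (hα : RegCoef α lo hi m M) (h : IsRegularField α B W D)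
    (hγ : IsCutoff γ C) {η : Vec n → ℝ} (hη : ContDiff ℝ 1 η) (hηc : HasCompactSupport η)
    (hηB : tsupport η ⊆ B) (hη1 : ∀ x, |η x| ≤ 1) :
    Integrable (fun x => η x ^ 2 * γ (‖W x‖ ^ 2) * α (‖W x‖ ^ 2) * ∑ s, ‖D s x‖ ^ 2) ∧
    Integrable (fun x => γ (‖W x‖ ^ 2) * α (‖W x‖ ^ 2) * ‖W x‖ ^ 2 *
      ∑ j, PhiLaplace.partialDeriv j η x ^ 2) ∧
    ∫ x, η x ^ 2 * γ (‖W x‖ ^ 2) * α (‖W x‖ ^ 2) * ∑ s, ‖D s x‖ ^ 2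
      ≤ (2 * (1 + M) / m) ^ 2 * ∫ x, γ (‖W x‖ ^ 2) * α (‖W x‖ ^ 2) * ‖W x‖ ^ 2 *
        ∑ j, PhiLaplace.partialDeriv j η x ^ 2 := by
  obtain ⟨E, hE0, hE⟩ := exists_bound_sum_partialDeriv_sq hη hηc
  have hm := hα.m_pos
  have hhi := hα.hi_pos
  have hWm := h.memLp.1
  have hg : Continuous fun P : Mat n N => γ (‖P‖ ^ 2) :=
    hγ.continuous_comp (by fun_prop) fun x => sq_nonneg _
  have ha : Continuous fun P : Mat n N => α (‖P‖ ^ 2) :=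
    hα.continuous_comp (by fun_prop) fun x => sq_nonneg _
  have hgW : AEStronglyMeasurable (fun x => γ (‖W x‖ ^ 2)) volume :=
    hg.comp_aestronglyMeasurable hWm
  have haW : AEStronglyMeasurable (fun x => α (‖W x‖ ^ 2)) volume :=
    ha.comp_aestronglyMeasurable hWm
  have hDs : Integrable fun x => ∑ s, ‖D s x‖ ^ 2 :=
    integrable_finsetSum _ fun s _ => (h.memLp_deriv s).integrable_norm_pow (p := 2) (by norm_num)
  have hW2 : Integrable fun x => ‖W x‖ ^ 2 := h.memLp.integrable_norm_pow (p := 2) (by norm_num)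
  have hpd : AEStronglyMeasurable (fun x => ∑ j, PhiLaplace.partialDeriv j η x ^ 2) volume :=
    (continuous_finsetSum _ fun j _ =>
      (partialDeriv_continuous hη j).pow 2).aestronglyMeasurable
  have i1 : Integrable fun x => η x ^ 2 * γ (‖W x‖ ^ 2) * α (‖W x‖ ^ 2) * ∑ s, ‖D s x‖ ^ 2 := by
    refine (hDs.const_mul hi).mono' ((((hη.continuous.pow 2).aestronglyMeasurable.mul hgW).mul
      haW).mul hDs.1) (Eventually.of_forall fun x => ?_)
    have h0 : 0 ≤ ∑ s, ‖D s x‖ ^ 2 := Finset.sum_nonneg fun _ _ => sq_nonneg _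
    have h1 := hγ.nonneg _ (sq_nonneg ‖W x‖)
    have h2 := hγ.le_one _ (sq_nonneg ‖W x‖)
    have h3 := (hα.pos (sq_nonneg ‖W x‖)).le
    have h4 := hα.le_hi _ (sq_nonneg ‖W x‖)
    have h5 : η x ^ 2 ≤ 1 := by rw [← sq_abs]; exact pow_le_one₀ (abs_nonneg _) (hη1 x)
    rw [Real.norm_eq_abs, abs_of_nonneg (by positivity)]
    calc _ ≤ 1 * 1 * hi * ∑ s, ‖D s x‖ ^ 2 := by gcongr
      _ = _ := by ring
  have i2 : Integrable fun x => γ (‖W x‖ ^ 2) * α (‖W x‖ ^ 2) * ‖W x‖ ^ 2 *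
      ∑ j, PhiLaplace.partialDeriv j η x ^ 2 := by
    refine (hW2.const_mul (hi * E)).mono' (((hgW.mul haW).mul hW2.1).mul hpd)
      (Eventually.of_forall fun x => ?_)
    have h0 : 0 ≤ ∑ j, PhiLaplace.partialDeriv j η x ^ 2 :=
      Finset.sum_nonneg fun _ _ => sq_nonneg _
    have h1 := hγ.nonneg _ (sq_nonneg ‖W x‖)
    have h2 := hγ.le_one _ (sq_nonneg ‖W x‖)
    have h3 := (hα.pos (sq_nonneg ‖W x‖)).le
    have h4 := hα.le_hi _ (sq_nonneg ‖W x‖)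
    rw [Real.norm_eq_abs, abs_of_nonneg (by positivity)]
    calc _ ≤ 1 * hi * ‖W x‖ ^ 2 * E := by gcongr; exact hE x
      _ = _ := by ring
  refine ⟨i1, i2, ?_⟩
  have i3 := fun s => h.integral_inner_testGrad hα hγ hη hηc hηB hη1 s
  have i4 := integrable_finsetSum Finset.univ fun s _ => (i3 s).1
  -- The pointwise inequality is available only in B, where D is symmetric. Outside B both sides
  -- vanish together with η and its derivatives.
  have key := integral_mono_ae (μ := volume) ((i1.const_mul (m / 2)).sub
    (i2.const_mul (2 * (1 + M) ^ 2 / m))) i4 (by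
      filter_upwards [h.symm] with x hx
      by_cases hxB : x ∈ B
      · have := hα.le_sum_inner_testGrad (η := η x) (hγ.nonneg _ (sq_nonneg ‖W x‖))
          (hγ.deriv_nonneg _ (sq_nonneg ‖W x‖)) (fun j => PhiLaplace.partialDeriv j η x) (W x)
          (fun s => D s x) (hx hxB)
        exact this
      · have hxs : x ∉ tsupport η := fun h' => hxB (hηB h')
        have e1 : η x = 0 := image_eq_zero_of_notMem_tsupport hxs
        have e2 : ∀ j, PhiLaplace.partialDeriv j η x = 0 := fun j =>
          image_eq_zero_of_notMem_tsupport fun h' => hxs (tsupport_partialDeriv_subset η j h')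
        simp [testGrad, e1, e2])
  have e5 : ∫ x, ∑ s, inner ℝ (regFluxDeriv α (W x) (D s x))
      (testGrad (η x) (γ (‖W x‖ ^ 2)) (deriv γ (‖W x‖ ^ 2))
        (fun j => PhiLaplace.partialDeriv j η x) (W x) (fun j => D j x) s) = 0 := by
    rw [integral_finsetSum _ fun s _ => (i3 s).1]
    exact Finset.sum_eq_zero fun s _ => (i3 s).2
  rw [e5, integral_sub' (i1.const_mul (m / 2)) (i2.const_mul (2 * (1 + M) ^ 2 / m)),
    integral_const_mul, integral_const_mul] at key
  set I := ∫ x, η x ^ 2 * γ (‖W x‖ ^ 2) * α (‖W x‖ ^ 2) * ∑ s, ‖D s x‖ ^ 2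
  set J := ∫ x, γ (‖W x‖ ^ 2) * α (‖W x‖ ^ 2) * ‖W x‖ ^ 2 *
        ∑ j, PhiLaplace.partialDeriv j η x ^ 2
  -- The constant is (2(1+M)²/m)·(2/m): the Young weight divided by the surviving ellipticity m/2.
  have : (2 * (1 + M) / m) ^ 2 * J - I
      = -(m / 2 * I - 2 * (1 + M) ^ 2 / m * J) * (2 / m) := by
    field_simp; ring
  have h6 : 0 ≤ -(m / 2 * I - 2 * (1 + M) ^ 2 / m * J) * (2 / m) :=
    mul_nonneg (by linarith) (by positivity)
  linarith

end IsRegularField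

end CaccioppoliInequality

/-! ### A Sobolev inequality and cutoff functions -/

section Sobolev

variable {n : ℕ}

theorem norm_fderiv_le_sum_partialDeriv (f : Vec n → ℝ) (x : Vec n) :
    ‖fderiv ℝ f x‖ ≤ ∑ j, |partialDeriv j f x| := by
  refine ContinuousLinearMap.opNorm_le_bound _ (Finset.sum_nonneg fun _ _ => abs_nonneg _)
    fun h => ?_
  have hh : h = ∑ j, h j • EuclideanSpace.single j (1 : ℝ) := by
    ext i; simp [Finset.sum_apply, Pi.single_apply]
  have h1 : fderiv ℝ f x h = ∑ j, h j * partialDeriv j f x := by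
    conv_lhs => rw [hh]
    simp [map_sum, partialDeriv]
  rw [h1, Finset.sum_mul]
  refine (norm_sum_le _ _).trans (Finset.sum_le_sum fun j _ => ?_)
  rw [norm_mul, mul_comm, Real.norm_eq_abs, Real.norm_eq_abs]
  gcongr
  exact PiLp.norm_apply_le h j

/-- The fundamental theorem of calculus, transported to the line by the isometry between the
one-dimensional Euclidean space and ℝ. It supplies the case n = 1, where the exponent n/(n − 1) is
not finite. -/
theorem abs_le_integral_partialDeriv_of_dim_one {f : Vec 1 → ℝ} (hf : ContDiff ℝ 1 f)
    (hfc : HasCompactSupport f) (x : Vec 1) : |f x| ≤ ∫ y, |partialDeriv 0 f y| := by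
  let L : ℝ → Vec 1 := fun t => t • EuclideanSpace.single 0 1
  have hLc : ContDiff ℝ 1 L := by fun_prop
  have hL : ∀ y : Vec 1, L (y 0) = y := fun y => by
    ext i; fin_cases i; simp [L]
  have hd : ∀ t, HasDerivAt (fun s => f (L s)) (partialDeriv 0 f (L t)) t := fun t => by
    have h1 : HasDerivAt L (EuclideanSpace.single 0 1) t := by
      simpa using (hasDerivAt_id t).smul_const (EuclideanSpace.single (0 : Fin 1) (1 : ℝ))
    exact ((hf.differentiable (by simp)) (L t)).hasFDerivAt.comp_hasDerivAt t h1
  have hemb : Topology.IsClosedEmbedding L := by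
    refine Topology.IsClosedEmbedding.of_continuous_injective_isClosedMap hLc.continuous
      (fun s t h => ?_) ?_
    · simpa [L] using congrArg (fun y : Vec 1 => y 0) h
    · have : IsHomeomorph L := ⟨hLc.continuous, ?_, ?_⟩
      · exact this.isClosedMap
      · let e : Vec 1 ≃ₜ ℝ := ⟨⟨fun y => y 0, L, hL, fun t => by simp [L]⟩, by fun_prop,
          hLc.continuous⟩
        exact e.symm.isOpenMap
      · exact ⟨fun s t h => by simpa [L] using congrArg (fun y : Vec 1 => y 0) h,
          fun y => ⟨y 0, hL y⟩⟩
  have hgc : HasCompactSupport fun s => f (L s) := hfc.comp_isClosedEmbedding hemb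
  have hg : ContDiff ℝ 1 fun s => f (L s) := hf.comp hLc
  have hmp : MeasurePreserving (fun y : Vec 1 => y 0) volume volume :=
    (volume_preserving_funUnique (Fin 1) ℝ).comp (PiLp.volume_preserving_ofLp (Fin 1))
  have h0 := hgc.enorm_le_lintegral_Ici_deriv hg (x 0)
  have h1 : ‖f x‖ₑ ≤ ∫⁻ y, ‖partialDeriv 0 f y‖ₑ := by
    calc ‖f x‖ₑ = ‖f (L (x 0))‖ₑ := by rw [hL]
      _ ≤ ∫⁻ t in Iic (x 0), ‖deriv (fun s => f (L s)) t‖ₑ := h0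
      _ ≤ ∫⁻ t, ‖deriv (fun s => f (L s)) t‖ₑ := setLIntegral_le_lintegral _ _
      _ = ∫⁻ y : Vec 1, ‖deriv (fun s => f (L s)) (y 0)‖ₑ :=
        (hmp.lintegral_comp (by
          have := (hg.continuous_deriv le_rfl)
          fun_prop)).symm
      _ = ∫⁻ y, ‖partialDeriv 0 f y‖ₑ := by
        simp_rw [(hd _).deriv, hL]
  have hi : Integrable (partialDeriv 0 f) :=
    (partialDeriv_continuous hf 0).integrable_of_hasCompactSupport
      (hasCompactSupport_partialDeriv hfc 0)
  rw [← ofReal_norm, ← ofReal_integral_norm_eq_lintegral_enorm hi] at h1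
  simpa using (ENNReal.ofReal_le_ofReal_iff (integral_nonneg fun y => norm_nonneg _)).1 h1

/-- The Sobolev inequality combined with the Hölder inequality. -/
theorem exists_sobolev_const (hn : 0 < n) : ∃ C : ℝ, 0 < C ∧ ∀ f : Vec n → ℝ, ContDiff ℝ 1 f →
    HasCompactSupport f → ∀ S : Set (Vec n), volume S ≠ ⊤ →
      ∫ x in S, |f x| ≤ C * (volume.real S) ^ (1 / (n : ℝ)) * ∫ x, ∑ j, |partialDeriv j f x| := by
  have hpi : ∀ {f : Vec n → ℝ}, ContDiff ℝ 1 f → HasCompactSupport f →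
      Integrable fun x => ∑ j, |partialDeriv j f x| := fun hf hfc =>
    integrable_finsetSum _ fun j _ => ((partialDeriv_continuous hf j).integrable_of_hasCompactSupport
      (hasCompactSupport_partialDeriv hfc j)).norm
  -- For n > 1, Gagliardo–Nirenberg–Sobolev holds with p = n/(n − 1), and Hölder on S contributes
  -- |S|^(1 − 1/p) = |S|^(1/n). For n = 1 the sup bound gives |S| directly.
  rcases Nat.lt_or_ge 1 n with h1 | h1
  · have hn1 : (1 : ℝ) < n := by exact_mod_cast h1
    set p : NNReal := (Real.conjExponent (n : ℝ)).toNNReal with hp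
    have hc : Real.HolderConjugate (n : ℝ) (Real.conjExponent n) :=
      Real.HolderConjugate.conjExponent hn1
    have hpc : NNReal.HolderConjugate (Module.finrank ℝ (Vec n) : NNReal) p := by
      have := hc.toNNReal
      simpa using this
    have hp0 : (p : ℝ) = Real.conjExponent n := Real.coe_toNNReal _ hc.symm.nonneg
    set C₀ := eLpNormLESNormFDerivOneConst (volume : Measure (Vec n)) p
    refine ⟨C₀ + 1, by positivity, fun f hf hfc S hS => ?_⟩
    have k1 := eLpNorm_le_eLpNorm_fderiv_one (volume : Measure (Vec n)) hf hfc hpc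
    have hp1 : (1 : ENNReal) ≤ p := by
      have : (1 : ℝ) ≤ p := by rw [hp0]; exact hc.symm.lt.le
      exact_mod_cast this
    have k2 := eLpNorm_le_eLpNorm_mul_rpow_measure_univ (μ := volume.restrict S) hp1
      hf.continuous.aestronglyMeasurable
    have k3 : (1 : ℝ) / (1 : ENNReal).toReal - 1 / (p : ENNReal).toReal = 1 / n := by
      have := hc.inv_add_inv_eq_one
      simp only [ENNReal.toReal_one, ENNReal.coe_toReal, hp0, one_div]
      linarith
    rw [k3, Measure.restrict_apply_univ] at k2
    have k4 : eLpNorm f p (volume.restrict S) ≤ eLpNorm f p volume :=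
      eLpNorm_mono_measure f Measure.restrict_le_self
    have hfi : Integrable f := hf.continuous.integrable_of_hasCompactSupport hfc
    have hf'i : Integrable (fderiv ℝ f) :=
      (hf.continuous_fderiv (by simp)).integrable_of_hasCompactSupport (hfc.fderiv ℝ)
    have k5 : eLpNorm f 1 (volume.restrict S)
        ≤ C₀ * eLpNorm (fderiv ℝ f) 1 volume * volume S ^ (1 / (n : ℝ)) :=
      k2.trans (by gcongr; exact k4.trans k1)
    rw [eLpNorm_one_eq_lintegral_enorm, eLpNorm_one_eq_lintegral_enorm,
      ← ofReal_integral_norm_eq_lintegral_enorm hfi.integrableOn,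
      ← ofReal_integral_norm_eq_lintegral_enorm hf'i, ← ENNReal.ofReal_toReal hS,
      ENNReal.ofReal_rpow_of_nonneg ENNReal.toReal_nonneg (by positivity),
      ← ENNReal.ofReal_coe_nnreal, ← ENNReal.ofReal_mul (by positivity),
      ← ENNReal.ofReal_mul (by positivity), ENNReal.ofReal_le_ofReal_iff (by positivity)] at k5
    have k6 : ∫ x, ‖fderiv ℝ f x‖ ≤ ∫ x, ∑ j, |partialDeriv j f x| :=
      integral_mono hf'i.norm (hpi hf hfc) fun x => norm_fderiv_le_sum_partialDeriv f x
    have k7 : 0 ≤ ∫ x, ‖fderiv ℝ f x‖ := integral_nonneg fun x => norm_nonneg _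
    calc ∫ x in S, |f x| ≤ C₀ * (∫ x, ‖fderiv ℝ f x‖) * (volume S).toReal ^ (1 / (n : ℝ)) := k5
      _ ≤ (C₀ + 1) * (∫ x, ∑ j, |partialDeriv j f x|) * (volume S).toReal ^ (1 / (n : ℝ)) := by
          gcongr
          linarith
      _ = _ := by rw [Measure.real]; ring
  · obtain rfl : n = 1 := by omega
    refine ⟨1, one_pos, fun f hf hfc S hS => ?_⟩
    have k1 : ∀ x, |f x| ≤ ∫ y, ∑ j, |partialDeriv j f y| := fun x => by
      simpa using abs_le_integral_partialDeriv_of_dim_one hf hfc x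
    have hfi : Integrable f := hf.continuous.integrable_of_hasCompactSupport hfc
    calc ∫ x in S, |f x| ≤ ∫ x in S, ∫ y, ∑ j, |partialDeriv j f y| :=
          integral_mono hfi.norm.integrableOn (integrableOn_const hS) k1
      _ = _ := by simp

/-- The derivative of the smooth transition function is bounded. -/
theorem exists_deriv_smoothTransition_le : ∃ c : ℝ, 0 < c ∧ ∀ t,
    0 ≤ deriv Real.smoothTransition t ∧ deriv Real.smoothTransition t ≤ c ∧
      (t ∉ Icc (0 : ℝ) 1 → deriv Real.smoothTransition t = 0) := by
  have hc : Continuous (deriv Real.smoothTransition) :=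
    (Real.smoothTransition.contDiff (n := 1)).continuous_deriv le_rfl
  obtain ⟨c, hcb⟩ := isCompact_Icc.exists_bound_of_continuousOn (s := Icc (0 : ℝ) 1) hc.continuousOn
  have h0 : ∀ t, t ∉ Icc (0 : ℝ) 1 → deriv Real.smoothTransition t = 0 := fun t ht => by
    rw [mem_Icc, not_and_or, not_le, not_le] at ht
    rcases ht with ht | ht
    · have : Real.smoothTransition =ᶠ[𝓝 t] fun _ => 0 := by
        filter_upwards [Iio_mem_nhds ht] with s hs
        exact Real.smoothTransition.zero_of_nonpos (le_of_lt hs)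
      rw [this.deriv_eq]; simp
    · have : Real.smoothTransition =ᶠ[𝓝 t] fun _ => 1 := by
        filter_upwards [Ioi_mem_nhds ht] with s hs
        exact Real.smoothTransition.one_of_one_le (le_of_lt hs)
      rw [this.deriv_eq]; simp
  refine ⟨|c| + 1, by positivity, fun t => ⟨Real.smoothTransition.monotone.deriv_nonneg, ?_, h0 t⟩⟩
  by_cases ht : t ∈ Icc (0 : ℝ) 1
  · have := hcb t ht
    have h2 := le_abs_self (deriv Real.smoothTransition t)
    rw [Real.norm_eq_abs] at this
    have h3 := le_abs_self c
    linarith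
  · rw [h0 t ht]; positivity

/-- A cutoff function between concentric balls. -/
theorem exists_ball_cutoff : ∃ L : ℝ, 0 < L ∧ ∀ (n : ℕ) (x₀ : Vec n) (ρ σ : ℝ), 0 < ρ → ρ < σ →
    ∃ η : Vec n → ℝ, ContDiff ℝ 1 η ∧ HasCompactSupport η ∧ tsupport η ⊆ Metric.closedBall x₀ σ ∧
      (∀ x, 0 ≤ η x ∧ η x ≤ 1) ∧ (∀ x ∈ Metric.ball x₀ ρ, η x = 1) ∧
      (∀ x, x ∉ Metric.ball x₀ σ → η x = 0 ∧ ∀ j, partialDeriv j η x = 0) ∧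
      ∀ x, ∑ j, partialDeriv j η x ^ 2 ≤ (L / (σ - ρ)) ^ 2 := by
  obtain ⟨c, hc, hcb⟩ := exists_deriv_smoothTransition_le
  refine ⟨2 * c, by positivity, fun n x₀ ρ σ hρ hρσ => ?_⟩
  have hd : 0 < σ ^ 2 - ρ ^ 2 := by nlinarith
  -- The squared distance is smooth at the centre. The slope is still of order 1/(σ − ρ), because
  -- 2|x − x₀|/(σ² − ρ²) ≤ 2/(σ − ρ) on the ball of radius σ.
  set q : Vec n → ℝ := fun x => (σ ^ 2 - ‖x - x₀‖ ^ 2) / (σ ^ 2 - ρ ^ 2) with hq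
  have hqc : ContDiff ℝ 1 q := by
    refine ContDiff.div_const ?_ _
    exact contDiff_const.sub ((contDiff_id.sub contDiff_const).norm_sq ℝ)
  set η : Vec n → ℝ := fun x => Real.smoothTransition (q x) with hη
  have hηc : ContDiff ℝ 1 η := Real.smoothTransition.contDiff.comp hqc
  have hout : ∀ x, x ∉ Metric.ball x₀ σ → q x ≤ 0 := fun x hx => by
    rw [Metric.mem_ball, dist_eq_norm, not_lt] at hx
    refine div_nonpos_of_nonpos_of_nonneg ?_ hd.le
    have := pow_le_pow_left₀ (hρ.trans hρσ).le hx 2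
    linarith
  have hsupp : tsupport η ⊆ Metric.closedBall x₀ σ := by
    refine closure_minimal (fun x hx => ?_) Metric.isClosed_closedBall
    by_contra h'
    refine hx (Real.smoothTransition.zero_of_nonpos (hout x fun h'' => h' ?_))
    exact Metric.ball_subset_closedBall h''
  have hp : ∀ x j, partialDeriv j η x
      = deriv Real.smoothTransition (q x) * (-(2 * (x - x₀) j) / (σ ^ 2 - ρ ^ 2)) := by
    intro x j
    have h1 : HasFDerivAt (fun y : Vec n => ‖y - x₀‖ ^ 2) (2 • innerSL ℝ (x - x₀)) x := by
      have := ((hasFDerivAt_id x).sub_const x₀).norm_sq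
      simpa using this
    have h2 := (h1.const_sub (σ ^ 2)).mul_const (σ ^ 2 - ρ ^ 2)⁻¹
    have h3 := (((Real.smoothTransition.contDiff (n := 1)).differentiable (by simp))
      (q x)).hasDerivAt.comp_hasFDerivAt x (f := q) (by simpa [hq, div_eq_mul_inv] using h2)
    refine (partialDeriv_eq_of_hasFDerivAt (f := η) h3 j).trans ?_
    simp [EuclideanSpace.inner_single_right, div_eq_mul_inv]
    left; ring
  refine ⟨η, hηc, HasCompactSupport.of_support_subset_isCompact (isCompact_closedBall x₀ σ)
    (subset_tsupport _ |>.trans hsupp), hsupp,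
    fun x => ⟨Real.smoothTransition.nonneg _, Real.smoothTransition.le_one _⟩, fun x hx => ?_,
    fun x hx => ⟨Real.smoothTransition.zero_of_nonpos (hout x hx), fun j => ?_⟩, fun x => ?_⟩
  · refine Real.smoothTransition.one_of_one_le ?_
    rw [Metric.mem_ball, dist_eq_norm] at hx
    rw [hq, one_le_div hd]
    have := pow_le_pow_left₀ (norm_nonneg _) hx.le 2
    linarith
  -- Off the open ball η attains its minimum 0, so the gradient vanishes there, including on the
  -- boundary sphere.
  · have h0 : IsMinOn η univ x := fun y _ => by
      change η x ≤ η y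
      rw [show η x = 0 from Real.smoothTransition.zero_of_nonpos (hout x hx)]
      exact Real.smoothTransition.nonneg _
    have h1 := (h0.isLocalMin (univ_mem)).fderiv_eq_zero
    simp [partialDeriv, h1]
  · simp_rw [hp, mul_pow]
    rw [← Finset.mul_sum]
    have e1 : ∑ j, (-(2 * (x - x₀) j) / (σ ^ 2 - ρ ^ 2)) ^ 2
        = (2 * ‖x - x₀‖ / (σ ^ 2 - ρ ^ 2)) ^ 2 := by
      rw [div_pow, mul_pow, EuclideanSpace.real_norm_sq_eq, Finset.mul_sum, Finset.sum_div]
      exact Finset.sum_congr rfl fun j _ => by rw [div_pow]; ring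
    rw [e1, ← mul_pow]
    obtain ⟨hd0, hdc, hdz⟩ := hcb (q x)
    have hσρ : 0 < σ - ρ := by linarith
    by_cases hx : ‖x - x₀‖ ≤ σ
    · have e2 : 2 * ‖x - x₀‖ / (σ ^ 2 - ρ ^ 2) ≤ 2 / (σ - ρ) := by
        rw [div_le_div_iff₀ hd hσρ]
        nlinarith
      refine pow_le_pow_left₀ (by positivity) ?_ 2
      calc _ ≤ c * (2 / (σ - ρ)) := mul_le_mul hdc e2 (by positivity) hc.le
        _ = _ := by ring
    · have : q x ∉ Icc (0 : ℝ) 1 := fun h' => by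
        have h1 : q x < 0 := by
          refine div_neg_of_neg_of_pos ?_ hd
          have := pow_lt_pow_left₀ (not_le.1 hx) (hρ.trans hρσ).le two_ne_zero
          linarith
        exact absurd h'.1 (not_le.2 h1)
      rw [hdz this, zero_mul, zero_pow two_ne_zero]
      positivity

end Sobolev

/-! ### De Giorgi iteration -/

section DeGiorgi

variable {n N : ℕ}

theorem hasDerivAt_of_contDiffOn_Ioi {p : ℝ → ℝ} (hp : ∃ c, 0 < c ∧ ContDiffOn ℝ 1 p (Ioi (-c)))
    {r : ℝ} (hr : 0 ≤ r) : HasDerivAt p (deriv p r) r := by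
  obtain ⟨c, hc, h⟩ := hp
  exact ((h.contDiffAt (Ioi_mem_nhds (by linarith))).differentiableAt (by simp)).hasDerivAt

theorem contDiff_comp_of_contDiffOn_Ioi {p : ℝ → ℝ}
    (hp : ∃ c, 0 < c ∧ ContDiffOn ℝ 1 p (Ioi (-c))) {E : Type*} [NormedAddCommGroup E]
    [NormedSpace ℝ E] {f : E → ℝ} (hf : ContDiff ℝ 1 f) (hf0 : ∀ x, 0 ≤ f x) :
    ContDiff ℝ 1 fun x => p (f x) := by
  obtain ⟨c, hc, h⟩ := hp
  exact h.comp_contDiff hf fun x => lt_of_lt_of_le (by simpa using hc) (hf0 x)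

theorem continuous_deriv_comp_of_contDiffOn_Ioi {p : ℝ → ℝ}
    (hp : ∃ c, 0 < c ∧ ContDiffOn ℝ 1 p (Ioi (-c))) {X : Type*} [TopologicalSpace X] {f : X → ℝ}
    (hf : Continuous f) (hf0 : ∀ x, 0 ≤ f x) : Continuous fun x => deriv p (f x) := by
  obtain ⟨c, hc, h⟩ := hp
  refine continuous_iff_continuousAt.2 fun x => ?_
  have h1 : ContinuousAt (deriv p) (f x) :=
    (h.continuousOn_deriv_of_isOpen isOpen_Ioi le_rfl).continuousAt
      (Ioi_mem_nhds (by linarith [hf0 x]))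
  exact h1.comp (f := f) hf.continuousAt

/-- The partial derivative of `η² p(|W|²)`. -/
def chainDeriv (p : ℝ → ℝ) (η e : ℝ) (W D : Mat n N) : ℝ :=
  η ^ 2 * (deriv p (‖W‖ ^ 2) * (2 * inner ℝ W D)) + 2 * η * e * p (‖W‖ ^ 2)

theorem partialDeriv_sq_mul_comp {p : ℝ → ℝ} (hp : ∃ c, 0 < c ∧ ContDiffOn ℝ 1 p (Ioi (-c)))
    {η : Vec n → ℝ} (hη : ContDiff ℝ 1 η) {V : Vec n → Mat n N} (hV : ContDiff ℝ 1 V) (j : Fin n)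
    (x : Vec n) : partialDeriv j (fun y => η y ^ 2 * p (‖V y‖ ^ 2)) x
      = chainDeriv p (η x) (partialDeriv j η x) (V x) (partialDeriv j V x) := by
  have hηd := hη.differentiable (by simp)
  have hVd := hV.differentiable (by simp)
  have hg : ContDiff ℝ 1 fun y => p (‖V y‖ ^ 2) :=
    contDiff_comp_of_contDiffOn_Ioi hp (hV.norm_sq ℝ) fun y => sq_nonneg _
  have p1 : partialDeriv j (fun y => p (‖V y‖ ^ 2)) x
      = deriv p (‖V x‖ ^ 2) * (2 * inner ℝ (V x) (partialDeriv j V x)) := by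
    have h1 := (hasDerivAt_of_contDiffOn_Ioi hp (sq_nonneg ‖V x‖)).comp_hasFDerivAt x
      (f := fun y => ‖V y‖ ^ 2) (hVd x).hasFDerivAt.norm_sq
    refine (partialDeriv_eq_of_hasFDerivAt h1 j).trans ?_
    simp [partialDeriv]
  have := partialDeriv_smul (c := fun y => η y ^ 2) (f := fun y => p (‖V y‖ ^ 2))
    (hηd.pow 2) (hg.differentiable (by simp)) j x
  simp only [smul_eq_mul] at this
  rw [this, p1, partialDeriv_sq hηd, chainDeriv]

/-- Young's inequality twice with a common weight t. In the De Giorgi step t is the width of the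
annulus, so that the derivative terms, once estimated by Caccioppoli, and the zero order terms both
scale like 1/t. -/
theorem abs_chainDeriv_le {p : ℝ → ℝ} {η e a b t : ℝ} {W D : Mat n N} (ht : 0 < t)
    (ha : |deriv p (‖W‖ ^ 2)| ≤ a) (hb : |p (‖W‖ ^ 2)| ≤ b) :
    |chainDeriv p η e W D| ≤ a * (η ^ 2 * (t * ‖D‖ ^ 2 + t⁻¹ * ‖W‖ ^ 2))
      + b * (t * e ^ 2 + t⁻¹ * η ^ 2) := by
  have ha0 := (abs_nonneg _).trans ha
  have hb0 := (abs_nonneg _).trans hb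
  have h1 := abs_real_inner_le_norm W D
  have k1 : 2 * (‖W‖ * ‖D‖) ≤ t * ‖D‖ ^ 2 + t⁻¹ * ‖W‖ ^ 2 := by
    have : t * ‖D‖ ^ 2 + t⁻¹ * ‖W‖ ^ 2 - 2 * (‖W‖ * ‖D‖) = t⁻¹ * (t * ‖D‖ - ‖W‖) ^ 2 := by
      field_simp; ring
    have : 0 ≤ t⁻¹ * (t * ‖D‖ - ‖W‖) ^ 2 := by positivity
    linarith
  have k2 : 2 * (|η| * |e|) ≤ t * e ^ 2 + t⁻¹ * η ^ 2 := by
    have : t * e ^ 2 + t⁻¹ * η ^ 2 - 2 * (|η| * |e|) = t⁻¹ * (t * |e| - |η|) ^ 2 := by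
      rw [← sq_abs e, ← sq_abs η]; field_simp; ring
    have : 0 ≤ t⁻¹ * (t * |e| - |η|) ^ 2 := by positivity
    linarith
  rw [chainDeriv]
  refine (abs_add_le _ _).trans (add_le_add ?_ ?_)
  · rw [abs_mul, abs_mul, abs_mul, abs_of_nonneg (sq_nonneg η), abs_two]
    calc η ^ 2 * (|deriv p (‖W‖ ^ 2)| * (2 * |inner ℝ W D|))
        ≤ η ^ 2 * (a * (2 * (‖W‖ * ‖D‖))) := by gcongr
      _ = a * (η ^ 2 * (2 * (‖W‖ * ‖D‖))) := by ring
      _ ≤ _ := by gcongr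
  · rw [abs_mul, abs_mul, abs_mul, abs_two]
    calc 2 * |η| * |e| * |p (‖W‖ ^ 2)| ≤ 2 * |η| * |e| * b := by gcongr
      _ = b * (2 * (|η| * |e|)) := by ring
      _ ≤ _ := by gcongr

theorem sum_abs_chainDeriv_le {p : ℝ → ℝ} {η Λ E : ℝ} {e : Fin n → ℝ} {W : Mat n N}
    {D : Fin n → Mat n N} (hη : |η| ≤ 1) (hΛ : 0 ≤ Λ) (hp1 : |p (‖W‖ ^ 2)| ≤ Λ * ‖W‖ ^ 2)
    (hp2 : |deriv p (‖W‖ ^ 2)| ≤ Λ) (hE : ∑ j, e j ^ 2 ≤ E) :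
    ∑ j, |chainDeriv p η (e j) W (D j)|
      ≤ Λ * (1 + 2 * n + E) * (‖W‖ ^ 2 + ∑ j, ‖D j‖ ^ 2) := by
  have hη2 : η ^ 2 ≤ 1 := by rw [← sq_abs]; exact pow_le_one₀ (abs_nonneg _) hη
  have h1 : ∀ j, |chainDeriv p η (e j) W (D j)|
      ≤ Λ * ‖D j‖ ^ 2 + Λ * ‖W‖ ^ 2 * (2 + e j ^ 2) := fun j => by
    refine (abs_chainDeriv_le one_pos hp2 hp1).trans ?_
    have h2 : Λ * (η ^ 2 * (1 * ‖D j‖ ^ 2 + 1⁻¹ * ‖W‖ ^ 2))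
        ≤ Λ * (1 * (1 * ‖D j‖ ^ 2 + 1⁻¹ * ‖W‖ ^ 2)) := by gcongr
    have h3 : Λ * ‖W‖ ^ 2 * (1 * e j ^ 2 + 1⁻¹ * η ^ 2)
        ≤ Λ * ‖W‖ ^ 2 * (1 * e j ^ 2 + 1⁻¹ * 1) := by gcongr
    refine (add_le_add h2 h3).trans (le_of_eq ?_)
    rw [inv_one]; ring
  have h2 := Finset.sum_le_sum fun j (_ : j ∈ Finset.univ) => h1 j
  rw [Finset.sum_add_distrib, ← Finset.mul_sum, ← Finset.mul_sum, Finset.sum_add_distrib] at h2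
  simp only [Finset.sum_const, Finset.card_univ, Fintype.card_fin, nsmul_eq_mul] at h2
  obtain ⟨T, hT⟩ : ∃ T, T = ∑ j, ‖D j‖ ^ 2 := ⟨_, rfl⟩
  have hT0 : 0 ≤ T := hT ▸ Finset.sum_nonneg fun _ _ => sq_nonneg _
  have hE0 : 0 ≤ ∑ j, e j ^ 2 := Finset.sum_nonneg fun _ _ => sq_nonneg _
  rw [← hT] at h2 ⊢
  have h4 : Λ * ‖W‖ ^ 2 * ∑ j, e j ^ 2 ≤ Λ * ‖W‖ ^ 2 * E := by gcongr
  have h5 : 0 ≤ Λ * n * T := by positivity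
  have h6 : 0 ≤ Λ * E * T := mul_nonneg (mul_nonneg hΛ (hE0.trans hE)) hT0
  have h7 : 0 ≤ Λ * ‖W‖ ^ 2 := by positivity
  nlinarith

namespace IsRegularField

variable {α γ : ℝ → ℝ} {lo hi m M C : ℝ} {B : Set (Vec n)} {W : Vec n → Mat n N}
  {D : Fin n → Vec n → Mat n N}

set_option maxHeartbeats 800000 in
-- The Sobolev inequality for η²p(|W|²), with W merely weakly differentiable: it is applied to the
-- mollified field and passed to the limit. Linear growth of p and boundedness of p' put both
-- integrands under the energy. S will be a superlevel set of W, hence only null measurable.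
theorem setIntegral_le_of_sobolev (h : IsRegularField α B W D) {CS : ℝ}
    (hCS : ∀ f : Vec n → ℝ, ContDiff ℝ 1 f →
    HasCompactSupport f → ∀ S : Set (Vec n), volume S ≠ ⊤ →
      ∫ x in S, |f x| ≤ CS * (volume.real S) ^ (1 / (n : ℝ)) *
        ∫ x, ∑ j, |PhiLaplace.partialDeriv j f x|)
    {p : ℝ → ℝ} {Λ : ℝ} (hp : ∃ c, 0 < c ∧ ContDiffOn ℝ 1 p (Ioi (-c)))
    (hp1 : ∀ r, 0 ≤ r → |p r| ≤ Λ * r) (hp2 : ∀ r, 0 ≤ r → |deriv p r| ≤ Λ)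
    {η : Vec n → ℝ} (hη : ContDiff ℝ 1 η) (hηc : HasCompactSupport η)
    (hηB : tsupport η ⊆ B) (hη1 : ∀ x, |η x| ≤ 1) {S : Set (Vec n)}
    (hS : NullMeasurableSet S) (hSf : volume S ≠ ⊤) :
    Integrable (fun x => ∑ j, |chainDeriv p (η x) (PhiLaplace.partialDeriv j η x) (W x) (D j x)|) ∧
    ∫ x in S, |η x ^ 2 * p (‖W x‖ ^ 2)| ≤ CS * (volume.real S) ^ (1 / (n : ℝ)) *
      ∫ x, ∑ j, |chainDeriv p (η x) (PhiLaplace.partialDeriv j η x) (W x) (D j x)| := by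
  obtain ⟨k₀, hk₀⟩ := exists_closedBall_subset hηc.isCompact h.isOpen hηB
  obtain ⟨E, hE0, hE⟩ := exists_bound_sum_partialDeriv_sq hη hηc
  have hΛ : 0 ≤ Λ := (abs_nonneg _).trans (hp2 0 le_rfl)
  have hη2 : ∀ x, η x ^ 2 ≤ 1 := fun x => by
    rw [← sq_abs]; exact pow_le_one₀ (abs_nonneg _) (hη1 x)
  have hpc : Continuous fun P : Mat n N => p (‖P‖ ^ 2) :=
    (contDiff_comp_of_contDiffOn_Ioi hp (contDiff_id.norm_sq ℝ) fun x => sq_nonneg _).continuous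
  have hpc' : Continuous fun P : Mat n N => deriv p (‖P‖ ^ 2) :=
    continuous_deriv_comp_of_contDiffOn_Ioi hp (by fun_prop) fun x => sq_nonneg _
  obtain ⟨Z, hZ⟩ : ∃ Z : Vec n × Mat n N × (Fin n → Mat n N) → ℝ, ∀ q, Z q =
      ∑ j, |chainDeriv p (η q.1) (PhiLaplace.partialDeriv j η q.1) q.2.1 (q.2.2 j)| :=
    ⟨_, fun _ => rfl⟩
  have hZc : Continuous Z := by
    rw [funext hZ]
    refine continuous_finsetSum _ fun j _ => Continuous.abs ?_
    have c1 : Continuous fun q : Vec n × Mat n N × (Fin n → Mat n N) => η q.1 :=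
      hη.continuous.comp continuous_fst
    have c2 : Continuous fun q : Vec n × Mat n N × (Fin n → Mat n N) => q.2.1 := by fun_prop
    have c3 : Continuous fun q : Vec n × Mat n N × (Fin n → Mat n N) =>
      PhiLaplace.partialDeriv j η q.1 := (partialDeriv_continuous hη j).comp continuous_fst
    have c4 : Continuous fun q : Vec n × Mat n N × (Fin n → Mat n N) => q.2.2 j := by fun_prop
    exact ((c1.pow 2).mul ((hpc'.comp c2).mul (continuous_const.mul (c2.inner c4)))).add
      (((continuous_const.mul c1).mul c3).mul (hpc.comp c2))
  have hZle : ∀ (V : Vec n → Mat n N) (X : Fin n → Vec n → Mat n N) x,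
      Z (x, V x, fun j => X j x) ≤ Λ * (1 + 2 * n + E) * energy V X x := by
    intro V X x
    rw [hZ]
    exact sum_abs_chainDeriv_le (D := fun j => X j x) (hη1 x) hΛ (hp1 _ (sq_nonneg ‖V x‖))
      (hp2 _ (sq_nonneg ‖V x‖)) (hE x)
  have hZ0 : ∀ q, 0 ≤ Z q := fun q => by
    rw [hZ]; exact Finset.sum_nonneg fun _ _ => abs_nonneg _
  have hDm : AEStronglyMeasurable (fun x j => D j x) volume :=
    (aemeasurable_pi_lambda _ fun j => (h.memLp_deriv j).1.aemeasurable).aestronglyMeasurable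
  have hZW : ∀ x, ∑ j, |chainDeriv p (η x) (PhiLaplace.partialDeriv j η x) (W x) (D j x)|
      = Z (x, W x, fun j => D j x) := fun x => (hZ (x, W x, fun j => D j x)).symm
  simp_rw [hZW]
  refine ⟨(h.energy_integrable.const_mul (Λ * (1 + 2 * n + E))).mono'
    (hZc.comp_aestronglyMeasurable (f := fun x => (x, W x, fun j => D j x))
      (aestronglyMeasurable_id.prodMk (h.memLp.1.prodMk hDm)))
    (Eventually.of_forall fun x => ?_), ?_⟩
  · rw [Real.norm_eq_abs, abs_of_nonneg (hZ0 _)]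
    exact hZle W D x
  have hVc : ∀ k, Continuous (mol k W) := fun k => (h.mol_contDiff k).continuous
  have hDc : ∀ k j, Continuous (mol k (D j)) := fun k j =>
    (PhiLaplace.mol_contDiff k (memLp_two_locallyIntegrable (h.memLp_deriv j))).continuous
  have lim1 : Tendsto (fun k => ∫ x, Z (x, mol k W x, fun j => mol k (D j) x)) atTop
      (𝓝 (∫ x, Z (x, W x, fun j => D j x))) := by
    refine tendsto_integral_of_le_mol h.energy_integrable (integrable_zero _ _ _)
      (C := Λ * (1 + 2 * n + E)) (k₀ := 0) (fun k => ?_) (fun k _ x => ?_) ?_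
    · have c5 : Continuous fun x => (x, mol k W x, fun j => mol k (D j) x) :=
        continuous_id.prodMk ((hVc k).prodMk (continuous_pi fun j => hDc k j))
      exact (hZc.comp c5).aestronglyMeasurable
    · rw [abs_of_nonneg (hZ0 _), Pi.zero_apply, add_zero]
      refine (hZle _ _ x).trans ?_
      have := h.energy_mol_le k x
      gcongr
    · filter_upwards [h.mol_tendsto] with x hx
      exact (hZc.tendsto (x, W x, fun j => D j x)).comp
        (tendsto_const_nhds.prodMk_nhds (hx.1.prodMk_nhds (tendsto_pi_nhds.2 hx.2)))
  have lim2 : Tendsto (fun k => ∫ x, S.indicator (fun x => |η x ^ 2 * p (‖mol k W x‖ ^ 2)|) x) atTop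
      (𝓝 (∫ x, S.indicator (fun x => |η x ^ 2 * p (‖W x‖ ^ 2)|) x)) := by
    refine tendsto_integral_of_le_mol h.energy_integrable (integrable_zero _ _ _)
      (C := Λ) (k₀ := 0) (fun k => ?_) (fun k _ x => ?_) ?_
    · exact (((hη.continuous.pow 2).mul (hpc.comp (hVc k))).abs).aestronglyMeasurable.indicator₀ hS
    · have h0 : 0 ≤ mol k (energy W D) x :=
        le_trans (add_nonneg (sq_nonneg _) (Finset.sum_nonneg fun _ _ => sq_nonneg _))
          (h.energy_mol_le k x)
      rw [Pi.zero_apply, add_zero]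
      by_cases hx : x ∈ S
      · rw [indicator_of_mem hx, abs_abs, abs_mul, abs_of_nonneg (sq_nonneg _)]
        have h1 := (norm_sq_le_energy (mol k W) (fun s => mol k (D s)) x).trans
          (h.energy_mol_le k x)
        calc η x ^ 2 * |p (‖mol k W x‖ ^ 2)| ≤ 1 * (Λ * ‖mol k W x‖ ^ 2) := by
              gcongr
              · exact hη2 x
              · exact hp1 _ (sq_nonneg ‖mol k W x‖)
          _ ≤ _ := by rw [one_mul]; gcongr
      · rw [indicator_of_notMem hx, abs_zero]
        positivity
    · filter_upwards [h.mol_tendsto] with x hx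
      by_cases hxS : x ∈ S
      · simp only [indicator_of_mem hxS]
        exact (((hpc.tendsto (W x)).comp hx.1).const_mul _).abs
      · simp only [indicator_of_notMem hxS]
        exact tendsto_const_nhds
  rw [← integral_indicator₀ hS]
  refine le_of_tendsto_of_tendsto lim2 (lim1.const_mul _) ?_
  filter_upwards [eventually_ge_atTop k₀] with k hk
  rw [integral_indicator₀ hS]
  have hV1 : ContDiff ℝ 1 (mol k W) := (h.mol_contDiff k).of_le (by simp)
  have hf : ContDiff ℝ 1 fun x => η x ^ 2 * p (‖mol k W x‖ ^ 2) :=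
    (hη.pow 2).mul (contDiff_comp_of_contDiffOn_Ioi hp (hV1.norm_sq ℝ) fun x => sq_nonneg _)
  have hfc : HasCompactSupport fun x => η x ^ 2 * p (‖mol k W x‖ ^ 2) := hηc.mono fun y hy => by
    rw [Function.mem_support] at hy ⊢
    exact fun h0 => hy (by rw [h0]; simp)
  refine (hCS _ hf hfc S hSf).trans (le_of_eq ?_)
  congr 2; ext x
  rw [hZ]
  refine Finset.sum_congr rfl fun j _ => ?_
  rw [partialDeriv_sq_mul_comp hp hη hV1]
  by_cases hx : x ∈ tsupport η
  · rw [h.partialDeriv_mol ((hk₀ k hk).2 x hx) j]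
  · have e1 : η x = 0 := image_eq_zero_of_notMem_tsupport hx
    simp [chainDeriv, e1]

end IsRegularField

end DeGiorgi

/-! ### One step of the De Giorgi iteration on superlevel sets of the energy density -/

section Iteration

variable {n N : ℕ}

/-- γ is a smooth transition applied to (α(r)r − k)/(l − k), which increases with r. Its derivative
lives where α(r)r ≤ l, and there r(α(r)r)' ≤ 2Mα(r)r ≤ 2Ml. So rγ' is bounded through M and the
levels alone, whatever the size of α. -/
theorem exists_isCutoff : ∃ c : ℝ, 0 < c ∧ ∀ {α : ℝ → ℝ} {lo hi m M : ℝ}, RegCoef α lo hi m M →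
    ∀ {k l : ℝ}, 0 < k → k < l → ∃ γ : ℝ → ℝ, IsCutoff γ (c * M * l / (l - k)) ∧
      (∀ r, 0 ≤ r → α r * r ≤ k → γ r = 0) ∧ ∀ r, 0 ≤ r → l ≤ α r * r → γ r = 1 := by
  obtain ⟨c, hc, hcb⟩ := exists_deriv_smoothTransition_le
  refine ⟨2 * c, by positivity, fun {α lo hi m M} hα {k l} hk hkl => ?_⟩
  have hM := hα.one_le
  have hm := hα.m_pos
  have hd : 0 < l - k := by linarith
  have hq : ∀ r, 0 ≤ r → HasDerivAt (fun r => (α r * r - k) / (l - k))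
      ((deriv α r * r + α r * 1) / (l - k)) r := fun r hr =>
    (((hα.hasDerivAt hr).mul (hasDerivAt_id r)).sub_const k).div_const (l - k)
  have hγ : ∀ r, 0 ≤ r → deriv (fun r => Real.smoothTransition ((α r * r - k) / (l - k))) r
      = deriv Real.smoothTransition ((α r * r - k) / (l - k))
        * ((deriv α r * r + α r * 1) / (l - k)) := fun r hr =>
    ((((Real.smoothTransition.contDiff (n := 1)).differentiable (by simp)) _).hasDerivAt.comp r
      (hq r hr)).deriv
  refine ⟨fun r => Real.smoothTransition ((α r * r - k) / (l - k)),
    ⟨?_, fun r _ => Real.smoothTransition.nonneg _, fun r _ => Real.smoothTransition.le_one _,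
      fun r hr => ?_, fun r hr => ?_⟩, fun r hr h => ?_, fun r hr h => ?_⟩
  · obtain ⟨d, hd, h⟩ := hα.contDiffOn
    exact ⟨d, hd, Real.smoothTransition.contDiff.comp_contDiffOn
      (((h.mul contDiffOn_id).sub contDiffOn_const).div_const _)⟩
  · rw [hγ r hr]
    refine mul_nonneg (hcb _).1 (div_nonneg ?_ hd.le)
    have := hα.lower r hr
    have := hα.pos hr
    nlinarith
  · rw [hγ r hr]
    obtain ⟨h0, h1, h2⟩ := hcb ((α r * r - k) / (l - k))
    have hl : 0 ≤ 2 * c * M * l / (l - k) := by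
      have : 0 < l := hk.trans hkl
      positivity
    by_cases h3 : (α r * r - k) / (l - k) ∈ Icc (0 : ℝ) 1
    · have h4 : α r * r ≤ l := by
        have := h3.2
        rw [div_le_one hd] at this
        linarith
      have h5 := hα.upper r hr
      have h6 := hα.pos hr
      have h7 : 0 ≤ deriv α r * r + α r * 1 := by nlinarith [hα.lower r hr]
      have h8 : r * (deriv α r * r + α r * 1) ≤ 2 * M * l := by
        have : r * (deriv α r * r + α r * 1) ≤ r * (2 * M * α r) := by gcongr; nlinarith
        nlinarith
      calc r * (deriv Real.smoothTransition ((α r * r - k) / (l - k))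
            * ((deriv α r * r + α r * 1) / (l - k)))
          = deriv Real.smoothTransition ((α r * r - k) / (l - k))
            * (r * (deriv α r * r + α r * 1)) / (l - k) := by ring
        _ ≤ c * (2 * M * l) / (l - k) := by gcongr
        _ = _ := by ring
    · rw [h2 h3]
      simpa using hl
  · exact Real.smoothTransition.zero_of_nonpos
      (div_nonpos_of_nonpos_of_nonneg (by linarith) hd.le)
  · refine Real.smoothTransition.one_of_one_le ?_
    rw [one_le_div hd]; linarith

/-- The part of the energy density `α(|W|²)|W|²` above the level `l`. -/
def levelPart (α : ℝ → ℝ) (l : ℝ) (W : Mat n N) : ℝ :=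
  if l < α (‖W‖ ^ 2) * ‖W‖ ^ 2 then α (‖W‖ ^ 2) * ‖W‖ ^ 2 else 0

namespace RegCoef

variable {α : ℝ → ℝ} {lo hi m M : ℝ} (hα : RegCoef α lo hi m M)
include hα

theorem density_nonneg (P : Mat n N) : 0 ≤ α (‖P‖ ^ 2) * ‖P‖ ^ 2 :=
  mul_nonneg (hα.pos (sq_nonneg _)).le (sq_nonneg _)

theorem continuous_density : Continuous fun P : Mat n N => α (‖P‖ ^ 2) * ‖P‖ ^ 2 :=
  (hα.continuous_comp (by fun_prop) fun x => sq_nonneg _).mul (by fun_prop)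

theorem levelPart_nonneg (l : ℝ) (P : Mat n N) : 0 ≤ levelPart α l P := by
  unfold levelPart
  split_ifs
  · exact hα.density_nonneg P
  · exact le_rfl

theorem levelPart_le (l : ℝ) (P : Mat n N) : levelPart α l P ≤ α (‖P‖ ^ 2) * ‖P‖ ^ 2 := by
  unfold levelPart
  split_ifs
  · exact le_rfl
  · exact hα.density_nonneg P

theorem levelPart_anti {k l : ℝ} (hkl : k ≤ l) (P : Mat n N) :
    levelPart α l P ≤ levelPart α k P := by
  have := hα.density_nonneg P
  unfold levelPart
  split_ifs <;> linarith

theorem measurable_levelPart (l : ℝ) : Measurable (levelPart (n := n) (N := N) α l) :=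
  Measurable.ite (measurableSet_lt measurable_const hα.continuous_density.measurable)
    hα.continuous_density.measurable measurable_const

end RegCoef

namespace IsRegularField

variable {α γ : ℝ → ℝ} {lo hi m M C : ℝ} {B : Set (Vec n)} {W : Vec n → Mat n N}
  {D : Fin n → Vec n → Mat n N}

theorem density_integrable (hα : RegCoef α lo hi m M) (h : IsRegularField α B W D) :
    Integrable fun x => α (‖W x‖ ^ 2) * ‖W x‖ ^ 2 := by
  refine ((h.memLp.integrable_norm_pow (p := 2) (by norm_num)).const_mul hi).mono'
    (hα.continuous_density.comp_aestronglyMeasurable h.memLp.1) (Eventually.of_forall fun x => ?_)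
  rw [Real.norm_eq_abs, abs_of_nonneg (hα.density_nonneg _)]
  have := hα.le_hi _ (sq_nonneg ‖W x‖)
  gcongr

theorem levelPart_integrable (hα : RegCoef α lo hi m M) (h : IsRegularField α B W D) (l : ℝ) :
    Integrable fun x => levelPart α l (W x) := by
  refine (h.density_integrable hα).mono' ?_ (Eventually.of_forall fun x => ?_)
  · exact ((hα.measurable_levelPart l).comp_aemeasurable h.memLp.1.aemeasurable).aestronglyMeasurable
  · rw [Real.norm_eq_abs, abs_of_nonneg (hα.levelPart_nonneg l _)]
    exact hα.levelPart_le l _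

/-- One step of the De Giorgi iteration. -/
theorem levelPart_step (hα : RegCoef α lo hi m M) (h : IsRegularField α B W D) {CS L : ℝ}
    (hCS0 : 0 < CS)
    (hCS : ∀ f : Vec n → ℝ, ContDiff ℝ 1 f →
      HasCompactSupport f → ∀ S : Set (Vec n), volume S ≠ ⊤ →
      ∫ x in S, |f x| ≤ CS * (volume.real S) ^ (1 / (n : ℝ)) *
        ∫ x, ∑ j, |PhiLaplace.partialDeriv j f x|)
    {k l : ℝ} (hk : 0 < k) (hγ : IsCutoff γ C)
    (hγ0 : ∀ r, 0 ≤ r → α r * r ≤ k → γ r = 0) (hγ1 : ∀ r, 0 ≤ r → l ≤ α r * r → γ r = 1)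
    {x₀ : Vec n} {ρ σ : ℝ} (hρσ : ρ < σ) (hσB : Metric.closedBall x₀ σ ⊆ B)
    {η : Vec n → ℝ} (hη : ContDiff ℝ 1 η) (hηc : HasCompactSupport η)
    (hηs : tsupport η ⊆ Metric.closedBall x₀ σ) (hη01 : ∀ x, 0 ≤ η x ∧ η x ≤ 1)
    (hηρ : ∀ x ∈ Metric.ball x₀ ρ, η x = 1)
    (hησ : ∀ x, x ∉ Metric.ball x₀ σ → η x = 0 ∧ ∀ j, PhiLaplace.partialDeriv j η x = 0)
    (hηL : ∀ x, ∑ j, PhiLaplace.partialDeriv j η x ^ 2 ≤ (L / (σ - ρ)) ^ 2) :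
    ∫ x in Metric.ball x₀ ρ, levelPart α l (W x)
      ≤ CS * ((∫ x in Metric.ball x₀ σ, levelPart α k (W x)) / k) ^ (1 / (n : ℝ)) *
        ((2 * M + 2 * C) * (((2 * (1 + M) / m) ^ 2 + 1) * L ^ 2 + 2 * n) / (σ - ρ)
          * ∫ x in Metric.ball x₀ σ, levelPart α k (W x)) := by
  -- This width is the Young weight below: Caccioppoli costs (L/t)² times the weight t, the zero
  -- order terms cost 1/t, and both become a multiple of Y/t.
  set t := σ - ρ with ht_def
  have ht : 0 < t := by linarith
  have hM := hα.one_le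
  have hm := hα.m_pos
  have hhi := hα.hi_pos
  have hC := hγ.const_nonneg
  set Γ := 2 * M + 2 * C with hΓ
  have hΓ1 : 1 ≤ Γ := by linarith
  have hη1 : ∀ x, |η x| ≤ 1 := fun x => by rw [abs_of_nonneg (hη01 x).1]; exact (hη01 x).2
  have hη2 : ∀ x, η x ^ 2 ≤ 1 := fun x => pow_le_one₀ (hη01 x).1 (hη01 x).2
  set Y := ∫ x in Metric.ball x₀ σ, levelPart α k (W x) with hY
  have hlk := h.levelPart_integrable hα k
  have hll := h.levelPart_integrable hα l
  -- the function `p`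
  set p : ℝ → ℝ := fun r => α r * r * γ r ^ 2 with hp
  have hpd : ∀ r, 0 ≤ r → deriv p r
      = (deriv α r * r + α r) * γ r ^ 2 + α r * r * (2 * γ r * deriv γ r) := fun r hr => by
    have h1 := ((hα.hasDerivAt hr).mul (hasDerivAt_id r)).mul ((hγ.hasDerivAt hr).pow 2)
    refine h1.deriv.trans ?_
    simp
  have hpC : ∃ c, 0 < c ∧ ContDiffOn ℝ 1 p (Ioi (-c)) := by
    obtain ⟨c₁, hc₁, h₁⟩ := hα.contDiffOn
    obtain ⟨c₂, hc₂, h₂⟩ := hγ.contDiffOn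
    refine ⟨min c₁ c₂, lt_min hc₁ hc₂, ?_⟩
    have h₁' := h₁.mono (Ioi_subset_Ioi (neg_le_neg (min_le_left c₁ c₂)))
    have h₂' := h₂.mono (Ioi_subset_Ioi (neg_le_neg (min_le_right c₁ c₂)))
    exact (h₁'.mul contDiffOn_id).mul (h₂'.pow 2)
  -- The square of γ in p leaves one factor γ in both terms of p'. This is exactly the weight γα
  -- under which the Caccioppoli inequality controls D; with a single γ, the term with γ' would
  -- escape it.
  have hp' : ∀ r, 0 ≤ r → |deriv p r| ≤ Γ * (γ r * α r) := fun r hr => by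
    have a0 := hα.pos hr
    have g0 := hγ.nonneg r hr
    have g1 := hγ.le_one r hr
    have d0 := hγ.deriv_nonneg r hr
    have d1 := hγ.mul_deriv_le r hr
    have a1 := hα.lower r hr
    have a2 := hα.upper r hr
    have s0 : 0 ≤ deriv α r * r + α r := by nlinarith
    have s1 : deriv α r * r + α r ≤ 2 * M * α r := by nlinarith
    rw [hpd r hr, abs_of_nonneg (by positivity)]
    have s2 : (deriv α r * r + α r) * γ r ^ 2 ≤ 2 * M * α r * γ r := by
      have : γ r ^ 2 ≤ γ r := by nlinarith
      calc _ ≤ 2 * M * α r * γ r ^ 2 := by gcongr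
        _ ≤ _ := by gcongr
    have s3 : α r * r * (2 * γ r * deriv γ r) ≤ 2 * C * α r * γ r := by
      calc α r * r * (2 * γ r * deriv γ r) = 2 * (r * deriv γ r) * α r * γ r := by ring
        _ ≤ _ := by gcongr
    calc _ ≤ 2 * M * α r * γ r + 2 * C * α r * γ r := add_le_add s2 s3
      _ = _ := by rw [hΓ]; ring
  have hpb : ∀ r, 0 ≤ r → 0 ≤ p r ∧ p r ≤ γ r * (α r * r) := fun r hr => by
    have a0 := hα.pos hr
    have g0 := hγ.nonneg r hr
    have g1 := hγ.le_one r hr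
    refine ⟨by positivity, ?_⟩
    have : γ r ^ 2 ≤ γ r := by nlinarith
    calc p r ≤ α r * r * γ r := by simp only [hp]; gcongr
      _ = _ := by ring
  have hp1 : ∀ r, 0 ≤ r → |p r| ≤ Γ * hi * r := fun r hr => by
    rw [abs_of_nonneg (hpb r hr).1]
    refine (hpb r hr).2.trans ?_
    have := hγ.le_one r hr
    have := hα.le_hi r hr
    have := (hα.pos hr).le
    calc γ r * (α r * r) ≤ 1 * (hi * r) := by gcongr
      _ ≤ Γ * (hi * r) := by gcongr
      _ = _ := by ring
  have hp2 : ∀ r, 0 ≤ r → |deriv p r| ≤ Γ * hi := fun r hr => by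
    refine (hp' r hr).trans ?_
    have := hγ.le_one r hr
    have := hγ.nonneg r hr
    have := hα.le_hi r hr
    have := (hα.pos hr).le
    calc Γ * (γ r * α r) ≤ Γ * (1 * hi) := by gcongr
      _ = _ := by ring
  -- the level set
  have hSm : NullMeasurableSet (Metric.ball x₀ σ ∩ {x | k < α (‖W x‖ ^ 2) * ‖W x‖ ^ 2}) volume :=
    (measurableSet_ball.nullMeasurableSet).inter (nullMeasurableSet_lt aemeasurable_const
      (hα.continuous_density.comp_aestronglyMeasurable h.memLp.1).aemeasurable)
  set S := Metric.ball x₀ σ ∩ {x | k < α (‖W x‖ ^ 2) * ‖W x‖ ^ 2} with hS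
  have hSf : volume S ≠ ⊤ :=
    ((measure_mono inter_subset_left).trans_lt measure_ball_lt_top).ne
  -- Chebyshev: the truncated density exceeds k on S.
  have hSY : volume.real S ≤ Y / k := by
    rw [le_div_iff₀ hk]
    calc volume.real S * k = ∫ x in S, k := by simp
      _ = ∫ x, S.indicator (fun _ => k) x := (integral_indicator₀ hSm).symm
      _ ≤ ∫ x, (Metric.ball x₀ σ).indicator (fun x => levelPart α k (W x)) x := by
          refine integral_mono ((integrableOn_const hSf).integrable_indicator₀ hSm)
            (hlk.indicator measurableSet_ball) fun x => ?_
          by_cases hx : x ∈ S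
          · have hx2 : k < α (‖W x‖ ^ 2) * ‖W x‖ ^ 2 := hx.2
            rw [indicator_of_mem hx, indicator_of_mem hx.1, levelPart, if_pos hx2]
            exact hx2.le
          · rw [indicator_of_notMem hx]
            exact indicator_nonneg (fun x _ => hα.levelPart_nonneg k _) x
      _ = Y := integral_indicator measurableSet_ball
  have hY0 : 0 ≤ Y := setIntegral_nonneg measurableSet_ball fun x _ => hα.levelPart_nonneg k _
  obtain ⟨i0, key⟩ := h.setIntegral_le_of_sobolev hCS hpC hp1 hp2 hη hηc (hηs.trans hσB) hη1 hSm hSf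
  obtain ⟨i1, i2, cac⟩ := h.caccioppoli hα hγ hη hηc (hηs.trans hσB) hη1
  -- left-hand side
  have hleft : ∫ x in Metric.ball x₀ ρ, levelPart α l (W x)
      ≤ ∫ x in S, |η x ^ 2 * p (‖W x‖ ^ 2)| := by
    have hf1 : Integrable fun x => |η x ^ 2 * p (‖W x‖ ^ 2)| := by
      refine ((h.memLp.integrable_norm_pow (p := 2) (by norm_num)).const_mul (Γ * hi)).mono' ?_
        (Eventually.of_forall fun x => ?_)
      · have hpc : Continuous fun P : Mat n N => p (‖P‖ ^ 2) :=
          (contDiff_comp_of_contDiffOn_Ioi hpC (contDiff_id.norm_sq ℝ)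
            fun x => sq_nonneg _).continuous
        exact (((hη.continuous.pow 2).aestronglyMeasurable.mul
          (hpc.comp_aestronglyMeasurable h.memLp.1))).norm
      · rw [Real.norm_eq_abs, abs_abs, abs_mul, abs_of_nonneg (sq_nonneg (η x))]
        have := hp1 _ (sq_nonneg ‖W x‖)
        calc η x ^ 2 * |p (‖W x‖ ^ 2)| ≤ 1 * (Γ * hi * ‖W x‖ ^ 2) := by
              gcongr
              exact hη2 x
          _ = _ := one_mul _
    rw [← integral_indicator measurableSet_ball, ← integral_indicator₀ hSm]
    refine integral_mono (hll.indicator measurableSet_ball)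
      (hf1.integrableOn.integrable_indicator₀ hSm) fun x => ?_
    have hnn : 0 ≤ S.indicator (fun x => |η x ^ 2 * p (‖W x‖ ^ 2)|) x :=
      indicator_nonneg (fun x _ => abs_nonneg _) x
    by_cases hx : x ∈ Metric.ball x₀ ρ
    · rw [indicator_of_mem hx, levelPart]
      split_ifs with hl
      · have g1 := hγ1 _ (sq_nonneg ‖W x‖) hl.le
        have hxS : x ∈ S := by
          refine ⟨Metric.ball_subset_ball hρσ.le hx, ?_⟩
          by_contra hcon
          rw [mem_ofPred_eq, not_lt] at hcon
          have := hγ0 _ (sq_nonneg ‖W x‖) hcon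
          rw [g1] at this
          exact one_ne_zero this
        rw [indicator_of_mem hxS, hηρ x hx]
        simp only [hp, g1]
        rw [one_pow, one_mul, mul_one]
        exact le_abs_self _
      · exact hnn
    · rw [indicator_of_notMem hx]
      exact hnn
  -- right-hand side
  have hpt : ∀ x, ∑ j, |chainDeriv p (η x) (PhiLaplace.partialDeriv j η x) (W x) (D j x)|
      ≤ Γ * t * (η x ^ 2 * γ (‖W x‖ ^ 2) * α (‖W x‖ ^ 2) * ∑ s, ‖D s x‖ ^ 2)
        + Γ * t * (γ (‖W x‖ ^ 2) * α (‖W x‖ ^ 2) * ‖W x‖ ^ 2 *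
            ∑ j, PhiLaplace.partialDeriv j η x ^ 2)
        + Γ * (2 * n / t) * (Metric.ball x₀ σ).indicator (fun x => levelPart α k (W x)) x := by
    intro x
    have r0 := sq_nonneg ‖W x‖
    obtain ⟨r, hr⟩ : ∃ r, r = ‖W x‖ ^ 2 := ⟨_, rfl⟩
    have a0 := (hα.pos r0).le
    have g0 := hγ.nonneg _ r0
    have g1 := hγ.le_one _ r0
    have b1 : η x ^ 2 * (γ (‖W x‖ ^ 2) * (α (‖W x‖ ^ 2) * ‖W x‖ ^ 2))
        ≤ (Metric.ball x₀ σ).indicator (fun x => levelPart α k (W x)) x := by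
      by_cases hx : x ∈ Metric.ball x₀ σ
      · rw [indicator_of_mem hx, levelPart]
        split_ifs with hl
        · calc _ ≤ 1 * (1 * (α (‖W x‖ ^ 2) * ‖W x‖ ^ 2)) := by
                gcongr
                exact hη2 x
            _ = _ := by ring
        · rw [hγ0 _ r0 (not_lt.1 hl)]; simp
      · rw [indicator_of_notMem hx, (hησ x hx).1]; simp
    have hb := hpb _ r0
    have c1 : ∀ j, |chainDeriv p (η x) (PhiLaplace.partialDeriv j η x) (W x) (D j x)|
        ≤ Γ * (γ (‖W x‖ ^ 2) * α (‖W x‖ ^ 2)) * (η x ^ 2 * (t * ‖D j x‖ ^ 2 + t⁻¹ * ‖W x‖ ^ 2))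
          + Γ * (γ (‖W x‖ ^ 2) * (α (‖W x‖ ^ 2) * ‖W x‖ ^ 2)) *
            (t * PhiLaplace.partialDeriv j η x ^ 2 + t⁻¹ * η x ^ 2) := fun j => by
      refine abs_chainDeriv_le ht (hp' _ r0) ?_
      rw [abs_of_nonneg hb.1]
      refine hb.2.trans (le_mul_of_one_le_left ?_ hΓ1)
      positivity
    refine (Finset.sum_le_sum fun j _ => c1 j).trans ?_
    have e1 : ∑ j, (Γ * (γ (‖W x‖ ^ 2) * α (‖W x‖ ^ 2)) *
          (η x ^ 2 * (t * ‖D j x‖ ^ 2 + t⁻¹ * ‖W x‖ ^ 2))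
          + Γ * (γ (‖W x‖ ^ 2) * (α (‖W x‖ ^ 2) * ‖W x‖ ^ 2)) *
            (t * PhiLaplace.partialDeriv j η x ^ 2 + t⁻¹ * η x ^ 2))
        = Γ * t * (η x ^ 2 * γ (‖W x‖ ^ 2) * α (‖W x‖ ^ 2) * ∑ s, ‖D s x‖ ^ 2)
        + Γ * t * (γ (‖W x‖ ^ 2) * α (‖W x‖ ^ 2) * ‖W x‖ ^ 2 *
            ∑ j, PhiLaplace.partialDeriv j η x ^ 2)
        + Γ * (2 * n / t) * (η x ^ 2 * (γ (‖W x‖ ^ 2) * (α (‖W x‖ ^ 2) * ‖W x‖ ^ 2))) := by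
      simp only [mul_add, Finset.sum_add_distrib, ← Finset.mul_sum, Finset.sum_const,
        Finset.card_univ, Fintype.card_fin, nsmul_eq_mul]
      ring
    rw [e1]
    gcongr
  have i3 : Integrable fun x => (Metric.ball x₀ σ).indicator (fun x => levelPart α k (W x)) x :=
    hlk.indicator measurableSet_ball
  have hright := integral_mono i0 ((((i1.const_mul (Γ * t)).add (i2.const_mul (Γ * t)))).add
    (i3.const_mul (Γ * (2 * n / t)))) hpt
  rw [integral_add' ((i1.const_mul (Γ * t)).add (i2.const_mul (Γ * t)))
    (i3.const_mul (Γ * (2 * n / t))), integral_add' (i1.const_mul (Γ * t)) (i2.const_mul (Γ * t)),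
    integral_const_mul, integral_const_mul, integral_const_mul,
    integral_indicator measurableSet_ball] at hright
  have hJ : ∫ x, γ (‖W x‖ ^ 2) * α (‖W x‖ ^ 2) * ‖W x‖ ^ 2 *
      ∑ j, PhiLaplace.partialDeriv j η x ^ 2 ≤ (L / t) ^ 2 * Y := by
    rw [hY, ← integral_indicator measurableSet_ball, ← integral_const_mul]
    refine integral_mono i2 (i3.const_mul _) fun x => ?_
    have r0 := sq_nonneg ‖W x‖
    have a0 := (hα.pos r0).le
    have g0 := hγ.nonneg _ r0
    have g1 := hγ.le_one _ r0
    by_cases hx : x ∈ Metric.ball x₀ σ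
    · simp only [indicator_of_mem hx, levelPart]
      split_ifs with hl
      · calc _ ≤ 1 * α (‖W x‖ ^ 2) * ‖W x‖ ^ 2 * (L / t) ^ 2 := by
              gcongr
              exact hηL x
          _ = _ := by ring
      · rw [hγ0 _ r0 (not_lt.1 hl)]; simp
    · simp only [indicator_of_notMem hx, (hησ x hx).2]
      simp
  set I := ∫ x, η x ^ 2 * γ (‖W x‖ ^ 2) * α (‖W x‖ ^ 2) * ∑ s, ‖D s x‖ ^ 2
  set J := ∫ x, γ (‖W x‖ ^ 2) * α (‖W x‖ ^ 2) * ‖W x‖ ^ 2 *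
        ∑ j, PhiLaplace.partialDeriv j η x ^ 2
  set K := (2 * (1 + M) / m) ^ 2 with hK
  have hK0 : 0 ≤ K := sq_nonneg _
  have hfin : Γ * t * I + Γ * t * J + Γ * (2 * n / t) * Y
      ≤ Γ * ((K + 1) * L ^ 2 + 2 * n) / t * Y := by
    have e1 : Γ * t * I + Γ * t * J ≤ Γ * t * ((K + 1) * ((L / t) ^ 2 * Y)) := by
      have : Γ * t * I + Γ * t * J ≤ Γ * t * (K * J) + Γ * t * J := by gcongr
      have h2 : Γ * t * (K * J) + Γ * t * J = Γ * t * ((K + 1) * J) := by ring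
      rw [h2] at this
      refine this.trans ?_
      gcongr
    refine (add_le_add_left e1 _).trans (le_of_eq ?_)
    field_simp
  calc ∫ x in Metric.ball x₀ ρ, levelPart α l (W x)
      ≤ _ := hleft
    _ ≤ _ := key
    _ ≤ CS * (Y / k) ^ (1 / (n : ℝ)) * (Γ * ((K + 1) * L ^ 2 + 2 * n) / t * Y) := by
        have e2 := hright.trans hfin
        have e3 : 0 ≤ ∫ x, ∑ j, |chainDeriv p (η x) (PhiLaplace.partialDeriv j η x) (W x) (D j x)| :=
          integral_nonneg fun x => Finset.sum_nonneg fun _ _ => abs_nonneg _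
        have e4 : volume.real S ^ (1 / (n : ℝ)) ≤ (Y / k) ^ (1 / (n : ℝ)) :=
          Real.rpow_le_rpow measureReal_nonneg hSY (by positivity)
        exact mul_le_mul (mul_le_mul_of_nonneg_left e4 hCS0.le) e2 e3 (by positivity)

end IsRegularField

end Iteration

/-! ### Fast geometric decay and the sup bound for regular fields -/

section SupBound

/-- The ratio 4^(−n) is chosen so that the n-th root of the decay, 4^(−j), cancels the growing
factor 4^j. The smallness of Y 0 says precisely that A(Y₀/K)^(1/n)/d ≤ 4^(−n), so the induction
closes. -/
theorem le_geometric_of_iteration {Y : ℕ → ℝ} {n : ℕ} (hn : 0 < n) {A K d : ℝ} (hA : 0 < A)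
    (hK : 0 < K) (hd : 0 < d) (hY : ∀ j, 0 ≤ Y j)
    (hstep : ∀ j, Y (j + 1) ≤ A * 4 ^ j / d * (Y j / K) ^ (1 / (n : ℝ)) * Y j)
    (h0 : A ^ n * 4 ^ (n * n) * Y 0 ≤ K * d ^ n) (j : ℕ) : Y j ≤ Y 0 * ((1 / 4 : ℝ) ^ n) ^ j := by
  have hn' : (0 : ℝ) ≤ 1 / n := by positivity
  have e0 : (Y 0 / K) ^ (1 / (n : ℝ)) ≤ d / (A * 4 ^ n) := by
    have h1 : Y 0 / K ≤ (d / (A * 4 ^ n)) ^ n := by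
      rw [div_pow, mul_pow, ← pow_mul, div_le_div_iff₀ hK (by positivity)]
      linarith
    have h2 := Real.rpow_le_rpow (div_nonneg (hY 0) hK.le) h1 hn'
    rw [one_div, Real.pow_rpow_inv_natCast (by positivity) hn.ne'] at h2
    rwa [one_div]
  induction j with
  | zero => simp
  | succ j ih =>
    have h1 : (Y j / K) ^ (1 / (n : ℝ)) ≤ d / (A * 4 ^ n) * (1 / 4) ^ j := by
      calc (Y j / K) ^ (1 / (n : ℝ)) ≤ (Y 0 / K * ((1 / 4 : ℝ) ^ j) ^ n) ^ (1 / (n : ℝ)) := by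
            refine Real.rpow_le_rpow (div_nonneg (hY j) hK.le) ?_ hn'
            rw [div_mul_eq_mul_div]
            gcongr
            rwa [pow_right_comm]
        _ = (Y 0 / K) ^ (1 / (n : ℝ)) * (1 / 4) ^ j := by
            rw [Real.mul_rpow (div_nonneg (hY 0) hK.le) (by positivity), one_div (n : ℝ),
              Real.pow_rpow_inv_natCast (by positivity) hn.ne']
        _ ≤ _ := by gcongr
    have hYj := hY j
    calc Y (j + 1) ≤ A * 4 ^ j / d * (Y j / K) ^ (1 / (n : ℝ)) * Y j := hstep j
      _ ≤ A * 4 ^ j / d * (d / (A * 4 ^ n) * (1 / 4) ^ j) * (Y 0 * ((1 / 4 : ℝ) ^ n) ^ j) := by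
          gcongr
      _ = Y 0 * ((1 / 4 : ℝ) ^ n) ^ (j + 1) := by
          rw [pow_succ, one_div, inv_pow, inv_pow]
          field_simp

set_option maxHeartbeats 800000 in
/-- The local sup bound for regular fields. -/
theorem exists_sup_const {n : ℕ} (hn : 0 < n) {m M : ℝ} (hm : 0 < m) (hM : 1 ≤ M) :
    ∃ C : ℝ, 0 < C ∧ ∀ {N : ℕ} {α : ℝ → ℝ} {lo hi : ℝ} {B : Set (Vec n)} {W : Vec n → Mat n N}
      {D : Fin n → Vec n → Mat n N}, RegCoef α lo hi m M → IsRegularField α B W D →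
      ∀ {x₀ : Vec n} {R R₀ : ℝ}, 0 < R → R < R₀ → Metric.closedBall x₀ R₀ ⊆ B → ∀ K : ℝ, 0 < K →
        C * ∫ x in Metric.ball x₀ R₀, α (‖W x‖ ^ 2) * ‖W x‖ ^ 2 ≤ K * (R₀ - R) ^ n →
        ∀ᵐ x, x ∈ Metric.ball x₀ R → α (‖W x‖ ^ 2) * ‖W x‖ ^ 2 ≤ K := by
  obtain ⟨CS, hCS0, hCS⟩ := exists_sobolev_const hn
  obtain ⟨c, hc, hcut⟩ := exists_isCutoff
  obtain ⟨L, hL, hball⟩ := exists_ball_cutoff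
  set A₀ := ((2 * (1 + M) / m) ^ 2 + 1) * L ^ 2 + 2 * n with hA₀
  have hA₀0 : 0 < A₀ := by positivity
  -- The outer 4 combines a factor 2 from levels staying above K/2 and a factor 2 from consecutive
  -- radii being d·2^(−j)/2 apart. The inner 4 comes from the level gap K·2^(−j)/4 in the cutoff
  -- constant.
  set A := CS * 4 * (2 * M + 2 * c * M * 4) * A₀ with hA
  have hA0 : 0 < A := by positivity
  refine ⟨A ^ n * 4 ^ (n * n), by positivity, fun {N α lo hi B W D} hα h {x₀ R R₀} hR hRR hB K hK
    hsmall => ?_⟩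
  obtain ⟨d, hd⟩ : ∃ d, d = R₀ - R := ⟨_, rfl⟩
  have hd0 : 0 < d := by linarith
  rw [← hd] at hsmall
  -- Radii shrink from R₀ to R while levels rise from K/2 to K. The cutoff constant and the gap of
  -- the radii each cost a factor 2^j, which together give 4^j.
  obtain ⟨Y, hYdef⟩ : ∃ Y : ℕ → ℝ, ∀ j, Y j = ∫ x in Metric.ball x₀ (R + d * (1 / 2) ^ j),
      levelPart α (K * (1 - (1 / 2) ^ j / 2)) (W x) := ⟨_, fun _ => rfl⟩
  have hY0 : ∀ j, 0 ≤ Y j := fun j => by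
    rw [hYdef]
    exact setIntegral_nonneg measurableSet_ball fun x _ => hα.levelPart_nonneg _ _
  have hi := fun l => h.levelPart_integrable hα l
  have hstep : ∀ j, Y (j + 1) ≤ A * 4 ^ j / d * (Y j / K) ^ (1 / (n : ℝ)) * Y j := fun j => by
    have hYj := hY0 j
    obtain ⟨a, ha⟩ : ∃ a : ℝ, a = (1 / 2) ^ j := ⟨_, rfl⟩
    have ha0 : 0 < a := by rw [ha]; positivity
    have ha1 : a ≤ 1 := by rw [ha]; exact pow_le_one₀ (by norm_num) (by norm_num)
    have ha4 : (4 : ℝ) ^ j = 1 / a ^ 2 := by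
      rw [ha, ← pow_mul, mul_comm, pow_mul, one_div (((1 / 2 : ℝ) ^ 2) ^ j), ← inv_pow]
      norm_num
    have hYj' := hYdef j
    have hYs := hYdef (j + 1)
    rw [pow_succ, ← ha] at hYs
    rw [← ha] at hYj'
    have hk : 0 < K * (1 - a / 2) := mul_pos hK (by linarith)
    have hkl : K * (1 - a / 2) < K * (1 - a * (1 / 2) / 2) := by
      refine mul_lt_mul_of_pos_left ?_ hK; linarith
    obtain ⟨γ, hγ, hγ0, hγ1⟩ := hcut hα hk hkl
    have hρσ : R + d * (a * (1 / 2)) < R + d * a := by nlinarith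
    obtain ⟨η, η1, η2, η3, η4, η5, η6, η7⟩ :=
      hball n x₀ (R + d * (a * (1 / 2))) (R + d * a) (by positivity) hρσ
    have hσB : Metric.closedBall x₀ (R + d * a) ⊆ B :=
      (Metric.closedBall_subset_closedBall (by nlinarith)).trans hB
    have key := h.levelPart_step hα hCS0 hCS hk hγ hγ0 hγ1 hρσ hσB η1 η2 η3 η4 η5 η6 η7
    rw [← hYs, ← hYj'] at key
    have e1 : (Y j / (K * (1 - a / 2))) ^ (1 / (n : ℝ)) ≤ 2 * (Y j / K) ^ (1 / (n : ℝ)) := by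
      have hn1 : (1 : ℝ) / n ≤ 1 := by
        rw [div_le_one (by positivity)]; exact_mod_cast hn
      calc (Y j / (K * (1 - a / 2))) ^ (1 / (n : ℝ)) ≤ (2 * (Y j / K)) ^ (1 / (n : ℝ)) := by
            refine Real.rpow_le_rpow (by positivity) ?_ (by positivity)
            rw [← mul_div_assoc, div_le_div_iff₀ hk hK]
            have h6 : 0 ≤ Y j * K * (1 - a) := mul_nonneg (by positivity) (by linarith)
            nlinarith
        _ = 2 ^ (1 / (n : ℝ)) * (Y j / K) ^ (1 / (n : ℝ)) :=
            Real.mul_rpow (by norm_num) (by positivity)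
        _ ≤ 2 ^ (1 : ℝ) * (Y j / K) ^ (1 / (n : ℝ)) := by
            gcongr
            norm_num
        _ = _ := by rw [Real.rpow_one]
    have e2 : 2 * M + 2 * (c * M * (K * (1 - a * (1 / 2) / 2)) /
        (K * (1 - a * (1 / 2) / 2) - K * (1 - a / 2))) ≤ (2 * M + 2 * c * M * 4) / a := by
      have e3 : K * (1 - a * (1 / 2) / 2) - K * (1 - a / 2) = K * a / 4 := by ring
      rw [e3]
      have e4 : 2 * (c * M * (K * (1 - a * (1 / 2) / 2)) / (K * a / 4))
          = 2 * c * M * 4 * (1 - a * (1 / 2) / 2) / a := by field_simp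
      rw [e4, add_div]
      refine add_le_add ?_ ?_
      · rw [le_div_iff₀ ha0]
        nlinarith
      · refine div_le_div_of_nonneg_right (mul_le_of_le_one_right (by positivity) ?_) ha0.le
        linarith
    have e5 : R + d * a - (R + d * (a * (1 / 2))) = d * a / 2 := by ring
    rw [e5] at key
    rw [← hA₀] at key
    generalize 2 * M + 2 * (c * M * (K * (1 - a * (1 / 2) / 2)) /
        (K * (1 - a * (1 / 2) / 2) - K * (1 - a / 2))) = G at key e2
    have hX' : 0 ≤ (Y j / (K * (1 - a / 2))) ^ (1 / (n : ℝ)) := by positivity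
    generalize (Y j / (K * (1 - a / 2))) ^ (1 / (n : ℝ)) = X at key e1 hX'
    have hX : 0 ≤ (Y j / K) ^ (1 / (n : ℝ)) := by positivity
    have e6 : G * A₀ / (d * a / 2) * Y j ≤ (2 * M + 2 * c * M * 4) / a * A₀ / (d * a / 2) * Y j := by
      gcongr
    have e7 : CS * X ≤ CS * (2 * (Y j / K) ^ (1 / (n : ℝ))) := mul_le_mul_of_nonneg_left e1 hCS0.le
    have e8 : CS * (2 * (Y j / K) ^ (1 / (n : ℝ))) *
          ((2 * M + 2 * c * M * 4) / a * A₀ / (d * a / 2) * Y j)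
        = A * 4 ^ j / d * (Y j / K) ^ (1 / (n : ℝ)) * Y j := by
      rw [ha4, hA]
      generalize (Y j / K) ^ (1 / (n : ℝ)) = X'
      field_simp
      ring
    rw [← e8]
    refine key.trans ?_
    exact (mul_le_mul_of_nonneg_left e6 (mul_nonneg hCS0.le hX')).trans
      (mul_le_mul_of_nonneg_right e7 (by positivity))
  have hY00 : A ^ n * 4 ^ (n * n) * Y 0 ≤ K * d ^ n := by
    refine le_trans (mul_le_mul_of_nonneg_left ?_ (by positivity)) hsmall
    rw [hYdef 0]
    have : R + d * (1 / 2) ^ 0 = R₀ := by rw [hd]; ring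
    rw [this]
    exact integral_mono (hi _).integrableOn (h.density_integrable hα).integrableOn
      fun x => hα.levelPart_le _ _
  have hgeo := le_geometric_of_iteration hn hA0 hK hd0 hY0 hstep hY00
  have hlim : Tendsto (fun j => Y 0 * ((1 / 4 : ℝ) ^ n) ^ j) atTop (𝓝 0) := by
    have : (1 / 4 : ℝ) ^ n < 1 := pow_lt_one₀ (by norm_num) (by norm_num) hn.ne'
    simpa using (tendsto_pow_atTop_nhds_zero_of_lt_one (by positivity) this).const_mul (Y 0)
  have hle : ∀ j, ∫ x in Metric.ball x₀ R, levelPart α K (W x) ≤ Y j := fun j => by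
    rw [hYdef]
    have hpow : (0 : ℝ) < (1 / 2) ^ j := by positivity
    calc ∫ x in Metric.ball x₀ R, levelPart α K (W x)
        ≤ ∫ x in Metric.ball x₀ R, levelPart α (K * (1 - (1 / 2) ^ j / 2)) (W x) :=
          integral_mono (hi _).integrableOn (hi _).integrableOn fun x =>
            hα.levelPart_anti (by nlinarith) _
      _ ≤ _ := setIntegral_mono_set (hi _).integrableOn
          (Eventually.of_forall fun x => hα.levelPart_nonneg _ _)
          (Metric.ball_subset_ball (by nlinarith)).eventuallyLE
  have hzero : ∫ x in Metric.ball x₀ R, levelPart α K (W x) = 0 :=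
    le_antisymm (ge_of_tendsto' hlim fun j => (hle j).trans (hgeo j))
      (setIntegral_nonneg measurableSet_ball fun x _ => hα.levelPart_nonneg _ _)
  rw [integral_eq_zero_iff_of_nonneg (fun x => hα.levelPart_nonneg _ _) (hi K).integrableOn] at hzero
  rw [Filter.EventuallyEq, ae_restrict_iff' measurableSet_ball] at hzero
  filter_upwards [hzero] with x hx hxR
  have := hx hxR
  by_contra hcon
  rw [not_le] at hcon
  rw [levelPart, if_pos hcon] at this
  exact absurd this (hK.trans hcon).ne'

end SupBound

/-! ### The regularised Dirichlet problem -/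

section Comparison

variable {n N : ℕ}

/-- A solution of the regularised equation on a ball with gradient in `L²` is a regular field on
every smaller ball. -/
theorem exists_isRegularField {α : ℝ → ℝ} {lo hi m M : ℝ} (hα : RegCoef α lo hi m M)
    {x₀ : Vec n} {r₁ r₂ : ℝ} (hr₁ : 0 < r₁) (hr : r₁ < r₂) {W : Vec n → Mat n N}
    (hW : MemLp W 2 volume) (hW0 : ∀ x, x ∉ Metric.ball x₀ r₂ → W x = 0)
    {v : ℕ → Vec n → Vec N} (hv : ∀ k, ContDiff ℝ ∞ (v k))
    (hlim : Tendsto (fun k => ∫ x in Metric.ball x₀ r₂, ‖classicalGrad (v k) x - W x‖ ^ 2)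
      atTop (𝓝 0))
    (heq : ∀ ζ : Vec n → Vec N, IsTestFunction (Metric.ball x₀ r₂) ζ →
      ∫ x in Metric.ball x₀ r₂, inner ℝ (regFlux α (W x)) (classicalGrad ζ x) = 0) :
    ∃ D, IsRegularField α (Metric.ball x₀ r₁) W D := by
  have hsub : Metric.ball x₀ r₁ ⊆ Metric.ball x₀ r₂ := Metric.ball_subset_ball hr.le
  obtain ⟨C, -, hC⟩ := exists_difference_bound hα hr₁ hr hW hW0 hv hlim heq
  choose D hD1 _ hD3 using fun s => exists_weak_partialDeriv hW
    (B := Metric.ball x₀ r₁) measurableSet_ball (C := C) (d := (r₂ - r₁) / 2) (by linarith) hC s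
  have hvL : ∀ k, MemLp (classicalGrad (v k)) 2 (volume.restrict (Metric.ball x₀ r₂)) := fun k =>
    Continuous.memLp_ball (classicalGrad_contDiff (hv k)).continuous x₀ r₂ 2
  refine ⟨D, Metric.isOpen_ball, hW, hD1, hD3, weakDeriv_symm Metric.isOpen_ball hW hD1 hD3
    fun ψ hψ s j i => integral_partialDeriv_mul_comm hW hv hvL hlim (hψ.mono hsub) s j i,
    fun ζ hζ => ?_⟩
  rw [← heq ζ (hζ.mono hsub)]
  refine (setIntegral_inner_eq_integral fun x hx => ?_).symm
  rw [hW0 x hx, regFlux, smul_zero]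

/-- The solution of the regularised Dirichlet problem with smooth boundary data `v`, given through
its gradient `W`. -/
theorem exists_comparison_const (hn : 0 < n) {m M : ℝ} (hm : 0 < m) (hM : 1 ≤ M) :
    ∃ C : ℝ, 0 < C ∧ ∀ {N : ℕ} {α : ℝ → ℝ} {lo hi : ℝ}, RegCoef α lo hi m M →
      ∀ {x₀ : Vec n} {R : ℝ}, 0 < R → ∀ v : Vec n → Vec N, ContDiff ℝ ∞ v →
      ∃ W : Vec n → Mat n N, MemLp W 2 (volume.restrict (Metric.ball x₀ (2 * R))) ∧
        (∀ F : Vec n → Mat n N, MemLp F 2 (volume.restrict (Metric.ball x₀ (2 * R))) →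
          (∀ ζ : Vec n → Vec N, IsTestFunction (Metric.ball x₀ (2 * R)) ζ →
            ∫ x in Metric.ball x₀ (2 * R), inner ℝ (F x) (classicalGrad ζ x) = 0) →
          ∫ x in Metric.ball x₀ (2 * R), inner ℝ (F x) (W x - classicalGrad v x) = 0) ∧
        ∫ x in Metric.ball x₀ (2 * R), inner ℝ (regFlux α (W x)) (W x - classicalGrad v x) = 0 ∧
        ∫ x in Metric.ball x₀ (2 * R), α (‖W x‖ ^ 2) * ‖W x‖ ^ 2 ≤ 2 * 2 ^ M *
          ∫ x in Metric.ball x₀ (2 * R), α (‖classicalGrad v x‖ ^ 2) * ‖classicalGrad v x‖ ^ 2 ∧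
        ∀ K : ℝ, 0 < K →
          C * ∫ x in Metric.ball x₀ (2 * R),
            α (‖classicalGrad v x‖ ^ 2) * ‖classicalGrad v x‖ ^ 2 ≤ K * R ^ n →
          ∀ᵐ x, x ∈ Metric.ball x₀ R → α (‖W x‖ ^ 2) * ‖W x‖ ^ 2 ≤ K := by
  obtain ⟨C, hC, hsup⟩ := exists_sup_const hn hm hM
  refine ⟨C * (2 * 2 ^ M) * 2 ^ n, by positivity, fun {N α lo hi} hα {x₀ R} hR v hv => ?_⟩
  set U := Metric.ball x₀ (2 * R) with hU
  have hQ : MemLp (classicalGrad v) 2 (volume.restrict U) :=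
    Continuous.memLp_ball (classicalGrad_contDiff hv).continuous x₀ (2 * R) 2
  obtain ⟨G, hG, ⟨ζ, hζ, hζlim⟩, heq⟩ := exists_regular_solution hα hQ
  obtain ⟨W, hWdef⟩ : ∃ W : Vec n → Mat n N, W = U.indicator fun x => classicalGrad v x + G x :=
    ⟨_, rfl⟩
  have hWU : ∀ x ∈ U, W x = classicalGrad v x + G x := fun x hx => by
    rw [hWdef, indicator_of_mem hx]
  have hW0 : ∀ x, x ∉ U → W x = 0 := fun x hx => by rw [hWdef, indicator_of_notMem hx]
  have hW : MemLp W 2 volume := by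
    rw [hWdef, memLp_indicator_iff_restrict measurableSet_ball]
    exact hQ.add hG
  have hWr : MemLp W 2 (volume.restrict U) := hW.restrict U
  have hlim : Tendsto (fun k => ∫ x in U, ‖classicalGrad (fun y => v y + ζ k y) x - W x‖ ^ 2)
      atTop (𝓝 0) := by
    refine hζlim.congr fun k => setIntegral_congr_fun measurableSet_ball fun x hx => ?_
    rw [hWU x hx, classicalGrad_add (hv.differentiable (by simp)) (hζ k).differentiable,
      add_sub_add_left_eq_sub]
  have heqW : ∀ ψ : Vec n → Vec N, IsTestFunction U ψ →
      ∫ x in U, inner ℝ (regFlux α (W x)) (classicalGrad ψ x) = 0 := fun ψ hψ => by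
    rw [← heq ψ hψ]
    refine setIntegral_congr_fun measurableSet_ball fun x hx => ?_
    rw [hWU x hx]
  have horth : ∀ F : Vec n → Mat n N, MemLp F 2 (volume.restrict U) →
      (∀ ψ : Vec n → Vec N, IsTestFunction U ψ →
        ∫ x in U, inner ℝ (F x) (classicalGrad ψ x) = 0) →
      ∫ x in U, inner ℝ (F x) (W x - classicalGrad v x) = 0 := fun F hF h => by
    rw [← integral_inner_eq_zero_of_tendsto hF hG hζ hζlim h]
    refine setIntegral_congr_fun measurableSet_ball fun x hx => ?_
    rw [hWU x hx, add_sub_cancel_left]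
  have hAW : MemLp (fun x => regFlux α (W x)) 2 (volume.restrict U) :=
    hWr.of_le_mul (c := hi) (hα.continuous_regFlux.comp_aestronglyMeasurable hWr.1)
      (Eventually.of_forall fun x => hα.norm_regFlux_le _)
  have hAorth := horth _ hAW heqW
  have hdens : ∀ {Z : Vec n → Mat n N}, MemLp Z 2 (volume.restrict U) →
      IntegrableOn (fun x => α (‖Z x‖ ^ 2) * ‖Z x‖ ^ 2) U := fun {Z} hZ => by
    refine ((hZ.integrable_norm_pow (p := 2) (by norm_num)).const_mul hi).mono'
      (hα.continuous_density.comp_aestronglyMeasurable hZ.1) (Eventually.of_forall fun x => ?_)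
    rw [Real.norm_eq_abs, abs_of_nonneg (hα.density_nonneg _)]
    have := hα.le_hi _ (sq_nonneg ‖Z x‖)
    gcongr
  -- W − ∇v is orthogonal to the flux of W, so the energy of W equals the pairing of its flux with
  -- ∇v. Young's inequality with factor 1/2 is absorbed, hence 2·2^M.
  have henergy : ∫ x in U, α (‖W x‖ ^ 2) * ‖W x‖ ^ 2 ≤ 2 * 2 ^ M *
      ∫ x in U, α (‖classicalGrad v x‖ ^ 2) * ‖classicalGrad v x‖ ^ 2 := by
    have i1 := integrable_inner_of_memLp hAW hQ
    have i2 : IntegrableOn (fun x => inner ℝ (regFlux α (W x)) (W x)) U :=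
      integrable_inner_of_memLp hAW hWr
    have e1 : ∫ x in U, α (‖W x‖ ^ 2) * ‖W x‖ ^ 2
        = ∫ x in U, inner ℝ (regFlux α (W x)) (classicalGrad v x) := by
      have : ∫ x in U, inner ℝ (regFlux α (W x)) (W x - classicalGrad v x)
          = (∫ x in U, inner ℝ (regFlux α (W x)) (W x))
            - ∫ x in U, inner ℝ (regFlux α (W x)) (classicalGrad v x) := by
        rw [← integral_sub i2 i1]
        simp_rw [inner_sub_right]
      rw [hAorth] at this
      rw [← sub_eq_zero.1 this.symm]
      simp_rw [regFlux, inner_smul_left, real_inner_self_eq_norm_sq]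
      rfl
    have e2 := integral_mono i1 (((hdens hWr).const_mul (1 / 2)).add ((hdens hQ).const_mul (2 ^ M)))
      fun x => hα.inner_regFlux_le (W x) (classicalGrad v x)
    rw [integral_add' ((hdens hWr).const_mul (1 / 2)) ((hdens hQ).const_mul (2 ^ M)),
      integral_const_mul, integral_const_mul, ← e1] at e2
    linarith
  refine ⟨W, hWr, horth, hAorth, henergy, fun K hK hKs => ?_⟩
  -- Radii R < 3R/2 < 7R/4 < 2R: differentiability holds on the 7R/4 ball, whose interior must
  -- contain the closed 3R/2 ball used by the iteration. The gap R/2 produces the factor 2^n.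
  obtain ⟨D, hD⟩ := exists_isRegularField hα (r₁ := 7 / 4 * R) (r₂ := 2 * R) (by positivity)
    (by linarith) hW hW0 (fun k => hv.add (hζ k).contDiff) hlim heqW
  refine hsup hα hD (R₀ := 3 / 2 * R) hR (by linarith)
    (Metric.closedBall_subset_ball (by linarith)) K hK ?_
  have e3 : ∫ x in Metric.ball x₀ (3 / 2 * R), α (‖W x‖ ^ 2) * ‖W x‖ ^ 2
      ≤ ∫ x in U, α (‖W x‖ ^ 2) * ‖W x‖ ^ 2 :=
    setIntegral_mono_set (hdens hWr) (Eventually.of_forall fun x => hα.density_nonneg _)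
      (Metric.ball_subset_ball (by linarith)).eventuallyLE
  have e4 : (3 / 2 * R - R) ^ n = R ^ n / 2 ^ n := by
    rw [← div_pow]; congr 1; ring
  rw [e4, ← mul_div_assoc, le_div_iff₀ (by positivity)]
  calc _ ≤ C * (2 * 2 ^ M *
      ∫ x in U, α (‖classicalGrad v x‖ ^ 2) * ‖classicalGrad v x‖ ^ 2) * 2 ^ n := by
        gcongr
        exact e3.trans henergy
    _ = C * (2 * 2 ^ M) * 2 ^ n *
      ∫ x in U, α (‖classicalGrad v x‖ ^ 2) * ‖classicalGrad v x‖ ^ 2 := by ring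
    _ ≤ _ := hKs

end Comparison

/-! ### Orlicz functions -/

section Orlicz

/-- The hypothesis bounds the logarithmic derivative by p/t, written without division so that f may
vanish or be negative. -/
theorem antitoneOn_mul_rpow_neg {f f' : ℝ → ℝ} {p : ℝ} (hf : ∀ t, 0 < t → HasDerivAt f (f' t) t)
    (hp : ∀ t, 0 < t → f' t * t ≤ p * f t) : AntitoneOn (fun t => f t * t ^ (-p)) (Ioi 0) := by
  have hder : ∀ t ∈ Ioi (0 : ℝ), HasDerivAt (fun t : ℝ => f t * t ^ (-p))
      (f' t * t ^ (-p) + f t * (-p * t ^ (-p - 1))) t := fun t ht =>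
    (hf t ht).mul (Real.hasDerivAt_rpow_const (Or.inl (ne_of_gt ht)))
  refine antitoneOn_of_deriv_nonpos (convex_Ioi 0)
    (fun t ht => (hder t ht).continuousAt.continuousWithinAt)
    (fun t ht => ((hder t (by simpa using ht)).differentiableAt).differentiableWithinAt)
    fun t ht => ?_
  have ht0 : (0 : ℝ) < t := by simpa using ht
  rw [(hder t ht0).deriv, Real.rpow_sub_one ht0.ne']
  have h1 : f' t * t ^ (-p) + f t * (-p * (t ^ (-p) / t)) = (f' t * t - p * f t) * (t ^ (-p) / t) := by
    field_simp; ring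
  rw [h1]
  exact mul_nonpos_of_nonpos_of_nonneg (by linarith [hp t ht0]) (by positivity)

theorem le_rpow_mul_of_deriv_mul_le {f f' : ℝ → ℝ} {p : ℝ}
    (hf : ∀ t, 0 < t → HasDerivAt f (f' t) t)
    (hp : ∀ t, 0 < t → f' t * t ≤ p * f t) {c t : ℝ} (hc : 1 ≤ c) (ht : 0 < t) :
    f (c * t) ≤ c ^ p * f t := by
  have hc0 : 0 < c := by linarith
  have h := antitoneOn_mul_rpow_neg hf hp (mem_Ioi.2 ht) (mem_Ioi.2 (mul_pos hc0 ht))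
    (le_mul_of_one_le_left ht.le hc)
  simp only [Real.mul_rpow hc0.le ht.le, Real.rpow_neg hc0.le] at h
  have h1 : 0 < t ^ (-p) := Real.rpow_pos_of_pos ht _
  have h2 : 0 < c ^ p := Real.rpow_pos_of_pos hc0 _
  have h3 : f (c * t) * (c ^ p)⁻¹ ≤ f t := by
    refine le_of_mul_le_mul_right ?_ h1
    linarith
  rw [← div_eq_mul_inv, div_le_iff₀ h2] at h3
  linarith

/-- Lower growth of the regularised derivative. -/
theorem RegCoef.rpow_mul_le {α : ℝ → ℝ} {lo hi m M : ℝ} (hα : RegCoef α lo hi m M) {c t : ℝ}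
    (hc : 1 ≤ c) (ht : 0 ≤ t) : c ^ m * (t * α (t ^ 2)) ≤ c * t * α ((c * t) ^ 2) := by
  rcases ht.eq_or_lt with rfl | ht
  · simp
  -- Applied to −tα(t²), the upper growth lemma becomes a lower one; its hypothesis is then `lower`.
  have := le_rpow_mul_of_deriv_mul_le (f := fun t => -(t * α (t ^ 2))) (p := m)
    (fun t _ => (hα.hasDerivAt_mul_self t).neg) (fun t ht => by
      have h1 := mul_le_mul_of_nonneg_left (hα.lower _ (sq_nonneg t)) ht.le
      nlinarith) hc ht
  linarith

/-- The derivative of an Orlicz function, extended by zero. -/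
def om (φ : ℝ → ℝ) (t : ℝ) : ℝ := if 0 < t then deriv φ t else 0

namespace IsOrliczWith

variable {κ₁ κ₂ : ℝ} {φ : ℝ → ℝ} (h : IsOrliczWith κ₁ κ₂ φ)
include h

omit h in
theorem om_of_pos {t : ℝ} (ht : 0 < t) : om φ t = deriv φ t := if_pos ht

omit h in
theorem om_zero : om φ 0 = 0 := if_neg (lt_irrefl 0)

theorem hasDerivAt {t : ℝ} (ht : 0 < t) : HasDerivAt φ (om φ t) t := by
  rw [om_of_pos ht]
  exact ((h.contDiffOn_two.contDiffAt (Ioi_mem_nhds ht)).differentiableAt (by simp)).hasDerivAt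

theorem hasDerivAt_om {t : ℝ} (ht : 0 < t) : HasDerivAt (om φ) (deriv (deriv φ) t) t := by
  have h1 : ContDiffOn ℝ 1 (deriv φ) (Ioi 0) :=
    ((contDiffOn_succ_iff_deriv_of_isOpen (n := 1) isOpen_Ioi).1
      (by simpa [one_add_one_eq_two] using h.contDiffOn_two)).2.2
  have h2 := ((h1.contDiffAt (Ioi_mem_nhds ht)).differentiableAt (by simp)).hasDerivAt
  refine h2.congr_of_eventuallyEq ?_
  filter_upwards [Ioi_mem_nhds ht] with s hs using om_of_pos hs

theorem contDiffOn_om : ContDiffOn ℝ 1 (om φ) (Ioi 0) :=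
  (((contDiffOn_succ_iff_deriv_of_isOpen (n := 1) isOpen_Ioi).1
      (by simpa [one_add_one_eq_two] using h.contDiffOn_two)).2.2).congr
    fun _ ht => om_of_pos ht

theorem continuousOn : ContinuousOn φ (Ici 0) := h.contDiffOn_one.continuousOn

/-- The mean value theorem on `[0, t]`. -/
theorem exists_om_eq {t : ℝ} (ht : 0 < t) : ∃ s, 0 < s ∧ s < t ∧ φ t = om φ s * t := by
  obtain ⟨s, hs, hs'⟩ := exists_hasDerivAt_eq_slope φ (om φ) ht
    (h.continuousOn.mono Icc_subset_Ici_self) fun x hx => h.hasDerivAt hx.1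
  refine ⟨s, hs.1, hs.2, ?_⟩
  rw [hs', h.map_zero, sub_zero, sub_zero, div_mul_cancel₀ _ ht.ne']

theorem om_monotoneOn_Ioi : MonotoneOn (om φ) (Ioi 0) := by
  have h1 : MonotoneOn (deriv φ) (Ioi 0) :=
    (h.convexOn.subset Ioi_subset_Ici_self (convex_Ioi 0)).monotoneOn_deriv
      fun x hx => (h.hasDerivAt hx).differentiableAt
  intro s hs t ht hst
  rw [om_of_pos hs, om_of_pos ht]
  exact h1 hs ht hst

theorem om_nonneg (t : ℝ) : 0 ≤ om φ t := by
  rcases le_or_gt t 0 with ht | ht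
  · simp [om, not_lt.2 ht]
  · obtain ⟨s, hs, hst, he⟩ := h.exists_om_eq ht
    have h1 := h.nonneg t ht.le
    have h2 : 0 ≤ om φ s := by
      rw [he] at h1
      exact nonneg_of_mul_nonneg_left h1 ht
    exact h2.trans (h.om_monotoneOn_Ioi hs ht hst.le)

theorem om_mul_le_of_pos {c t : ℝ} (hc : 1 ≤ c) (ht : 0 < t) : om φ (c * t) ≤ c ^ κ₂ * om φ t :=
  le_rpow_mul_of_deriv_mul_le (fun _ hs => h.hasDerivAt_om hs)
    (fun s hs => by rw [om_of_pos hs]; exact h.le_deriv s hs) hc ht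

theorem om_mul_le {c t : ℝ} (hc : 1 ≤ c) (ht : 0 ≤ t) : om φ (c * t) ≤ c ^ κ₂ * om φ t := by
  rcases ht.eq_or_lt with rfl | ht
  · simp [om_zero]
  · exact h.om_mul_le_of_pos hc ht

/-- If φ' vanished at t, the power growth bound would force φ' = 0 beyond t. Then φ would be
constant there, against φ → ∞. -/
theorem om_pos {t : ℝ} (ht : 0 < t) : 0 < om φ t := by
  by_contra hcon
  have h0 : om φ t = 0 := le_antisymm (not_lt.1 hcon) (h.om_nonneg t)
  have h1 : ∀ s, t ≤ s → om φ s = 0 := fun s hs => by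
    have h2 := h.om_mul_le_of_pos (c := s / t) ((one_le_div ht).2 hs) ht
    rw [div_mul_cancel₀ _ ht.ne', h0, mul_zero] at h2
    exact le_antisymm h2 (h.om_nonneg s)
  have h3 : ∀ s, t < s → φ s = φ t := fun s hs => by
    obtain ⟨x, hx, hx'⟩ := exists_hasDerivAt_eq_slope φ (om φ) hs
      (h.continuousOn.mono (Icc_subset_Ici_self.trans (Ici_subset_Ici.2 ht.le)))
      fun x hx => h.hasDerivAt (ht.trans hx.1)
    rw [h1 x hx.1.le] at hx'
    have : s - t ≠ 0 := by linarith
    field_simp at hx'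
    linarith
  obtain ⟨s, hs1, hs2⟩ := ((h.tendsto_atTop.eventually_gt_atTop (φ t)).and
    (eventually_gt_atTop t)).exists
  exact absurd (h3 s hs2) hs1.ne'

/-- If φ' took equal values at two positive points, φ'' would vanish at some x between them, and
`deriv_le` would give φ'(x) ≤ 0. -/
theorem om_strictMonoOn : StrictMonoOn (om φ) (Ici 0) := by
  intro s hs t ht hst
  have ht0 : 0 < t := lt_of_le_of_lt hs hst
  rcases (mem_Ici.1 hs).eq_or_lt with rfl | hs0
  · rw [om_zero]; exact h.om_pos ht0
  · obtain ⟨x, hx, hx'⟩ := exists_hasDerivAt_eq_slope (om φ) (deriv (deriv φ)) hst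
      (fun x hx => (h.hasDerivAt_om (hs0.trans_le hx.1)).continuousAt.continuousWithinAt)
      fun x hx => h.hasDerivAt_om (hs0.trans hx.1)
    have hx0 : 0 < x := hs0.trans hx.1
    have h1 := h.deriv_le x hx0
    rw [← om_of_pos hx0] at h1
    have h2 := h.om_pos hx0
    have h3 := h.om_monotoneOn_Ioi hs0 ht0 hst.le
    refine lt_of_le_of_ne h3 fun he => ?_
    rw [hx', he, sub_self, zero_div] at h1
    linarith

theorem om_mono : Monotone (om φ) := by
  intro s t hst
  rcases le_or_gt s 0 with hs | hs
  · have : om φ s = 0 := if_neg (not_lt.2 hs)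
    rw [this]; exact h.om_nonneg t
  · exact h.om_monotoneOn_Ioi hs (hs.trans_le hst) hst

/-- On [0, ∞) `om φ` is the one-sided derivative, continuous because φ is C¹ up to 0 with φ'(0) = 0.
The two-sided `deriv φ 0` would depend on irrelevant values of φ at negative arguments. -/
theorem om_continuous : Continuous (om φ) := by
  have h1 : ContinuousOn (derivWithin φ (Ici 0)) (Ici 0) :=
    h.contDiffOn_one.continuousOn_derivWithin (uniqueDiffOn_Ici 0) le_rfl
  have h2 : ∀ t ∈ Ici (0 : ℝ), om φ t = derivWithin φ (Ici 0) t := fun t ht => by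
    rcases (mem_Ici.1 ht).eq_or_lt with rfl | ht0
    · rw [om_zero, h.deriv_zero.derivWithin (uniqueDiffOn_Ici 0 0 self_mem_Ici)]
    · rw [(h.hasDerivAt ht0).hasDerivWithinAt.derivWithin (uniqueDiffOn_Ici 0 t ht)]
  have h3 : ContinuousOn (om φ) (Ici 0) := h1.congr h2
  have h4 : om φ = fun t => om φ (max t 0) := by
    ext t
    rcases le_total t 0 with ht | ht
    · rw [max_eq_right ht, om_zero]; exact if_neg (not_lt.2 ht)
    · rw [max_eq_left ht]
  rw [h4]
  exact h3.comp_continuous (by fun_prop) fun t => le_max_right t 0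

theorem le_mul_om {t : ℝ} (ht : 0 ≤ t) : φ t ≤ t * om φ t := by
  rcases ht.eq_or_lt with rfl | ht
  · simp [h.map_zero]
  · obtain ⟨s, hs, hst, he⟩ := h.exists_om_eq ht
    rw [he, mul_comm]
    have := h.om_mono hst.le
    gcongr

/-- The mean value theorem for (1 + κ₂)φ(t) − tφ'(t), which vanishes at 0 and has derivative κ₂φ' −
tφ'' ≥ 0. With `le_mul_om` it makes tφ'(t) a substitute for φ(t). -/
theorem mul_om_le {t : ℝ} (ht : 0 ≤ t) : t * om φ t ≤ (1 + κ₂) * φ t := by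
  rcases ht.eq_or_lt with rfl | ht
  · simp [h.map_zero]
  set g : ℝ → ℝ := fun t => (1 + κ₂) * φ t - t * om φ t with hg
  have hgc : ContinuousOn g (Icc 0 t) :=
    (continuousOn_const.mul (h.continuousOn.mono Icc_subset_Ici_self)).sub
      (continuousOn_id.mul h.om_continuous.continuousOn)
  obtain ⟨s, hs, he⟩ := exists_hasDerivAt_eq_slope g
    (fun s => (1 + κ₂) * om φ s - (1 * om φ s + s * deriv (deriv φ) s)) ht hgc fun s hs =>
      ((h.hasDerivAt hs.1).const_mul _).sub ((hasDerivAt_id s).mul (h.hasDerivAt_om hs.1))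
  have h1 : deriv (deriv φ) s * s ≤ κ₂ * om φ s := by
    rw [om_of_pos hs.1]; exact h.le_deriv s hs.1
  have h2 : g 0 = 0 := by simp [hg, h.map_zero]
  rw [h2, sub_zero, sub_zero] at he
  have h3 : 0 ≤ g t / t := by rw [← he]; linarith
  have h4 : 0 ≤ g t := by
    have := mul_nonneg h3 ht.le
    rwa [div_mul_cancel₀ _ ht.ne'] at this
  simp only [hg] at h4
  linarith

theorem map_mul_le {c t : ℝ} (hc : 1 ≤ c) (ht : 0 ≤ t) : φ (c * t) ≤ c ^ (1 + κ₂) * φ t := by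
  rcases ht.eq_or_lt with rfl | ht
  · simp [h.map_zero]
  · exact le_rpow_mul_of_deriv_mul_le (fun _ hs => h.hasDerivAt hs)
      (fun s hs => by rw [mul_comm]; exact h.mul_om_le hs.le) hc ht

theorem mul_om_strictMonoOn : StrictMonoOn (fun t => t * om φ t) (Ici 0) := by
  intro s hs t ht hst
  have h1 := h.om_strictMonoOn hs ht hst
  have h2 := h.om_nonneg s
  have hs0 : 0 ≤ s := hs
  simp only
  nlinarith

theorem mul_om_tendsto : Tendsto (fun t => t * om φ t) atTop atTop :=
  tendsto_atTop_mono' _ ((eventually_ge_atTop 0).mono fun _ ht => h.le_mul_om ht) h.tendsto_atTop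

theorem exists_mul_om_eq {y : ℝ} (hy : 0 ≤ y) : ∃ t, 0 ≤ t ∧ t * om φ t = y := by
  obtain ⟨T, hT, hT0⟩ := ((h.mul_om_tendsto.eventually_ge_atTop y).and
    (eventually_ge_atTop 0)).exists
  have hc : ContinuousOn (fun t => t * om φ t) (Icc 0 T) :=
    (continuous_id.mul h.om_continuous).continuousOn
  obtain ⟨t, ht, he⟩ := intermediate_value_Icc hT0 hc (show y ∈ Icc ((0 : ℝ) * om φ 0) (T * om φ T)
    from ⟨by simpa using hy, hT⟩)
  exact ⟨t, ht.1, he⟩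

end IsOrliczWith

end Orlicz

/-! ### Uniformly elliptic approximations of φ' with fixed characteristics -/

section Regularisation

/-- The regularised coefficient: `t * regCoef φ l (t ^ 2)` approximates `φ' t` as `l → 0`. -/
def regCoef (φ : ℝ → ℝ) (l r : ℝ) : ℝ :=
  l + om φ √(l ^ 2 + r) / (√(l ^ 2 + r) + l * om φ √(l ^ 2 + r))

namespace IsOrliczWith

variable {κ₁ κ₂ : ℝ} {φ : ℝ → ℝ} (h : IsOrliczWith κ₁ κ₂ φ)
include h

/-- With s = √(l² + r) and x = φ'(s), the coefficient is l + x/(s + lx). The summand l bounds it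
below, the denominator bounds the quotient by 1/l, and s ≥ l makes it C¹ across r = 0. In the
derivative of the quotient only sφ''(s) − φ'(s) appears, which lies between (m − 1)x and (M − 1)x.
The remaining factor r/s is at most s ≤ s + lx, so m and M do not depend on l. -/
theorem isRegCoef (hκ₁ : 0 < κ₁) {l : ℝ} (hl : 0 < l) :
    RegCoef (regCoef φ l) l (l + 1 / l) (min 1 κ₁⁻¹) (max 1 κ₂) := by
  have hs : ∀ r, 0 ≤ r → 0 < √(l ^ 2 + r) := fun r hr => Real.sqrt_pos.2 (by positivity)
  have hB : ∀ r, 0 ≤ r → 0 ≤ om φ √(l ^ 2 + r) / (√(l ^ 2 + r) + l * om φ √(l ^ 2 + r)) :=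
    fun r hr => by
      have := hs r hr
      have := h.om_nonneg √(l ^ 2 + r)
      positivity
  have hder : ∀ r, 0 ≤ r → HasDerivAt (regCoef φ l)
      ((√(l ^ 2 + r) * deriv (deriv φ) √(l ^ 2 + r) - om φ √(l ^ 2 + r)) /
        (√(l ^ 2 + r) + l * om φ √(l ^ 2 + r)) ^ 2 * (1 / (2 * √(l ^ 2 + r)))) r := fun r hr => by
    have h0 := hs r hr
    have h1 := h.om_nonneg √(l ^ 2 + r)
    have d1 : HasDerivAt (fun r => √(l ^ 2 + r)) (1 / (2 * √(l ^ 2 + r))) r :=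
      ((hasDerivAt_id r).const_add (l ^ 2)).sqrt (by simp only [id]; positivity)
    have d2 := h.hasDerivAt_om h0
    have d3 : HasDerivAt (fun s => om φ s / (s + l * om φ s))
        ((√(l ^ 2 + r) * deriv (deriv φ) √(l ^ 2 + r) - om φ √(l ^ 2 + r)) /
        (√(l ^ 2 + r) + l * om φ √(l ^ 2 + r)) ^ 2) √(l ^ 2 + r) := by
      refine (d2.div ((hasDerivAt_id _).add (d2.const_mul l))
        (by simp only [Pi.add_apply]; positivity)).congr_deriv ?_
      simp only [Pi.add_apply]
      congr 1
      ring
    exact (d3.comp r d1).const_add l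
  have hr2 : ∀ r, 0 ≤ r → r / √(l ^ 2 + r) ≤ √(l ^ 2 + r) := fun r hr => by
    rw [div_le_iff₀ (hs r hr), Real.mul_self_sqrt (by positivity)]
    nlinarith [sq_nonneg l]
  have key : ∀ r, 0 ≤ r → 2 * r * deriv (regCoef φ l) r = (r / √(l ^ 2 + r)) *
      (√(l ^ 2 + r) * deriv (deriv φ) √(l ^ 2 + r) - om φ √(l ^ 2 + r)) /
        (√(l ^ 2 + r) + l * om φ √(l ^ 2 + r)) ^ 2 := fun r hr => by
    rw [(hder r hr).deriv]
    have := hs r hr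
    field_simp
  refine ⟨hl, lt_min one_pos (inv_pos.2 hκ₁), min_le_left _ _, le_max_left _ _, ⟨l ^ 2, by positivity,
    ?_⟩, fun r hr => ?_, fun r hr => ?_, fun r hr => ?_, fun r hr => ?_⟩
  · have hpos : ∀ r ∈ Ioi (-(l ^ 2)), 0 < l ^ 2 + r := fun r hr => by
      have := mem_Ioi.1 hr; linarith
    have c1 : ContDiffOn ℝ 1 (fun r => √(l ^ 2 + r)) (Ioi (-(l ^ 2))) :=
      ContDiffOn.sqrt (contDiffOn_const.add contDiffOn_id) fun r hr => (hpos r hr).ne'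
    have c2 : ContDiffOn ℝ 1 (fun r => om φ √(l ^ 2 + r)) (Ioi (-(l ^ 2))) :=
      h.contDiffOn_om.comp c1 fun r hr => Real.sqrt_pos.2 (hpos r hr)
    refine contDiffOn_const.add (c2.div (c1.add (contDiffOn_const.mul c2)) fun r hr => ?_)
    have := Real.sqrt_pos.2 (hpos r hr)
    have := h.om_nonneg √(l ^ 2 + r)
    positivity
  · exact le_add_of_nonneg_right (hB r hr)
  · refine add_le_add_right ?_ l
    have := hs r hr
    have := h.om_nonneg √(l ^ 2 + r)
    rw [div_le_div_iff₀ (by positivity) hl]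
    nlinarith
  · rw [key r hr]
    have k1 := h.om_nonneg √(l ^ 2 + r)
    have k2 := hs r hr
    have k3 := hr2 r hr
    have k4 : om φ √(l ^ 2 + r) ≤ κ₁ * (deriv (deriv φ) √(l ^ 2 + r) * √(l ^ 2 + r)) := by
      rw [om_of_pos k2]; exact h.deriv_le _ k2
    have hm : min 1 κ₁⁻¹ ≤ 1 := min_le_left _ _
    have hm' : min 1 κ₁⁻¹ ≤ κ₁⁻¹ := min_le_right _ _
    have hBr := hB r hr
    simp only [regCoef]
    set s := √(l ^ 2 + r)
    set x := om φ s
    set m := min 1 κ₁⁻¹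
    have k5 : m * x ≤ deriv (deriv φ) s * s := by
      have : κ₁⁻¹ * x ≤ deriv (deriv φ) s * s := by
        rw [inv_mul_le_iff₀ hκ₁]; exact k4
      nlinarith
    have k6 : (m - 1) * (x / (s + l * x)) ≤
        (r / s) * (s * deriv (deriv φ) s - x) / (s + l * x) ^ 2 := by
      have e1 : (m - 1) * (x / (s + l * x)) = (m - 1) * x * (s + l * x) / (s + l * x) ^ 2 := by
        field_simp
      rw [e1]
      refine div_le_div_of_nonneg_right ?_ (by positivity)
      have q0 : 0 ≤ r / s := by positivity
      have q1 : (r / s) * ((m - 1) * x) ≤ (r / s) * (s * deriv (deriv φ) s - x) := by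
        gcongr; linarith
      have q2 : r / s ≤ s + l * x := by nlinarith
      have q3 : (s + l * x) * ((m - 1) * x) ≤ (r / s) * ((m - 1) * x) :=
        mul_le_mul_of_nonpos_right q2 (by nlinarith)
      linarith
    nlinarith
  · rw [key r hr]
    have k1 := h.om_nonneg √(l ^ 2 + r)
    have k2 := hs r hr
    have k3 := hr2 r hr
    have k4 : deriv (deriv φ) √(l ^ 2 + r) * √(l ^ 2 + r) ≤ κ₂ * om φ √(l ^ 2 + r) := by
      rw [om_of_pos k2]; exact h.le_deriv _ k2
    have hM : 1 ≤ max 1 κ₂ := le_max_left _ _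
    have hM' : κ₂ ≤ max 1 κ₂ := le_max_right _ _
    have hBr := hB r hr
    simp only [regCoef]
    set s := √(l ^ 2 + r)
    set x := om φ s
    set M := max 1 κ₂
    have k6 : (r / s) * (s * deriv (deriv φ) s - x) / (s + l * x) ^ 2
        ≤ (M - 1) * (x / (s + l * x)) := by
      have e1 : (M - 1) * (x / (s + l * x)) = (M - 1) * x * (s + l * x) / (s + l * x) ^ 2 := by
        field_simp
      rw [e1]
      refine div_le_div_of_nonneg_right ?_ (by positivity)
      have q0 : 0 ≤ r / s := by positivity
      have q1 : (r / s) * (s * deriv (deriv φ) s - x) ≤ (r / s) * ((M - 1) * x) := by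
        gcongr; nlinarith
      have q2 : r / s ≤ s + l * x := by nlinarith
      have q3 : (r / s) * ((M - 1) * x) ≤ (s + l * x) * ((M - 1) * x) :=
        mul_le_mul_of_nonneg_right q2 (by nlinarith)
      linarith
    nlinarith

/-- Uniform convergence of the regularised derivative on bounded intervals. -/
theorem exists_regCoef_near {T ε : ℝ} (hT : 0 ≤ T) (hε : 0 < ε) :
    ∃ l, 0 < l ∧ ∀ t, 0 ≤ t → t ≤ T → |t * regCoef φ l (t ^ 2) - om φ t| ≤ ε := by
  obtain ⟨δ, hδ, hδu⟩ := Metric.uniformContinuousOn_iff_le.1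
    (isCompact_Icc.uniformContinuousOn_of_continuous
      (h.om_continuous.continuousOn (s := Icc 0 (T + 1)))) (ε / 2) (by positivity)
  obtain ⟨τ, hτ, hτε⟩ : ∃ τ, 0 < τ ∧ om φ τ ≤ ε := by
    have h1 : ∀ᶠ t in 𝓝 (0 : ℝ), om φ t < ε :=
      h.om_continuous.continuousAt.eventually_lt_const (by rwa [om_zero])
    have h2 : ∀ᶠ t in 𝓝[>] (0 : ℝ), om φ t < ε := h1.filter_mono nhdsWithin_le_nhds
    obtain ⟨τ, h3, h4⟩ := (h2.and self_mem_nhdsWithin).exists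
    exact ⟨τ, h4, h3.le⟩
  set Ω := om φ T with hΩ
  have hΩ0 : 0 ≤ Ω := h.om_nonneg T
  -- Four demands on l: l ≤ 1 keeps t + l in the interval of uniform continuity, l ≤ δ controls the
  -- shift from t to s ≤ t + l, and lT ≤ ε/2 makes the linear term small. The last bounds the loss
  -- from the enlarged denominator when t ≥ τ; for t ≤ τ that loss is at most φ'(τ) ≤ ε.
  obtain ⟨l, hl, hl1, hlδ, hlT, hlτ⟩ : ∃ l : ℝ, 0 < l ∧ l ≤ 1 ∧ l ≤ δ ∧ l * T ≤ ε / 2 ∧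
      Ω * (l * (1 + Ω)) / τ ≤ ε := by
    refine ⟨min 1 (min δ (min (ε / (2 * (T + 1))) (ε * τ / ((Ω + 1) * (1 + Ω))))), by positivity,
      min_le_left _ _, (min_le_right _ _).trans (min_le_left _ _), ?_, ?_⟩
    · set l := min 1 (min δ (min (ε / (2 * (T + 1))) (ε * τ / ((Ω + 1) * (1 + Ω)))))
      have h1 : l ≤ ε / (2 * (T + 1)) :=
        (min_le_right _ _).trans ((min_le_right _ _).trans (min_le_left _ _))
      have h0 : 0 ≤ l := by positivity
      rw [le_div_iff₀ (by positivity)] at h1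
      nlinarith
    · set l := min 1 (min δ (min (ε / (2 * (T + 1))) (ε * τ / ((Ω + 1) * (1 + Ω)))))
      have h1 : l ≤ ε * τ / ((Ω + 1) * (1 + Ω)) :=
        (min_le_right _ _).trans ((min_le_right _ _).trans (min_le_right _ _))
      have h0 : 0 ≤ l := by positivity
      rw [le_div_iff₀ (by positivity)] at h1
      rw [div_le_iff₀ hτ]
      nlinarith [mul_nonneg h0 hΩ0]
  refine ⟨l, hl, fun t ht htT => ?_⟩
  obtain ⟨s, hs⟩ : ∃ s, s = √(l ^ 2 + t ^ 2) := ⟨_, rfl⟩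
  have hs0 : 0 < s := by rw [hs]; exact Real.sqrt_pos.2 (by positivity)
  have hts : t ≤ s := by rw [hs]; exact Real.le_sqrt_of_sq_le (by nlinarith)
  have hsl : s ≤ t + l := by
    rw [hs]; exact Real.sqrt_le_iff.2 ⟨by positivity, by nlinarith⟩
  have e1 : t * regCoef φ l (t ^ 2) = l * t + t * (om φ s / (s + l * om φ s)) := by
    rw [regCoef, ← hs]; ring
  have hx0 := h.om_nonneg s
  have hy0 := h.om_nonneg t
  have hyΩ : om φ t ≤ Ω := h.om_mono htT
  have hyx : om φ t ≤ om φ s := h.om_mono hts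
  have hup : om φ s ≤ om φ t + ε / 2 := by
    have h1 := hδu (t + l) ⟨by linarith, by linarith⟩ t ⟨ht, by linarith⟩ (by
      rw [Real.dist_eq, add_sub_cancel_left, abs_of_pos hl]; exact hlδ)
    rw [Real.dist_eq] at h1
    have h2 := h.om_mono hsl
    have h3 := (abs_le.1 h1).2
    linarith
  rw [e1, abs_le]
  constructor
  · have h1 : t * om φ t / (t + l * (1 + Ω)) ≤ t * (om φ s / (s + l * om φ s)) := by
      rw [← mul_div_assoc, div_le_div_iff₀ (by nlinarith) (by positivity)]
      have q1 : om φ t * (s + l * om φ s) ≤ om φ s * (t + l * (1 + Ω)) := by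
        have q2 : om φ t * s ≤ om φ s * (t + l) := by
          calc om φ t * s ≤ om φ t * (t + l) := by gcongr
            _ ≤ _ := by gcongr
        have q3 : om φ t * (l * om φ s) ≤ Ω * (l * om φ s) := by gcongr
        nlinarith
      nlinarith
    have h2 : om φ t - t * om φ t / (t + l * (1 + Ω)) ≤ ε := by
      have hy1 : 0 < l * (1 + Ω) := by positivity
      have e2 : om φ t - t * om φ t / (t + l * (1 + Ω))
          = om φ t * (l * (1 + Ω)) / (t + l * (1 + Ω)) := by
        field_simp; ring
      rw [e2]
      rcases le_total t τ with h3 | h3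
      · refine le_trans ?_ ((h.om_mono h3).trans hτε)
        rw [div_le_iff₀ (by positivity)]
        nlinarith [mul_nonneg hy0 ht]
      · refine le_trans ?_ hlτ
        gcongr
        linarith
    have h4 : 0 ≤ l * t := by positivity
    linarith
  · have h1 : t * (om φ s / (s + l * om φ s)) ≤ om φ s := by
      rw [← mul_div_assoc, div_le_iff₀ (by positivity)]
      nlinarith [mul_nonneg hx0 (mul_nonneg hl.le hx0)]
    have h2 : l * t ≤ l * T := by gcongr
    linarith

end IsOrliczWith

end Regularisation

/-! ### Integrability of the flux and mollification of the solution -/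

section Flux

variable {n N : ℕ} {κ₁ κ₂ : ℝ} {φ : ℝ → ℝ}

theorem norm_flux (φ : ℝ → ℝ) (hφ : ∀ t, 0 ≤ om φ t) (P : Mat n N) :
    ‖flux φ P‖ = om φ ‖P‖ := by
  rcases eq_or_ne P 0 with rfl | hP
  · simp [flux, IsOrliczWith.om_zero]
  · have hP' : 0 < ‖P‖ := norm_pos_iff.2 hP
    rw [flux, norm_smul, ← IsOrliczWith.om_of_pos hP', Real.norm_of_nonneg (div_nonneg (hφ _) hP'.le),
      div_mul_cancel₀ _ hP'.ne']

theorem IsOrliczWith.continuous_flux (h : IsOrliczWith κ₁ κ₂ φ) :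
    Continuous (flux φ : Mat n N → Mat n N) := by
  rw [continuous_iff_continuousAt]
  intro P
  rcases eq_or_ne P 0 with rfl | hP
  · have h0 : flux φ (0 : Mat n N) = 0 := by simp [flux]
    rw [ContinuousAt, h0, tendsto_zero_iff_norm_tendsto_zero]
    have : Tendsto (fun Q : Mat n N => om φ ‖Q‖) (𝓝 0) (𝓝 (om φ ‖(0 : Mat n N)‖)) :=
      (h.om_continuous.comp continuous_norm).tendsto 0
    rw [norm_zero, IsOrliczWith.om_zero] at this
    exact this.congr fun Q => (norm_flux φ h.om_nonneg Q).symm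
  · have hP' : ‖P‖ ≠ 0 := norm_ne_zero_iff.2 hP
    have h1 : ContinuousAt (fun Q : Mat n N => (om φ ‖Q‖ / ‖Q‖) • Q) P :=
      ((h.om_continuous.comp continuous_norm).continuousAt.div continuous_norm.continuousAt
        hP').smul continuousAt_id
    refine h1.congr ?_
    filter_upwards [isOpen_ne.mem_nhds hP] with Q hQ
    rw [flux, IsOrliczWith.om_of_pos (norm_pos_iff.2 hQ)]

/-- The power growth of φ makes the Luxemburg scale k harmless: |f| ≤ max(1, k)·(|f|/k), and the
factor max(1, k) comes out of φ as a power. -/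
theorem IsOrliczWith.integrableOn_mul_om (h : IsOrliczWith κ₁ κ₂ φ) {F : Type*}
    [NormedAddCommGroup F] {S : Set (Vec n)} {f : Vec n → F} (hf : MemOrlicz φ S f) :
    IntegrableOn (fun x => ‖f x‖ * om φ ‖f x‖) S := by
  obtain ⟨hm, k, hk, hi⟩ := hf
  have hc : Continuous fun t : ℝ => t * om φ t := continuous_id.mul h.om_continuous
  refine (hi.const_mul ((1 + κ₂) * max 1 k ^ (1 + κ₂))).mono'
    (hc.comp_aestronglyMeasurable hm.norm) (Eventually.of_forall fun x => ?_)
  have hs : 0 ≤ ‖f x‖ / k := by positivity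
  have hle : ‖f x‖ ≤ max 1 k * (‖f x‖ / k) := by
    calc ‖f x‖ = k * (‖f x‖ / k) := by field_simp
      _ ≤ max 1 k * (‖f x‖ / k) := mul_le_mul_of_nonneg_right (le_max_right _ _) hs
  have hmax : 0 ≤ max 1 k * (‖f x‖ / k) := (norm_nonneg _).trans hle
  rw [Real.norm_of_nonneg (mul_nonneg (norm_nonneg _) (h.om_nonneg _))]
  calc ‖f x‖ * om φ ‖f x‖
      ≤ max 1 k * (‖f x‖ / k) * om φ (max 1 k * (‖f x‖ / k)) :=
        mul_le_mul hle (h.om_mono hle) (h.om_nonneg _) hmax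
    _ ≤ (1 + κ₂) * φ (max 1 k * (‖f x‖ / k)) := h.mul_om_le hmax
    _ ≤ (1 + κ₂) * (max 1 k ^ (1 + κ₂) * φ (‖f x‖ / k)) := by
        have h1 : 0 ≤ 1 + κ₂ := by
          have := h.mul_om_le (t := 1) zero_le_one
          have h2 := mul_pos one_pos (h.om_pos one_pos)
          have h3 := h.nonneg 1 zero_le_one
          by_contra hneg
          nlinarith
        exact mul_le_mul_of_nonneg_left (h.map_mul_le (le_max_left _ _) hs) h1
    _ = (1 + κ₂) * max 1 k ^ (1 + κ₂) * φ (‖f x‖ / k) := by ring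

theorem IsOrliczWith.integrableOn_map_norm (h : IsOrliczWith κ₁ κ₂ φ) {F : Type*}
    [NormedAddCommGroup F] {S : Set (Vec n)} {f : Vec n → F} (hf : MemOrlicz φ S f) :
    IntegrableOn (fun x => φ ‖f x‖) S := by
  have hc : Continuous fun t : ℝ => φ |t| :=
    h.continuousOn.comp_continuous continuous_abs fun t => abs_nonneg t
  refine (h.integrableOn_mul_om hf).mono' ?_ (Eventually.of_forall fun x => ?_)
  · simpa using hc.comp_aestronglyMeasurable hf.1.norm
  · rw [Real.norm_of_nonneg (h.nonneg _ (norm_nonneg _))]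
    exact h.le_mul_om (norm_nonneg _)

/-- φ'(t) is at most φ'(1) for t ≤ 1 and at most tφ'(t) for t ≥ 1; finite measure of K takes care of
the first part. -/
theorem IsOrliczWith.integrable_flux (h : IsOrliczWith κ₁ κ₂ φ) {P : Vec n → Mat n N}
    {K : Set (Vec n)} (hK : volume K ≠ ⊤) (hP : AEStronglyMeasurable P)
    (hPK : ∀ x, x ∉ K → P x = 0) (hH : Integrable fun x => ‖P x‖ * om φ ‖P x‖) :
    Integrable fun x => flux φ (P x) := by
  have hm : AEStronglyMeasurable fun x => flux φ (P x) :=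
    (h.continuous_flux (n := n) (N := N)).comp_aestronglyMeasurable hP
  have h0 : ∀ x, x ∉ K → flux φ (P x) = 0 := fun x hx => by simp [hPK x hx, flux]
  rw [← integrableOn_iff_integrable_of_support_subset (s := K)
    (fun x hx => by_contra fun hxK => hx (h0 x hxK))]
  refine ((integrableOn_const (C := om φ 1) hK).add hH.integrableOn).mono' hm.restrict
    (Eventually.of_forall fun x => ?_)
  rw [norm_flux φ h.om_nonneg]
  simp only [Pi.add_apply]
  rcases le_total ‖P x‖ 1 with h1 | h1
  · have := mul_nonneg (norm_nonneg (P x)) (h.om_nonneg ‖P x‖)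
    linarith [h.om_mono h1]
  · nlinarith [h.om_nonneg 1, h.om_nonneg ‖P x‖]

/-- u and Du are cut off to a neighbourhood V of the closed ball, which makes all fields globally
integrable and is invisible to mollification at small scale. Mollified Du is then the gradient of
mollified u on the ball. The mollified flux satisfies the weak equation there because mollification
can be moved onto the test function. It is not the flux of the mollified gradient; that defect is
estimated separately. -/
theorem IsLocalWeakSolution.exists_mollified (h : IsOrliczWith κ₁ κ₂ φ) {Ω : Set (Vec n)}
    (hΩ : IsOpen Ω) {u : Vec n → Vec N} {Du : Vec n → Mat n N}
    (hu : IsLocalWeakSolution φ Ω u Du) {x₀ : Vec n} {r : ℝ} (hr : Metric.closedBall x₀ r ⊆ Ω) :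
    ∃ P : Vec n → Mat n N, (∀ x ∈ Metric.closedBall x₀ r, P x = Du x) ∧ Integrable P ∧
      (Integrable fun x => ‖P x‖ * om φ ‖P x‖) ∧ (Integrable fun x => flux φ (P x)) ∧
      ∃ k₀ : ℕ, ∀ k, k₀ ≤ k →
        (∃ v : Vec n → Vec N, ContDiff ℝ ∞ v ∧
          ∀ x ∈ Metric.ball x₀ r, classicalGrad v x = mol k P x) ∧
        ∀ ζ : Vec n → Vec N, IsTestFunction (Metric.ball x₀ r) ζ →
          ∫ x in Metric.ball x₀ r,
            inner ℝ (mol k (fun y => flux φ (P y)) x) (classicalGrad ζ x) = 0 := by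
  have hKc : IsCompact (Metric.closedBall x₀ r) := isCompact_closedBall x₀ r
  obtain ⟨δ, hδ, hδΩ⟩ := hKc.exists_cthickening_subset_open hΩ hr
  obtain ⟨K, hK⟩ : ∃ K, K = Metric.cthickening δ (Metric.closedBall x₀ r) := ⟨_, rfl⟩
  obtain ⟨V, hV⟩ : ∃ V, V = Metric.thickening δ (Metric.closedBall x₀ r) := ⟨_, rfl⟩
  have hKcpt : IsCompact K := hK ▸ hKc.cthickening
  have hVo : IsOpen V := hV ▸ Metric.isOpen_thickening
  have hVK : V ⊆ K := by
    rw [hV, hK]; exact Metric.thickening_subset_cthickening _ _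
  have hKΩ : K ⊆ Ω := hK ▸ hδΩ
  have hBV : Metric.closedBall x₀ r ⊆ V := hV ▸ Metric.self_subset_thickening hδ _
  have hVΩ : V ⊆ Ω := hVK.trans hKΩ
  have hVm := hVo.measurableSet
  have hS := hu.memOrliczSobolevLoc
  have hW := hS.isWeakGradient
  obtain ⟨P, hP⟩ : ∃ P, P = V.indicator Du := ⟨_, rfl⟩
  obtain ⟨w, hw⟩ : ∃ w, w = V.indicator u := ⟨_, rfl⟩
  have hPV : ∀ x ∈ V, P x = Du x := fun x hx => by rw [hP, indicator_of_mem hx]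
  have hP0 : ∀ x, x ∉ V → P x = 0 := fun x hx => by rw [hP, indicator_of_notMem hx]
  have hwV : ∀ x ∈ V, w x = u x := fun x hx => by rw [hw, indicator_of_mem hx]
  have hPi : Integrable P := by
    rw [hP, integrable_indicator_iff hVm]
    exact (hW.locallyIntegrableOn_grad.integrableOn_compact_subset hKΩ hKcpt).mono_set hVK
  have hwi : Integrable w := by
    rw [hw, integrable_indicator_iff hVm]
    exact (hW.locallyIntegrableOn.integrableOn_compact_subset hKΩ hKcpt).mono_set hVK
  have hH : Integrable fun x => ‖P x‖ * om φ ‖P x‖ := by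
    have h1 := (h.integrableOn_mul_om (hS.memOrlicz_grad K hKcpt hKΩ)).mono_set hVK
    refine ((integrable_indicator_iff hVm).2 h1).congr (Eventually.of_forall fun x => ?_)
    by_cases hx : x ∈ V
    · simp only [indicator_of_mem hx, hPV x hx]
    · simp only [indicator_of_notMem hx, hP0 x hx, norm_zero, zero_mul]
  have hfl : Integrable fun x => flux φ (P x) :=
    h.integrable_flux hKcpt.measure_lt_top.ne hPi.aestronglyMeasurable
      (fun x hx => hP0 x fun hxV => hx (hVK hxV)) hH
  have hweak : ∀ (s : Fin n) (i : Fin N) (ψ : Vec n → ℝ), IsTestFunction V ψ →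
      ∫ y, partialDeriv s ψ y • w y i = -∫ y, ψ y • P y (s, i) := by
    intro s i ψ hψ
    have h1 := hW.integral_eq ψ (hψ.mono hVΩ) s i
    have e0 : ∀ x, x ∉ V → ψ x = 0 := fun x hx =>
      image_eq_zero_of_notMem_tsupport fun hx' => hx (hψ.tsupport_subset hx')
    have e1 : ∀ x, x ∉ V → partialDeriv s ψ x = 0 := fun x hx =>
      image_eq_zero_of_notMem_tsupport fun hx' =>
        hx (hψ.tsupport_subset (tsupport_partialDeriv_subset ψ s hx'))
    rw [setIntegral_eq_integral_of_forall_compl_eq_zero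
        (fun x hx => by rw [e1 x fun hxV => hx (hVΩ hxV), mul_zero]),
      setIntegral_eq_integral_of_forall_compl_eq_zero
        (fun x hx => by rw [e0 x fun hxV => hx (hVΩ hxV), mul_zero])] at h1
    have h2 : ∀ y, partialDeriv s ψ y • w y i = u y i * partialDeriv s ψ y := fun y => by
      by_cases hy : y ∈ V
      · rw [hwV y hy, smul_eq_mul, mul_comm]
      · rw [e1 y hy, zero_smul, mul_zero]
    have h3 : ∀ y, ψ y • P y (s, i) = Du y (s, i) * ψ y := fun y => by
      by_cases hy : y ∈ V
      · rw [hPV y hy, smul_eq_mul, mul_comm]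
      · rw [e0 y hy, zero_smul, mul_zero]
    simp only [h2, h3, h1]
  obtain ⟨k₀, hk₀⟩ := exists_closedBall_subset hKc hVo hBV
  refine ⟨P, fun x hx => hPV x (hBV hx), hPi, hH, hfl, k₀, fun k hk => ⟨⟨mol k w,
    mol_contDiff k hwi.locallyIntegrable, fun x hx => ?_⟩, fun ζ hζ => ?_⟩⟩
  · ext ⟨s, i⟩
    have hwl : LocallyIntegrable w := hwi.locallyIntegrable
    have hwil : LocallyIntegrable fun y => w y i :=
      ((EuclideanSpace.proj i : Vec N →L[ℝ] ℝ).integrable_comp hwi).locallyIntegrable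
    have hd : Differentiable ℝ (mol k w) := (mol_contDiff k hwl).differentiable (by simp)
    rw [classicalGrad_apply, ← partialDeriv_coord hd, mol_coord k hPi.locallyIntegrable]
    have : (fun y => mol k w y i) = mol k fun y => w y i := funext fun y => mol_coord k hwl y i
    simp only [this]
    exact partialDeriv_mol_eq hwil ((hk₀ k hk).2 x (Metric.ball_subset_closedBall hx))
      (hweak s i)
  · have hζc := hζ.hasCompactSupport
    have hζ1 : ContDiff ℝ 1 ζ := hζ.contDiff.of_le (by exact_mod_cast le_top)
    have hgc := classicalGrad_continuous hζ1
    have hz : ∀ x, x ∉ Metric.ball x₀ r → classicalGrad ζ x = 0 := fun x hx =>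
      image_eq_zero_of_notMem_tsupport fun hx' =>
        hx (hζ.tsupport_subset (tsupport_classicalGrad_subset ζ hx'))
    have htest : IsTestFunction V (mol k ζ) := by
      refine isTestFunction_mol hζ.contDiff.continuous hζc (Subset.trans ?_ (hk₀ k hk).1)
      exact Metric.cthickening_subset_of_subset _
        (hζ.tsupport_subset.trans Metric.ball_subset_closedBall)
    have hz' : ∀ x, x ∉ V → classicalGrad (mol k ζ) x = 0 := fun x hx =>
      image_eq_zero_of_notMem_tsupport fun hx' =>
        hx (htest.tsupport_subset (tsupport_classicalGrad_subset _ hx'))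
    rw [setIntegral_eq_integral_of_forall_compl_eq_zero
      (fun x hx => by rw [hz x hx, inner_zero_right]),
      integral_inner_mol k hfl hgc (hgc.bounded_above_of_compact_support
        (hasCompactSupport_classicalGrad hζc))]
    have h1 := hu.weak_eq _ (htest.mono hVΩ)
    rw [setIntegral_eq_integral_of_forall_compl_eq_zero
      (fun x hx => by rw [hz' x fun hxV => hx (hVΩ hxV), inner_zero_right])] at h1
    rw [← h1]
    refine integral_congr_ae (Eventually.of_forall fun x => ?_)
    simp only
    rw [← classicalGrad_mol_of_contDiff k hζ1 hζc]
    by_cases hx : x ∈ V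
    · rw [hPV x hx]
    · rw [hz' x hx, inner_zero_right, inner_zero_right]

end Flux

/-! ### Pointwise bounds for mollified gradients and for the comparison error -/

section Approximation

variable {n N : ℕ} {κ₁ κ₂ : ℝ} {φ : ℝ → ℝ}

/-- For t beyond s, monotonicity of φ' gives φ'(s)t ≤ tφ'(t). Being affine in tφ'(t), the bound can
be mollified directly. -/
theorem IsOrliczWith.le_add_mul_om_div (h : IsOrliczWith κ₁ κ₂ φ) {s t : ℝ} (hs : 0 < s)
    (ht : 0 ≤ t) : t ≤ s + (om φ s)⁻¹ * (t * om φ t) := by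
  have hos := h.om_pos hs
  rcases le_total t s with hts | hts
  · have := mul_nonneg (inv_nonneg.2 hos.le) (mul_nonneg ht (h.om_nonneg t))
    linarith
  · have h1 : om φ s * t ≤ t * om φ t := by
      rw [mul_comm]; exact mul_le_mul_of_nonneg_left (h.om_mono hts) ht
    have h2 : t ≤ (om φ s)⁻¹ * (t * om φ t) := by
      rw [← div_eq_inv_mul, le_div_iff₀ hos]; linarith
    linarith

theorem IsOrliczWith.om_le_add_mul_om_div (h : IsOrliczWith κ₁ κ₂ φ) {s t : ℝ} (hs : 0 < s)
    (ht : 0 ≤ t) : om φ t ≤ om φ s + s⁻¹ * (t * om φ t) := by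
  rcases le_total t s with hts | hts
  · have := mul_nonneg (inv_nonneg.2 hs.le) (mul_nonneg ht (h.om_nonneg t))
    linarith [h.om_mono hts]
  · have h1 : s * om φ t ≤ t * om φ t := mul_le_mul_of_nonneg_right hts (h.om_nonneg t)
    have h2 : om φ t ≤ s⁻¹ * (t * om φ t) := by
      rw [← div_eq_inv_mul, le_div_iff₀ hs]; linarith
    linarith [h.om_nonneg s]

theorem mol_const_add_mul (k : ℕ) {g : Vec n → ℝ} (hg : LocallyIntegrable g) (a c : ℝ)
    (x : Vec n) : mol k (fun y => a + c * g y) x = a + c * mol k g x := by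
  have h1 : ∀ y, mker n k (x - y) • (a + c * g y)
      = a * mker n k (x - y) + c * (mker n k (x - y) • g y) := fun y => by
    simp only [smul_eq_mul]; ring
  have h2 : mol k (fun y => a + c * g y) x = ∫ y, mker n k (x - y) • (a + c * g y) := rfl
  have h3 : mol k g x = ∫ y, mker n k (x - y) • g y := rfl
  rw [h2, h3, integral_congr_ae (Eventually.of_forall h1),
    integral_add ((mker_sub_integrable k x).const_mul a)
      ((mol_integrand_integrable k hg x).const_mul c),
    integral_const_mul, integral_const_mul, integral_mker_sub, mul_one]

theorem locallyIntegrable_const_add_mul {g : Vec n → ℝ} (hg : LocallyIntegrable g) (a c : ℝ) :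
    LocallyIntegrable fun y => a + c * g y :=
  (locallyIntegrable_const a).add (hg.smul c)

/-- The affine majorants of t and φ'(t) in terms of tφ'(t) are averaged at a value s with sφ'(s)
above the average of |P|φ'(|P|). This bounds the mollified gradient and the mollified flux by the
same s, in place of Jensen's inequality for φ and its conjugate. -/
theorem IsOrliczWith.norm_mol_le_of_pos (h : IsOrliczWith κ₁ κ₂ φ) {P : Vec n → Mat n N}
    (hP : Integrable P) (hH : Integrable fun x => ‖P x‖ * om φ ‖P x‖)
    (hfl : Integrable fun x => flux φ (P x)) {k : ℕ} {x : Vec n} {s : ℝ} (hs : 0 < s)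
    (hsx : mol k (fun y => ‖P y‖ * om φ ‖P y‖) x ≤ s * om φ s) :
    ‖mol k P x‖ ≤ 2 * s ∧ ‖mol k (fun y => flux φ (P y)) x‖ ≤ 2 * om φ s := by
  have hos := h.om_pos hs
  have hHl := hH.locallyIntegrable
  constructor
  · calc ‖mol k P x‖ ≤ mol k (fun y => ‖P y‖) x := norm_mol_le k P x
      _ ≤ mol k (fun y => s + (om φ s)⁻¹ * (‖P y‖ * om φ ‖P y‖)) x :=
        mol_mono k hP.norm.locallyIntegrable (locallyIntegrable_const_add_mul hHl _ _)
          (fun y => h.le_add_mul_om_div hs (norm_nonneg _)) x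
      _ = s + (om φ s)⁻¹ * mol k (fun y => ‖P y‖ * om φ ‖P y‖) x :=
        mol_const_add_mul k hHl _ _ x
      _ ≤ s + (om φ s)⁻¹ * (s * om φ s) := by gcongr
      _ = 2 * s := by field_simp; ring
  · calc ‖mol k (fun y => flux φ (P y)) x‖ ≤ mol k (fun y => ‖flux φ (P y)‖) x :=
          norm_mol_le k _ x
      _ ≤ mol k (fun y => om φ s + s⁻¹ * (‖P y‖ * om φ ‖P y‖)) x :=
        mol_mono k hfl.norm.locallyIntegrable (locallyIntegrable_const_add_mul hHl _ _)
          (fun y => by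
            rw [norm_flux φ h.om_nonneg]
            exact h.om_le_add_mul_om_div hs (norm_nonneg _)) x
      _ = om φ s + s⁻¹ * mol k (fun y => ‖P y‖ * om φ ‖P y‖) x :=
        mol_const_add_mul k hHl _ _ x
      _ ≤ om φ s + s⁻¹ * (s * om φ s) := by gcongr
      _ = 2 * om φ s := by field_simp; ring

theorem IsOrliczWith.norm_mol_le (h : IsOrliczWith κ₁ κ₂ φ) {P : Vec n → Mat n N}
    (hP : Integrable P) (hH : Integrable fun x => ‖P x‖ * om φ ‖P x‖)
    (hfl : Integrable fun x => flux φ (P x)) {k : ℕ} {x : Vec n} {s : ℝ} (hs : 0 ≤ s)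
    (hsx : mol k (fun y => ‖P y‖ * om φ ‖P y‖) x ≤ s * om φ s) :
    ‖mol k P x‖ ≤ 2 * s ∧ ‖mol k (fun y => flux φ (P y)) x‖ ≤ 2 * om φ s := by
  -- The case s = 0 is reached by letting t decrease to s, since the affine majorants need a
  -- positive point.
  have hev : ∀ᶠ t in 𝓝[>] s, ‖mol k P x‖ ≤ 2 * t ∧
      ‖mol k (fun y => flux φ (P y)) x‖ ≤ 2 * om φ t := by
    filter_upwards [self_mem_nhdsWithin] with t ht
    have ht' : s < t := ht
    refine h.norm_mol_le_of_pos hP hH hfl (hs.trans_lt ht') (hsx.trans ?_)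
    exact mul_le_mul ht'.le (h.om_mono ht'.le) (h.om_nonneg _) (hs.trans ht'.le)
  have h1 : Tendsto (fun t : ℝ => 2 * t) (𝓝[>] s) (𝓝 (2 * s)) :=
    ((continuous_const.mul continuous_id).tendsto s).mono_left nhdsWithin_le_nhds
  have h2 : Tendsto (fun t : ℝ => 2 * om φ t) (𝓝[>] s) (𝓝 (2 * om φ s)) :=
    ((continuous_const.mul h.om_continuous).tendsto s).mono_left nhdsWithin_le_nhds
  exact ⟨ge_of_tendsto h1 (hev.mono fun t ht => ht.1),
    ge_of_tendsto h2 (hev.mono fun t ht => ht.2)⟩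

theorem norm_flux_sub_regFlux_le {α : ℝ → ℝ} {ε : ℝ}
    (hε : 0 ≤ ε) {Q : Mat n N} (hQ : |‖Q‖ * α (‖Q‖ ^ 2) - om φ ‖Q‖| ≤ ε) :
    ‖flux φ Q - regFlux α Q‖ ≤ ε := by
  rcases eq_or_ne Q 0 with rfl | hQ0
  · simpa [flux, regFlux] using hε
  · have hQ' : 0 < ‖Q‖ := norm_pos_iff.2 hQ0
    have h1 : flux φ Q - regFlux α Q = (om φ ‖Q‖ / ‖Q‖ - α (‖Q‖ ^ 2)) • Q := by
      rw [flux, regFlux, ← IsOrliczWith.om_of_pos hQ', sub_smul]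
    have h2 : ‖Q‖ * α (‖Q‖ ^ 2) - om φ ‖Q‖ = -((om φ ‖Q‖ / ‖Q‖ - α (‖Q‖ ^ 2)) * ‖Q‖) := by
      field_simp; ring
    rw [h1, norm_smul, Real.norm_eq_abs]
    rwa [h2, abs_neg, abs_mul, abs_of_pos hQ'] at hQ

theorem IsOrliczWith.norm_sub_flux_le (h : IsOrliczWith κ₁ κ₂ φ) {F Q : Mat n N} {s : ℝ}
    (hs : 0 ≤ s) (hQ : ‖Q‖ ≤ 2 * s) (hF : ‖F‖ ≤ 2 * om φ s) :
    ‖F - flux φ Q‖ ≤ (2 + 2 ^ κ₂) * om φ s := by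
  have h1 := norm_sub_le F (flux φ Q)
  rw [norm_flux φ h.om_nonneg] at h1
  have h2 := (h.om_mono hQ).trans (h.om_mul_le one_le_two hs)
  linarith

/-- The error F − A_α(Q) consists of the mollification defect f and a regularisation error ≤ ε. The
term f|W| is the delicate one: for |W| ≤ Λs it is a multiple of fs, which has a small integral, and
for larger |W| it is a fraction Λ^(−m) of the energy of W. Everything else carries a factor ε. -/
theorem IsOrliczWith.inner_sub_regFlux_le (h : IsOrliczWith κ₁ κ₂ φ) {α : ℝ → ℝ} {lo hi m M : ℝ}
    (hα : RegCoef α lo hi m M) {F Q W : Mat n N} {s ε T Λ : ℝ} (hs : 0 ≤ s)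
    (hQ : ‖Q‖ ≤ 2 * s) (hF : ‖F‖ ≤ 2 * om φ s) (hT : 2 * s ≤ T) (hT1 : 1 ≤ T) (hε : 0 ≤ ε)
    (hε1 : ε ≤ om φ 1 / 2)
    (hnear : ∀ t, 0 ≤ t → t ≤ T → |t * α (t ^ 2) - om φ t| ≤ ε) (hΛ : 1 ≤ Λ) :
    inner ℝ (F - regFlux α Q) (W - Q) ≤ (Λ + 2) * (‖F - flux φ Q‖ * s)
      + ((2 + 2 ^ κ₂) * Λ ^ (-m) + ε * ((5 + 2 ^ κ₂) * (1 + 2 / om φ 1)))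
        * (α (‖W‖ ^ 2) * ‖W‖ ^ 2)
      + ε * ((5 + 2 ^ κ₂) * (1 + 2 / om φ 1)) * (1 + s * om φ s) := by
  have ho1 := h.om_pos one_pos
  obtain ⟨A, hA⟩ : ∃ A : ℝ, A = 2 + 2 ^ κ₂ := ⟨_, rfl⟩
  have h2κ : (0 : ℝ) < 2 ^ κ₂ := Real.rpow_pos_of_pos two_pos _
  have hA0 : 0 < A := by rw [hA]; positivity
  obtain ⟨f, hf⟩ : ∃ f, f = ‖F - flux φ Q‖ := ⟨_, rfl⟩
  have hf0 : 0 ≤ f := hf ▸ norm_nonneg _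
  have hfA : f ≤ A * om φ s := by rw [hf, hA]; exact h.norm_sub_flux_le hs hQ hF
  obtain ⟨w, hw⟩ : ∃ w, w = ‖W‖ := ⟨_, rfl⟩
  have hw0 : 0 ≤ w := hw ▸ norm_nonneg _
  obtain ⟨E, hE⟩ : ∃ E, E = α (w ^ 2) * w ^ 2 := ⟨_, rfl⟩
  have hE0 : 0 ≤ E := by
    rw [hE]; exact mul_nonneg (hα.pos (sq_nonneg w)).le (sq_nonneg w)
  have hEw : E = w * (w * α (w ^ 2)) := by rw [hE]; ring
  have hos := h.om_nonneg s
  have hsub : ‖F - regFlux α Q‖ ≤ f + ε := by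
    have h1 : F - regFlux α Q = (F - flux φ Q) + (flux φ Q - regFlux α Q) := by abel
    rw [h1, hf]
    exact (norm_add_le _ _).trans (add_le_add le_rfl
      (norm_flux_sub_regFlux_le hε (hnear _ (norm_nonneg _) (hQ.trans hT))))
  have hin : inner ℝ (F - regFlux α Q) (W - Q) ≤ (f + ε) * (w + 2 * s) := by
    refine (real_inner_le_norm _ _).trans (mul_le_mul hsub ?_ (norm_nonneg _) (by linarith))
    have := norm_sub_le W Q
    rw [hw]; linarith
  -- At t = 1 the regularised derivative is at least φ'(1) − ε ≥ φ'(1)/2, and it increases, so the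
  -- energy controls |W| linearly for |W| ≥ 1.
  have hwE : w ≤ 1 + 2 / om φ 1 * E := by
    rcases le_total w 1 with h1 | h1
    · have : 0 ≤ 2 / om φ 1 * E := by positivity
      linarith
    · have h2 : 1 * α (1 ^ 2) ≤ w * α (w ^ 2) := hα.monotone_mul_self h1
      have h3 := (abs_le.1 (hnear 1 zero_le_one hT1)).1
      have h4 : om φ 1 / 2 ≤ w * α (w ^ 2) := by linarith
      have h5 : w * (om φ 1 / 2) ≤ E := by
        rw [hEw]; exact mul_le_mul_of_nonneg_left h4 hw0
      have h6 : w ≤ 2 / om φ 1 * E := by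
        rw [div_mul_eq_mul_div, le_div_iff₀ ho1]; linarith
      linarith
  have hsE : s ≤ 1 + 2 / om φ 1 * (s * om φ s) := by
    have h1 := h.le_add_mul_om_div one_pos hs
    have h2 : (om φ 1)⁻¹ * (s * om φ s) ≤ 2 / om φ 1 * (s * om φ s) := by
      refine mul_le_mul_of_nonneg_right ?_ (mul_nonneg hs hos)
      rw [← one_div]
      gcongr
      norm_num
    linarith
  -- For |W| ≥ Λs the lower growth gives sα(s²) ≤ Λ^(−m)|W|α(|W|²). Since f is at most a multiple of
  -- φ'(s), hence of sα(s²) + ε, the factor Λ^(−m) appears in front of the energy.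
  have hfw : f * w ≤ Λ * (f * s) + A * Λ ^ (-m) * E + A * ε * w := by
    have hΛ0 : 0 < Λ := by linarith
    have hΛm : 0 < Λ ^ (-m) := Real.rpow_pos_of_pos hΛ0 _
    have hp1 : 0 ≤ A * Λ ^ (-m) * E := by positivity
    have hp2 : 0 ≤ A * ε * w := by positivity
    rcases le_total w (Λ * s) with h1 | h1
    · have := mul_le_mul_of_nonneg_left h1 hf0
      linarith
    · have h2 := hα.rpow_mul_le hΛ hs
      have h3 : Λ * s * α ((Λ * s) ^ 2) ≤ w * α (w ^ 2) := hα.monotone_mul_self h1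
      have h4 : s * α (s ^ 2) ≤ Λ ^ (-m) * (w * α (w ^ 2)) := by
        rw [Real.rpow_neg hΛ0.le, ← div_eq_inv_mul, le_div_iff₀ (Real.rpow_pos_of_pos hΛ0 _)]
        linarith
      have h5 := (abs_le.1 (hnear s hs (by linarith))).1
      have h6 : f ≤ A * (Λ ^ (-m) * (w * α (w ^ 2)) + ε) :=
        hfA.trans (mul_le_mul_of_nonneg_left (by linarith) hA0.le)
      have h7 := mul_le_mul_of_nonneg_right h6 hw0
      have h8 : 0 ≤ Λ * (f * s) := by positivity
      have h9 : A * (Λ ^ (-m) * (w * α (w ^ 2)) + ε) * w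
          = A * Λ ^ (-m) * E + A * ε * w := by rw [hEw]; ring
      linarith
  have hA5 : (5 : ℝ) + 2 ^ κ₂ = A + 3 := by rw [hA]; ring
  rw [hA5, ← hA, ← hf, ← hw, ← hE]
  obtain ⟨c, hc⟩ : ∃ c, c = 2 / om φ 1 := ⟨_, rfl⟩
  have hc0 : 0 < c := by rw [hc]; positivity
  rw [← hc] at hwE hsE ⊢
  obtain ⟨Y, hY⟩ : ∃ Y, Y = s * om φ s := ⟨_, rfl⟩
  have hY0 : 0 ≤ Y := by rw [hY]; positivity
  rw [← hY] at hsE ⊢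
  have e1 : (A * ε + ε) * w ≤ (A * ε + ε) * (1 + c * E) :=
    mul_le_mul_of_nonneg_left hwE (by positivity)
  have e2 : ε * 2 * s ≤ ε * 2 * (1 + c * Y) := mul_le_mul_of_nonneg_left hsE (by positivity)
  have e3 : 0 ≤ ε * ((A + 1) * c * Y) := by positivity
  have e4 : 0 ≤ ε * ((A + 3) * Y) := by positivity
  have e5 : 0 ≤ ε * (2 * c * E) := by positivity
  have e6 : 0 ≤ ε * ((A + 3) * E) := by positivity
  have e7 : 0 ≤ ε * ((A + 3) * c) := by positivity
  calc inner ℝ (F - regFlux α Q) (W - Q) ≤ (f + ε) * (w + 2 * s) := hin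
    _ = f * w + ε * w + 2 * (f * s) + ε * 2 * s := by ring
    _ ≤ Λ * (f * s) + A * Λ ^ (-m) * E + (A * ε + ε) * (1 + c * E) + 2 * (f * s)
        + ε * 2 * (1 + c * Y) := by linarith
    _ ≤ (Λ + 2) * (f * s) + (A * Λ ^ (-m) + ε * ((A + 3) * (1 + c))) * E
        + ε * ((A + 3) * (1 + c)) * (1 + Y) := by linarith

end Approximation

/-! ### Convergence of the energies and of the comparison error -/

section Limits

variable {n N : ℕ} {κ₁ κ₂ : ℝ} {φ : ℝ → ℝ}

/-- A nonnegative solution `s` of `s * φ' s = y`. -/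
theorem IsOrliczWith.exists_inverse (h : IsOrliczWith κ₁ κ₂ φ) :
    ∃ S : ℝ → ℝ, Monotone S ∧ (∀ y, 0 ≤ S y) ∧ ∀ y, 0 ≤ y → S y * om φ (S y) = y := by
  choose S hS0 hS using fun y : ℝ => h.exists_mul_om_eq (le_max_right y 0)
  refine ⟨S, fun a b hab => ?_, hS0, fun y hy => by rw [hS, max_eq_left hy]⟩
  refine (h.mul_om_strictMonoOn.le_iff_le (hS0 a) (hS0 b)).1 ?_
  simp only [hS]
  exact max_le_max_right 0 hab

theorem tendsto_setIntegral_of_le_mol {g : Vec n → ℝ} (hg : Integrable g)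
    {U : Set (Vec n)} (hU : MeasurableSet U) (hUf : volume U ≠ ⊤)
    {Φ : ℕ → Vec n → ℝ} {Ψ : Vec n → ℝ}
    (hΦ : ∀ k, AEStronglyMeasurable (Φ k) (volume.restrict U)) {C c : ℝ}
    (hg0 : ∀ x, 0 ≤ g x) (hC : 0 ≤ C)
    (hb : ∀ k, ∀ x ∈ U, |Φ k x| ≤ C * mol k g x + c)
    (hlim : ∀ᵐ x, x ∈ U → Tendsto (fun k => Φ k x) atTop (𝓝 (Ψ x))) :
    Tendsto (fun k => ∫ x in U, Φ k x) atTop (𝓝 (∫ x in U, Ψ x)) := by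
  simp only [← integral_indicator hU]
  refine tendsto_integral_of_le_mol (k₀ := 0) (C := C) hg
    ((integrable_indicator_iff hU).2 (integrableOn_const (C := c) hUf))
    (fun k => (aestronglyMeasurable_indicator_iff hU).2 (hΦ k)) (fun k _ x => ?_) ?_
  · by_cases hx : x ∈ U
    · simp only [indicator_of_mem hx]
      exact hb k x hx
    · simp only [indicator_of_notMem hx, abs_zero, add_zero]
      exact mul_nonneg hC (mol_nonneg k hg0 x)
  · filter_upwards [hlim] with x hx
    by_cases hxU : x ∈ U
    · simpa only [indicator_of_mem hxU] using hx hxU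
    · simp only [indicator_of_notMem hxU]
      exact tendsto_const_nhds

variable {P : Vec n → Mat n N} {U : Set (Vec n)}

/-- The integrand is at most (2 + 2^κ₂) times the mollification of |P|φ'(|P|), because S inverts
tφ'(t). It tends to zero almost everywhere: both fluxes converge to the flux of P, while S stays
bounded where the mollified density converges. -/
theorem IsOrliczWith.tendsto_integral_defect (h : IsOrliczWith κ₁ κ₂ φ) (hP : Integrable P)
    (hH : Integrable fun x => ‖P x‖ * om φ ‖P x‖) (hfl : Integrable fun x => flux φ (P x))
    (hU : MeasurableSet U) (hUf : volume U ≠ ⊤) {S : ℝ → ℝ} (hS : Monotone S)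
    (hS0 : ∀ y, 0 ≤ S y) (hSe : ∀ y, 0 ≤ y → S y * om φ (S y) = y) :
    Tendsto (fun k => ∫ x in U, ‖mol k (fun y => flux φ (P y)) x - flux φ (mol k P x)‖
      * S (mol k (fun y => ‖P y‖ * om φ ‖P y‖) x)) atTop (𝓝 0) := by
  obtain ⟨H, hHd⟩ : ∃ H : Vec n → ℝ, H = fun y => ‖P y‖ * om φ ‖P y‖ := ⟨_, rfl⟩
  rw [← hHd] at hH ⊢
  have hH0 : ∀ y, 0 ≤ H y := fun y => by
    rw [hHd]; exact mul_nonneg (norm_nonneg _) (h.om_nonneg _)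
  have hpt : ∀ k x, ‖mol k P x‖ ≤ 2 * S (mol k H x) ∧
      ‖mol k (fun y => flux φ (P y)) x‖ ≤ 2 * om φ (S (mol k H x)) := fun k x =>
    h.norm_mol_le hP (hHd ▸ hH) hfl (hS0 _) (by
      rw [← hHd, hSe _ (mol_nonneg k hH0 x)])
  have hcQ : ∀ k, Continuous (mol k P) := fun k =>
    (mol_contDiff k hP.locallyIntegrable).continuous
  have hcH : ∀ k, Continuous (mol k H) := fun k =>
    (mol_contDiff k hH.locallyIntegrable).continuous
  have hcF : ∀ k, Continuous (mol k fun y => flux φ (P y)) := fun k =>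
    (mol_contDiff k hfl.locallyIntegrable).continuous
  have hA : (0 : ℝ) ≤ 2 + 2 ^ κ₂ := by positivity
  have key := tendsto_setIntegral_of_le_mol hH hU hUf
    (Φ := fun k x => ‖mol k (fun y => flux φ (P y)) x - flux φ (mol k P x)‖ * S (mol k H x))
    (Ψ := fun _ => 0) (C := 2 + 2 ^ κ₂) (c := 0)
    (fun k => ((((hcF k).sub (h.continuous_flux.comp (hcQ k))).norm.measurable.mul
      (hS.measurable.comp (hcH k).measurable))).aestronglyMeasurable) hH0 hA
    (fun k x _ => ?_) ?_
  · simpa using key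
  · have hb := h.norm_sub_flux_le (hS0 _) (hpt k x).1 (hpt k x).2
    rw [abs_of_nonneg (mul_nonneg (norm_nonneg _) (hS0 _)), add_zero]
    calc _ ≤ (2 + 2 ^ κ₂) * om φ (S (mol k H x)) * S (mol k H x) :=
          mul_le_mul_of_nonneg_right hb (hS0 _)
      _ = (2 + 2 ^ κ₂) * (S (mol k H x) * om φ (S (mol k H x))) := by ring
      _ = (2 + 2 ^ κ₂) * mol k H x := by rw [hSe _ (mol_nonneg k hH0 x)]
  · filter_upwards [mol_tendsto_ae hP.locallyIntegrable, mol_tendsto_ae hH.locallyIntegrable,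
      mol_tendsto_ae hfl.locallyIntegrable] with x hx1 hx2 hx3 _
    have h1 : Tendsto (fun k => ‖mol k (fun y => flux φ (P y)) x - flux φ (mol k P x)‖)
        atTop (𝓝 0) := by
      have := (hx3.sub ((h.continuous_flux.tendsto (P x)).comp hx1)).norm
      simpa using this
    have h2 : Tendsto (fun k => ‖mol k (fun y => flux φ (P y)) x - flux φ (mol k P x)‖
        * S (H x + 1)) atTop (𝓝 0) := by simpa using h1.mul_const (S (H x + 1))
    refine squeeze_zero' (Eventually.of_forall fun k => mul_nonneg (norm_nonneg _) (hS0 _)) ?_ h2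
    filter_upwards [hx2.eventually_lt_const (lt_add_one (H x))] with k hk
    exact mul_le_mul_of_nonneg_left (hS hk.le) (norm_nonneg _)

/-- The mollified gradient stays in the range where the regularised derivative is ε_k-close to φ',
so the integrand converges almost everywhere. The choice of S and the doubling of φ' bound it by a
multiple of the mollified density plus a constant. -/
theorem IsOrliczWith.tendsto_integral_energy (h : IsOrliczWith κ₁ κ₂ φ) (hP : Integrable P)
    (hH : Integrable fun x => ‖P x‖ * om φ ‖P x‖) (hfl : Integrable fun x => flux φ (P x))
    (hU : MeasurableSet U) (hUf : volume U ≠ ⊤) {S : ℝ → ℝ}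
    (hS0 : ∀ y, 0 ≤ S y) (hSe : ∀ y, 0 ≤ y → S y * om φ (S y) = y)
    {α : ℕ → ℝ → ℝ} {ε T : ℕ → ℝ} (hα : ∀ k, Continuous fun Q : Mat n N => α k (‖Q‖ ^ 2))
    (hε : Tendsto ε atTop (𝓝 0)) (hε1 : ∀ k, ε k ≤ 1)
    (hT : ∀ k, ∀ x ∈ U, 2 * S (mol k (fun y => ‖P y‖ * om φ ‖P y‖) x) ≤ T k)
    (hnear : ∀ k t, 0 ≤ t → t ≤ T k → |t * α k (t ^ 2) - om φ t| ≤ ε k) :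
    Tendsto (fun k => ∫ x in U, α k (‖mol k P x‖ ^ 2) * ‖mol k P x‖ ^ 2) atTop
      (𝓝 (∫ x in U, ‖P x‖ * om φ ‖P x‖)) := by
  obtain ⟨H, hHd⟩ : ∃ H : Vec n → ℝ, H = fun y => ‖P y‖ * om φ ‖P y‖ := ⟨_, rfl⟩
  simp only [← hHd] at hT
  have hH' : Integrable H := hHd ▸ hH
  have hH0 : ∀ y, 0 ≤ H y := fun y => by
    rw [hHd]; exact mul_nonneg (norm_nonneg _) (h.om_nonneg _)
  have hpt : ∀ k x, ‖mol k P x‖ ≤ 2 * S (mol k H x) := fun k x =>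
    (h.norm_mol_le hP hH hfl (hS0 _) (by
      rw [← hHd, hSe _ (mol_nonneg k hH0 x)])).1
  have hcQ : ∀ k, Continuous (mol k P) := fun k =>
    (mol_contDiff k hP.locallyIntegrable).continuous
  have ho1 := h.om_pos one_pos
  have hnear' : ∀ k, ∀ x ∈ U, |‖mol k P x‖ * α k (‖mol k P x‖ ^ 2) - om φ ‖mol k P x‖| ≤ ε k :=
    fun k x hx => hnear k _ (norm_nonneg _) ((hpt k x).trans (hT k x hx))
  refine tendsto_setIntegral_of_le_mol hH' hU hUf
    (C := 2 * (2 ^ κ₂ + (om φ 1)⁻¹)) (c := 2)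
    (fun k => ?_) hH0 (by positivity) (fun k x hx => ?_) ?_
  · exact (((hα k).comp (hcQ k)).mul ((hcQ k).norm.pow 2)).aestronglyMeasurable
  · obtain ⟨s, hs⟩ : ∃ s, s = S (mol k H x) := ⟨_, rfl⟩
    obtain ⟨q, hq⟩ : ∃ q, q = ‖mol k P x‖ := ⟨_, rfl⟩
    have hs0 : 0 ≤ s := hs ▸ hS0 _
    have hq0 : 0 ≤ q := hq ▸ norm_nonneg _
    have hqs : q ≤ 2 * s := by rw [hq, hs]; exact hpt k x
    have h1 := hnear' k x hx
    rw [← hq] at h1 ⊢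
    have hm : s * om φ s = mol k H x := by rw [hs, hSe _ (mol_nonneg k hH0 x)]
    have h2 : |q * α k (q ^ 2)| ≤ om φ q + ε k := by
      have := abs_sub_abs_le_abs_sub (q * α k (q ^ 2)) (om φ q)
      rw [abs_of_nonneg (h.om_nonneg q)] at this
      linarith
    have h3 : om φ q ≤ 2 ^ κ₂ * om φ s := (h.om_mono hqs).trans (h.om_mul_le one_le_two hs0)
    have h4 := h.le_add_mul_om_div one_pos hs0
    rw [hm] at h4
    have h5 : α k (q ^ 2) * q ^ 2 = q * (q * α k (q ^ 2)) := by ring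
    rw [h5, abs_mul, abs_of_nonneg hq0]
    calc q * |q * α k (q ^ 2)| ≤ 2 * s * (2 ^ κ₂ * om φ s + 1) :=
          mul_le_mul hqs (by linarith [hε1 k]) (abs_nonneg _) (by positivity)
      _ = 2 * 2 ^ κ₂ * (s * om φ s) + 2 * s := by ring
      _ ≤ 2 * 2 ^ κ₂ * mol k H x + 2 * (1 + (om φ 1)⁻¹ * mol k H x) := by rw [hm]; linarith
      _ = 2 * (2 ^ κ₂ + (om φ 1)⁻¹) * mol k H x + 2 := by ring
  · filter_upwards [mol_tendsto_ae hP.locallyIntegrable] with x hx hxU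
    have h1 : Tendsto (fun k => om φ ‖mol k P x‖) atTop (𝓝 (om φ ‖P x‖)) :=
      (h.om_continuous.tendsto _).comp hx.norm
    have h2 : Tendsto (fun k => ‖mol k P x‖ * α k (‖mol k P x‖ ^ 2) - om φ ‖mol k P x‖) atTop
        (𝓝 0) :=
      squeeze_zero_norm (fun k => hnear' k x hxU) hε
    have h3 := hx.norm.mul (h2.add h1)
    rw [zero_add] at h3
    refine h3.congr fun k => ?_
    ring

/-- For fixed Λ the terms X and Y disappear in the limit and leave AΛ^(−m)L; then Λ → ∞. The order
matters, since Λ multiplies X. -/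
theorem tendsto_zero_of_le_rpow {D X Y E : ℕ → ℝ} {m A L : ℝ} (hm : 0 < m) {k₀ : ℕ}
    (hD : ∀ k, k₀ ≤ k → 0 ≤ D k) (hX : Tendsto X atTop (𝓝 0)) (hY : Tendsto Y atTop (𝓝 0))
    (hE : Tendsto E atTop (𝓝 L))
    (hle : ∀ Λ : ℝ, 1 ≤ Λ → ∀ k, k₀ ≤ k →
      D k ≤ (Λ + 2) * X k + A * Λ ^ (-m) * E k + Y k) :
    Tendsto D atTop (𝓝 0) := by
  have hlim : Tendsto (fun Λ : ℝ => A * Λ ^ (-m) * L) atTop (𝓝 0) := by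
    have := ((tendsto_rpow_neg_atTop hm).const_mul A).mul_const L
    simpa using this
  refine tendsto_order.2 ⟨fun a ha => ?_, fun a ha => ?_⟩
  · filter_upwards [eventually_ge_atTop k₀] with k hk
    exact ha.trans_le (hD k hk)
  · obtain ⟨Λ, hΛa, hΛ⟩ := ((hlim.eventually_lt_const ha).and (eventually_ge_atTop 1)).exists
    have h1 : Tendsto (fun k => (Λ + 2) * X k + A * Λ ^ (-m) * E k + Y k) atTop
        (𝓝 (A * Λ ^ (-m) * L)) := by
      have := ((hX.const_mul (Λ + 2)).add (hE.const_mul (A * Λ ^ (-m)))).add hY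
      simpa using this
    filter_upwards [h1.eventually_lt_const hΛa, eventually_ge_atTop k₀] with k hk hk0
    exact (hle Λ hΛ k hk0).trans_lt hk

/-- Both the regularised flux of W and F are orthogonal to W − Q, so the flux of W may be replaced
by F. The pointwise estimate is then integrated. -/
theorem IsOrliczWith.integral_inner_sub_regFlux_le (h : IsOrliczWith κ₁ κ₂ φ) {α : ℝ → ℝ}
    {lo hi m M : ℝ} (hα : RegCoef α lo hi m M) (hU : MeasurableSet U) (hUf : volume U ≠ ⊤)
    {F Q W : Vec n → Mat n N} {s : Vec n → ℝ} {ε T : ℝ}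
    (hFm : MemLp F 2 (volume.restrict U)) (hQm : MemLp Q 2 (volume.restrict U))
    (hWm : MemLp W 2 (volume.restrict U))
    (hsi : IntegrableOn (fun x => s x * om φ (s x)) U)
    (hfi : IntegrableOn (fun x => ‖F x - flux φ (Q x)‖ * s x) U)
    (hs : ∀ x ∈ U, 0 ≤ s x) (hQ : ∀ x ∈ U, ‖Q x‖ ≤ 2 * s x)
    (hF : ∀ x ∈ U, ‖F x‖ ≤ 2 * om φ (s x)) (hT : ∀ x ∈ U, 2 * s x ≤ T) (hT1 : 1 ≤ T)
    (hε : 0 ≤ ε) (hε1 : ε ≤ om φ 1 / 2)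
    (hnear : ∀ t, 0 ≤ t → t ≤ T → |t * α (t ^ 2) - om φ t| ≤ ε)
    (hW0 : ∫ x in U, inner ℝ (regFlux α (W x)) (W x - Q x) = 0)
    (hF0 : ∫ x in U, inner ℝ (F x) (W x - Q x) = 0) {Λ : ℝ} (hΛ : 1 ≤ Λ) :
    ∫ x in U, inner ℝ (regFlux α (W x) - regFlux α (Q x)) (W x - Q x) ≤
      (Λ + 2) * (∫ x in U, ‖F x - flux φ (Q x)‖ * s x)
      + ((2 + 2 ^ κ₂) * Λ ^ (-m) + ε * ((5 + 2 ^ κ₂) * (1 + 2 / om φ 1)))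
        * (∫ x in U, α (‖W x‖ ^ 2) * ‖W x‖ ^ 2)
      + ε * ((5 + 2 ^ κ₂) * (1 + 2 / om φ 1))
        * ((volume U).toReal + ∫ x in U, s x * om φ (s x)) := by
  have hfin : IsFiniteMeasure (volume.restrict U) := isFiniteMeasure_restrict.2 hUf
  have hreg : ∀ {V : Vec n → Mat n N}, MemLp V 2 (volume.restrict U) →
      MemLp (fun x => regFlux α (V x)) 2 (volume.restrict U) := fun {V} hV =>
    MemLp.of_le_mul hV (hα.continuous_regFlux.comp_aestronglyMeasurable hV.1)
      (Eventually.of_forall fun x => hα.norm_regFlux_le _)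
  have hWQ := hWm.sub hQm
  have i1 := integrable_inner_of_memLp (hreg hWm) hWQ
  have i2 := integrable_inner_of_memLp (hreg hQm) hWQ
  have i3 := integrable_inner_of_memLp hFm hWQ
  have iW : IntegrableOn (fun x => α (‖W x‖ ^ 2) * ‖W x‖ ^ 2) U := by
    refine (integrable_inner_of_memLp (hreg hWm) hWm).congr (Eventually.of_forall fun x => ?_)
    simp only [regFlux, inner_smul_left, real_inner_self_eq_norm_sq]
    simp
  have e1 : ∫ x in U, inner ℝ (regFlux α (W x) - regFlux α (Q x)) (W x - Q x)
      = ∫ x in U, inner ℝ (F x - regFlux α (Q x)) (W x - Q x) := by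
    simp only [inner_sub_left (𝕜 := ℝ)]
    simp only [Pi.sub_apply] at i1 i2 i3
    rw [integral_sub i1 i2, integral_sub i3 i2, hW0, hF0]
  obtain ⟨B, hB⟩ : ∃ B : ℝ, B = ε * ((5 + 2 ^ κ₂) * (1 + 2 / om φ 1)) := ⟨_, rfl⟩
  have ione : IntegrableOn (fun _ : Vec n => (1 : ℝ)) U := integrableOn_const hUf
  have j1 := hfi.const_mul (Λ + 2)
  have j2 := iW.const_mul ((2 + 2 ^ κ₂) * Λ ^ (-m) + B)
  have j3 := (ione.add hsi).const_mul B
  have e2 : (volume U).toReal + ∫ x in U, s x * om φ (s x)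
      = ∫ x in U, (1 + s x * om φ (s x)) := by
    rw [integral_add ione hsi]
    simp [Measure.real]
  rw [e1, ← hB, e2, ← integral_const_mul, ← integral_const_mul, ← integral_const_mul,
    ← integral_add j1 j2]
  simp only [Pi.add_apply] at j3
  have j12 := j1.add j2
  simp only [Pi.add_def] at j12
  have j4 := j12.add j3
  simp only [Pi.add_def] at j4
  rw [← integral_add j12 j3]
  refine setIntegral_mono_on ?_ j4 hU fun x hx => ?_
  · simp only [inner_sub_left (𝕜 := ℝ)]
    simp only [Pi.sub_apply] at i2 i3
    exact i3.sub i2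
  · rw [hB]
    exact h.inner_sub_regFlux_le hα (hs x hx) (hQ x hx) (hF x hx) (hT x hx) hT1 hε hε1 hnear hΛ

end Limits

/-! ### Passage of the sup bound from the regularised solutions to the given gradient -/

section Bound

variable {n : ℕ} {κ₁ κ₂ : ℝ}

theorem exists_seq_tendsto_ae_of_integral {X : Type*} [MeasurableSpace X] {μ : Measure X}
    {g : ℕ → X → ℝ} (hg : ∀ k, Integrable (g k) μ) (hg0 : ∀ k x, 0 ≤ g k x)
    (hlim : Tendsto (fun k => ∫ x, g k x ∂μ) atTop (𝓝 0)) :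
    ∃ ns : ℕ → ℕ, StrictMono ns ∧ ∀ᵐ x ∂μ, Tendsto (fun i => g (ns i) x) atTop (𝓝 0) := by
  have h1 : TendstoInMeasure μ g atTop (fun _ => (0 : ℝ)) := by
    refine tendstoInMeasure_of_tendsto_eLpNorm (p := 1) one_ne_zero
      (fun k => (hg k).aestronglyMeasurable) aestronglyMeasurable_const ?_
    have h2 : ∀ k, eLpNorm (g k - fun _ => (0 : ℝ)) 1 μ = ENNReal.ofReal (∫ x, g k x ∂μ) := by
      intro k
      have h3 : (g k - fun _ => (0 : ℝ)) = g k := by ext x; simp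
      rw [h3, eLpNorm_one_eq_lintegral_enorm, ← ofReal_integral_norm_eq_lintegral_enorm (hg k)]
      simp only [Real.norm_of_nonneg (hg0 k _)]
    simp only [h2]
    simpa using ENNReal.tendsto_ofReal hlim
  obtain ⟨ns, hns, h⟩ := h1.exists_seq_tendsto_ae
  exact ⟨ns, hns, h⟩

/-- The comparison argument. The regularised solutions W_k obey |W_k| ≤ t on the smaller ball for
large k, and the monotonicity defect between W_k and the mollified gradients tends to zero in L¹.
Only an almost everywhere convergent subsequence of that defect is needed, not convergence of W_k.
-/
theorem exists_norm_le_const (hn : 0 < n) (hκ₁ : 0 < κ₁) :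
    ∃ C : ℝ, 0 < C ∧ ∀ {N : ℕ} {φ : ℝ → ℝ}, IsOrliczWith κ₁ κ₂ φ →
      ∀ {P : Vec n → Mat n N}, Integrable P → (Integrable fun x => ‖P x‖ * om φ ‖P x‖) →
      (Integrable fun x => flux φ (P x)) → ∀ {x₀ : Vec n} {R : ℝ}, 0 < R → ∀ {k₀ : ℕ},
      (∀ k, k₀ ≤ k →
        (∃ v : Vec n → Vec N, ContDiff ℝ ∞ v ∧
          ∀ x ∈ Metric.ball x₀ (2 * R), classicalGrad v x = mol k P x) ∧
        ∀ ζ : Vec n → Vec N, IsTestFunction (Metric.ball x₀ (2 * R)) ζ →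
          ∫ x in Metric.ball x₀ (2 * R),
            inner ℝ (mol k (fun y => flux φ (P y)) x) (classicalGrad ζ x) = 0) →
      ∀ {t : ℝ}, 0 < t →
        C * ∫ x in Metric.ball x₀ (2 * R), ‖P x‖ * om φ ‖P x‖ < t * om φ t * R ^ n →
        ∀ᵐ x, x ∈ Metric.ball x₀ R → ‖P x‖ ≤ t := by
  have hm : 0 < min 1 κ₁⁻¹ := lt_min one_pos (inv_pos.2 hκ₁)
  obtain ⟨C, hC0, hC⟩ := exists_comparison_const hn hm (le_max_left 1 κ₂)
  obtain ⟨m, hmd⟩ : ∃ m, m = min 1 κ₁⁻¹ := ⟨_, rfl⟩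
  obtain ⟨M, hMd⟩ : ∃ M, M = max 1 κ₂ := ⟨_, rfl⟩
  refine ⟨C, hC0, ?_⟩
  intro N φ h P hP hH hfl x₀ R hR k₀ hk₀ t ht htC
  obtain ⟨U, hUd⟩ : ∃ U, U = Metric.ball x₀ (2 * R) := ⟨_, rfl⟩
  have hUm : MeasurableSet U := hUd ▸ measurableSet_ball
  have hUf : volume U ≠ ⊤ := hUd ▸ Metric.isBounded_ball.measure_lt_top.ne
  have ho1 := h.om_pos one_pos
  obtain ⟨S, hSm, hS0, hSe⟩ := h.exists_inverse
  obtain ⟨H, hHd⟩ : ∃ H : Vec n → ℝ, H = fun y => ‖P y‖ * om φ ‖P y‖ := ⟨_, rfl⟩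
  have hHi : Integrable H := hHd ▸ hH
  have hH0 : ∀ y, 0 ≤ H y := fun y => by
    rw [hHd]; exact mul_nonneg (norm_nonneg _) (h.om_nonneg _)
  obtain ⟨Q, hQd⟩ : ∃ Q : ℕ → Vec n → Mat n N, Q = fun k => mol k P := ⟨_, rfl⟩
  obtain ⟨F, hFd⟩ : ∃ F : ℕ → Vec n → Mat n N, F = fun k => mol k fun y => flux φ (P y) :=
    ⟨_, rfl⟩
  have hcQ : ∀ k, Continuous (Q k) := fun k => by
    rw [hQd]; exact (mol_contDiff k hP.locallyIntegrable).continuous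
  have hcH : ∀ k, Continuous (mol k H) := fun k =>
    (mol_contDiff k hHi.locallyIntegrable).continuous
  have hcF : ∀ k, Continuous (F k) := fun k => by
    rw [hFd]; exact (mol_contDiff k hfl.locallyIntegrable).continuous
  have hQ2 : ∀ k, MemLp (Q k) 2 (volume.restrict U) := fun k => by
    rw [hUd]; exact Continuous.memLp_ball (hcQ k) _ _ _
  have hF2 : ∀ k, MemLp (F k) 2 (volume.restrict U) := fun k => by
    rw [hUd]; exact Continuous.memLp_ball (hcF k) _ _ _
  have hpt : ∀ k x, ‖Q k x‖ ≤ 2 * S (mol k H x) ∧ ‖F k x‖ ≤ 2 * om φ (S (mol k H x)) := by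
    intro k x
    rw [hQd, hFd]
    exact h.norm_mol_le hP hH hfl (hS0 _) (by rw [← hHd, hSe _ (mol_nonneg k hH0 x)])
  -- The range on which φ' must be approximated. It covers all values of the mollified gradient on
  -- the ball, by compactness, and tends to infinity so that it eventually contains t.
  have hTex : ∀ k : ℕ, ∃ T : ℝ, (k : ℝ) + 1 ≤ T ∧ ∀ x ∈ U, 2 * S (mol k H x) ≤ T := by
    intro k
    obtain ⟨b, hb⟩ := ((isCompact_closedBall x₀ (2 * R)).image (hcH k)).bddAbove
    refine ⟨max (k + 1) (2 * S b), le_max_left _ _, fun x hx => le_max_of_le_right ?_⟩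
    have hxb : mol k H x ≤ b :=
      hb (mem_image_of_mem _ (Metric.ball_subset_closedBall (hUd ▸ hx)))
    linarith [hSm hxb]
  choose T hTk hT using hTex
  have hTk0 : ∀ k, 1 ≤ T k := fun k => by
    have : (0 : ℝ) ≤ k := Nat.cast_nonneg k
    linarith [hTk k]
  obtain ⟨ε, hεd⟩ : ∃ ε : ℕ → ℝ, ∀ k, ε k = min (1 / ((k : ℝ) + 1)) (om φ 1 / 2) :=
    ⟨_, fun _ => rfl⟩
  have hε0 : ∀ k, 0 < ε k := fun k => by
    rw [hεd]; exact lt_min (by positivity) (by positivity)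
  have hεk : ∀ k, ε k ≤ 1 / ((k : ℝ) + 1) := fun k => by rw [hεd]; exact min_le_left _ _
  have hεo : ∀ k, ε k ≤ om φ 1 / 2 := fun k => by rw [hεd]; exact min_le_right _ _
  have hε1 : ∀ k, ε k ≤ 1 := fun k => (hεk k).trans (by
    rw [div_le_one (by positivity)]
    have : (0 : ℝ) ≤ k := Nat.cast_nonneg k
    linarith)
  have hεlim : Tendsto ε atTop (𝓝 0) :=
    squeeze_zero (fun k => (hε0 k).le) hεk tendsto_one_div_add_atTop_nhds_zero_nat
  -- The regularisation parameter is chosen after the mollification scale, since the range T k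
  -- depends on that scale.
  choose l hl hnear using fun k => h.exists_regCoef_near (zero_le_one.trans (hTk0 k)) (hε0 k)
  obtain ⟨α, hαd⟩ : ∃ α : ℕ → ℝ → ℝ, α = fun k => regCoef φ (l k) := ⟨_, rfl⟩
  have hα : ∀ k, RegCoef (α k) (l k) (l k + 1 / l k) m M := fun k => by
    rw [hαd, hmd, hMd]; exact h.isRegCoef hκ₁ (hl k)
  have hnear' : ∀ k s, 0 ≤ s → s ≤ T k → |s * α k (s ^ 2) - om φ s| ≤ ε k := by
    rw [hαd]; exact hnear
  obtain ⟨E, hEd⟩ : ∃ E : ℕ → ℝ, ∀ k, E k = ∫ x in U, α k (‖Q k x‖ ^ 2) * ‖Q k x‖ ^ 2 :=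
    ⟨_, fun _ => rfl⟩
  have hElim : Tendsto E atTop (𝓝 (∫ x in U, ‖P x‖ * om φ ‖P x‖)) := by
    have := h.tendsto_integral_energy hP hH hfl hUm hUf hS0 hSe (α := α) (ε := ε) (T := T)
      (fun k => (hα k).continuous_comp (continuous_norm.pow 2) fun Q => sq_nonneg _) hεlim hε1
      (by rw [← hHd]; exact hT) hnear'
    refine this.congr fun k => ?_
    rw [hEd, hQd]
  have hWex : ∀ k, ∃ W : Vec n → Mat n N, k₀ ≤ k →
      MemLp W 2 (volume.restrict U) ∧
      ∫ x in U, inner ℝ (F k x) (W x - Q k x) = 0 ∧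
      ∫ x in U, inner ℝ (regFlux (α k) (W x)) (W x - Q k x) = 0 ∧
      ∫ x in U, α k (‖W x‖ ^ 2) * ‖W x‖ ^ 2 ≤ 2 * 2 ^ M * E k ∧
      ∀ K : ℝ, 0 < K → C * E k ≤ K * R ^ n →
        ∀ᵐ x, x ∈ Metric.ball x₀ R → α k (‖W x‖ ^ 2) * ‖W x‖ ^ 2 ≤ K := by
    intro k
    by_cases hk : k₀ ≤ k
    swap
    · exact ⟨0, fun hk' => absurd hk' hk⟩
    obtain ⟨⟨v, hv, hvQ⟩, hFk⟩ := hk₀ k hk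
    have hα' := hα k
    rw [hmd, hMd] at hα'
    obtain ⟨W, hW2, hWF, hW0, hWE, hWK⟩ := hC hα' hR v hv
    rw [← hUd] at hvQ hFk hW2 hWF hW0 hWE hWK
    have hvQ' : ∀ x ∈ U, classicalGrad v x = Q k x := by rw [hQd]; exact hvQ
    have eE : ∫ x in U, α k (‖classicalGrad v x‖ ^ 2) * ‖classicalGrad v x‖ ^ 2 = E k := by
      rw [hEd]
      exact setIntegral_congr_fun hUm fun x hx => by simp only [hvQ' x hx]
    rw [eE] at hWE hWK
    refine ⟨W, fun _ => ⟨hW2, ?_, ?_, by rw [hMd]; exact hWE, hWK⟩⟩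
    · rw [← hWF (F k) (hF2 k) (by rw [hFd]; exact hFk)]
      exact setIntegral_congr_fun hUm fun x hx => by simp only [hvQ' x hx]
    · rw [← hW0]
      exact setIntegral_congr_fun hUm fun x hx => by simp only [hvQ' x hx]
  choose W hW using hWex
  obtain ⟨g, hgd⟩ : ∃ g : ℕ → Vec n → ℝ, ∀ k x, g k x =
      inner ℝ (regFlux (α k) (W k x) - regFlux (α k) (Q k x)) (W k x - Q k x) :=
    ⟨_, fun _ _ => rfl⟩
  have hg0 : ∀ k x, 0 ≤ g k x := fun k x => by
    rw [hgd]
    refine le_trans ?_ ((hα k).le_inner_regFlux_sub (W k x) (Q k x))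
    exact mul_nonneg (mul_nonneg (hα k).m_pos.le (hα k).lo_pos.le) (sq_nonneg _)
  have hgi : ∀ k, k₀ ≤ k → IntegrableOn (g k) U := by
    intro k hk
    have hreg : ∀ {V : Vec n → Mat n N}, MemLp V 2 (volume.restrict U) →
        MemLp (fun x => regFlux (α k) (V x)) 2 (volume.restrict U) := fun {V} hV =>
      MemLp.of_le_mul hV ((hα k).continuous_regFlux.comp_aestronglyMeasurable hV.1)
        (Eventually.of_forall fun x => (hα k).norm_regFlux_le _)
    refine (integrable_inner_of_memLp ((hreg (hW k hk).1).sub (hreg (hQ2 k)))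
      ((hW k hk).1.sub (hQ2 k))).congr (Eventually.of_forall fun x => ?_)
    simp only [Pi.sub_apply, hgd]
  have hHlim : Tendsto (fun k => ∫ x in U, mol k H x) atTop (𝓝 (∫ x in U, H x)) := by
    refine tendsto_setIntegral_of_le_mol hHi hUm hUf (C := 1) (c := 0)
      (fun k => (hcH k).aestronglyMeasurable) hH0 zero_le_one (fun k x _ => ?_) ?_
    · rw [abs_of_nonneg (mol_nonneg k hH0 x)]; linarith
    · filter_upwards [mol_tendsto_ae hHi.locallyIntegrable] with x hx _ using hx
  have hXlim : Tendsto (fun k => ∫ x in U, ‖F k x - flux φ (Q k x)‖ * S (mol k H x)) atTop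
      (𝓝 0) := by
    have := h.tendsto_integral_defect hP hH hfl hUm hUf hSm hS0 hSe
    rw [hFd, hQd, hHd]; exact this
  obtain ⟨B, hB⟩ : ∃ B : ℝ, B = (5 + 2 ^ κ₂) * (1 + 2 / om φ 1) := ⟨_, rfl⟩
  have hB0 : 0 ≤ B := by rw [hB]; positivity
  have hgle : ∀ Λ : ℝ, 1 ≤ Λ → ∀ k, k₀ ≤ k → ∫ x in U, g k x ≤
      (Λ + 2) * (∫ x in U, ‖F k x - flux φ (Q k x)‖ * S (mol k H x))
      + (2 + 2 ^ κ₂) * Λ ^ (-m) * (2 * 2 ^ M * E k)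
      + (ε k * B * (2 * 2 ^ M * E k) + ε k * B * ((volume U).toReal + ∫ x in U, mol k H x)) := by
    intro Λ hΛ k hk
    obtain ⟨hW2, hWF, hW0, hWE, -⟩ := hW k hk
    have hSH : ∀ x, S (mol k H x) * om φ (S (mol k H x)) = mol k H x := fun x =>
      hSe _ (mol_nonneg k hH0 x)
    have hHiU : IntegrableOn (mol k H) U := (mol_integrable k hHi).integrableOn
    have hdi : IntegrableOn (fun x => ‖F k x - flux φ (Q k x)‖ * S (mol k H x)) U := by
      refine (hHiU.const_mul (2 + 2 ^ κ₂)).mono' ?_ (Eventually.of_forall fun x => ?_)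
      · exact ((((hcF k).sub (h.continuous_flux.comp (hcQ k))).norm.measurable.mul
          (hSm.measurable.comp (hcH k).measurable))).aestronglyMeasurable
      · rw [Real.norm_of_nonneg (mul_nonneg (norm_nonneg _) (hS0 _))]
        have hb := h.norm_sub_flux_le (hS0 _) (hpt k x).1 (hpt k x).2
        calc _ ≤ (2 + 2 ^ κ₂) * om φ (S (mol k H x)) * S (mol k H x) :=
              mul_le_mul_of_nonneg_right hb (hS0 _)
          _ = (2 + 2 ^ κ₂) * (S (mol k H x) * om φ (S (mol k H x))) := by ring
          _ = (2 + 2 ^ κ₂) * mol k H x := by rw [hSH]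
    have key := h.integral_inner_sub_regFlux_le (hα k) hUm hUf (s := fun x => S (mol k H x))
      (hF2 k) (hQ2 k) hW2 (by simpa only [hSH] using hHiU) hdi (fun x _ => hS0 _)
      (fun x _ => (hpt k x).1) (fun x _ => (hpt k x).2) (hT k) (hTk0 k) (hε0 k).le (hεo k)
      (hnear' k) hW0 hWF hΛ
    simp only [hSH, ← hB] at key
    simp only [hgd]
    have hΛm : 0 < Λ ^ (-m) := Real.rpow_pos_of_pos (by linarith) _
    have hcoef : 0 ≤ (2 + 2 ^ κ₂) * Λ ^ (-m) + ε k * B :=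
      add_nonneg (by positivity) (mul_nonneg (hε0 k).le hB0)
    have := mul_le_mul_of_nonneg_left hWE hcoef
    linarith
  have hglim : Tendsto (fun k => ∫ x in U, g k x) atTop (𝓝 0) := by
    refine tendsto_zero_of_le_rpow (hα 0).m_pos
      (fun k _ => integral_nonneg (hg0 k)) hXlim ?_ (hElim.const_mul (2 * 2 ^ M)) hgle
    have h1 := (hεlim.mul_const B).mul (hElim.const_mul (2 * 2 ^ M))
    have h2 := (hεlim.mul_const B).mul (hHlim.const_add (volume U).toReal)
    simpa using h1.add h2
  obtain ⟨ns, hns, hgae⟩ := exists_seq_tendsto_ae_of_integral (μ := volume.restrict U)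
    (g := fun i => g (i + k₀)) (fun i => hgi _ (Nat.le_add_left _ _)) (fun i => hg0 _)
    (hglim.comp (tendsto_add_atTop_nat k₀))
  have hsub : Tendsto (fun i => ns i + k₀) atTop atTop :=
    (tendsto_add_atTop_nat k₀).comp hns.tendsto_atTop
  have hWt : ∀ᶠ k in atTop, t ≤ T k ∧ ∀ᵐ x, x ∈ Metric.ball x₀ R → ‖W k x‖ ≤ t := by
    have hRn : 0 < R ^ n := pow_pos hR n
    rw [← hUd] at htC
    have hI0 : 0 ≤ C * ∫ x in U, ‖P x‖ * om φ ‖P x‖ :=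
      mul_nonneg hC0.le (integral_nonneg fun x => mul_nonneg (norm_nonneg _) (h.om_nonneg _))
    -- The strict inequality in the hypothesis leaves room for a level K above the limiting energy
    -- bound and below tφ'(t). For large k the energies and the approximation error fit on either
    -- side of it.
    obtain ⟨K, hK1, hK2⟩ := exists_between ((div_lt_iff₀ hRn).2 htC)
    have hK0 : 0 < K := (div_nonneg hI0 hRn.le).trans_lt hK1
    have e1 : ∀ᶠ k in atTop, C * E k < K * R ^ n :=
      (hElim.const_mul C).eventually_lt_const ((div_lt_iff₀ hRn).1 hK1)
    have e2 : ∀ᶠ k in atTop, K < t * (om φ t - ε k) := by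
      have : Tendsto (fun k => t * (om φ t - ε k)) atTop (𝓝 (t * (om φ t - 0))) :=
        (hεlim.const_sub _).const_mul t
      rw [sub_zero] at this
      exact this.eventually_const_lt hK2
    have e3 : ∀ᶠ k : ℕ in atTop, t ≤ T k := by
      filter_upwards [tendsto_natCast_atTop_atTop.eventually_ge_atTop t] with k hk
      linarith [hTk k]
    filter_upwards [e1, e2, e3, eventually_ge_atTop k₀] with k h1 h2 h3 hk
    refine ⟨h3, ?_⟩
    filter_upwards [(hW k hk).2.2.2.2 K hK0 h1.le] with x hx hxR
    by_contra hcon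
    have hcon' : t ≤ ‖W k x‖ := (not_le.1 hcon).le
    have h4 : t * α k (t ^ 2) ≤ ‖W k x‖ * α k (‖W k x‖ ^ 2) := (hα k).monotone_mul_self hcon'
    have h5 := (abs_le.1 (hnear' k t ht.le h3)).1
    have h6 : t * (om φ t - ε k) ≤ ‖W k x‖ * (‖W k x‖ * α k (‖W k x‖ ^ 2)) := by
      have h7 : t * (om φ t - ε k) ≤ t * (t * α k (t ^ 2)) :=
        mul_le_mul_of_nonneg_left (by linarith) ht.le
      have h8 : 0 ≤ t * α k (t ^ 2) := mul_nonneg ht.le ((hα k).pos (sq_nonneg t)).le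
      exact h7.trans (mul_le_mul hcon' h4 h8 (norm_nonneg _))
    have h9 := hx hxR
    have h10 : ‖W k x‖ * (‖W k x‖ * α k (‖W k x‖ ^ 2)) = α k (‖W k x‖ ^ 2) * ‖W k x‖ ^ 2 := by
      ring
    linarith
  obtain ⟨k₁, hk₁⟩ := eventually_atTop.1 hWt
  have hWae : ∀ᵐ x, ∀ k, k₁ ≤ k → x ∈ Metric.ball x₀ R → ‖W k x‖ ≤ t := by
    refine ae_all_iff.2 fun k => ?_
    by_cases hk : k₁ ≤ k
    · filter_upwards [(hk₁ k hk).2] with x hx _ using hx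
    · exact Eventually.of_forall fun x hk' => absurd hk' hk
  filter_upwards [hWae, (ae_restrict_iff' hUm).1 hgae, mol_tendsto_ae hP.locallyIntegrable]
    with x hxW hxg hxQ hxR
  have hxU : x ∈ U := hUd ▸ Metric.ball_subset_ball (by linarith) hxR
  have hxQ' : Tendsto (fun k => ‖Q k x‖) atTop (𝓝 ‖P x‖) := by rw [hQd]; exact hxQ.norm
  by_contra hcon
  have hlt : t < ‖P x‖ := not_le.1 hcon
  have hom : om φ t < om φ ‖P x‖ := h.om_strictMonoOn ht.le (norm_nonneg (P x)) hlt
  have hX : Tendsto (fun k => om φ ‖Q k x‖ - om φ t - 2 * ε k) atTop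
      (𝓝 (om φ ‖P x‖ - om φ t)) := by
    have := (((h.om_continuous.tendsto _).comp hxQ').sub_const (om φ t)).sub
      (hεlim.const_mul 2)
    simpa using this
  have hY : Tendsto (fun k => ‖Q k x‖ - t) atTop (𝓝 (‖P x‖ - t)) := hxQ'.sub_const t
  -- Where |W_k| ≤ t < |Q_k|, radial monotonicity bounds the defect below by the product of the gaps
  -- in flux and in length. Each approximation of φ' costs one ε_k. The limit of this product is
  -- positive if |P(x)| > t, while the defect tends to zero along the subsequence.
  have hXY : ∀ᶠ k in atTop,
      (om φ ‖Q k x‖ - om φ t - 2 * ε k) * (‖Q k x‖ - t) ≤ g k x := by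
    filter_upwards [hX.eventually_const_lt (sub_pos.2 hom),
      hY.eventually_const_lt (sub_pos.2 hlt), eventually_ge_atTop k₁] with k hXk hYk hk
    have h1 := mul_sub_le_inner_smul_sub ((hα k).pos (sq_nonneg ‖W k x‖)).le
      ((hα k).pos (sq_nonneg ‖Q k x‖)).le (W k x) (Q k x)
    rw [hgd]
    refine le_trans ?_ h1
    have hw := hxW k hk hxR
    have h2 : ‖W k x‖ * α k (‖W k x‖ ^ 2) ≤ t * α k (t ^ 2) := (hα k).monotone_mul_self hw
    have h3 := (abs_le.1 (hnear' k t ht.le (hk₁ k hk).1)).2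
    have h4 := (abs_le.1 (hnear' k ‖Q k x‖ (norm_nonneg _)
      ((hpt k x).1.trans (hT k x hxU)))).1
    have h5 : (α k (‖W k x‖ ^ 2) * ‖W k x‖ - α k (‖Q k x‖ ^ 2) * ‖Q k x‖) * (‖W k x‖ - ‖Q k x‖)
        = (‖Q k x‖ * α k (‖Q k x‖ ^ 2) - ‖W k x‖ * α k (‖W k x‖ ^ 2))
          * (‖Q k x‖ - ‖W k x‖) := by ring
    rw [h5]
    exact mul_le_mul (by linarith) (by linarith) hYk.le (by linarith)
  have hle := le_of_tendsto_of_tendsto ((hX.mul hY).comp hsub) (hxg hxU) (hsub.eventually hXY)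
  have hpos := mul_pos (sub_pos.2 hom) (sub_pos.2 hlt)
  linarith

end Bound

/-! ### From the level bound to the mean value estimate -/

section Average

variable {n : ℕ} {κ₁ κ₂ : ℝ}

theorem exists_map_norm_le_average (hn : 0 < n) (hκ₁ : 0 < κ₁) (hκ₂ : 0 < κ₂) :
    ∃ c : ℝ, 0 < c ∧ ∀ {N : ℕ} {φ : ℝ → ℝ}, IsOrliczWith κ₁ κ₂ φ →
      ∀ {Ω : Set (Vec n)}, IsOpen Ω → ∀ {u : Vec n → Vec N} {Du : Vec n → Mat n N},
      IsLocalWeakSolution φ Ω u Du → ∀ {x₀ : Vec n} {R : ℝ}, 0 < R →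
      Metric.closedBall x₀ (2 * R) ⊆ Ω →
      ∀ᵐ x, x ∈ Metric.ball x₀ R → φ ‖Du x‖ ≤ c * ⨍ x in Metric.ball x₀ (2 * R), φ ‖Du x‖ := by
  obtain ⟨C, hC0, hC⟩ := exists_norm_le_const (κ₂ := κ₂) hn hκ₁
  obtain ⟨b, hb⟩ : ∃ b, b = (volume (Metric.ball (0 : Vec n) 1)).toReal := ⟨_, rfl⟩
  have hb0 : 0 < b := by
    rw [hb]
    exact ENNReal.toReal_pos (Metric.measure_ball_pos volume _ one_pos).ne'
      Metric.isBounded_ball.measure_lt_top.ne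
  -- 1 + κ₂ pays for replacing tφ'(t) by φ(t), and 2^n b is the volume of the ball of radius 2R
  -- divided by R^n.
  refine ⟨C * (1 + κ₂) * (2 ^ n * b), by positivity, ?_⟩
  intro N φ h Ω hΩ u Du hu x₀ R hR hsub
  obtain ⟨P, hPD, hP, hH, hfl, k₀, hk₀⟩ := hu.exists_mollified h hΩ hsub
  obtain ⟨U, hUd⟩ : ∃ U, U = Metric.ball x₀ (2 * R) := ⟨_, rfl⟩
  have hUm : MeasurableSet U := hUd ▸ measurableSet_ball
  have hPU : ∀ x ∈ U, P x = Du x := fun x hx =>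
    hPD x (Metric.ball_subset_closedBall (hUd ▸ hx))
  have hRn : 0 < R ^ n := pow_pos hR n
  have hφi : IntegrableOn (fun x => φ ‖Du x‖) U := hUd ▸
    (h.integrableOn_map_norm (hu.memOrliczSobolevLoc.memOrlicz_grad _
      (isCompact_closedBall x₀ (2 * R)) hsub)).mono_set Metric.ball_subset_closedBall
  have hE : ∫ x in U, ‖P x‖ * om φ ‖P x‖ ≤ (1 + κ₂) * ∫ x in U, φ ‖Du x‖ := by
    rw [← integral_const_mul]
    refine setIntegral_mono_on hH.integrableOn (hφi.const_mul _) hUm fun x hx => ?_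
    rw [hPU x hx]
    exact h.mul_om_le (norm_nonneg _)
  have hI0 : 0 ≤ ∫ x in U, ‖P x‖ * om φ ‖P x‖ :=
    integral_nonneg fun x => mul_nonneg (norm_nonneg _) (h.om_nonneg _)
  -- t₀ is the critical level, at which the smallness condition holds with equality. Strict
  -- monotonicity of tφ'(t) makes every level t₀ + 1/(j + 1) admissible, and j → ∞ recovers t₀ even
  -- when it is zero.
  obtain ⟨t₀, ht₀, ht₀e⟩ := h.exists_mul_om_eq
    (div_nonneg (mul_nonneg hC0.le hI0) hRn.le)
  have hae : ∀ j : ℕ, ∀ᵐ x, x ∈ Metric.ball x₀ R → ‖P x‖ ≤ t₀ + 1 / ((j : ℝ) + 1) := by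
    intro j
    have hj : (0 : ℝ) < 1 / ((j : ℝ) + 1) := by positivity
    have hpos : 0 < t₀ + 1 / ((j : ℝ) + 1) := by linarith
    refine hC h hP hH hfl hR hk₀ hpos ?_
    rw [← hUd, ← div_lt_iff₀ hRn, ← ht₀e]
    exact h.mul_om_strictMonoOn ht₀ hpos.le (by linarith)
  have hvol : (volume U).toReal = R ^ n * (2 ^ n * b) := by
    rw [hUd, Measure.addHaar_ball_of_pos _ _ (by positivity), ENNReal.toReal_mul,
      ENNReal.toReal_ofReal (by positivity), ← hb, finrank_euclideanSpace_fin, mul_pow]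
    ring
  have hav : C * (1 + κ₂) * (2 ^ n * b) * ⨍ x in U, φ ‖Du x‖
      = C * ((1 + κ₂) * ∫ x in U, φ ‖Du x‖) / R ^ n := by
    rw [setAverage_eq, Measure.real, hvol, smul_eq_mul]
    field_simp
  filter_upwards [ae_all_iff.2 hae] with x hx hxR
  have hxt : ‖P x‖ ≤ t₀ := by
    refine ge_of_tendsto (x := atTop) (f := fun j : ℕ => t₀ + 1 / ((j : ℝ) + 1)) ?_
      (Eventually.of_forall fun j => hx j hxR)
    simpa using tendsto_one_div_add_atTop_nhds_zero_nat.const_add t₀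
  have hxU : x ∈ U := hUd ▸ Metric.ball_subset_ball (by linarith) hxR
  rw [← hUd, hav, ← hPU x hxU]
  calc φ ‖P x‖ ≤ ‖P x‖ * om φ ‖P x‖ := h.le_mul_om (norm_nonneg _)
    _ ≤ t₀ * om φ t₀ := mul_le_mul hxt (h.om_mono hxt) (h.om_nonneg _) ht₀
    _ = C * (∫ x in U, ‖P x‖ * om φ ‖P x‖) / R ^ n := ht₀e
    _ ≤ C * ((1 + κ₂) * ∫ x in U, φ ‖Du x‖) / R ^ n := by gcongr

end Average

end PhiLaplace

end

/-- Local boundedness of the gradient of (scalar or vectorial) `φ`-harmonic functions. The constant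
depends only on the dimension `n` and on the characteristics `κ₁, κ₂` of `φ`. -/
theorem theorem5p2 (n : ℕ) (κ₁ κ₂ : ℝ) (hκ₁ : 0 < κ₁) (hκ₂ : 0 < κ₂) :
    ∃ c : ℝ, 0 < c ∧
      ∀ (N : ℕ) (φ : ℝ → ℝ), PhiLaplace.IsOrliczWith κ₁ κ₂ φ →
      ∀ Ω : Set (PhiLaplace.Vec n), IsOpen Ω →
      ∀ (u : PhiLaplace.Vec n → PhiLaplace.Vec N) (Du : PhiLaplace.Vec n → PhiLaplace.Mat n N),
        PhiLaplace.IsLocalWeakSolution φ Ω u Du →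
      ∀ (x₀ : PhiLaplace.Vec n) (R : ℝ), 0 < R → closure (Metric.ball x₀ (2 * R)) ⊆ Ω →
        IntegrableOn (fun x => φ ‖Du x‖) (Metric.ball x₀ (2 * R)) ∧
        essSup (fun x => ENNReal.ofReal (φ ‖Du x‖)) (volume.restrict (Metric.ball x₀ R)) ≤
          ENNReal.ofReal (c * ⨍ x in Metric.ball x₀ (2 * R), φ ‖Du x‖) := by
  have hconst : ∃ c : ℝ, 0 < c ∧ ∀ {N : ℕ} {φ : ℝ → ℝ}, PhiLaplace.IsOrliczWith κ₁ κ₂ φ →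
      ∀ {Ω : Set (PhiLaplace.Vec n)}, IsOpen Ω →
      ∀ {u : PhiLaplace.Vec n → PhiLaplace.Vec N} {Du : PhiLaplace.Vec n → PhiLaplace.Mat n N},
      PhiLaplace.IsLocalWeakSolution φ Ω u Du → ∀ {x₀ : PhiLaplace.Vec n} {R : ℝ}, 0 < R →
      Metric.closedBall x₀ (2 * R) ⊆ Ω → ∀ᵐ x, x ∈ Metric.ball x₀ R →
        φ ‖Du x‖ ≤ c * ⨍ x in Metric.ball x₀ (2 * R), φ ‖Du x‖ := by
    rcases Nat.eq_zero_or_pos n with rfl | hn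
    -- In dimension zero matrices with no rows form a one-point space, so the gradient and φ of its
    -- norm vanish identically.
    · refine ⟨1, one_pos, fun {N φ} h {Ω} _ {u Du} _ {x₀ R} _ _ =>
        Eventually.of_forall fun x _ => ?_⟩
      have hz : ∀ y, φ ‖Du y‖ = 0 := fun y => by
        rw [Subsingleton.elim (Du y) 0, norm_zero, h.map_zero]
      simp [hz]
    · exact PhiLaplace.exists_map_norm_le_average hn hκ₁ hκ₂
  obtain ⟨c, hc0, hc⟩ := hconst
  refine ⟨c, hc0, fun N φ h Ω hΩ u Du hu x₀ R hR hsub => ?_⟩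
  rw [closure_ball x₀ (by positivity)] at hsub
  refine ⟨(h.integrableOn_map_norm (hu.memOrliczSobolevLoc.memOrlicz_grad _
    (isCompact_closedBall x₀ (2 * R)) hsub)).mono_set Metric.ball_subset_closedBall, ?_⟩
  refine essSup_le_of_ae_le _ ((ae_restrict_iff' measurableSet_ball).2 ?_)
  filter_upwards [hc h hΩ hu hR hsub] with x hx hxR
  exact ENNReal.ofReal_le_ofReal (hx hxR)
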